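/- Let $N\ge 2$, let $M\in\frac12\mathbb N$ (with $M=0$ allowed), and let $\Sigma$ be the complex Hilbert space with orthonormal basis $|s_1,\dots,s_N\rangle$, $s_i\in\{-M,-M+1,\dots,M\}$. Let $S_{ij}$ be the operator on $\Sigma$ exchanging the $i$-th and $j$-th spins. Particle indices are cyclic ($x_0\equiv x_N$, $x_{N+1}\equiv x_1$), sums and products run from $1$ to $N$ unless stated otherwise, $r^2=\sum_i x_i^2$, $\overline x=\frac1N\sum_i x_i$, and $[\cdot]$ is the integer part. Let $a>\frac12$, and also $b>\frac12$ for $H_1$ and $\omega>0$ for $H_0,H_1$. Put $H_\epsilon=-\sum_i\partial_{x_i}^2+V_\epsilon$, where $$V_0=\omega^2r^2+\sum_i\frac{2a^2}{(x_i-x_{i-1})(x_i-x_{i+1})}+\sum_i\frac{2a}{(x_i-x_{i+1})^2}(a-S_{i,i+1}),$$ $$V_1=\omega^2r^2+\sum_i\frac{b(b-1)}{x_i^2}+\sum_i\frac{8a^2x_i^2}{(x_i^2-x_{i-1}^2)(x_i^2-x_{i+1}^2)}+4a\sum_i\frac{x_i^2+x_{i+1}^2}{(x_i^2-x_{i+1}^2)^2}(a-S_{i,i+1}),$$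 $$V_2=2a^2\sum_i\cot(x_i-x_{i-1})\cot(x_i-x_{i+1})+2a\sum_i\csc^2(x_i-x_{i+1})(a-S_{i,i+1}),$$ acting on $\Sigma$-valued functions on the configuration spaces $C_0=\{x_1<\dots<x_N\}$, $C_1=\{0<x_1<\dots<x_N\}$, $C_2=\{x_1<\dots<x_N<x_1+\pi\}$. Let $\Lambda$ be the projection on states symmetric under simultaneous permutations of the spatial and spin coordinates, and define $|s_i\rangle,\ |s_{ij}\rangle=|s_{ji}\rangle\in\Sigma$ by $\Lambda(x_1|s\rangle)=\sum_ix_i|s_i\rangle$ and $\Lambda(x_1x_2|s\rangle)=\sum_{i<j}x_ix_j|s_{ij}\rangle$. Let $\Sigma'$ be the space of $|s\rangle\in\Sigma$ for which $\sum_i|s_{i,i+1}\rangle$ is invariant under all permutations of the spins. $L_n^{\lambda}$ and $P_n^{(\alpha,\beta)}$ denote the generalized Laguerre and Jacobi polynomials (for arbitrary real parameters). An eigenfunction of $H_\epsilon$ with eigenvalue $E$ is a function $\Psi:C_\epsilon\to\Sigma$ that is smooth, satisfies $H_\epsilon\Psi=E\Psi$ on $C_\epsilon$, and is square integrable on $C_\epsilon$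 for $\epsilon=0,1$. For $\epsilon=2$ square integrability is replaced by zero total momentum, $\sum_i\partial_{x_i}\Psi=0$, and square integrability on $\{x\in C_2:0\le\overline x\le1\}$. The zero function is allowed here; nonvanishing is stated separately. The ground state energy of $H_\epsilon$ is the infimum of $\langle\Phi,H_\epsilon\Phi\rangle/\langle\Phi,\Phi\rangle$ over nonzero $\Phi\in C_c^\infty(C_\epsilon;\Sigma)$. For every $|s\rangle\in\Sigma$ and all integers $l,m,k\ge0$ in the ranges indicated, the following holds. **1.** Let $\alpha=N(a+\frac12)-\frac32$, $\beta=\beta(m)=1-m-N(a+\frac12)$, $t=\frac{2r^2}{N\overline x^2}-1$ and, for $j\ge0$, $\mu_{l,j}=e^{-\frac\omega2r^2}\,\overline x^{\,j}L_l^{-\beta}(\omega r^2)\prod_i|x_i-x_{i+1}|^a$, where always $\beta=\beta(m)$, also when $j\ne m$. Then $E_0=N\omega(2a+1)$ is the ground state energy of $H_0$, and the following functions (extended continuously to $\overline x=0$) are eigenfunctions of $H_0$ with eigenvalue $E_{lm}=E_0+2\omega(2l+m)$: $$\Psi^{(0)}_{lm}=\mu_{lm}P^{(\alpha,\beta)}_{[m/2]}(t)\,\Lambda|s\rangle\quad(m\ge0),$$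 $$\Psi^{(1)}_{lm}=\mu_{l,m-1}P^{(\alpha+1,\beta)}_{[\frac{m-1}2]}(t)\big[\Lambda(x_1|s\rangle)-\overline x\,\Lambda|s\rangle\big]\quad(m\ge1),$$ $$\Psi^{(2)}_{lm}=\mu_{l,m-2}\Big[P^{(\alpha+2,\beta)}_{[\frac m2]-1}(t)\big(\Lambda(x_1^2|s\rangle)-2\overline x\Lambda(x_1|s\rangle)\big)+\overline x^2\Big(P^{(\alpha+2,\beta)}_{[\frac m2]-1}(t)-\tfrac{2(\alpha+1)}{2[\frac{m-1}2]+1}P^{(\alpha+1,\beta)}_{[\frac m2]-1}(t)\Big)\Lambda|s\rangle\Big]\quad(m\ge2),$$ $$\Psi^{(3)}_{lm}=\mu_{l,m-3}\Big[\tfrac2{3N}P^{(\alpha+3,\beta)}_{[\frac{m-3}2]}(t)\sum_ix_i^3+\overline x^3\varphi_m(t)\Big]\Lambda|s\rangle\quad(m\ge3),$$ $$\Psi^{(4)}_{lm}=\mu_{l,m-4}\Big[\tfrac{3}{2([\frac{m-3}2]+\frac12)}\overline x^2P^{(\alpha+3,\beta)}_{[\frac m2]-2}(t)\Lambda(x_1^2|s\rangle)+\Big(\tfrac32\overline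 x^3\phi_m(t)-\tfrac1NP^{(\alpha+4,\beta)}_{[\frac m2]-2}(t)\sum_ix_i^3\Big)\Lambda(x_1|s\rangle)+\Big(\tfrac1N\overline xP^{(\alpha+4,\beta)}_{[\frac m2]-2}(t)\sum_ix_i^3+\tfrac32\overline x^4\chi_m(t)\Big)\Lambda|s\rangle\Big]\quad(m\ge4),$$ and, if $|s\rangle\in\Sigma'$, $$\widetilde\Psi^{(2)}_{lm}=\mu_{l,m-2}\Big[P^{(\alpha+2,\beta)}_{[\frac m2]-1}(t)\big(\Lambda(x_1x_2|s\rangle)-\overline x\Lambda((x_1+x_2)|s\rangle)\big)+\overline x^2\Big(P^{(\alpha+2,\beta)}_{[\frac m2]-1}(t)+\tfrac{2(\alpha+1)}{(2[\frac{m-1}2]+1)(N-1)}P^{(\alpha+1,\beta)}_{[\frac m2]-1}(t)\Big)\Lambda|s\rangle\Big]\quad(m\ge2)$$ (if $S_{12}|s\rangle=|s\rangle$, then $\Lambda((x_1+x_2)|s\rangle)=2\Lambda(x_1|s\rangle)$). Here, for even $m$, $$\varphi_m=\tfrac{m+2\alpha+2}{m-1}P^{(\alpha+2,\beta-2)}_{\frac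 m2}-P^{(\alpha+3,\beta-1)}_{\frac m2-1}-\tfrac{4\alpha+7}{m-1}P^{(\alpha+2,\beta-1)}_{\frac m2-1}+\tfrac13P^{(\alpha+3,\beta)}_{\frac m2-2},$$ $$\phi_m=P^{(\alpha+4,\beta-1)}_{\frac m2-1}-2P^{(\alpha+3,\beta-1)}_{\frac m2-1}-\tfrac{m+2\alpha+3}{(m-1)(m-3)}P^{(\alpha+2,\beta-1)}_{\frac m2-1}-\tfrac13P^{(\alpha+4,\beta)}_{\frac m2-2}+\tfrac{m+2\alpha-1}{m-3}P^{(\alpha+3,\beta)}_{\frac m2-2},$$ $$\chi_m=\tfrac{3m+2\alpha}{(m-1)(m-3)}P^{(\alpha+2,\beta-1)}_{\frac m2-1}+\tfrac{2m-7}{m-3}P^{(\alpha+3,\beta-1)}_{\frac m2-1}-P^{(\alpha+4,\beta-1)}_{\frac m2-1}-\tfrac{m+2\alpha+2}{(m-1)(m-3)}P^{(\alpha+2,\beta)}_{\frac m2-2}-\tfrac{m+2\alpha}{m-3}P^{(\alpha+3,\beta)}_{\frac m2-2}+\tfrac13P^{(\alpha+4,\beta)}_{\frac m2-2},$$ and,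 for odd $m$, $$\varphi_m=2P^{(\alpha+2,\beta-1)}_{\frac{m-1}2}-P^{(\alpha+3,\beta-1)}_{\frac{m-1}2}+\tfrac13P^{(\alpha+3,\beta)}_{\frac{m-3}2}+\tfrac{m+2\alpha+2}{m(m-2)}P^{(\alpha+1,\beta)}_{\frac{m-3}2}-\tfrac{m+2\alpha+2}{m-2}P^{(\alpha+2,\beta)}_{\frac{m-3}2},$$ $$\phi_m=P^{(\alpha+4,\beta-1)}_{\frac{m-3}2}-\tfrac{2m-5}{m-2}P^{(\alpha+3,\beta-1)}_{\frac{m-3}2}-\tfrac13P^{(\alpha+4,\beta)}_{\frac{m-5}2}+\tfrac{m+2\alpha-1}{m-2}P^{(\alpha+3,\beta)}_{\frac{m-5}2},$$ $$\chi_m=\tfrac{2m-3}{m(m-2)}P^{(\alpha+2,\beta-1)}_{\frac{m-3}2}+\tfrac{2(m-3)}{m-2}P^{(\alpha+3,\beta-1)}_{\frac{m-3}2}-P^{(\alpha+4,\beta-1)}_{\frac{m-3}2}-\tfrac{m+2\alpha+1}{m(m-2)}P^{(\alpha+2,\beta)}_{\frac{m-5}2}-\tfrac{m+2\alpha}{m-2}P^{(\alpha+3,\beta)}_{\frac{m-5}2}+\tfrac13P^{(\alpha+4,\beta)}_{\frac{m-5}2}.$$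 **2.** Let $\alpha=N(2a+b+\frac12)$, $\beta=N(4a+b+\frac32)$ and $\mu=e^{-\frac\omega2r^2}\prod_i|x_i^2-x_{i+1}^2|^ax_i^b$. Then $E_0=N\omega(4a+2b+1)$ is the ground state energy of $H_1$, and the following functions are eigenfunctions of $H_1$ with eigenvalue $E_k=E_0+4k\omega$: $$\Psi^{(0)}_k=\mu L_k^{\alpha-1}(\omega r^2)\Lambda|s\rangle\ (k\ge0),\qquad \Psi^{(1)}_k=\mu L_{k-1}^{\alpha+1}(\omega r^2)\big[N\Lambda(x_1^2|s\rangle)-r^2\Lambda|s\rangle\big]\ (k\ge1),$$ $$\Psi^{(2)}_k=\mu L_{k-2}^{\alpha+3}(\omega r^2)\Big[N(\alpha+1)\sum_ix_i^4-\beta r^4\Big]\Lambda|s\rangle\ (k\ge2).$$ **3.** Let $\mu=\prod_i\sin^a|x_i-x_{i+1}|$. Then $E_0=2Na^2$ is the ground state energy of $H_2$, and the following functions are zero-momentum eigenfunctions of $H_2$: $$\Psi_0=\mu\Lambda|s\rangle,\quad \Psi_1=\mu\sum_i\cos(2(x_i-\overline x))|s_i\rangle,\quad\Psi_2=\mu\sum_i\sin(2(x_i-\overline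 x))|s_i\rangle,$$ $$\Psi_3=\mu\Big[\tfrac{2a}{2a+1}\Lambda|s\rangle+\sum_{i\ne j}\cos(2(x_i-x_j))|s_j\rangle\Big],\quad \Psi_4=\mu\sum_{i\ne j}\sin(2(x_i-x_j))|s_j\rangle,$$ with energies $E_0$ for $\Psi_0$, $E_0+4(2a+1-\frac1N)$ for $\Psi_1,\Psi_2$, and $E_0+8(2a+1)$ for $\Psi_3,\Psi_4$. Moreover none of these functions vanishes identically, in the following cases: if $\Lambda|s\rangle\neq0$, for $\Psi^{(0)}_{lm},\Psi^{(2)}_{lm},\widetilde\Psi^{(2)}_{lm}$ (the last for $|s\rangle\in\Sigma'$), $\Psi^{(3)}_{lm}$ (when $N\ge3$), $\Psi^{(0)}_k,\Psi^{(2)}_k,\Psi_0,\Psi_1,\Psi_3$; if the vectors $|s_1\rangle,\dots,|s_N\rangle$ are not all equal, for $\Psi^{(1)}_{lm}$, $\Psi^{(4)}_{lm}$ (when $N\ge3$), $\Psi^{(1)}_k,\Psi_2,\Psi_4$. -/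

import Mathlib

noncomputable section

namespace NearNeighbour

/-! ## Spin space, permutations and symmetrization -/

/-- Positions of `N` particles on the line. -/
abbrev Pos (N : ℕ) := Fin N → ℝ

/-- The internal space of `N` particles of spin `M = κ / 2`. The basis vector
`EuclideanSpace.single s 1` is the state whose `i`-th spin is `s i - M`, with `s i ∈ {0, …, 2M}`. -/
abbrev Spin (N κ : ℕ) := EuclideanSpace ℂ (Fin N → Fin (κ + 1))

/-- A wave function with internal degrees of freedom. -/
abbrev Wave (N κ : ℕ) := Pos N → Spin N κ

variable {N κ : ℕ}

/-- Action of a permutation of the particles on spin states: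
the basis vector of `s` is sent to the basis vector of `s ∘ σ⁻¹`. -/
def permSpin (σ : Equiv.Perm (Fin N)) (v : Spin N κ) : Spin N κ :=
  WithLp.toLp 2 (fun s => v (s ∘ σ))

/-- The spin exchange operator `S_{ij}`. -/
def exchange (i j : Fin N) (v : Spin N κ) : Spin N κ := permSpin (Equiv.swap i j) v

/-- The projection `Λ` on the states that are symmetric under simultaneous permutations of the
spatial and spin coordinates of the particles. -/
def symmetrize (Ψ : Wave N κ) : Wave N κ := fun x =>
  ((N.factorial : ℝ)⁻¹) • ∑ σ : Equiv.Perm (Fin N), permSpin σ (Ψ (x ∘ σ))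

/-- The vector `|s_i⟩` in `Λ(x₁|s⟩) = ∑ x_i |s_i⟩`; see `symmetrize_coord`. -/
def spinOne [NeZero N] (s : Spin N κ) (i : Fin N) : Spin N κ :=
  ((N.factorial : ℝ)⁻¹) •
    ∑ σ ∈ (Finset.univ : Finset (Equiv.Perm (Fin N))).filter (fun σ => σ 0 = i), permSpin σ s

/-- The vector `|s_{ij}⟩ = |s_{ji}⟩` in `Λ(x₁x₂|s⟩) = ∑_{i<j} x_i x_j |s_{ij}⟩`;
see `symmetrize_coord_mul`. -/
def spinTwo [NeZero N] (s : Spin N κ) (i j : Fin N) : Spin N κ :=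
  ((N.factorial : ℝ)⁻¹) •
    ∑ σ ∈ (Finset.univ : Finset (Equiv.Perm (Fin N))).filter
      (fun σ => (σ 0 = i ∧ σ 1 = j) ∨ (σ 0 = j ∧ σ 1 = i)), permSpin σ s

lemma permSpin_smul (σ : Equiv.Perm (Fin N)) (c : ℝ) (v : Spin N κ) :
    permSpin σ (c • v) = c • permSpin σ v := rfl

lemma symmetrize_coord [NeZero N] (s : Spin N κ) (x : Pos N) :
    symmetrize (fun y => y 0 • s) x = ∑ i, x i • spinOne s i := by
  simp only [symmetrize, spinOne, permSpin_smul, Function.comp]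
  simp_rw [smul_comm (x _) ((N.factorial : ℝ)⁻¹)]
  rw [← Finset.smul_sum]
  congr 1
  simp_rw [Finset.smul_sum, Finset.sum_filter]
  rw [Finset.sum_comm]
  simp

lemma symmetrize_coord_mul [NeZero N] (hN : 2 ≤ N) (s : Spin N κ) (x : Pos N) :
    symmetrize (fun y => (y 0 * y 1) • s) x =
      ∑ i, ∑ j, if i < j then (x i * x j) • spinTwo s i j else 0 := by
  have h01 : (0 : Fin N) ≠ 1 := by
    intro h
    have h' := congrArg Fin.val h
    rw [Fin.val_one', Fin.val_zero, Nat.mod_eq_of_lt (by omega)] at h'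
    omega
  have key : ∀ i j : Fin N, (if i < j then (x i * x j) • spinTwo s i j else 0) =
      ((N.factorial : ℝ)⁻¹) • ∑ σ : Equiv.Perm (Fin N),
        if i < j ∧ ((σ 0 = i ∧ σ 1 = j) ∨ (σ 0 = j ∧ σ 1 = i)) then
          (x (σ 0) * x (σ 1)) • permSpin σ s else 0 := by
    intro i j
    by_cases hij : i < j
    · simp only [hij, if_true, true_and, spinTwo]
      rw [smul_comm, Finset.smul_sum, Finset.sum_filter]
      congr 1
      refine Finset.sum_congr rfl fun σ _ => ?_
      split_ifs with h
      · rcases h with ⟨rfl, rfl⟩ | ⟨rfl, rfl⟩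
        · rfl
        · rw [mul_comm]
      · rfl
    · simp [hij]
  simp_rw [key, ← Finset.smul_sum]
  simp only [symmetrize, permSpin_smul, Function.comp]
  congr 1
  have hs : ∀ f : Fin N → Fin N → Equiv.Perm (Fin N) → Spin N κ,
      ∑ i, ∑ j, ∑ σ, f i j σ = ∑ σ, ∑ i, ∑ j, f i j σ := fun f => by
    rw [Finset.sum_comm]
    simp_rw [Finset.sum_comm (s := (Finset.univ : Finset (Fin N)))
      (t := (Finset.univ : Finset (Equiv.Perm (Fin N))))]
    refine Finset.sum_congr rfl fun σ _ => Finset.sum_comm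
  rw [hs]
  refine Finset.sum_congr rfl fun σ _ => ?_
  have hne : σ 0 ≠ σ 1 := fun h => h01 (σ.injective h)
  rcases lt_or_gt_of_ne hne with h | h
  · rw [Finset.sum_eq_single (σ 0), Finset.sum_eq_single (σ 1)]
    · simp [h]
    · rintro j - hj
      rw [if_neg]
      rintro ⟨-, ⟨-, h2⟩ | ⟨h2, h3⟩⟩
      · exact hj h2.symm
      · exact hne h3.symm
    · simp
    · rintro i - hi
      refine Finset.sum_eq_zero fun j _ => ?_
      rw [if_neg]
      rintro ⟨hl, ⟨h2, -⟩ | ⟨h2, h3⟩⟩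
      · exact hi h2.symm
      · rw [← h2, ← h3] at hl
        exact lt_asymm h hl
    · simp
  · rw [Finset.sum_eq_single (σ 1), Finset.sum_eq_single (σ 0)]
    · simp [h]
    · rintro j - hj
      rw [if_neg]
      rintro ⟨-, ⟨h2, h3⟩ | ⟨h2, -⟩⟩
      · exact hne h2
      · exact hj h2.symm
    · simp
    · rintro i - hi
      refine Finset.sum_eq_zero fun j _ => ?_
      rw [if_neg]
      rintro ⟨hl, ⟨h2, h3⟩ | ⟨-, h3⟩⟩
      · rw [← h2, ← h3] at hl
        exact lt_asymm h hl
      · exact hi h3.symm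
    · simp

/-- The subspace `Σ'` of spin states `|s⟩` for which `∑_i |s_{i,i+1}⟩` (cyclic indices) is
symmetric under all permutations of the particles. -/
def SpinPrime (N κ : ℕ) [NeZero N] : Set (Spin N κ) :=
  {s | ∀ σ : Equiv.Perm (Fin N),
    permSpin σ (∑ i, spinTwo s i (i + 1)) = ∑ i, spinTwo s i (i + 1)}

/-- `Λ|s⟩`. -/
def sym0 (s : Spin N κ) : Wave N κ := symmetrize (fun _ => s)

/-- `Λ(x₁|s⟩)`. -/
def sym1 [NeZero N] (s : Spin N κ) : Wave N κ := symmetrize (fun x => x 0 • s)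

/-- `Λ(x₁²|s⟩)`. -/
def sym2 [NeZero N] (s : Spin N κ) : Wave N κ := symmetrize (fun x => (x 0) ^ 2 • s)

/-- `Λ(x₁x₂|s⟩)`. -/
def sym11 [NeZero N] (s : Spin N κ) : Wave N κ := symmetrize (fun x => (x 0 * x 1) • s)

/-- `Λ((x₁+x₂)|s⟩)`. -/
def symSum [NeZero N] (s : Spin N κ) : Wave N κ := symmetrize (fun x => (x 0 + x 1) • s)

/-! ## Differential operators and Hamiltonians -/

/-- The partial derivative `∂/∂x_i`. -/
def pd (i : Fin N) (Ψ : Wave N κ) : Wave N κ := fun x => fderiv ℝ Ψ x (Pi.single i 1)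

/-- `-∑ ∂_{x_i}² + V`. -/
def hamiltonian (V : Pos N → Spin N κ → Spin N κ) (Ψ : Wave N κ) : Wave N κ := fun x =>
  -(∑ i, pd i (pd i Ψ) x) + V x (Ψ x)

/-- The total momentum `P = -i ∑ ∂_{x_i}`. -/
def momentum (Ψ : Wave N κ) : Wave N κ := fun x => (-Complex.I) • ∑ i, pd i Ψ x

/-- `∑ x_i^k`. -/
def psum (k : ℕ) (x : Pos N) : ℝ := ∑ i, x i ^ k

/-- The centre of mass coordinate. -/
def com (x : Pos N) : ℝ := (∑ i, x i) / N

section Potentials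

variable [NeZero N]

def V0 (ω a : ℝ) (x : Pos N) (v : Spin N κ) : Spin N κ :=
  (ω ^ 2 * psum 2 x + ∑ i, 2 * a ^ 2 / ((x i - x (i - 1)) * (x i - x (i + 1)))) • v
    + ∑ i, (2 * a / (x i - x (i + 1)) ^ 2) • (a • v - exchange i (i + 1) v)

def V1 (ω a b : ℝ) (x : Pos N) (v : Spin N κ) : Spin N κ :=
  (ω ^ 2 * psum 2 x + ∑ i, b * (b - 1) / x i ^ 2
      + ∑ i, 8 * a ^ 2 * x i ^ 2 / ((x i ^ 2 - x (i - 1) ^ 2) * (x i ^ 2 - x (i + 1) ^ 2))) • v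
    + ∑ i, (4 * a * ((x i ^ 2 + x (i + 1) ^ 2) / (x i ^ 2 - x (i + 1) ^ 2) ^ 2)) •
        (a • v - exchange i (i + 1) v)

def V2 (a : ℝ) (x : Pos N) (v : Spin N κ) : Spin N κ :=
  (2 * a ^ 2 * ∑ i, Real.cot (x i - x (i - 1)) * Real.cot (x i - x (i + 1))) • v
    + ∑ i, (2 * a * (1 / Real.sin (x i - x (i + 1)) ^ 2)) • (a • v - exchange i (i + 1) v)

def H0 (ω a : ℝ) : Wave N κ → Wave N κ := hamiltonian (V0 ω a)

def H1 (ω a b : ℝ) : Wave N κ → Wave N κ := hamiltonian (V1 ω a b)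

def H2 (a : ℝ) : Wave N κ → Wave N κ := hamiltonian (V2 a)

end Potentials

/-! ## Configuration spaces, eigenfunctions, ground state energy -/

/-- `x_1 < ⋯ < x_N`. -/
def C0 (N : ℕ) : Set (Pos N) := {x | StrictMono x}

/-- `0 < x_1 < ⋯ < x_N`. -/
def C1 (N : ℕ) : Set (Pos N) := {x | StrictMono x ∧ ∀ i, 0 < x i}

/-- `x_1 < ⋯ < x_N < x_1 + π`. -/
def C2 (N : ℕ) : Set (Pos N) := {x | StrictMono x ∧ ∀ i j, x i - x j < Real.pi}

/-- `Ψ` is smooth on the configuration space `C` and satisfies `H Ψ = E Ψ` there. (The zero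
function is not excluded, since spin vectors are arbitrary.) -/
def Solves (H : Wave N κ → Wave N κ) (C : Set (Pos N)) (Ψ : Wave N κ) (E : ℝ) : Prop :=
  ContDiffOn ℝ (⊤ : ℕ∞) Ψ C ∧ ∀ x ∈ C, H Ψ x = E • Ψ x

/-- Square integrable solution of `H Ψ = E Ψ` on `C`. -/
def IsEigenfunction (H : Wave N κ → Wave N κ) (C : Set (Pos N)) (Ψ : Wave N κ) (E : ℝ) : Prop :=
  Solves H C Ψ E ∧ MeasureTheory.MemLp Ψ 2 (MeasureTheory.volume.restrict C)

/-- The expression `F`, which may contain negative powers of the centre of mass coordinate,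
extends to an eigenfunction on all of `C`. (The extension is unique, by continuity.) -/
def ExtendsToEigenfunction (H : Wave N κ → Wave N κ) (C : Set (Pos N)) (F : Wave N κ) (E : ℝ) :
    Prop :=
  ∃ Ψ : Wave N κ, (∀ x ∈ C, com x ≠ 0 → Ψ x = F x) ∧ IsEigenfunction H C Ψ E

/-- Solution of `H Ψ = E Ψ` on `C` with zero total momentum (so that `Ψ` does not depend on the
centre of mass), square integrable over the relative coordinates, i.e. over the part of `C` whose
centre of mass lies in a unit interval. -/
def IsZeroMomentumEigenfunction (H : Wave N κ → Wave N κ) (C : Set (Pos N)) (Ψ : Wave N κ)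
    (E : ℝ) : Prop :=
  Solves H C Ψ E ∧ (∀ x ∈ C, momentum Ψ x = 0) ∧
    MeasureTheory.MemLp Ψ 2 (MeasureTheory.volume.restrict {x ∈ C | com x ∈ Set.Icc (0 : ℝ) 1})

/-- `F` is not identically zero on the configuration space (away from a zero of the centre of mass
coordinate, where formulas may be singular). -/
def Nonvanishing (C : Set (Pos N)) (F : Wave N κ) : Prop := ∃ x ∈ C, com x ≠ 0 ∧ F x ≠ 0

/-- `E` is the infimum of the energy `⟨Φ, H Φ⟩ / ⟨Φ, Φ⟩` over the nonzero smooth wave functions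
with compact support in the configuration space. -/
def IsGroundStateEnergy (H : Wave N κ → Wave N κ) (C : Set (Pos N)) (E : ℝ) : Prop :=
  IsGLB {q : ℝ | ∃ Φ : Wave N κ, ContDiff ℝ (⊤ : ℕ∞) Φ ∧ HasCompactSupport Φ ∧ tsupport Φ ⊆ C ∧ Φ ≠ 0 ∧
    q = (∫ x, (inner ℂ (Φ x) (H Φ x)).re) / ∫ x, ‖Φ x‖ ^ 2} E

/-! ## Classical polynomials -/

/-- The binomial coefficient `z (z - 1) ⋯ (z - k + 1) / k!` for real `z`. -/
def gbinom (z : ℝ) (k : ℕ) : ℝ := (∏ i ∈ Finset.range k, (z - i)) / k.factorial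

/-- The generalized Laguerre polynomial `L_n^λ(x)`. -/
def laguerre (n : ℕ) (lam x : ℝ) : ℝ :=
  ∑ k ∈ Finset.range (n + 1), (-1) ^ k * gbinom (n + lam) (n - k) * x ^ k / k.factorial

/-- The Jacobi polynomial `P_n^{(α,β)}(t)`, for arbitrary real parameters. -/
def jacobi (n : ℕ) (α β t : ℝ) : ℝ :=
  ∑ k ∈ Finset.range (n + 1), gbinom (n + α) (n - k) * gbinom (n + β) k
    * ((t - 1) / 2) ^ k * ((t + 1) / 2) ^ (n - k)

/-! ## Ground state energies -/

def ground0 (N : ℕ) (ω a : ℝ) : ℝ := N * ω * (2 * a + 1)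

def ground1 (N : ℕ) (ω a b : ℝ) : ℝ := N * ω * (4 * a + 2 * b + 1)

def ground2 (N : ℕ) (a : ℝ) : ℝ := 2 * N * a ^ 2

/-! ## The rational model -/

/-- `φ_m`. -/
def phi3 (m : ℕ) (α β t : ℝ) : ℝ :=
  if Even m then
    (m + 2 * α + 2) / (m - 1) * jacobi (m / 2) (α + 2) (β - 2) t
      - jacobi (m / 2 - 1) (α + 3) (β - 1) t
      - (4 * α + 7) / (m - 1) * jacobi (m / 2 - 1) (α + 2) (β - 1) t
      + 1 / 3 * jacobi (m / 2 - 2) (α + 3) β t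
  else
    2 * jacobi ((m - 1) / 2) (α + 2) (β - 1) t
      - jacobi ((m - 1) / 2) (α + 3) (β - 1) t
      + 1 / 3 * jacobi ((m - 3) / 2) (α + 3) β t
      + (m + 2 * α + 2) / (m * (m - 2)) * jacobi ((m - 3) / 2) (α + 1) β t
      - (m + 2 * α + 2) / (m - 2) * jacobi ((m - 3) / 2) (α + 2) β t

/-- The function multiplying `Λ(x₁|s⟩)` in the fifth family. -/
def phi4 (m : ℕ) (α β t : ℝ) : ℝ :=
  if Even m then
    jacobi (m / 2 - 1) (α + 4) (β - 1) t
      - 2 * jacobi (m / 2 - 1) (α + 3) (β - 1) t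
      - (m + 2 * α + 3) / ((m - 1) * (m - 3)) * jacobi (m / 2 - 1) (α + 2) (β - 1) t
      - 1 / 3 * jacobi (m / 2 - 2) (α + 4) β t
      + (m + 2 * α - 1) / (m - 3) * jacobi (m / 2 - 2) (α + 3) β t
  else
    jacobi ((m - 3) / 2) (α + 4) (β - 1) t
      - (2 * m - 5) / (m - 2) * jacobi ((m - 3) / 2) (α + 3) (β - 1) t
      - 1 / 3 * jacobi ((m - 5) / 2) (α + 4) β t
      + (m + 2 * α - 1) / (m - 2) * jacobi ((m - 5) / 2) (α + 3) β t

/-- The function multiplying `Λ|s⟩` in the fifth family. -/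
def chi4 (m : ℕ) (α β t : ℝ) : ℝ :=
  if Even m then
    (3 * m + 2 * α) / ((m - 1) * (m - 3)) * jacobi (m / 2 - 1) (α + 2) (β - 1) t
      + (2 * m - 7) / (m - 3) * jacobi (m / 2 - 1) (α + 3) (β - 1) t
      - jacobi (m / 2 - 1) (α + 4) (β - 1) t
      - (m + 2 * α + 2) / ((m - 1) * (m - 3)) * jacobi (m / 2 - 2) (α + 2) β t
      - (m + 2 * α) / (m - 3) * jacobi (m / 2 - 2) (α + 3) β t
      + 1 / 3 * jacobi (m / 2 - 2) (α + 4) β t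
  else
    (2 * m - 3) / (m * (m - 2)) * jacobi ((m - 3) / 2) (α + 2) (β - 1) t
      + 2 * (m - 3) / (m - 2) * jacobi ((m - 3) / 2) (α + 3) (β - 1) t
      - jacobi ((m - 3) / 2) (α + 4) (β - 1) t
      - (m + 2 * α + 1) / (m * (m - 2)) * jacobi ((m - 5) / 2) (α + 2) β t
      - (m + 2 * α) / (m - 2) * jacobi ((m - 5) / 2) (α + 3) β t
      + 1 / 3 * jacobi ((m - 5) / 2) (α + 4) β t

def alpha0 (N : ℕ) (a : ℝ) : ℝ := N * (a + 1 / 2) - 3 / 2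

def beta0 (N : ℕ) (a : ℝ) (m : ℕ) : ℝ := 1 - m - N * (a + 1 / 2)

/-- `t = 2r² / (N x̄²) - 1`. -/
def tvar (x : Pos N) : ℝ := 2 * psum 2 x / (N * com x ^ 2) - 1

section Rational

variable [NeZero N]

/-- `exp(-ωr²/2) ∏ |x_i - x_{i+1}|^a`. -/
def gauge0 (ω a : ℝ) (x : Pos N) : ℝ :=
  Real.exp (-(ω / 2) * psum 2 x) * ∏ i, |x i - x (i + 1)| ^ a

/-- `exp(-ωr²/2) x̄^k L_l^{-β}(ωr²) ∏ |x_i - x_{i+1}|^a`. -/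
def mu0 (ω a β : ℝ) (l k : ℕ) (x : Pos N) : ℝ :=
  gauge0 ω a x * com x ^ k * laguerre l (-β) (ω * psum 2 x)

def psi0 (ω a : ℝ) (l m : ℕ) (s : Spin N κ) : Wave N κ := fun x =>
  let α := alpha0 N a
  let β := beta0 N a m
  let t := tvar x
  mu0 ω a β l m x • (jacobi (m / 2) α β t • sym0 s x)

def psi1 (ω a : ℝ) (l m : ℕ) (s : Spin N κ) : Wave N κ := fun x =>
  let α := alpha0 N a
  let β := beta0 N a m
  let t := tvar x
  mu0 ω a β l (m - 1) x •
    (jacobi ((m - 1) / 2) (α + 1) β t • sym1 s x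
      - (com x * jacobi ((m - 1) / 2) (α + 1) β t) • sym0 s x)

def psi2 (ω a : ℝ) (l m : ℕ) (s : Spin N κ) : Wave N κ := fun x =>
  let α := alpha0 N a
  let β := beta0 N a m
  let t := tvar x
  mu0 ω a β l (m - 2) x •
    (jacobi (m / 2 - 1) (α + 2) β t • (sym2 s x - (2 * com x) • sym1 s x)
      + (com x ^ 2 * (jacobi (m / 2 - 1) (α + 2) β t
          - 2 * (α + 1) / (2 * ((m - 1) / 2 : ℕ) + 1) * jacobi (m / 2 - 1) (α + 1) β t))
        • sym0 s x)

def psi3 (ω a : ℝ) (l m : ℕ) (s : Spin N κ) : Wave N κ := fun x =>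
  let α := alpha0 N a
  let β := beta0 N a m
  let t := tvar x
  mu0 ω a β l (m - 3) x •
    ((2 / (3 * N) * jacobi ((m - 3) / 2) (α + 3) β t * psum 3 x + com x ^ 3 * phi3 m α β t)
      • sym0 s x)

def psi4 (ω a : ℝ) (l m : ℕ) (s : Spin N κ) : Wave N κ := fun x =>
  let α := alpha0 N a
  let β := beta0 N a m
  let t := tvar x
  mu0 ω a β l (m - 4) x •
    ((3 / (2 * (((m - 3) / 2 : ℕ) + 1 / 2)) * com x ^ 2 * jacobi (m / 2 - 2) (α + 3) β t)
        • sym2 s x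
      + (3 / 2 * com x ^ 3 * phi4 m α β t
          - 1 / N * jacobi (m / 2 - 2) (α + 4) β t * psum 3 x) • sym1 s x
      + (1 / N * com x * jacobi (m / 2 - 2) (α + 4) β t * psum 3 x
          + 3 / 2 * com x ^ 4 * chi4 m α β t) • sym0 s x)

def psiTilde2 (ω a : ℝ) (l m : ℕ) (s : Spin N κ) : Wave N κ := fun x =>
  let α := alpha0 N a
  let β := beta0 N a m
  let t := tvar x
  mu0 ω a β l (m - 2) x •
    (jacobi (m / 2 - 1) (α + 2) β t • (sym11 s x - com x • symSum s x)
      + (com x ^ 2 * (jacobi (m / 2 - 1) (α + 2) β t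
          + 2 * (α + 1) / ((2 * ((m - 1) / 2 : ℕ) + 1) * (N - 1))
            * jacobi (m / 2 - 1) (α + 1) β t))
        • sym0 s x)

/-! ## The model with inverse square external potential -/

def alpha1 (N : ℕ) (a b : ℝ) : ℝ := N * (2 * a + b + 1 / 2)

def beta1 (N : ℕ) (a b : ℝ) : ℝ := N * (4 * a + b + 3 / 2)

def mu1 (ω a b : ℝ) (x : Pos N) : ℝ :=
  Real.exp (-(ω / 2) * psum 2 x) * ∏ i, (|x i ^ 2 - x (i + 1) ^ 2| ^ a * x i ^ b)

def xi0 (ω a b : ℝ) (k : ℕ) (s : Spin N κ) : Wave N κ := fun x =>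
  (mu1 ω a b x * laguerre k (alpha1 N a b - 1) (ω * psum 2 x)) • sym0 s x

def xi1 (ω a b : ℝ) (k : ℕ) (s : Spin N κ) : Wave N κ := fun x =>
  (mu1 ω a b x * laguerre (k - 1) (alpha1 N a b + 1) (ω * psum 2 x)) •
    ((N : ℝ) • sym2 s x - psum 2 x • sym0 s x)

def xi2 (ω a b : ℝ) (k : ℕ) (s : Spin N κ) : Wave N κ := fun x =>
  (mu1 ω a b x * laguerre (k - 2) (alpha1 N a b + 3) (ω * psum 2 x)
    * (N * (alpha1 N a b + 1) * psum 4 x - beta1 N a b * psum 2 x ^ 2)) • sym0 s x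

/-! ## The trigonometric model -/

def mu2 (a : ℝ) (x : Pos N) : ℝ := ∏ i, Real.sin |x i - x (i + 1)| ^ a

def eta0 (a : ℝ) (s : Spin N κ) : Wave N κ := fun x => mu2 a x • sym0 s x

def eta1 (a : ℝ) (s : Spin N κ) : Wave N κ := fun x =>
  mu2 a x • ∑ i, Real.cos (2 * (x i - com x)) • spinOne s i

def eta2 (a : ℝ) (s : Spin N κ) : Wave N κ := fun x =>
  mu2 a x • ∑ i, Real.sin (2 * (x i - com x)) • spinOne s i

def eta3 (a : ℝ) (s : Spin N κ) : Wave N κ := fun x =>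
  mu2 a x • ((2 * a / (2 * a + 1)) • sym0 s x
    + ∑ j, ∑ i ∈ Finset.univ.erase j, Real.cos (2 * (x i - x j)) • spinOne s j)

def eta4 (a : ℝ) (s : Spin N κ) : Wave N κ := fun x =>
  mu2 a x • ∑ j, ∑ i ∈ Finset.univ.erase j, Real.sin (2 * (x i - x j)) • spinOne s j

end Rational

end NearNeighbour

end

open NearNeighbour

namespace NearNeighbour
open scoped ContDiff

variable {N κ : ℕ} {E : Type*} [NormedAddCommGroup E] [NormedSpace ℝ E]

/-! ## Partial derivatives -/

/-! Each Hamiltonian becomes, after division by a positive function `μ`, an operator without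
zeroth-order term on spin-symmetric functions. Write the potential as `U + ∑ w_i (1 - S_{i,i+1})`
with `w_i ≥ 0`, and let `F` be the logarithmic gradient of `μ`. If `Δμ = (U - E₀) μ`, then `H (μ f)
= μ (E₀ f - gaugedOp F w f)`, where `gaugedOp` consists of the Laplacian, the drift `2 F · ∇` and
the exchange terms (`Gauge.hamiltonian_eq`). For the rational and trigonometric models `μ` is a
product over neighbouring pairs of a function with logarithmic derivative `a ℓ`, where `ℓ' = -(K +
ℓ²)`: `ℓ = 1 / d` with `K = 0`, or `ℓ = cot` with `K = 1` (`LinkFactor.gauge`). The model with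
inverse square external potential has its own gauge, `mu1_isGauge`.

Ground state energy. Integration by parts shows that `⟨Φ, HΦ⟩` is `E₀ ‖Φ‖²` plus the squared norms
of `(∂_i - F_i) Φ` plus nonnegative exchange terms; this is the lower bound `Gauge.energy_lower`.
For the upper bound take `μ χ v` with an exchange invariant spin vector `v` and a cutoff `χ`, so
that only `∫ μ² |∇χ|²` is lost. A cutoff at distance `δ` from a wall where `μ = O(d^e)` costs
`O(δ^(2e-1))`, which tends to zero because `e > 1/2`. The cutoff at infinity is harmless along
suitable radii because the mass of `μ²` in balls grows at most polynomially; this covers the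
trigonometric model, where `μ` is not square integrable (`Gauge.exists_test`).

Eigenfunctions. It remains to solve `gaugedOp f = -e f`. For `f = ∑ φ(x_k) |s_k⟩` an exchange
changes only two terms, and for suitable `φ` the pole of the exchange term on a link cancels the
pole of the drift (`LinkFactor.gaugedOp_spread`). In the two confined models one looks for
homogeneous functions annihilated by the operator without confinement (`Harm`); a Laguerre
polynomial in `ω r²` turns them into eigenfunctions of the confined problem (`Harm.laguerre`). In
the rational model a translation invariant solution moreover generates a sequence of solutions by
multiplication with polynomials in the centre of mass and the variance of the coordinates, whose
coefficients are those of Jacobi polynomials (`Harm.ladder`). The seeds are `sym0`, `wave1`,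
`wave2`, `cubic` times `sym0`, `wave4` and `waveTilde`. The functions in the theorem are
combinations of ladders over these seeds; that the explicit formulas agree with the combinations is
the content of `jacobi_relation_two`, `jacobi_relation_three` and `jacobi_relation_four`, all of
which follow from three contiguous relations between Jacobi polynomials. In the trigonometric model
the solutions are trigonometric sums and products of two of them.

Nonvanishing is read off from the leading power under a large translation (rational model), from a
dilation (inverse square model), and from the value or the gradient at the origin, a boundary point
of the configuration space (trigonometric model). -/

/-- The partial derivative of a function with values in a normed space. -/
noncomputable def pD (i : Fin N) (f : Pos N → E) : Pos N → E :=
  fun x => fderiv ℝ f x (Pi.single i 1)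

lemma pd_eq (i : Fin N) (Ψ : Wave N κ) : pd i Ψ = pD i Ψ := rfl

/-- `f` is differentiable at `x` and its `i`-th partial derivative is `f'`. -/
structure HasPD (i : Fin N) (f : Pos N → E) (f' : E) (x : Pos N) : Prop where
  diff : DifferentiableAt ℝ f x
  eq : pD i f x = f'

namespace HasPD

variable {i : Fin N} {x : Pos N} {f g : Pos N → E} {f' g' : E} {A B : Pos N → ℝ} {A' B' : ℝ}

lemma congr (h : HasPD i f f' x) (e : f' = g') : HasPD i f g' x := e ▸ h

lemma of_contDiff (h : ContDiff ℝ ∞ f) : HasPD i f (pD i f x) x :=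
  ⟨h.differentiable (by simp) x, rfl⟩

lemma congr_of_eventuallyEq (h : HasPD i f f' x) (e : g =ᶠ[nhds x] f) : HasPD i g f' x :=
  ⟨e.differentiableAt_iff.mpr h.diff, by rw [pD, e.fderiv_eq]; exact h.eq⟩

lemma const (c : E) : HasPD i (fun _ => c) 0 x :=
  ⟨differentiableAt_const c, by simp [pD]⟩

lemma coord (j : Fin N) : HasPD i (fun x => x j) (if i = j then 1 else 0) x := by
  refine ⟨differentiableAt_apply j x, ?_⟩
  have : (fun x : Pos N => x j) = ⇑(ContinuousLinearMap.proj (R := ℝ) (φ := fun _ => ℝ) j) := rfl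
  rw [pD, this, ContinuousLinearMap.fderiv]
  simp [Pi.single_apply, eq_comm]

lemma add (hf : HasPD i f f' x) (hg : HasPD i g g' x) :
    HasPD i (fun x => f x + g x) (f' + g') x :=
  ⟨hf.diff.add hg.diff, by
    rw [pD, fderiv_fun_add hf.diff hg.diff, ← hf.eq, ← hg.eq]; rfl⟩

lemma sub (hf : HasPD i f f' x) (hg : HasPD i g g' x) :
    HasPD i (fun x => f x - g x) (f' - g') x :=
  ⟨hf.diff.sub hg.diff, by
    rw [pD, fderiv_fun_sub hf.diff hg.diff, ← hf.eq, ← hg.eq]; rfl⟩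

lemma sum {ι : Type*} {s : Finset ι} {f : ι → Pos N → E} {f' : ι → E}
    (h : ∀ k ∈ s, HasPD i (f k) (f' k) x) :
    HasPD i (fun x => ∑ k ∈ s, f k x) (∑ k ∈ s, f' k) x := by
  refine ⟨DifferentiableAt.fun_sum fun k hk => (h k hk).diff, ?_⟩
  rw [pD, fderiv_fun_sum fun k hk => (h k hk).diff, sum_apply]
  exact Finset.sum_congr rfl fun k hk => (h k hk).eq

lemma smul (hA : HasPD i A A' x) (hf : HasPD i f f' x) :
    HasPD i (fun x => A x • f x) (A' • f x + A x • f') x := by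
  refine ⟨hA.diff.smul hf.diff, ?_⟩
  rw [pD, fderiv_fun_smul hA.diff hf.diff, ← hf.eq, ← hA.eq]
  simp [pD, add_comm]

lemma smul_const (hA : HasPD i A A' x) (c : E) : HasPD i (fun x => A x • c) (A' • c) x :=
  (hA.smul (const c)).congr (by simp)

lemma const_smul (c : ℝ) (hf : HasPD i f f' x) : HasPD i (fun x => c • f x) (c • f') x :=
  ((const c).smul hf).congr (by simp)

lemma mul (hA : HasPD i A A' x) (hB : HasPD i B B' x) :
    HasPD i (fun x => A x * B x) (A' * B x + A x * B') x := hA.smul hB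

lemma const_mul (c : ℝ) (hA : HasPD i A A' x) : HasPD i (fun x => c * A x) (c * A') x :=
  hA.const_smul c

lemma comp {φ : ℝ → ℝ} {φ' : ℝ} (hφ : HasDerivAt φ φ' (A x)) (hA : HasPD i A A' x) :
    HasPD i (fun x => φ (A x)) (φ' * A') x := by
  have h := hφ.comp_hasFDerivAt x hA.diff.hasFDerivAt
  refine ⟨h.differentiableAt, ?_⟩
  have e : fderiv ℝ (fun x => φ (A x)) x = φ' • fderiv ℝ A x := h.fderiv
  rw [pD, e, ← hA.eq]
  simp [pD]

lemma pow (hA : HasPD i A A' x) (n : ℕ) :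
    HasPD i (fun x => A x ^ n) (n * A x ^ (n - 1) * A') x :=
  comp (φ := fun y => y ^ n) (hasDerivAt_pow n (A x)) hA

lemma inv (hA : HasPD i A A' x) (h : A x ≠ 0) :
    HasPD i (fun x => (A x)⁻¹) (-A' / A x ^ 2) x :=
  (comp (hasDerivAt_inv h) hA).congr (by ring)

lemma exp (hA : HasPD i A A' x) :
    HasPD i (fun x => Real.exp (A x)) (A' * Real.exp (A x)) x :=
  (comp (Real.hasDerivAt_exp _) hA).congr (by ring)

end HasPD

lemma contDiff_pD {f : Pos N → E} (hf : ContDiff ℝ ∞ f) (i : Fin N) : ContDiff ℝ ∞ (pD i f) := by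
  unfold pD
  exact (hf.fderiv_right (m := ∞) (by simp)).clm_apply contDiff_const

lemma pD_eq_of {f : Pos N → E} {g : Pos N → E} {i : Fin N} (h : ∀ x, HasPD i f (g x) x) :
    pD i f = g := funext fun x => (h x).eq

lemma pD_add {f g : Pos N → E} (hf : ContDiff ℝ ∞ f) (hg : ContDiff ℝ ∞ g) (i : Fin N) :
    pD i (fun x => f x + g x) = fun x => pD i f x + pD i g x :=
  pD_eq_of fun _ => (HasPD.of_contDiff hf).add (HasPD.of_contDiff hg)

lemma pD_sum {ι : Type*} {s : Finset ι} {f : ι → Pos N → E} (hf : ∀ k ∈ s, ContDiff ℝ ∞ (f k))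
    (i : Fin N) : pD i (fun x => ∑ k ∈ s, f k x) = fun x => ∑ k ∈ s, pD i (f k) x :=
  pD_eq_of fun _ => HasPD.sum fun k hk => HasPD.of_contDiff (hf k hk)

lemma pD_smul {A : Pos N → ℝ} {f : Pos N → E} (hA : ContDiff ℝ ∞ A) (hf : ContDiff ℝ ∞ f)
    (i : Fin N) : pD i (fun x => A x • f x) = fun x => pD i A x • f x + A x • pD i f x :=
  pD_eq_of fun _ => (HasPD.of_contDiff hA).smul (HasPD.of_contDiff hf)

lemma pD_const_smul (c : ℝ) {f : Pos N → E} (hf : ContDiff ℝ ∞ f)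
    (i : Fin N) : pD i (fun x => c • f x) = fun x => c • pD i f x :=
  pD_eq_of fun _ => (HasPD.of_contDiff hf).const_smul c

lemma pD_const (c : E) (i : Fin N) : pD i (fun _ => c) = fun _ => 0 :=
  pD_eq_of fun _ => HasPD.const c

/-! ## Permutations of the spins -/

section Spin

lemma permSpin_apply (σ : Equiv.Perm (Fin N)) (v : Spin N κ) (s : Fin N → Fin (κ + 1)) :
    permSpin σ v s = v (s ∘ σ) := rfl

lemma permSpin_mul (σ τ : Equiv.Perm (Fin N)) (v : Spin N κ) :
    permSpin (σ * τ) v = permSpin σ (permSpin τ v) := rfl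

lemma permSpin_add (σ : Equiv.Perm (Fin N)) (v w : Spin N κ) :
    permSpin σ (v + w) = permSpin σ v + permSpin σ w := rfl

lemma permSpin_sum (σ : Equiv.Perm (Fin N)) {ι : Type*} (t : Finset ι) (v : ι → Spin N κ) :
    permSpin σ (∑ k ∈ t, v k) = ∑ k ∈ t, permSpin σ (v k) := by
  classical
  induction t using Finset.induction_on with
  | empty => simp; rfl
  | insert k t hk ih => rw [Finset.sum_insert hk, Finset.sum_insert hk, permSpin_add, ih]

lemma norm_permSpin (σ : Equiv.Perm (Fin N)) (v : Spin N κ) : ‖permSpin σ v‖ = ‖v‖ := by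
  rw [EuclideanSpace.norm_eq, EuclideanSpace.norm_eq]
  congr 1
  exact Equiv.sum_comp (Equiv.arrowCongr σ.symm (Equiv.refl (Fin (κ + 1))))
    (fun s => ‖v s‖ ^ 2)

lemma exchange_smul (i j : Fin N) (c : ℝ) (v : Spin N κ) :
    exchange i j (c • v) = c • exchange i j v := rfl

lemma exchange_add (i j : Fin N) (v w : Spin N κ) :
    exchange i j (v + w) = exchange i j v + exchange i j w := rfl

lemma exchange_sum (i j : Fin N) {ι : Type*} (t : Finset ι) (v : ι → Spin N κ) :
    exchange i j (∑ k ∈ t, v k) = ∑ k ∈ t, exchange i j (v k) := permSpin_sum _ t v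

/-- Exchanges are isometries, so `⟨v, S v⟩` is at most `‖v‖²` by Cauchy–Schwarz. This gives the
exchange part of the potential its sign. -/
lemma inner_sub_exchange_nonneg (i j : Fin N) (v : Spin N κ) :
    0 ≤ (inner ℂ v (v - exchange i j v)).re := by
  rw [inner_sub_right, Complex.sub_re]
  have h1 : (inner ℂ v v : ℂ).re = ‖v‖ ^ 2 := by
    rw [inner_self_eq_norm_sq_to_K]; norm_cast
  have h2 : (inner ℂ v (exchange i j v) : ℂ).re ≤ ‖v‖ * ‖v‖ := by
    have := re_inner_le_norm (𝕜 := ℂ) v (exchange i j v)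
    rwa [exchange, norm_permSpin] at this
  nlinarith

end Spin

/-! ## Gauge transformed Hamiltonians -/

section Gauge

variable [NeZero N]

/-- The operator `∑ ∂_i² + 2 ∑ F_i ∂_i - ∑ w_i (1 - S_{i,i+1})`. -/
noncomputable def gaugedOp (F w : Fin N → Pos N → ℝ) (f : Wave N κ) : Wave N κ := fun x =>
  ∑ i, pD i (pD i f) x + (2 : ℝ) • ∑ i, F i x • pD i f x
    - ∑ i, w i x • (f x - exchange i (i + 1) (f x))

/-- The operator `∑ ∂_i² + 2 ∑ F_i ∂_i` on scalar functions. -/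
noncomputable def scalarOp (F : Fin N → Pos N → ℝ) (A : Pos N → ℝ) : Pos N → ℝ := fun x =>
  ∑ i, pD i (pD i A) x + 2 * ∑ i, F i x * pD i A x

lemma gaugedOp_add (F w : Fin N → Pos N → ℝ) {f g : Wave N κ} (hf : ContDiff ℝ ∞ f)
    (hg : ContDiff ℝ ∞ g) (x : Pos N) :
    gaugedOp F w (fun x => f x + g x) x = gaugedOp F w f x + gaugedOp F w g x := by
  simp only [gaugedOp, pD_add hf hg, pD_add (contDiff_pD hf _) (contDiff_pD hg _), exchange_add,
    smul_add, Finset.sum_add_distrib, smul_sub, Finset.sum_sub_distrib]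
  abel

lemma gaugedOp_sum (F w : Fin N → Pos N → ℝ) {ι : Type*} (t : Finset ι) {f : ι → Wave N κ}
    (hf : ∀ k, ContDiff ℝ ∞ (f k)) (x : Pos N) :
    gaugedOp F w (fun x => ∑ k ∈ t, f k x) x = ∑ k ∈ t, gaugedOp F w (f k) x := by
  classical
  induction t using Finset.induction_on with
  | empty =>
    have h0 : ∀ i j : Fin N, exchange i j (0 : Spin N κ) = 0 := fun i j => rfl
    simp [gaugedOp, pD_const, h0]
  | insert k t hk ih =>
    simp only [Finset.sum_insert hk]
    rw [gaugedOp_add F w (hf k) (ContDiff.sum fun j _ => hf j), ih]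

/-- The exchange acts on spins only and commutes with multiplication by `A`, so the single cross
term is the one from the Laplacian. -/
lemma gaugedOp_smul (F w : Fin N → Pos N → ℝ) {A : Pos N → ℝ} {f : Wave N κ}
    (hA : ContDiff ℝ ∞ A) (hf : ContDiff ℝ ∞ f) (x : Pos N) :
    gaugedOp F w (fun x => A x • f x) x =
      scalarOp F A x • f x + (2 : ℝ) • ∑ i, pD i A x • pD i f x + A x • gaugedOp F w f x := by
  have h2 : ∀ i, pD i (pD i (fun x => A x • f x)) x =
      pD i (pD i A) x • f x + (2 : ℝ) • (pD i A x • pD i f x) + A x • pD i (pD i f) x := by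
    intro i
    rw [pD_smul hA hf, (((HasPD.of_contDiff (contDiff_pD hA i)).smul (HasPD.of_contDiff hf)).add
      ((HasPD.of_contDiff hA).smul (HasPD.of_contDiff (contDiff_pD hf i)))).eq]
    simp only [two_smul]
    abel
  have h1 : ∀ i, F i x • pD i (fun x => A x • f x) x =
      (F i x * pD i A x) • f x + A x • (F i x • pD i f x) := by
    intro i
    rw [pD_smul hA hf, smul_add, smul_smul, smul_comm (F i x)]
  have h3 : ∀ i, w i x • (A x • f x - exchange i (i + 1) (A x • f x)) =
      A x • (w i x • (f x - exchange i (i + 1) (f x))) := by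
    intro i
    rw [exchange_smul, ← smul_sub, smul_comm]
  unfold gaugedOp scalarOp
  simp only [h1, h2, h3]
  rw [Finset.sum_add_distrib, Finset.sum_add_distrib, Finset.sum_add_distrib, ← Finset.smul_sum,
    ← Finset.smul_sum, ← Finset.sum_smul, ← Finset.smul_sum, ← Finset.sum_smul, ← Finset.smul_sum]
  module

lemma gaugedOp_const_smul (F w : Fin N → Pos N → ℝ) (c : ℝ) {f : Wave N κ}
    (hf : ContDiff ℝ ∞ f) (x : Pos N) :
    gaugedOp F w (fun x => c • f x) x = c • gaugedOp F w f x := by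
  rw [gaugedOp_smul F w contDiff_const hf]
  simp [scalarOp, pD_const]

/-- A positive function `μ` with logarithmic gradient `F` that transforms the Hamiltonian with
potential `V` into `E - gaugedOp F w`; the potential on spin states is
`U + ∑ w_i (1 - S_{i,i+1})`. -/
structure Gauge (C : Set (Pos N)) (V : Pos N → Spin N κ → Spin N κ) (μ U : Pos N → ℝ)
    (F G w : Fin N → Pos N → ℝ) (E : ℝ) : Prop where
  isOpen : IsOpen C
  pos : ∀ x ∈ C, 0 < μ x
  smooth : ContDiffOn ℝ ∞ μ C
  hasPD : ∀ x ∈ C, ∀ i, HasPD i μ (F i x * μ x) x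
  hasPD' : ∀ x ∈ C, ∀ i, HasPD i (F i) (G i x) x
  cont' : ∀ i, ContinuousOn (G i) C
  contw : ∀ i, ContinuousOn (w i) C
  nonneg : ∀ x ∈ C, ∀ i, 0 ≤ w i x
  potential : ∀ x ∈ C, ∀ v, V x v = U x • v + ∑ i, w i x • (v - exchange i (i + 1) v)
  -- Since `∂_i² μ = (G_i + F_i²) μ`, this is the equation `Δμ = (U - E) μ`.
  energy : ∀ x ∈ C, ∑ i, (G i x + F i x ^ 2) = U x - E

variable {C : Set (Pos N)} {V : Pos N → Spin N κ → Spin N κ} {μ U : Pos N → ℝ}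
  {F G w : Fin N → Pos N → ℝ} {E₀ : ℝ}

lemma Gauge.pd_smul (h : Gauge C V μ U F G w E₀) {f : Wave N κ} (hf : ContDiff ℝ ∞ f)
    {x : Pos N} (hx : x ∈ C) (i : Fin N) :
    HasPD i (fun x => μ x • f x) (μ x • (F i x • f x + pD i f x)) x :=
  ((h.hasPD x hx i).smul (HasPD.of_contDiff hf)).congr (by
    rw [smul_add, smul_smul, mul_comm])

/-- Differentiating `μ f` twice gives `μ` times `(G_i + F_i²) f + 2 F_i ∂_i f + ∂_i² f`. Summed over
`i`, the zeroth-order part is `(U - E₀) f` and cancels the scalar potential up to `E₀`. -/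
lemma Gauge.hamiltonian_eq (h : Gauge C V μ U F G w E₀) {f : Wave N κ} (hf : ContDiff ℝ ∞ f)
    {x : Pos N} (hx : x ∈ C) :
    hamiltonian V (fun x => μ x • f x) x = μ x • (E₀ • f x - gaugedOp F w f x) := by
  have h2 : ∀ i, pd i (pd i (fun x => μ x • f x)) x =
      μ x • (((G i x + F i x ^ 2) • f x + (2 : ℝ) • (F i x • pD i f x)) + pD i (pD i f) x) := by
    intro i
    -- The gradient of `μ` is known on `C` only; openness of `C` gives the formula on a
    -- neighbourhood, so that it can be differentiated again.
    have e : pD i (fun x => μ x • f x) =ᶠ[nhds x]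
        fun x => μ x • (F i x • f x + pD i f x) := by
      filter_upwards [h.isOpen.mem_nhds hx] with y hy using (h.pd_smul hf hy i).eq
    have h3 := ((h.hasPD x hx i).smul (((h.hasPD' x hx i).smul (HasPD.of_contDiff hf)).add
      (HasPD.of_contDiff (contDiff_pD hf i)))).congr_of_eventuallyEq e
    rw [pd_eq, pd_eq, h3.eq]
    module
  unfold hamiltonian
  simp only [h2]
  rw [← Finset.smul_sum, Finset.sum_add_distrib, Finset.sum_add_distrib, ← Finset.sum_smul,
    h.energy x hx, h.potential x hx, ← Finset.smul_sum, gaugedOp]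
  have h4 : ∀ i, w i x • (μ x • f x - exchange i (i + 1) (μ x • f x)) =
      μ x • (w i x • (f x - exchange i (i + 1) (f x))) := by
    intro i
    rw [exchange_smul, ← smul_sub, smul_comm]
  simp only [h4, ← Finset.smul_sum]
  module

lemma Gauge.solves (h : Gauge C V μ U F G w E₀) {f : Wave N κ} (hf : ContDiff ℝ ∞ f) {e : ℝ}
    (he : ∀ x ∈ C, gaugedOp F w f x = -(e • f x)) :
    Solves (hamiltonian V) C (fun x => μ x • f x) (E₀ + e) := by
  refine ⟨h.smooth.smul hf.contDiffOn, fun x hx => ?_⟩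
  rw [h.hamiltonian_eq hf hx, he x hx]
  module

end Gauge

end NearNeighbour
namespace NearNeighbour
open scoped ContDiff
open MeasureTheory

variable {N κ : ℕ}

/-! ## The quadratic form of a gauge transformable Hamiltonian -/

section Form

/-- The factor `g` may blow up at the boundary of `C`, but the support of `φ` is a compact subset of
the open set `C`, so the product is continuous everywhere. -/
lemma integrable_mul_of_tsupport {C : Set (Pos N)} (hC : IsOpen C) {g φ : Pos N → ℝ}
    (hg : ContinuousOn g C) (hφ : Continuous φ) (hc : HasCompactSupport φ) (ht : tsupport φ ⊆ C) :
    Integrable (fun x => g x * φ x) := by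
  have hs : tsupport (fun x => g x * φ x) ⊆ tsupport φ := tsupport_mul_subset_right
  have h1 : Continuous (fun x => g x * φ x) := by
    refine continuous_of_tsupport fun x hx => ?_
    exact ((hg.continuousAt (hC.mem_nhds (ht (hs hx)))).mul hφ.continuousAt)
  exact h1.integrable_of_hasCompactSupport (hc.mul_left)

lemma tsupport_pD_subset {E : Type*} [NormedAddCommGroup E] [NormedSpace ℝ E]
    (i : Fin N) (f : Pos N → E) : tsupport (pD i f) ⊆ tsupport f := by
  refine closure_minimal ?_ (isClosed_tsupport f)
  intro x hx
  by_contra h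
  apply hx
  have : fderiv ℝ f x = 0 := by
    by_contra h'
    exact h (support_fderiv_subset ℝ h')
  simp [pD, this]

lemma hasCompactSupport_pD {E : Type*} [NormedAddCommGroup E] [NormedSpace ℝ E]
    {f : Pos N → E} (hf : HasCompactSupport f) (i : Fin N) : HasCompactSupport (pD i f) :=
  hf.of_isClosed_subset (isClosed_tsupport _) (tsupport_pD_subset i f)

variable [NeZero N] {C : Set (Pos N)} {V : Pos N → Spin N κ → Spin N κ} {μ U : Pos N → ℝ}
  {F G w : Fin N → Pos N → ℝ} {E₀ : ℝ}


lemma Gauge.contF (h : Gauge C V μ U F G w E₀) (i : Fin N) : ContinuousOn (F i) C :=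
  fun x hx => (h.hasPD' x hx i).diff.continuousAt.continuousWithinAt

/-- Expanding the square, `∫ (∂φ)² = -∫ φ ∂²φ` and `2 ∫ F φ ∂φ = -∫ G φ²` by parts. Compact support
inside `C` removes all boundary terms, however singular `F` and `G` are at the walls. -/
lemma Gauge.integral_partial (h : Gauge C V μ U F G w E₀) {φ : Pos N → ℝ} (hφ : ContDiff ℝ ∞ φ)
    (hc : HasCompactSupport φ) (ht : tsupport φ ⊆ C) (i : Fin N) :
    Integrable (fun x => -(φ x * pD i (pD i φ) x) + (G i x + F i x ^ 2) * φ x ^ 2) ∧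
    Integrable (fun x => (pD i φ x - F i x * φ x) ^ 2) ∧
    ∫ x, (-(φ x * pD i (pD i φ) x) + (G i x + F i x ^ 2) * φ x ^ 2) =
      ∫ x, (pD i φ x - F i x * φ x) ^ 2 := by
  have cφ := hφ.continuous
  have sP := contDiff_pD hφ i
  have cP := sP.continuous
  have cPP := (contDiff_pD sP i).continuous
  have tP : tsupport (pD i φ) ⊆ C := (tsupport_pD_subset i φ).trans ht
  have hcP := hasCompactSupport_pD hc i
  have cF := h.contF i
  have I := fun (g : Pos N → ℝ) (hg : ContinuousOn g C) =>
    integrable_mul_of_tsupport h.isOpen hg cφ hc ht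
  have I1 : Integrable (fun x => φ x * pD i (pD i φ) x) :=
    (I _ cPP.continuousOn).congr (by filter_upwards with x; ring)
  have I2 : Integrable (fun x => pD i φ x * pD i φ x) :=
    integrable_mul_of_tsupport h.isOpen cP.continuousOn cP hcP tP
  have I3 : Integrable (fun x => φ x * pD i φ x) :=
    (I _ cP.continuousOn).congr (by filter_upwards with x; ring)
  have I4 : Integrable (fun x => (F i x * φ x) * pD i φ x) :=
    (I _ (cF.mul cP.continuousOn)).congr (by filter_upwards with x; simp only [Pi.mul_apply]; ring)
  have I5 : Integrable (fun x => (G i x * φ x) * φ x) := I _ ((h.cont' i).mul cφ.continuousOn)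
  have I6 : Integrable (fun x => (F i x ^ 2 * φ x) * φ x) := I _ ((cF.pow 2).mul cφ.continuousOn)
  have I7 : Integrable (fun x => (F i x * φ x) * φ x) := I _ (cF.mul cφ.continuousOn)
  have e1 : ∫ x, φ x * pD i (pD i φ) x = -∫ x, pD i φ x * pD i φ x :=
    integral_mul_fderiv_eq_neg_fderiv_mul_of_integrable I2 I1 I3
      (fun x _ => hφ.differentiable (by simp) x) (fun x _ => sP.differentiable (by simp) x)
  -- Outside `C` nothing is known about `F`, but there the factor `φ` vanishes.
  have key : ∀ x, pD i (fun x => F i x * φ x) x * φ x =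
      (G i x * φ x) * φ x + (F i x * φ x) * pD i φ x := by
    intro x
    by_cases hx : x ∈ C
    · rw [((h.hasPD' x hx i).mul (HasPD.of_contDiff hφ)).eq]; ring
    · have : φ x = 0 := image_eq_zero_of_notMem_tsupport fun h' => hx (ht h')
      simp [this]
  have e2 : ∫ x, (F i x * φ x) * pD i φ x = -∫ x, pD i (fun x => F i x * φ x) x * φ x := by
    refine integral_mul_fderiv_eq_neg_fderiv_mul_of_integrable ?_ I4 I7 ?_ ?_
    · exact (I5.add I4).congr (by filter_upwards with x; exact (key x).symm)
    · exact fun x hx => ((h.hasPD' x (ht hx) i).diff).mul (hφ.differentiable (by simp) x)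
    · exact fun x _ => hφ.differentiable (by simp) x
  simp_rw [key] at e2
  rw [integral_add I5 I4] at e2
  have q1 : (fun x => -(φ x * pD i (pD i φ) x) + (G i x + F i x ^ 2) * φ x ^ 2) =
      fun x => (-(φ x * pD i (pD i φ) x) + (G i x * φ x) * φ x) + (F i x ^ 2 * φ x) * φ x := by
    funext x; ring
  have q2 : (fun x => (pD i φ x - F i x * φ x) ^ 2) =
      fun x => (pD i φ x * pD i φ x - 2 * ((F i x * φ x) * pD i φ x)) +
        (F i x ^ 2 * φ x) * φ x := by
    funext x; ring
  rw [q1, q2]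
  refine ⟨(I1.neg.add I5).add I6, (I2.sub (I4.const_mul 2)).add I6, ?_⟩
  have J1 : Integrable (fun x => -(φ x * pD i (pD i φ) x)) := I1.neg
  have J2 : Integrable (fun x => -(φ x * pD i (pD i φ) x) + (G i x * φ x) * φ x) := J1.add I5
  have J3 : Integrable (fun x => pD i φ x * pD i φ x - 2 * ((F i x * φ x) * pD i φ x)) :=
    I2.sub (I4.const_mul 2)
  rw [integral_add J2 I6, integral_add J1 I5, integral_neg, integral_add J3 I6,
    integral_sub I2 (I4.const_mul 2), integral_const_mul]
  linarith

lemma Gauge.integral_form (h : Gauge C V μ U F G w E₀) {φ : Pos N → ℝ} (hφ : ContDiff ℝ ∞ φ)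
    (hc : HasCompactSupport φ) (ht : tsupport φ ⊆ C) :
    Integrable (fun x => -(φ x * ∑ i, pD i (pD i φ) x) + U x * φ x ^ 2) ∧
    ∫ x, (-(φ x * ∑ i, pD i (pD i φ) x) + U x * φ x ^ 2) =
      (∑ i, ∫ x, (pD i φ x - F i x * φ x) ^ 2) + E₀ * ∫ x, φ x ^ 2 := by
  have e : (fun x => -(φ x * ∑ i, pD i (pD i φ) x) + U x * φ x ^ 2) = fun x =>
      ∑ i, (-(φ x * pD i (pD i φ) x) + (G i x + F i x ^ 2) * φ x ^ 2) + E₀ * φ x ^ 2 := by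
    funext x
    rw [Finset.sum_add_distrib, Finset.sum_neg_distrib, ← Finset.mul_sum, ← Finset.sum_mul]
    by_cases hx : x ∈ C
    · rw [h.energy x hx]; ring
    · have : φ x = 0 := image_eq_zero_of_notMem_tsupport fun h' => hx (ht h')
      simp [this]
  have I1 : Integrable (fun x => φ x ^ 2) :=
    (integrable_mul_of_tsupport h.isOpen hφ.continuous.continuousOn hφ.continuous hc ht).congr
      (by filter_upwards with x; ring)
  have I2 := fun i => h.integral_partial hφ hc ht i
  have I3 : Integrable (fun x => ∑ i, (-(φ x * pD i (pD i φ) x) + (G i x + F i x ^ 2) * φ x ^ 2)) :=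
    integrable_finsetSum _ fun i _ => (I2 i).1
  rw [e]
  refine ⟨I3.add (I1.const_mul E₀), ?_⟩
  rw [integral_add I3 (I1.const_mul E₀), integral_const_mul, integral_finsetSum _ fun i _ => (I2 i).1]
  simp_rw [fun i => (I2 i).2.2]

/-- The real coordinates of a spin state. -/
noncomputable def spinPart (b : Bool) (s : Fin N → Fin (κ + 1)) : Spin N κ →L[ℝ] ℝ :=
  (if b then Complex.reCLM else Complex.imCLM).comp
    ((EuclideanSpace.proj s : Spin N κ →L[ℂ] ℂ).restrictScalars ℝ)

omit [NeZero N] in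
lemma re_inner_eq (u v : Spin N κ) :
    (inner ℂ u v).re = ∑ b, ∑ s, spinPart b s u * spinPart b s v := by
  rw [EuclideanSpace.inner_eq_star_dotProduct]
  simp only [dotProduct, Complex.re_sum, Fintype.sum_bool, ← Finset.sum_add_distrib]
  refine Finset.sum_congr rfl fun s _ => ?_
  simp [spinPart, Complex.mul_re]
  ring

omit [NeZero N] in
lemma norm_sq_eq_sum_spinPart (u : Spin N κ) : ‖u‖ ^ 2 = ∑ b, ∑ s, spinPart b s u ^ 2 := by
  have h1 : (inner ℂ u u : ℂ).re = ‖u‖ ^ 2 := by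
    rw [inner_self_eq_norm_sq_to_K]; norm_cast
  rw [← h1, re_inner_eq]
  simp_rw [sq]

omit [NeZero N] in
lemma pD_clm {E : Type*} [NormedAddCommGroup E] [NormedSpace ℝ E] (L : E →L[ℝ] ℝ)
    {f : Pos N → E} (hf : ContDiff ℝ ∞ f) (i : Fin N) :
    pD i (fun x => L (f x)) = fun x => L (pD i f x) := by
  funext x
  have := L.hasFDerivAt.comp x (hf.differentiable (by simp) x).hasFDerivAt
  have e : fderiv ℝ (fun x => L (f x)) x = L.comp (fderiv ℝ f x) := this.fderiv
  rw [pD, e]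
  rfl

/-- Real and imaginary parts in the spin basis reduce the kinetic and scalar terms to
`Gauge.integral_form` for each real component. The squares appearing there and the exchange terms
are nonnegative and are discarded. -/
lemma Gauge.energy_lower (h : Gauge C V μ U F G w E₀) {Φ : Wave N κ} (hΦ : ContDiff ℝ ∞ Φ)
    (hc : HasCompactSupport Φ) (ht : tsupport Φ ⊆ C) :
    E₀ * ∫ x, ‖Φ x‖ ^ 2 ≤ ∫ x, (inner ℂ (Φ x) (hamiltonian V Φ x)).re := by
  set φ : Bool → (Fin N → Fin (κ + 1)) → Pos N → ℝ := fun b s x => spinPart b s (Φ x) with hφ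
  have sφ : ∀ b s, ContDiff ℝ ∞ (φ b s) := fun b s => (spinPart b s).contDiff.comp hΦ
  have cφ : ∀ b s, HasCompactSupport (φ b s) := fun b s => hc.comp_left (map_zero _)
  have tφ : ∀ b s, tsupport (φ b s) ⊆ C := fun b s =>
    (tsupport_comp_subset (map_zero (spinPart b s)) Φ).trans ht
  have z : ∀ x ∉ C, Φ x = 0 := fun x hx =>
    image_eq_zero_of_notMem_tsupport fun h' => hx (ht h')
  have I1 : ∀ b s, Integrable (fun x => φ b s x ^ 2) := fun b s =>
    (integrable_mul_of_tsupport h.isOpen (sφ b s).continuous.continuousOn (sφ b s).continuous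
      (cφ b s) (tφ b s)).congr (by filter_upwards with x; ring)
  have I2 := fun b s => h.integral_form (sφ b s) (cφ b s) (tφ b s)
  have e1 : ∫ x, ‖Φ x‖ ^ 2 = ∑ b, ∑ s, ∫ x, φ b s x ^ 2 := by
    simp_rw [norm_sq_eq_sum_spinPart]
    rw [integral_finsetSum _ fun b _ => integrable_finsetSum _ fun s _ => I1 b s]
    exact Finset.sum_congr rfl fun b _ => integral_finsetSum _ fun s _ => I1 b s
  have e2 : ∀ x, (inner ℂ (Φ x) (hamiltonian V Φ x)).re =
      (∑ b, ∑ s, (-(φ b s x * ∑ i, pD i (pD i (φ b s)) x) + U x * φ b s x ^ 2)) +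
        ∑ i, w i x * (inner ℂ (Φ x) (Φ x - exchange i (i + 1) (Φ x))).re := by
    intro x
    by_cases hx : x ∈ C
    · have q1 : ∀ b s, φ b s x * ∑ i, pD i (pD i (φ b s)) x =
          spinPart b s (Φ x) * spinPart b s (∑ i, pD i (pD i Φ) x) := by
        intro b s
        rw [map_sum]
        congr 1
        refine Finset.sum_congr rfl fun i _ => ?_
        rw [hφ, pD_clm _ hΦ, pD_clm _ (contDiff_pD hΦ i)]
      have q2 : ∀ (c : ℝ) (u v : Spin N κ), (inner ℂ u (c • v)).re = c * (inner ℂ u v).re := by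
        intro c u v
        rw [re_inner_eq, re_inner_eq]
        simp only [map_smul, smul_eq_mul, Finset.mul_sum]
        refine Finset.sum_congr rfl fun b _ => Finset.sum_congr rfl fun s _ => by ring
      simp_rw [q1, Finset.sum_add_distrib, Finset.sum_neg_distrib, ← Finset.mul_sum]
      rw [← re_inner_eq, hφ]
      dsimp only
      rw [← norm_sq_eq_sum_spinPart, hamiltonian, h.potential x hx, inner_add_right,
        inner_add_right, inner_neg_right]
      simp only [inner_sum, Complex.add_re, Complex.neg_re, Complex.re_sum, q2]
      have h1 : (inner ℂ (Φ x) (Φ x) : ℂ).re = ‖Φ x‖ ^ 2 := by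
        rw [inner_self_eq_norm_sq_to_K]; norm_cast
      rw [h1]
      simp only [pd_eq]
      ring
    · simp [z x hx, hφ]
  have I3 : Integrable (fun x => ∑ b, ∑ s,
      (-(φ b s x * ∑ i, pD i (pD i (φ b s)) x) + U x * φ b s x ^ 2)) :=
    integrable_finsetSum _ fun b _ => integrable_finsetSum _ fun s _ => (I2 b s).1
  have I4 : Integrable (fun x =>
      ∑ i, w i x * (inner ℂ (Φ x) (Φ x - exchange i (i + 1) (Φ x))).re) := by
    refine integrable_finsetSum _ fun i _ => ?_
    simp only [re_inner_eq, Finset.mul_sum]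
    refine integrable_finsetSum _ fun b _ => integrable_finsetSum _ fun s _ => ?_
    have ce : Continuous (fun x => spinPart b s (Φ x - exchange i (i + 1) (Φ x))) := by
      have : Continuous (fun x => exchange i (i + 1) (Φ x)) := by
        unfold exchange permSpin
        refine (PiLp.continuous_toLp 2 _).comp (continuous_pi fun s => ?_)
        exact (EuclideanSpace.proj (𝕜 := ℂ) (s ∘ _)).continuous.comp hΦ.continuous
      exact (spinPart b s).continuous.comp (hΦ.continuous.sub this)
    refine (integrable_mul_of_tsupport h.isOpen ((h.contw i).mul ce.continuousOn)
      (sφ b s).continuous (cφ b s) (tφ b s)).congr ?_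
    filter_upwards with x
    simp only [Pi.mul_apply, hφ]
    ring
  simp_rw [e2]
  rw [integral_add I3 I4, e1,
    integral_finsetSum _ fun b _ => integrable_finsetSum _ fun s _ => (I2 b s).1]
  have pos : 0 ≤ ∫ x, ∑ i, w i x * (inner ℂ (Φ x) (Φ x - exchange i (i + 1) (Φ x))).re := by
    refine integral_nonneg fun x => Finset.sum_nonneg fun i _ => ?_
    by_cases hx : x ∈ C
    · exact mul_nonneg (h.nonneg x hx i) (inner_sub_exchange_nonneg _ _ _)
    · simp [z x hx]
  have main : E₀ * ∑ b, ∑ s, ∫ x, φ b s x ^ 2 ≤ ∑ b, ∫ x, ∑ s,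
      (-(φ b s x * ∑ i, pD i (pD i (φ b s)) x) + U x * φ b s x ^ 2) := by
    rw [Finset.mul_sum]
    refine Finset.sum_le_sum fun b _ => ?_
    rw [integral_finsetSum _ fun s _ => (I2 b s).1, Finset.mul_sum]
    refine Finset.sum_le_sum fun s _ => ?_
    rw [(I2 b s).2]
    have : 0 ≤ ∑ i, ∫ x, (pD i (φ b s) x - F i x * φ b s x) ^ 2 :=
      Finset.sum_nonneg fun i _ => integral_nonneg fun x => sq_nonneg _
    linarith
  linarith

/-- An exchange invariant spin vector kills all exchange terms, so nothing is discarded and the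
energy is computed exactly. -/
lemma Gauge.energy_smul (h : Gauge C V μ U F G w E₀) {φ : Pos N → ℝ} (hφ : ContDiff ℝ ∞ φ)
    (hc : HasCompactSupport φ) (ht : tsupport φ ⊆ C) {v : Spin N κ}
    (hv : ∀ i j, exchange i j v = v) (hv1 : ‖v‖ = 1) :
    ∫ x, (inner ℂ (φ x • v) (hamiltonian V (fun x => φ x • v) x)).re =
      (∑ i, ∫ x, (pD i φ x - F i x * φ x) ^ 2) + E₀ * ∫ x, φ x ^ 2 := by
  rw [← (h.integral_form hφ hc ht).2]
  refine integral_congr_ae ?_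
  filter_upwards with x
  by_cases hx : x ∈ C
  · have q1 : ∀ i, pd i (pd i (fun x => φ x • v)) x = pD i (pD i φ) x • v := by
      intro i
      have : pD i (fun x => φ x • v) = fun x => pD i φ x • v :=
        pD_eq_of fun _ => (HasPD.of_contDiff hφ).smul_const v
      rw [pd_eq, pd_eq, this, ((HasPD.of_contDiff (contDiff_pD hφ i)).smul_const v).eq]
    have q2 : ∀ i, w i x • (φ x • v - exchange i (i + 1) (φ x • v)) = 0 := by
      intro i; rw [exchange_smul, hv, sub_self, smul_zero]
    have q3 : hamiltonian V (fun x => φ x • v) x =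
        (-(∑ i, pD i (pD i φ) x) + U x * φ x) • v := by
      unfold hamiltonian
      rw [h.potential x hx]
      simp only [q1, q2, Finset.sum_const_zero, ← Finset.sum_smul]
      module
    have h1 : (inner ℂ v v : ℂ).re = 1 := by
      rw [inner_self_eq_norm_sq_to_K, hv1]; norm_num
    rw [q3]
    have h2 : ∀ c d : ℝ, (inner ℂ (c • v) (d • v) : ℂ).re = c * d * (inner ℂ v v : ℂ).re := by
      intro c d
      rw [re_inner_eq, re_inner_eq]
      simp only [map_smul, smul_eq_mul, Finset.mul_sum]
      refine Finset.sum_congr rfl fun b _ => Finset.sum_congr rfl fun s _ => by ring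
    rw [h2, h1]
    ring
  · have : φ x = 0 := image_eq_zero_of_notMem_tsupport fun h' => hx (ht h')
    simp [this]

end Form
end NearNeighbour
namespace NearNeighbour
open scoped ContDiff
open MeasureTheory

variable {N κ : ℕ}

/-! ## Slabs and cutoff functions -/

/-- A shear replaces the coordinate `x_j` by `x_j + λ x_i`, preserves volume, and maps the slab into
a box with one edge `δ` and `N - 1` edges `2 R`. -/
lemma volume_slab_le {i j : Fin N} (hij : i ≠ j) (lam c : ℝ) {R δ : ℝ} (hR : 0 ≤ R) (hδ : 0 ≤ δ) :
    volume {x : Pos N | (∀ k, |x k| ≤ R) ∧ 0 ≤ x j + lam * x i + c ∧ x j + lam * x i + c ≤ δ} ≤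
      ENNReal.ofReal (δ * (2 * R) ^ (N - 1)) := by
  classical
  set t : Matrix.TransvectionStruct (Fin N) ℝ := ⟨j, i, hij.symm, lam⟩ with ht
  set lo : Pos N := fun k => if k = j then -c else -R with hlo
  set hi : Pos N := fun k => if k = j then δ - c else R with hhi
  have happ : ∀ (x : Pos N) k, Matrix.toLin' t.toMatrix x k = x k + if k = j then lam * x i else 0 := by
    intro x k
    rw [Matrix.toLin'_apply, ht, Matrix.TransvectionStruct.toMatrix, Matrix.transvection,
      Matrix.add_mulVec, Matrix.one_mulVec, Pi.add_apply]
    congr 1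
    by_cases hk : k = j
    · subst hk; simp [Matrix.mulVec, dotProduct, Matrix.single_apply]
    · simp [Matrix.mulVec, dotProduct, hk, Ne.symm hk]
  have hsub : {x : Pos N | (∀ k, |x k| ≤ R) ∧ 0 ≤ x j + lam * x i + c ∧ x j + lam * x i + c ≤ δ} ⊆
      (Matrix.toLin' t.toMatrix) ⁻¹' Set.Icc lo hi := by
    rintro x ⟨h1, h2, h3⟩
    rw [Set.mem_preimage, Set.mem_Icc, Pi.le_def, Pi.le_def]
    refine ⟨fun k => ?_, fun k => ?_⟩ <;> rw [happ] <;> by_cases hk : k = j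
    · subst hk; simp only [hlo, if_true]; linarith
    · simp only [hlo, hk, if_false]; linarith [(abs_le.mp (h1 k)).1]
    · subst hk; simp only [hhi, if_true]; linarith
    · simp only [hhi, hk, if_false]; linarith [(abs_le.mp (h1 k)).2]
  refine (measure_mono hsub).trans ?_
  rw [(Real.volume_preserving_transvectionStruct t).measure_preimage
    measurableSet_Icc.nullMeasurableSet, Real.volume_Icc_pi, Fintype.prod_eq_mul_prod_compl j]
  have e : ∀ k ∈ ({j} : Finset (Fin N))ᶜ, ENNReal.ofReal (hi k - lo k) = ENNReal.ofReal (2 * R) := by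
    intro k hk
    have hk' : k ≠ j := by simpa using hk
    simp only [hhi, hlo, hk', if_false]
    congr 1; ring
  rw [Finset.prod_congr rfl e, Finset.prod_const, Finset.card_compl, Fintype.card_fin,
    Finset.card_singleton, ENNReal.ofReal_mul hδ, ENNReal.ofReal_pow (by positivity)]
  simp [hhi, hlo]

/-- If every doubling of the radius increased `A` by more than the factor `2 ^ (n + 1)`, then `A (2
^ k R₁)` would grow at least like `2 ^ ((n + 1) k)`, against the assumed bound of order `2 ^ (n k)`.
-/
lemma exists_doubling {A : ℝ → ℝ} {D R₁ : ℝ} (n : ℕ) (hR : 0 < R₁) (hA : ∀ R, R₁ ≤ R → A R ≤ D * R ^ n)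
    (hpos : 0 < A R₁) : ∃ R, R₁ ≤ R ∧ 0 < A R ∧ A (2 * R) ≤ 2 ^ (n + 1) * A R := by
  by_contra! hcon
  have key : ∀ k : ℕ, ((2 : ℝ) ^ (n + 1)) ^ k * A R₁ ≤ A (2 ^ k * R₁) ∧ 0 < A (2 ^ k * R₁) := by
    intro k
    induction k with
    | zero => simpa using hpos
    | succ k ih =>
      have h1 : R₁ ≤ 2 ^ k * R₁ := le_mul_of_one_le_left hR.le (one_le_pow₀ (by norm_num))
      have h2 := hcon _ h1 ih.2
      have e : (2 : ℝ) ^ (k + 1) * R₁ = 2 * (2 ^ k * R₁) := by ring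
      rw [e]
      have h3 : ((2 : ℝ) ^ (n + 1)) ^ (k + 1) * A R₁ = 2 ^ (n + 1) * (((2 : ℝ) ^ (n + 1)) ^ k * A R₁) := by
        ring
      have h4 := mul_le_mul_of_nonneg_left ih.1 (show (0 : ℝ) ≤ 2 ^ (n + 1) by positivity)
      exact ⟨by rw [h3]; linarith, lt_of_le_of_lt (by have := ih.2; positivity) h2⟩
  obtain ⟨k, hk⟩ := pow_unbounded_of_one_lt (D * R₁ ^ n / A R₁) (show (1 : ℝ) < 2 by norm_num)
  have h1 : R₁ ≤ 2 ^ k * R₁ := le_mul_of_one_le_left hR.le (one_le_pow₀ (by norm_num))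
  have h2 := (key k).1.trans (hA _ h1)
  rw [div_lt_iff₀ hpos] at hk
  have h3 : ((2 : ℝ) ^ (n + 1)) ^ k * A R₁ = 2 ^ (n * k) * (2 ^ k * A R₁) := by ring
  have h4 : D * (2 ^ k * R₁) ^ n = 2 ^ (n * k) * (D * R₁ ^ n) := by ring
  rw [h3, h4] at h2
  have := le_of_mul_le_mul_left h2 (by positivity)
  linarith

lemma deriv_smoothTransition_eq_zero {t : ℝ} (ht : t ∉ Set.Icc (0 : ℝ) 1) :
    deriv Real.smoothTransition t = 0 := by
  rw [Set.mem_Icc, not_and_or, not_le, not_le] at ht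
  rcases ht with ht | ht
  · have : Real.smoothTransition =ᶠ[nhds t] fun _ => 0 := by
      filter_upwards [Iio_mem_nhds ht] with y hy using
        Real.smoothTransition.zero_of_nonpos (le_of_lt hy)
    rw [this.deriv_eq]; simp
  · have : Real.smoothTransition =ᶠ[nhds t] fun _ => 1 := by
      filter_upwards [Ioi_mem_nhds ht] with y hy using
        Real.smoothTransition.one_of_one_le (le_of_lt hy)
    rw [this.deriv_eq]; simp

/-- The derivative is continuous and vanishes off `[0, 1]`, so compactness of that interval
suffices. -/
lemma exists_smoothTransition_deriv_bound :
    ∃ K : ℝ, 0 < K ∧ ∀ t, |deriv Real.smoothTransition t| ≤ K := by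
  have hc : Continuous (deriv Real.smoothTransition) :=
    (Real.smoothTransition.contDiff (n := 1)).continuous_deriv le_rfl
  obtain ⟨K, hK⟩ := isCompact_Icc.exists_bound_of_continuousOn (s := Set.Icc (0 : ℝ) 1)
    hc.continuousOn
  refine ⟨max K 1, by positivity, fun t => ?_⟩
  by_cases ht : t ∈ Set.Icc (0 : ℝ) 1
  · exact (hK t ht).trans (le_max_left _ _)
  · rw [deriv_smoothTransition_eq_zero ht]; simp

/-- `f` takes values in `[0, 1]` at `x`, with `i`-th partial derivative at most `g`. -/
def CutBound (i : Fin N) (f : Pos N → ℝ) (g : ℝ) (x : Pos N) : Prop :=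
  0 ≤ f x ∧ f x ≤ 1 ∧ ∃ f', HasPD i f f' x ∧ |f'| ≤ g

/-- All factors lie in `[0, 1]`, so by the Leibniz rule the bounds for the derivatives simply add
up. -/
lemma CutBound.mul {i : Fin N} {f₁ f₂ : Pos N → ℝ} {g₁ g₂ : ℝ} {x : Pos N}
    (h₁ : CutBound i f₁ g₁ x) (h₂ : CutBound i f₂ g₂ x) :
    CutBound i (fun x => f₁ x * f₂ x) (g₁ + g₂) x := by
  obtain ⟨a1, b1, f1, c1, d1⟩ := h₁
  obtain ⟨a2, b2, f2, c2, d2⟩ := h₂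
  refine ⟨mul_nonneg a1 a2, mul_le_one₀ b1 a2 b2, _, c1.mul c2, (abs_add_le _ _).trans ?_⟩
  rw [abs_mul, abs_mul, abs_of_nonneg a1, abs_of_nonneg a2]
  have e1 : |f1| * f₂ x ≤ g₁ * 1 := mul_le_mul d1 b2 a2 ((abs_nonneg _).trans d1)
  have e2 : f₁ x * |f2| ≤ 1 * g₂ := mul_le_mul b1 d2 (abs_nonneg _) zero_le_one
  linarith

lemma CutBound.prod {ι : Type*} (s : Finset ι) {i : Fin N} {f : ι → Pos N → ℝ} {g : ι → ℝ}
    {x : Pos N} (h : ∀ k ∈ s, CutBound i (f k) (g k) x) :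
    CutBound i (fun x => ∏ k ∈ s, f k x) (∑ k ∈ s, g k) x := by
  classical
  induction s using Finset.induction_on with
  | empty =>
    simp only [Finset.prod_empty, Finset.sum_empty]
    exact ⟨zero_le_one, le_rfl, 0, HasPD.const _, by simp⟩
  | insert k s hk ih =>
    simp only [Finset.prod_insert hk, Finset.sum_insert hk]
    exact (h k (Finset.mem_insert_self _ _)).mul
      (ih fun j hj => h j (Finset.mem_insert_of_mem hj))

lemma abs_coord_le {x : Pos N} {R : ℝ} (hR : 0 ≤ R) (hx : psum 2 x ≤ R ^ 2) (k : Fin N) :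
    |x k| ≤ R := by
  refine abs_le_of_sq_le_sq ?_ hR
  exact (Finset.single_le_sum (f := fun i => x i ^ 2) (fun i _ => sq_nonneg _)
    (Finset.mem_univ k)).trans hx

lemma contDiff_psum (k : ℕ) : ContDiff ℝ ∞ (psum k : Pos N → ℝ) := by
  unfold psum
  fun_prop

lemma hasPD_psum (k : ℕ) (i : Fin N) (x : Pos N) :
    HasPD i (psum k) (k * x i ^ (k - 1)) x := by
  have h := HasPD.sum (s := Finset.univ) (f' := fun j : Fin N =>
    k * x j ^ (k - 1) * (if i = j then 1 else 0)) fun j _ => (HasPD.coord (i := i) (x := x) j).pow k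
  refine HasPD.congr h ?_
  simp

end NearNeighbour
namespace NearNeighbour
open scoped ContDiff
open MeasureTheory

variable {N κ : ℕ}

/-! ## Test functions close to the ground state -/

section Test

variable [NeZero N] {C : Set (Pos N)} {V : Pos N → Spin N κ → Spin N κ} {μ U : Pos N → ℝ}
  {F G w : Fin N → Pos N → ℝ} {E₀ : ℝ} {K : Type*} [Fintype K]

-- The transition happens only where `1 ≤ p d ≤ 2`; elsewhere the cutoff is locally constant.
-- Keeping this information confines the error to a slab along the wall.
omit [NeZero N] in
lemma cutBound_slab {K₀ : ℝ} (hK : ∀ t, |deriv Real.smoothTransition t| ≤ K₀) {d : Pos N → ℝ}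
    (hd : ∀ x i, ∃ d', HasPD i d d' x ∧ |d'| ≤ 1) {p : ℝ} (hp : 0 ≤ p) (x : Pos N) (i : Fin N) :
    CutBound i (fun x => Real.smoothTransition (p * d x - 1))
      (if 0 ≤ p * d x - 1 ∧ p * d x - 1 ≤ 1 then K₀ * p else 0) x := by
  obtain ⟨d', h1, h2⟩ := hd x i
  refine ⟨Real.smoothTransition.nonneg _, Real.smoothTransition.le_one _, _,
    HasPD.comp (A := fun x => p * d x - 1)
      ((Real.smoothTransition.contDiff (n := 1)).differentiable (by simp) _).hasDerivAt
      ((h1.const_mul p).sub (HasPD.const 1)), ?_⟩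
  split_ifs with h
  · rw [abs_mul, sub_zero, abs_mul, abs_of_nonneg hp]
    refine mul_le_mul (hK _) ?_ (by positivity) ((abs_nonneg _).trans (hK 0))
    exact mul_le_of_le_one_right hp h2
  · rw [deriv_smoothTransition_eq_zero h]; simp

-- This cutoff is `1` for `r ≤ R` and `0` for `r ≥ 2 R`. Where its derivative can be nonzero, `|x_i|
-- ≤ 2 R`, so the inner derivative `2 x_i / (3 R²)` is at most `4 / (3 R)` in modulus.
omit [NeZero N] in
lemma cutBound_ball {K₀ : ℝ} (hK : ∀ t, |deriv Real.smoothTransition t| ≤ K₀) {R : ℝ} (hR : 0 < R)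
    (x : Pos N) (i : Fin N) :
    CutBound i (fun x => Real.smoothTransition ((4 - psum 2 x / R ^ 2) / 3)) (2 * K₀ / R) x := by
  have hK0 : 0 ≤ K₀ := (abs_nonneg _).trans (hK 0)
  have h1 : HasPD i (fun x : Pos N => (4 - psum 2 x / R ^ 2) / 3) (-(2 * x i) / (3 * R ^ 2)) x := by
    have := ((HasPD.const (4 / 3 : ℝ)).sub ((hasPD_psum 2 i x).const_mul (1 / (3 * R ^ 2))))
    have e : (fun x : Pos N => (4 - psum 2 x / R ^ 2) / 3) =
        fun x => 4 / 3 - 1 / (3 * R ^ 2) * psum 2 x := by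
      funext y; field_simp
    rw [e]
    refine this.congr ?_
    norm_num
    field_simp
  refine ⟨Real.smoothTransition.nonneg _, Real.smoothTransition.le_one _, _,
    HasPD.comp (A := fun x : Pos N => (4 - psum 2 x / R ^ 2) / 3)
      ((Real.smoothTransition.contDiff (n := 1)).differentiable (by simp) _).hasDerivAt h1, ?_⟩
  by_cases h : (4 - psum 2 x / R ^ 2) / 3 ∈ Set.Icc (0 : ℝ) 1
  · have h2 : psum 2 x ≤ (2 * R) ^ 2 := by
      have := h.1
      have h3 : psum 2 x / R ^ 2 ≤ 4 := by linarith
      rw [div_le_iff₀ (by positivity)] at h3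
      linarith
    have h3 := abs_coord_le (by positivity) h2 i
    rw [abs_mul]
    have h4 : |-(2 * x i) / (3 * R ^ 2)| ≤ 2 / R := by
      rw [abs_div, abs_neg, abs_mul, abs_of_pos (show (0 : ℝ) < 3 * R ^ 2 by positivity),
        div_le_div_iff₀ (by positivity) hR]
      norm_num
      nlinarith
    calc _ ≤ K₀ * (2 / R) := mul_le_mul (hK _) h4 (abs_nonneg _) hK0
      _ = _ := by ring
  · rw [deriv_smoothTransition_eq_zero h]; simp; positivity

/-- The part of a ball where `d` is at most `δ`. -/
def slab (d : Pos N → ℝ) (R δ : ℝ) : Set (Pos N) := {x | psum 2 x ≤ R ^ 2 ∧ 0 ≤ d x ∧ d x ≤ δ}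

/-- Functions of the form `x_j + λ x_i + c` with `|λ| ≤ 1`. -/
def IsWall (d : Pos N → ℝ) : Prop :=
  ∃ i j : Fin N, i ≠ j ∧ ∃ lam c : ℝ, |lam| ≤ 1 ∧ ∀ x, d x = x j + lam * x i + c

omit [NeZero N] in
lemma IsWall.contDiff {d : Pos N → ℝ} (h : IsWall d) : ContDiff ℝ ∞ d := by
  obtain ⟨i, j, -, lam, c, -, h⟩ := h
  rw [funext h]
  fun_prop

omit [NeZero N] in
lemma IsWall.hasPD {d : Pos N → ℝ} (h : IsWall d) (x : Pos N) (k : Fin N) :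
    ∃ d', HasPD k d d' x ∧ |d'| ≤ 1 := by
  obtain ⟨i, j, hij, lam, c, hlam, h⟩ := h
  rw [funext h]
  refine ⟨_, (((HasPD.coord j).add ((HasPD.coord i).const_mul lam)).add (HasPD.const c)), ?_⟩
  by_cases h1 : k = j
  · subst h1; simp [hij.symm]
  · by_cases h2 : k = i
    · subst h2; simpa [h1] using hlam
    · simp [h1, h2]

omit [NeZero N] in
lemma IsWall.volume_slab {d : Pos N → ℝ} (h : IsWall d) {R δ : ℝ} (hR : 0 ≤ R) (hδ : 0 ≤ δ) :
    volume (slab d R δ) ≤ ENNReal.ofReal (δ * (2 * R) ^ (N - 1)) := by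
  obtain ⟨i, j, hij, lam, c, -, h⟩ := h
  refine (measure_mono ?_).trans (volume_slab_le hij lam c hR hδ)
  rintro x ⟨h1, h2, h3⟩
  rw [h] at h2 h3
  exact ⟨fun k => abs_coord_le hR h1 k, h2, h3⟩

omit [NeZero N] in
lemma IsWall.measurableSet_slab {d : Pos N → ℝ} (h : IsWall d) (R δ : ℝ) :
    MeasurableSet (slab d R δ) := by
  have h1 := h.contDiff.continuous
  have h2 : Continuous (psum 2 : Pos N → ℝ) := (contDiff_psum 2).continuous
  exact ((isClosed_le h2 continuous_const).inter
    ((isClosed_le continuous_const h1).inter (isClosed_le h1 continuous_const))).measurableSet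

omit [NeZero N] in
lemma measurableSet_ball_psum (R : ℝ) : MeasurableSet {x : Pos N | psum 2 x ≤ R ^ 2} :=
  (isClosed_le (contDiff_psum 2).continuous continuous_const).measurableSet

omit [NeZero N] in
lemma volume_ball_psum_le {R : ℝ} (hR : 0 ≤ R) :
    volume {x : Pos N | psum 2 x ≤ R ^ 2} ≤ ENNReal.ofReal ((2 * R) ^ N) := by
  refine (measure_mono (t := Set.Icc (fun _ => -R) fun _ => R) ?_).trans ?_
  · intro x hx
    exact ⟨fun k => (abs_le.mp (abs_coord_le hR hx k)).1, fun k => (abs_le.mp (abs_coord_le hR hx k)).2⟩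
  · rw [Real.volume_Icc_pi]
    simp only [Finset.prod_const, Finset.card_univ, Fintype.card_fin]
    rw [ENNReal.ofReal_pow (by positivity)]
    gcongr
    linarith

/-- The cutoff function that vanishes near the walls `d k = 0` and near infinity. -/
noncomputable def cutoff (d : K → Pos N → ℝ) (p R : ℝ) (x : Pos N) : ℝ :=
  Real.smoothTransition ((4 - psum 2 x / R ^ 2) / 3) *
    ∏ k, Real.smoothTransition (p * d k x - 1)

omit [NeZero N] in
lemma cutoff_cutBound {d : K → Pos N → ℝ} (hd : ∀ k, IsWall (d k)) {K₀ : ℝ}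
    (hK : ∀ t, |deriv Real.smoothTransition t| ≤ K₀) {p R : ℝ} (hp : 0 ≤ p) (hR : 0 < R)
    (x : Pos N) (i : Fin N) :
    CutBound i (cutoff d p R) (2 * K₀ / R + ∑ k,
      if 0 ≤ p * d k x - 1 ∧ p * d k x - 1 ≤ 1 then K₀ * p else 0) x :=
  (cutBound_ball hK hR x i).mul
    (CutBound.prod Finset.univ fun k _ => cutBound_slab hK (hd k).hasPD hp x i)

omit [NeZero N] in
lemma contDiff_cutoff {d : K → Pos N → ℝ} (hd : ∀ k, IsWall (d k)) (p R : ℝ) :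
    ContDiff ℝ ∞ (cutoff d p R) := by
  unfold cutoff
  refine ContDiff.mul ?_ (contDiff_prod fun k _ => ?_)
  · exact Real.smoothTransition.contDiff.comp
      ((contDiff_const.sub ((contDiff_psum 2).div_const _)).div_const _)
  · exact Real.smoothTransition.contDiff.comp
      ((contDiff_const.mul (hd k).contDiff).sub contDiff_const)

omit [NeZero N] in
lemma tsupport_cutoff_subset {d : K → Pos N → ℝ} (hd : ∀ k, IsWall (d k)) {p R : ℝ} (hR : 0 < R) :
    tsupport (cutoff d p R) ⊆ {x | psum 2 x ≤ (2 * R) ^ 2} ∩ ⋂ k, {x | 1 ≤ p * d k x} := by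
  refine closure_minimal ?_ ((isClosed_le (contDiff_psum 2).continuous continuous_const).inter
    (isClosed_iInter fun k => isClosed_le continuous_const
      (continuous_const.mul (hd k).contDiff.continuous)))
  intro x hx
  rw [Function.mem_support, cutoff, mul_ne_zero_iff, Finset.prod_ne_zero_iff] at hx
  refine ⟨?_, Set.mem_iInter.mpr fun k => ?_⟩
  · by_contra h
    apply hx.1
    refine Real.smoothTransition.zero_of_nonpos ?_
    rw [Set.mem_ofPred_eq, not_le] at h
    have : 4 ≤ psum 2 x / R ^ 2 := by
      rw [le_div_iff₀ (by positivity)]; linarith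
    linarith
  · by_contra h
    rw [Set.mem_ofPred_eq, not_le] at h
    exact hx.2 k (Finset.mem_univ k) (Real.smoothTransition.zero_of_nonpos (by linarith))

omit [NeZero N] in
lemma contDiff_of_contDiffAt_tsupport {f : Pos N → ℝ} (h : ∀ x ∈ tsupport f, ContDiffAt ℝ ∞ f x) :
    ContDiff ℝ ∞ f := by
  rw [contDiff_iff_contDiffAt]
  intro x
  by_cases hx : x ∈ tsupport f
  · exact h x hx
  · exact contDiffAt_const.congr_of_eventuallyEq (notMem_tsupport_iff_eventuallyEq.mp hx)

-- The test function is `μ χ` with `χ` a cutoff, and `(∂_i - F_i)(μ χ) = μ ∂_i χ`, so only the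
-- regions where `χ` varies contribute. In a slab of width `δ` along a wall the volume is `O(δ)`,
-- `μ` is `O(δ^e)` and `∇χ` is `O(1 / δ)`, in total `O(δ^(2e-1))`. The radial cutoff costs `O(R⁻²)`
-- times the mass of `μ²` in the ball of radius `2 R`, which by `exists_doubling` is comparable with
-- the mass in the ball of radius `R` for some large `R`.
set_option maxHeartbeats 1000000 in
lemma Gauge.exists_test (h : Gauge C V μ U F G w E₀) (hne : C.Nonempty) {d : K → Pos N → ℝ}
    (hd : ∀ k, IsWall (d k)) (hC : ∀ x, x ∈ C ↔ ∀ k, 0 < d k x) {B : ℝ} (hB : ∀ x ∈ C, μ x ≤ B)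
    {e : K → ℝ} (he : ∀ k, 1 / 2 < e k)
    (hM : ∀ R, ∃ M, ∀ x ∈ C, psum 2 x ≤ R → ∀ k, μ x ≤ M * d k x ^ e k) {ε : ℝ} (hε : 0 < ε) :
    ∃ φ : Pos N → ℝ, ContDiff ℝ ∞ φ ∧ HasCompactSupport φ ∧ tsupport φ ⊆ C ∧
      0 < ∫ x, φ x ^ 2 ∧ ∑ i, ∫ x, (pD i φ x - F i x * φ x) ^ 2 ≤ ε * ∫ x, φ x ^ 2 := by
  obtain ⟨K₀, hK0, hK⟩ := exists_smoothTransition_deriv_bound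
  obtain ⟨x₀, hx₀⟩ := hne
  have hmC : MeasurableSet C := h.isOpen.measurableSet
  have hB0 : 0 < B := (h.pos x₀ hx₀).trans_le (hB x₀ hx₀)
  set Bs : ℝ → Set (Pos N) := fun R => C ∩ {x | psum 2 x ≤ R ^ 2} with hBs
  have hmBs : ∀ R, MeasurableSet (Bs R) := fun R => hmC.inter (measurableSet_ball_psum R)
  have hfin : ∀ R, 0 ≤ R → volume (Bs R) < ⊤ := fun R hR =>
    (measure_mono Set.inter_subset_right).trans_lt
      ((volume_ball_psum_le hR).trans_lt ENNReal.ofReal_lt_top)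
  have hIμ : ∀ R, 0 ≤ R → IntegrableOn (fun x => μ x ^ 2) (Bs R) := by
    intro R hR
    refine (integrableOn_const (C := B ^ 2) (hfin R hR).ne).mono' ?_ ?_
    · exact ((h.smooth.continuousOn.pow 2).mono Set.inter_subset_left).aestronglyMeasurable (hmBs R)
    · filter_upwards [ae_restrict_mem (hmBs R)] with x hx
      rw [Real.norm_of_nonneg (sq_nonneg _)]
      exact pow_le_pow_left₀ (h.pos x hx.1).le (hB x hx.1) 2
  set A : ℝ → ℝ := fun R => ∫ x in Bs R, μ x ^ 2 with hA
  have hAle : ∀ R, 0 ≤ R → A R ≤ B ^ 2 * 2 ^ N * R ^ N := by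
    intro R hR
    have h1 : A R ≤ ∫ x in Bs R, B ^ 2 := by
      refine setIntegral_mono_on (hIμ R hR) ?_ (hmBs R) fun x hx =>
        pow_le_pow_left₀ (h.pos x hx.1).le (hB x hx.1) 2
      exact integrableOn_const (hfin R hR).ne
    rw [setIntegral_const, smul_eq_mul] at h1
    have h2 : volume.real (Bs R) ≤ (2 * R) ^ N := by
      refine ENNReal.toReal_le_of_le_ofReal (by positivity) ?_
      exact (measure_mono Set.inter_subset_right).trans (volume_ball_psum_le hR)
    calc A R ≤ volume.real (Bs R) * B ^ 2 := h1
      _ ≤ (2 * R) ^ N * B ^ 2 := by gcongr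
      _ = _ := by ring
  have hApos : ∀ R, psum 2 x₀ < R ^ 2 → 0 ≤ R → 0 < A R := by
    intro R hR hR0
    rw [hA, setIntegral_pos_iff_support_of_nonneg_ae]
    · have ho : IsOpen (C ∩ {x | psum 2 x < R ^ 2}) :=
        h.isOpen.inter (isOpen_lt (contDiff_psum 2).continuous continuous_const)
      refine (ho.measure_pos volume ⟨x₀, hx₀, hR⟩).trans_le (measure_mono ?_)
      rintro x ⟨h1, h2⟩
      exact ⟨(pow_pos (h.pos x h1) 2).ne', h1, (show psum 2 x < R ^ 2 from h2).le⟩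
    · filter_upwards with x using sq_nonneg _
    · exact hIμ R hR0
  set n : ℝ := (Fintype.card K : ℝ) with hn
  set L : ℝ := N * (n + 1) * (4 * K₀ ^ 2) * 2 ^ (N + 1) with hL
  have hn0 : 0 ≤ n := Nat.cast_nonneg _
  have hN0 : (0 : ℝ) ≤ N := Nat.cast_nonneg _
  have hL0 : 0 ≤ L := by positivity
  -- The three summands ensure that radii are at least `1`, that `x₀` lies inside the ball, so that
  -- its mass is positive, and that `L / R² ≤ ε / 4` for `R ≥ R₁`.
  set R₁ : ℝ := 1 + psum 2 x₀ + 4 * L / ε with hR₁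
  have hp0 : 0 ≤ psum 2 x₀ := Finset.sum_nonneg fun i _ => sq_nonneg _
  have hq0 : 0 ≤ 4 * L / ε := by positivity
  have hR₁1 : 1 ≤ R₁ := by linarith
  obtain ⟨R, hRR, hAR, hdoub⟩ := exists_doubling (A := A) (D := B ^ 2 * 2 ^ N) (R₁ := R₁) N
    (by linarith) (fun R hR => hAle R (by linarith)) (hApos R₁ (by nlinarith) (by linarith))
  have hR1 : 1 ≤ R := hR₁1.trans hRR
  have hR0 : 0 < R := by linarith
  obtain ⟨M, hM⟩ := hM ((2 * R) ^ 2)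
  set Q : ℝ := (4 * R) ^ (N - 1) with hQ
  have hQ0 : 0 ≤ Q := by positivity
  -- The wall error as a function of the slab width; the exponents `2 e k - 1` are positive.
  have htend : Filter.Tendsto (fun δ : ℝ => ∑ k, (4 * K₀ ^ 2 * M ^ 2 * Q) * δ ^ (2 * e k - 1))
      (nhdsWithin 0 (Set.Ioi 0)) (nhds 0) := by
    have : Filter.Tendsto (fun δ : ℝ => ∑ k, (4 * K₀ ^ 2 * M ^ 2 * Q) * δ ^ (2 * e k - 1))
      (nhds 0) (nhds (∑ k, (4 * K₀ ^ 2 * M ^ 2 * Q) * (0 : ℝ) ^ (2 * e k - 1))) := by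
      refine tendsto_finsetSum _ fun k _ => Filter.Tendsto.const_mul _ ?_
      exact (Real.continuousAt_rpow_const 0 _ (Or.inr (by linarith [he k]))).tendsto
    have e0 : ∑ k, (4 * K₀ ^ 2 * M ^ 2 * Q) * (0 : ℝ) ^ (2 * e k - 1) = 0 := by
      refine Finset.sum_eq_zero fun k _ => ?_
      rw [Real.zero_rpow (by linarith [he k]), mul_zero]
    rw [e0] at this
    exact this.mono_left nhdsWithin_le_nhds
  have htend2 : Filter.Tendsto (fun δ : ℝ => n * (B ^ 2 * Q) * δ)
      (nhdsWithin 0 (Set.Ioi 0)) (nhds 0) := by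
    have : Filter.Tendsto (fun δ : ℝ => n * (B ^ 2 * Q) * δ) (nhds 0) (nhds (n * (B ^ 2 * Q) * 0)) :=
      Filter.tendsto_id.const_mul _
    rw [mul_zero] at this
    exact this.mono_left nhdsWithin_le_nhds
  have hgap : 0 < ε * A R / (4 * (N * (n + 1) + 1)) := by positivity
  -- The width is chosen after `R`, since `M`, `Q` and `A R` depend on `R`. The second condition
  -- ensures that the slabs carry less than half of the mass `A R`.
  obtain ⟨δ, ⟨hδ1, hδ2⟩, hδ⟩ := (((htend.eventually (gt_mem_nhds hgap)).and
    (htend2.eventually (gt_mem_nhds (half_pos hAR)))).and self_mem_nhdsWithin).exists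
  -- With this slope the wall cutoff vanishes for `d ≤ δ / 2` and equals `1` for `d ≥ δ`.
  set p : ℝ := 2 / δ with hp
  have hp0 : 0 < p := by positivity
  set χ := cutoff d p R with hχ
  have sχ : ContDiff ℝ ∞ χ := contDiff_cutoff hd p R
  have tχ := tsupport_cutoff_subset (p := p) hd hR0
  have tχC : tsupport χ ⊆ C := fun x hx => (hC x).mpr fun k => by
    have := Set.mem_iInter.mp (tχ hx).2 k
    rw [Set.mem_ofPred_eq] at this
    exact pos_of_mul_pos_right (by linarith) hp0.le
  have cχ : HasCompactSupport χ := by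
    refine HasCompactSupport.of_support_subset_isCompact
      (isCompact_Icc (a := (fun _ => -(2 * R) : Pos N)) (b := fun _ => 2 * R)) ?_
    intro x hx
    have hb := (tχ (subset_tsupport _ hx)).1
    exact ⟨fun k => (abs_le.mp (abs_coord_le (by positivity) hb k)).1,
      fun k => (abs_le.mp (abs_coord_le (by positivity) hb k)).2⟩
  set φ : Pos N → ℝ := fun x => μ x * χ x with hφ
  have tφ : tsupport φ ⊆ tsupport χ := tsupport_mul_subset_right
  have sφ : ContDiff ℝ ∞ φ := contDiff_of_contDiffAt_tsupport fun x hx =>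
    (h.smooth.contDiffAt (h.isOpen.mem_nhds (tχC (tφ hx)))).mul sχ.contDiffAt
  have cφ : HasCompactSupport φ := cχ.mul_left
  have bχ := fun x i => cutoff_cutBound hd hK hp0.le hR0 x i
  -- lower bound for the norm
  have hslabfin : ∀ k ρ, 0 ≤ ρ → volume (slab (d k) ρ δ) < ⊤ := fun k ρ hρ =>
    ((hd k).volume_slab hρ hδ.le).trans_lt ENNReal.ofReal_lt_top
  have hslabreal : ∀ k, volume.real (slab (d k) (2 * R) δ) ≤ δ * Q := by
    intro k
    refine ENNReal.toReal_le_of_le_ofReal (by positivity) (((hd k).volume_slab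
      (by positivity) hδ.le).trans_eq ?_)
    rw [hQ]; ring_nf
  have hIs : ∀ k (c : ℝ), Integrable ((slab (d k) (2 * R) δ).indicator fun _ => c) := fun k c =>
    (integrable_indicator_iff ((hd k).measurableSet_slab _ _)).mpr
      (integrableOn_const (hslabfin k _ (by positivity)).ne)
  have hints : ∀ k (c : ℝ), 0 ≤ c →
      ∫ x, (slab (d k) (2 * R) δ).indicator (fun _ => c) x ≤ δ * Q * c := by
    intro k c hc
    rw [integral_indicator ((hd k).measurableSet_slab _ _), setIntegral_const, smul_eq_mul]
    exact mul_le_mul_of_nonneg_right (hslabreal k) hc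
  have hIb : ∀ ρ, 0 ≤ ρ → Integrable ((Bs ρ).indicator fun x => μ x ^ 2) := fun ρ hρ =>
    (integrable_indicator_iff (hmBs ρ)).mpr (hIμ ρ hρ)
  have hIφ : Integrable (fun x => φ x ^ 2) :=
    (integrable_mul_of_tsupport h.isOpen sφ.continuous.continuousOn sφ.continuous cφ
      (tφ.trans tχC)).congr (by filter_upwards with x; ring)
  have hlow : A R / 2 ≤ ∫ x, φ x ^ 2 := by
    -- Inside the ball of radius `R` and off the slabs the cutoff is `1`; in a slab the subtracted
    -- `B²` already exceeds `μ²`.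
    have hpt : ∀ x, (Bs R).indicator (fun x => μ x ^ 2) x -
        ∑ k, (slab (d k) (2 * R) δ).indicator (fun _ => B ^ 2) x ≤ φ x ^ 2 := by
      intro x
      have hs0 : ∀ k, 0 ≤ (slab (d k) (2 * R) δ).indicator (fun _ => B ^ 2) x := fun k =>
        Set.indicator_nonneg (fun _ _ => by positivity) x
      have hs1 := Finset.sum_nonneg fun k (_ : k ∈ Finset.univ) => hs0 k
      by_cases hx : x ∈ Bs R
      · rw [Set.indicator_of_mem hx]
        have hμx := h.pos x hx.1
        by_cases hk : ∃ k, x ∈ slab (d k) (2 * R) δ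
        · obtain ⟨k, hk⟩ := hk
          have h1 := Finset.single_le_sum (fun k _ => hs0 k) (Finset.mem_univ k)
          rw [Set.indicator_of_mem hk] at h1
          have h2 := pow_le_pow_left₀ hμx.le (hB x hx.1) 2
          have h3 := sq_nonneg (φ x)
          linarith
        · push Not at hk
          have hχ1 : χ x = 1 := by
            rw [hχ, cutoff, Real.smoothTransition.one_of_one_le, one_mul]
            · refine Finset.prod_eq_one fun k _ => Real.smoothTransition.one_of_one_le ?_
              have hxR : psum 2 x ≤ (2 * R) ^ 2 := hx.2.trans (by nlinarith)
              have h4 : δ < d k x := by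
                by_contra h5
                exact hk k ⟨hxR, ((hC x).mp hx.1 k).le, not_lt.mp h5⟩
              have : 2 ≤ p * d k x := by
                rw [hp, div_mul_eq_mul_div, le_div_iff₀ hδ]; linarith
              linarith
            · have : psum 2 x / R ^ 2 ≤ 1 := by
                rw [div_le_one (by positivity)]; exact hx.2
              linarith
          simp only [hφ, hχ1, mul_one]
          linarith
      · rw [Set.indicator_of_notMem hx]
        have h3 := sq_nonneg (φ x)
        linarith
    have hI2 : Integrable (fun x => ∑ k, (slab (d k) (2 * R) δ).indicator (fun _ => B ^ 2) x) :=
      integrable_finsetSum _ fun k _ => hIs k _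
    have h1 := integral_mono ((hIb R hR0.le).sub hI2) hIφ hpt
    simp only [Pi.sub_apply] at h1
    rw [integral_sub (hIb R hR0.le) hI2, integral_indicator (hmBs R),
      integral_finsetSum _ fun k _ => hIs k _] at h1
    have h2 : ∑ k, ∫ x, (slab (d k) (2 * R) δ).indicator (fun _ => B ^ 2) x ≤
        ∑ k : K, δ * Q * B ^ 2 :=
      Finset.sum_le_sum fun k _ => hints k _ (by positivity)
    rw [Finset.sum_const, Finset.card_univ, nsmul_eq_mul] at h2
    have h3 : n * (δ * Q * B ^ 2) = n * (B ^ 2 * Q) * δ := by ring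
    have h4 : A R = ∫ x in Bs R, μ x ^ 2 := rfl
    rw [← hn, h3] at h2
    linarith
  -- upper bound for the error
  set c : K → ℝ := fun k => (K₀ * p * (M * δ ^ e k)) ^ 2 with hc
  have hpt : ∀ i x, (pD i φ x - F i x * φ x) ^ 2 ≤
      (n + 1) * ((2 * K₀ / R) ^ 2 * (Bs (2 * R)).indicator (fun x => μ x ^ 2) x +
        ∑ k, (slab (d k) (2 * R) δ).indicator (fun _ => c k) x) := by
    intro i x
    have hs0 : ∀ k, 0 ≤ (slab (d k) (2 * R) δ).indicator (fun _ => c k) x := fun k =>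
      Set.indicator_nonneg (fun _ _ => by positivity) x
    have hs1 := Finset.sum_nonneg fun k (_ : k ∈ Finset.univ) => hs0 k
    have hb0 : 0 ≤ (Bs (2 * R)).indicator (fun x => μ x ^ 2) x :=
      Set.indicator_nonneg (fun _ _ => by positivity) x
    by_cases hx : x ∈ tsupport χ
    · have hxC := tχC hx
      have hμx := h.pos x hxC
      have hxB : x ∈ Bs (2 * R) := ⟨hxC, (tχ hx).1⟩
      obtain ⟨-, -, χ', hχ', hχb⟩ := bχ x i
      have e1 : pD i φ x - F i x * φ x = μ x * χ' := by
        rw [((h.hasPD x hxC i).mul hχ').eq]; simp only [hφ]; ring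
      rw [e1, Set.indicator_of_mem hxB]
      have e2 : |μ x * χ'| ≤ 2 * K₀ / R * μ x + ∑ k,
          (slab (d k) (2 * R) δ).indicator (fun _ => K₀ * p * (M * δ ^ e k)) x := by
        rw [abs_mul, abs_of_pos hμx]
        refine (mul_le_mul_of_nonneg_left hχb hμx.le).trans ?_
        rw [mul_add, mul_comm (μ x) (2 * K₀ / R), Finset.mul_sum]
        gcongr with k
        split_ifs with hk
        · have hdk : d k x ≤ δ := by
            have := hk.2
            have h5 : p * d k x ≤ 2 := by linarith
            rwa [hp, div_mul_eq_mul_div, div_le_iff₀ hδ, mul_le_mul_iff_right₀ (by norm_num)] at h5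
          have hd0 := (hC x).mp hxC k
          rw [Set.indicator_of_mem (show x ∈ slab (d k) (2 * R) δ from ⟨hxB.2, hd0.le, hdk⟩)]
          have h6 := hM x hxC hxB.2 k
          have hM0 : 0 ≤ M := by
            by_contra hneg
            have := mul_nonpos_of_nonpos_of_nonneg (not_le.mp hneg).le
              (Real.rpow_nonneg hd0.le (e k))
            linarith
          have h7 : d k x ^ e k ≤ δ ^ e k :=
            Real.rpow_le_rpow hd0.le hdk (by linarith [he k])
          rw [mul_comm (μ x)]
          gcongr
          exact h6.trans (by gcongr)
        · rw [mul_zero]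
          refine Set.indicator_apply_nonneg fun hxs => ?_
          have hd0 := (hC x).mp hxC k
          have h6 := hM x hxC hxB.2 k
          have hM0 : 0 ≤ M := by
            by_contra hneg
            have := mul_nonpos_of_nonpos_of_nonneg (not_le.mp hneg).le
              (Real.rpow_nonneg hd0.le (e k))
            linarith
          positivity
      have e3 : (μ x * χ') ^ 2 ≤ (2 * K₀ / R * μ x + ∑ k,
          (slab (d k) (2 * R) δ).indicator (fun _ => K₀ * p * (M * δ ^ e k)) x) ^ 2 := by
        rw [← sq_abs]
        exact pow_le_pow_left₀ (abs_nonneg _) e2 2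
      refine e3.trans ?_
      -- Cauchy–Schwarz for `n + 1` summands, indexed by `Option K`: `none` is the radial cutoff and
      -- `some k` the wall `k`.
      have e4 := sq_sum_le_card_mul_sum_sq (s := (Finset.univ : Finset (Option K)))
        (f := fun o => o.elim (2 * K₀ / R * μ x) fun k =>
          (slab (d k) (2 * R) δ).indicator (fun _ => K₀ * p * (M * δ ^ e k)) x)
      rw [Fintype.sum_option, Fintype.sum_option, Finset.card_univ, Fintype.card_option] at e4
      push_cast at e4
      refine e4.trans_eq ?_
      simp only [Option.elim]
      congr 1
      rw [mul_pow]
      congr 1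
      refine Finset.sum_congr rfl fun k _ => ?_
      by_cases hxs : x ∈ slab (d k) (2 * R) δ
      · rw [Set.indicator_of_mem hxs, Set.indicator_of_mem hxs]
      · rw [Set.indicator_of_notMem hxs, Set.indicator_of_notMem hxs]; norm_num
    · have h1 : φ x = 0 := image_eq_zero_of_notMem_tsupport fun h' => hx (tφ h')
      have h2 : pD i φ x = 0 := image_eq_zero_of_notMem_tsupport fun h' =>
        hx (tφ (tsupport_pD_subset i φ h'))
      rw [h1, h2]
      simp only [mul_zero, sub_zero, ne_eq, OfNat.ofNat_ne_zero, not_false_eq_true, zero_pow]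
      positivity
  have hup : ∀ i, ∫ x, (pD i φ x - F i x * φ x) ^ 2 ≤
      (n + 1) * ((2 * K₀ / R) ^ 2 * A (2 * R) + ∑ k, δ * Q * c k) := by
    intro i
    have hI2 : Integrable (fun x => ∑ k, (slab (d k) (2 * R) δ).indicator (fun _ => c k) x) :=
      integrable_finsetSum _ fun k _ => hIs k _
    have hI3 := (hIb (2 * R) (by positivity)).const_mul ((2 * K₀ / R) ^ 2)
    have h1 := integral_mono (h.integral_partial sφ cφ (tφ.trans tχC) i).2.1
      ((hI3.add hI2).const_mul (n + 1)) (hpt i)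
    refine h1.trans ?_
    simp only [Pi.add_apply]
    rw [integral_const_mul, integral_add hI3 hI2, integral_const_mul, integral_indicator (hmBs _),
      integral_finsetSum _ fun k _ => hIs k _]
    gcongr with k
    exact hints k _ (by positivity)
  refine ⟨φ, sφ, cφ, tφ.trans tχC, (half_pos hAR).trans_le hlow, ?_⟩
  have hsum := Finset.sum_le_sum fun i (_ : i ∈ (Finset.univ : Finset (Fin N))) => hup i
  rw [Finset.sum_const, Finset.card_univ, Fintype.card_fin, nsmul_eq_mul] at hsum
  refine hsum.trans ?_
  -- Because of `p² = 4 / δ²` the constant `c k` has order `δ ^ (2 e k - 2)`; the slab volume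
  -- supplies one more power of `δ`.
  have t1 : ∑ k, δ * Q * c k = ∑ k, (4 * K₀ ^ 2 * M ^ 2 * Q) * δ ^ (2 * e k - 1) := by
    refine Finset.sum_congr rfl fun k _ => ?_
    have : δ ^ (2 * e k - 1) = (δ ^ e k) ^ 2 / δ := by
      rw [Real.rpow_sub_one hδ.ne', ← Real.rpow_natCast, ← Real.rpow_mul hδ.le, mul_comm]
      norm_num
    rw [this, hc, hp]
    field_simp
    ring
  rw [t1]
  have t2 : N * (n + 1) * ((2 * K₀ / R) ^ 2 * A (2 * R)) ≤ ε * A R / 4 := by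
    have h1 : N * (n + 1) * ((2 * K₀ / R) ^ 2 * A (2 * R)) ≤
        N * (n + 1) * ((2 * K₀ / R) ^ 2 * (2 ^ (N + 1) * A R)) := by gcongr
    have h2 : N * (n + 1) * ((2 * K₀ / R) ^ 2 * (2 ^ (N + 1) * A R)) = L / R ^ 2 * A R := by
      rw [hL]; field_simp; ring
    have h3 : L / R ^ 2 ≤ ε / 4 := by
      rw [div_le_div_iff₀ (by positivity) (by norm_num)]
      have h4 : 4 * L / ε ≤ R := by linarith
      rw [div_le_iff₀ hε] at h4
      have h5 : R * ε ≤ ε * R ^ 2 := by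
        have := mul_le_mul_of_nonneg_left hR1 (mul_nonneg hR0.le hε.le)
        linear_combination this
      linarith
    rw [h2] at h1
    have h6 := mul_le_mul_of_nonneg_right h3 hAR.le
    linarith
  have t3 : N * (n + 1) * ∑ k, (4 * K₀ ^ 2 * M ^ 2 * Q) * δ ^ (2 * e k - 1) ≤ ε * A R / 4 := by
    have h1 : N * (n + 1) * ∑ k, (4 * K₀ ^ 2 * M ^ 2 * Q) * δ ^ (2 * e k - 1) ≤
        N * (n + 1) * (ε * A R / (4 * (N * (n + 1) + 1))) := by gcongr
    refine h1.trans ?_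
    rw [mul_div_assoc', div_le_div_iff₀ (by positivity) (by norm_num)]
    have h5 : 0 ≤ ε * A R := by positivity
    linear_combination 4 * h5
  have t4 : ε * (A R / 2) ≤ ε * ∫ x, φ x ^ 2 := by gcongr
  calc _ = N * (n + 1) * ((2 * K₀ / R) ^ 2 * A (2 * R)) +
        N * (n + 1) * ∑ k, (4 * K₀ ^ 2 * M ^ 2 * Q) * δ ^ (2 * e k - 1) := by ring
    _ ≤ _ := by linarith

/-- The energy of the gauge function is the ground state energy. -/
theorem Gauge.isGroundStateEnergy (h : Gauge C V μ U F G w E₀) (hne : C.Nonempty)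
    {d : K → Pos N → ℝ}
    (hd : ∀ k, IsWall (d k)) (hC : ∀ x, x ∈ C ↔ ∀ k, 0 < d k x) {B : ℝ} (hB : ∀ x ∈ C, μ x ≤ B)
    {e : K → ℝ} (he : ∀ k, 1 / 2 < e k)
    (hM : ∀ R, ∃ M, ∀ x ∈ C, psum 2 x ≤ R → ∀ k, μ x ≤ M * d k x ^ e k) :
    IsGroundStateEnergy (hamiltonian V) C E₀ := by
  constructor
  · rintro q ⟨Φ, hΦ, hc, ht, h0, rfl⟩
    have hpos : 0 < ∫ x, ‖Φ x‖ ^ 2 := by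
      obtain ⟨x, hx⟩ := Function.ne_iff.mp h0
      refine Continuous.integral_pos_of_hasCompactSupport_nonneg_nonzero (x := x)
        (hΦ.continuous.norm.pow 2) ?_ (fun x => by positivity) ?_
      · exact hc.comp_left (g := fun v => ‖v‖ ^ 2) (by simp)
      · simpa using hx
    rw [le_div_iff₀ hpos]
    exact h.energy_lower hΦ hc ht
  · intro b hb
    refine le_of_forall_pos_le_add fun ε hε => ?_
    obtain ⟨φ, h1, h2, h3, h4, h5⟩ := h.exists_test hne hd hC hB he hM hε
    -- All particles carry the same spin, so every exchange fixes this unit vector.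
    set v : Spin N κ := EuclideanSpace.single (fun _ => 0) 1 with hv
    have hv1 : ‖v‖ = 1 := by simp [hv]
    have hv2 : ∀ i j, exchange i j v = v := by
      intro i j
      ext s
      rw [exchange, permSpin_apply, hv]
      simp only [EuclideanSpace.single, PiLp.single_apply]
      congr 1
      simp only [eq_iff_iff]
      constructor
      · intro hs
        funext k
        have := congrFun hs (Equiv.swap i j k)
        simpa using this
      · rintro rfl; rfl
    have hnorm : ∀ x, ‖φ x • v‖ ^ 2 = φ x ^ 2 := by
      intro x; rw [norm_smul, hv1, mul_one, Real.norm_eq_abs, sq_abs]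
    have hmem := hb (a := _) ⟨fun x => φ x • v, h1.smul contDiff_const, h2.smul_right,
      (tsupport_smul_subset_left φ fun _ => v).trans h3, ?_, rfl⟩
    · simp_rw [hnorm] at hmem
      rw [h.energy_smul h1 h2 h3 hv2 hv1] at hmem
      refine hmem.trans ?_
      rw [div_le_iff₀ h4]
      linarith
    · intro h0
      have : ∀ x, φ x ^ 2 = 0 := fun x => by
        rw [← hnorm, congrFun h0 x]; simp
      simp [this] at h4

end Test
end NearNeighbour
namespace NearNeighbour
open scoped ContDiff

variable {N κ : ℕ}

/-! ## Binomial coefficients and Jacobi polynomials -/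

section Polynomials

lemma gbinom_zero (z : ℝ) : gbinom z 0 = 1 := by simp [gbinom]

lemma gbinom_succ (z : ℝ) (k : ℕ) : gbinom z (k + 1) * (k + 1) = gbinom z k * (z - k) := by
  unfold gbinom
  rw [Finset.prod_range_succ, Nat.factorial_succ]
  have := Nat.factorial_ne_zero k
  push_cast
  field_simp

lemma gbinom_add_one_succ (z : ℝ) (k : ℕ) :
    gbinom (z + 1) (k + 1) * (k + 1) = (z + 1) * gbinom z k := by
  unfold gbinom
  rw [Finset.prod_range_succ', Nat.factorial_succ]
  have := Nat.factorial_ne_zero k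
  have e : ∏ i ∈ Finset.range k, (z + 1 - ((i + 1 : ℕ) : ℝ)) = ∏ i ∈ Finset.range k, (z - i) :=
    Finset.prod_congr rfl fun i _ => by push_cast; ring
  rw [e]
  push_cast
  field_simp
  ring

lemma gbinom_pascal (z : ℝ) (k : ℕ) :
    gbinom (z + 1) (k + 1) = gbinom z (k + 1) + gbinom z k := by
  have h1 := gbinom_add_one_succ z k
  have h2 := gbinom_succ z k
  have h3 : ((k : ℝ) + 1) ≠ 0 := by positivity
  apply mul_right_cancel₀ h3
  linear_combination h1 - h2

lemma gbinom_ne_zero {z : ℝ} {k : ℕ} (h : ∀ i < k, z ≠ i) : gbinom z k ≠ 0 := by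
  refine div_ne_zero (Finset.prod_ne_zero_iff.mpr fun i hi => ?_) (by positivity)
  exact sub_ne_zero.mpr (h i (Finset.mem_range.mp hi))

lemma gbinom_eq_choose (z : ℝ) (k : ℕ) : gbinom z k = Ring.choose z k := by
  have h1 := Ring.descPochhammer_eq_factorial_smul_choose z k
  rw [← Polynomial.aeval_eq_smeval, Polynomial.aeval_def, Polynomial.eval₂_eq_eval_map,
    descPochhammer_map, descPochhammer_eval_eq_prod_range, nsmul_eq_mul] at h1
  rw [gbinom, h1, mul_div_cancel_left₀ _ (by positivity)]

/-- The expansion of the Jacobi polynomials at `t = 1`. -/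
lemma jacobi_eq (n : ℕ) (α β t : ℝ) :
    jacobi n α β t = ∑ j ∈ Finset.range (n + 1),
      gbinom (n + α) (n - j) * gbinom (n + j + (α + β)) j * ((t - 1) / 2) ^ j := by
  -- Substitute `(t + 1) / 2 = z + 1` with `z = (t - 1) / 2` and expand. The coefficient of `z ^ j`
  -- is then a convolution of binomial coefficients, which the Chu–Vandermonde identity sums.
  have h1 : ∀ k ∈ Finset.range (n + 1), gbinom (n + α) (n - k) * gbinom (n + β) k
      * ((t - 1) / 2) ^ k * ((t + 1) / 2) ^ (n - k) = ∑ j ∈ Finset.Ico k (n + 1),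
      gbinom (n + α) (n - j) * (gbinom (j + α) (j - k) * gbinom (n + β) k) * ((t - 1) / 2) ^ j := by
    intro k hk
    have hk' : k ≤ n := by simpa [Nat.lt_succ_iff] using hk
    rw [show (t + 1) / 2 = (t - 1) / 2 + 1 by ring, add_pow, Finset.sum_Ico_eq_sum_range,
      show n + 1 - k = n - k + 1 by omega, Finset.mul_sum]
    refine Finset.sum_congr rfl fun i hi => ?_
    have hi' : i ≤ n - k := by simpa [Nat.lt_succ_iff] using hi
    have h2 := Ring.choose_smul_choose ((n : ℝ) + α) (show n - (k + i) ≤ n - k by omega)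
    rw [nsmul_eq_mul, show n - k - (n - (k + i)) = i by omega,
      show n - (k + i) = n - k - i by omega, Nat.choose_symm hi'] at h2
    have h3 : (n : ℝ) + α - ((n - k - i : ℕ) : ℝ) = ((k + i : ℕ) : ℝ) + α := by
      rw [Nat.cast_sub hi', Nat.cast_sub hk']; push_cast; ring
    rw [h3] at h2
    simp only [gbinom_eq_choose]
    rw [show n - (k + i) = n - k - i by omega, show k + i - k = i by omega, one_pow, mul_one,
      pow_add]
    linear_combination (Ring.choose ((n : ℝ) + β) k * ((t - 1) / 2) ^ k * ((t - 1) / 2) ^ i) * h2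
  rw [jacobi, Finset.sum_congr rfl h1]
  rw [Finset.sum_comm' (t' := Finset.range (n + 1)) (s' := fun j => Finset.range (j + 1))]
  · refine Finset.sum_congr rfl fun j _ => ?_
    rw [← Finset.sum_mul, ← Finset.mul_sum]
    congr 2
    rw [gbinom_eq_choose, show (n : ℝ) + j + (α + β) = (j + α) + (n + β) by ring,
      Ring.add_choose_eq _ (Commute.all _ _), ← Finset.Nat.sum_antidiagonal_swap,
      Finset.Nat.sum_antidiagonal_eq_sum_range_succ_mk]
    exact Finset.sum_congr rfl fun k _ => by simp only [gbinom_eq_choose, Prod.swap]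
  · intro k j
    simp only [Finset.mem_range, Finset.mem_Ico]
    omega

/-- The Jacobi polynomial `P_n^{(A,S-A)}` as a function of `(t - 1) / 2`. -/
noncomputable def jac (n : ℕ) (A S z : ℝ) : ℝ :=
  ∑ j ∈ Finset.range (n + 1), gbinom (n + A) (n - j) * gbinom (n + j + S) j * z ^ j

lemma jacobi_eq_jac (n : ℕ) {α β S : ℝ} (h : α + β = S) (t : ℝ) :
    jacobi n α β t = jac n α S ((t - 1) / 2) := by
  rw [jacobi_eq, h]; rfl

lemma gbinom_sub_one (z : ℝ) (k : ℕ) : z * gbinom (z - 1) k = (z - k) * gbinom z k := by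
  cases k with
  | zero => simp [gbinom_zero]
  | succ k =>
    have h1 := gbinom_add_one_succ (z - 1) k
    have h2 := gbinom_succ (z - 1) k
    rw [sub_add_cancel] at h1
    have h3 : ((k : ℝ) + 1) ≠ 0 := by positivity
    apply mul_right_cancel₀ h3
    push_cast
    linear_combination z * h2 - (z - k - 1) * h1

/-- Pascal's rule in the first binomial coefficient. In classical notation, `P_{n+1}^{(α+1,β-1)} =
P_{n+1}^{(α,β)} + P_n^{(α+1,β)}`. The shifted parameters are separate variables tied by equations,
so that the lemma also applies to shifts like `α + 3 = α + 2 + 1` that are not syntactic. -/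
lemma jac_lower_beta (n : ℕ) {A A' S S' : ℝ} (hA : A' = A + 1) (hS : S' = S + 1) (z : ℝ) :
    jac (n + 1) A' S z = jac (n + 1) A S z + jac n A' S' z := by
  subst hA hS
  unfold jac
  rw [Finset.sum_range_succ, Finset.sum_range_succ _ (n + 1)]
  have h : ∀ j ∈ Finset.range (n + 1),
      gbinom ((n + 1 : ℕ) + (A + 1)) (n + 1 - j) * gbinom ((n + 1 : ℕ) + j + S) j * z ^ j =
      gbinom ((n + 1 : ℕ) + A) (n + 1 - j) * gbinom ((n + 1 : ℕ) + j + S) j * z ^ j +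
      gbinom (n + (A + 1)) (n - j) * gbinom (n + j + (S + 1)) j * z ^ j := by
    intro j hj
    have hj' : j ≤ n := by simpa [Nat.lt_succ_iff] using hj
    rw [show n + 1 - j = (n - j) + 1 by omega, ← add_assoc ((n + 1 : ℕ) : ℝ), gbinom_pascal]
    push_cast
    rw [show (n : ℝ) + (A + 1) = n + 1 + A by ring, show (n : ℝ) + j + (S + 1) = n + 1 + j + S by ring]
    ring
  rw [Finset.sum_congr rfl h, Finset.sum_add_distrib]
  simp only [Nat.sub_self, gbinom_zero]
  ring

/-- Compare coefficients of `z ^ j`: Pascal's rule treats the first binomial coefficient and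
`gbinom_sub_one` the second. The factor `n + 1 + S' - A'` is `n + 1 + β`. -/
lemma jac_lower_alpha (n : ℕ) {A A' S S' : ℝ} (hA : A' = A + 1) (hS : S' = S + 1) (z : ℝ) :
    (2 * n + 2 + S') * jac (n + 1) A S z =
      (n + 1 + S') * jac (n + 1) A' S' z - (n + 1 + S' - A') * jac n A' S' z := by
  subst hA hS
  unfold jac
  rw [Finset.sum_range_succ, Finset.sum_range_succ _ (n + 1), mul_add, mul_add, Finset.mul_sum,
    Finset.mul_sum, Finset.mul_sum, add_sub_right_comm, ← Finset.sum_sub_distrib]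
  congr 1
  · refine Finset.sum_congr rfl fun j hj => ?_
    have hj' : j ≤ n := by simpa [Nat.lt_succ_iff] using hj
    have h1 := gbinom_pascal ((n : ℝ) + 1 + A) (n - j)
    have h2 := gbinom_sub_one ((n : ℝ) + j + S + 2) j
    have h3 := gbinom_succ ((n : ℝ) + 1 + A) (n - j)
    rw [show n + 1 - j = (n - j) + 1 by omega]
    push_cast [Nat.cast_sub hj'] at h3 ⊢
    rw [show (n : ℝ) + 1 + (A + 1) = n + 1 + A + 1 by ring, h1,
      show (n : ℝ) + (A + 1) = n + 1 + A by ring,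
      show (n : ℝ) + 1 + j + (S + 1) = n + j + S + 2 by ring,
      show (n : ℝ) + j + (S + 1) = n + j + S + 2 - 1 by ring,
      show (n : ℝ) + 1 + j + S = n + j + S + 2 - 1 by ring]
    linear_combination
      (gbinom ((n : ℝ) + 1 + A) (n - j + 1) + gbinom ((n : ℝ) + 1 + A) (n - j)) * z ^ j * h2
        + gbinom ((n : ℝ) + j + S + 2 - 1) j * z ^ j * h3
  · have h2 := gbinom_sub_one (2 * (n : ℝ) + S + 3) (n + 1)
    simp only [Nat.sub_self, gbinom_zero]
    push_cast at h2 ⊢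
    rw [show (n : ℝ) + 1 + (n + 1) + S = 2 * n + S + 3 - 1 by ring,
      show (n : ℝ) + 1 + (n + 1) + (S + 1) = 2 * n + S + 3 by ring]
    linear_combination z ^ (n + 1) * h2

/-- Compare coefficients of `z ^ (j + 1)`; the constant terms on the right cancel. This relation
trades a factor `z`, which for the eigenfunctions is the variance divided by the squared centre of
mass, for changes of degree and parameters. -/
lemma mul_jac (n : ℕ) {A A' S S' : ℝ} (hA : A' = A + 1) (hS : S' = S + 1) (z : ℝ) :
    (2 * n + S + 2) * (z * jac n A' S' z) =
      (n + 1) * jac (n + 1) A S z - (n + A + 1) * jac n A S z := by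
  subst hA hS
  have h1 : (n + A + 1) * jac n A S z = ∑ j ∈ Finset.range (n + 1 + 1),
      ((n : ℝ) + 1 - j) * (gbinom (n + A + 1) (n + 1 - j) * gbinom (n + j + S) j * z ^ j) := by
    rw [Finset.sum_range_succ, jac, Finset.mul_sum]
    push_cast
    rw [sub_self, zero_mul, add_zero]
    refine Finset.sum_congr rfl fun j hj => ?_
    have hj' : j ≤ n := by simpa [Nat.lt_succ_iff] using hj
    have h := gbinom_add_one_succ ((n : ℝ) + A) (n - j)
    rw [show n + 1 - j = (n - j) + 1 by omega]
    push_cast [Nat.cast_sub hj'] at h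
    linear_combination (-(gbinom (n + j + S) j) * z ^ j) * h
  rw [h1, jac, jac, Finset.sum_range_succ' _ (n + 1), Finset.sum_range_succ' _ (n + 1), mul_add,
    Finset.mul_sum, Finset.mul_sum, Finset.mul_sum]
  have h0 : ((n : ℝ) + 1) * (gbinom ((n + 1 : ℕ) + A) (n + 1 - 0) *
      gbinom ((n + 1 : ℕ) + (0 : ℕ) + S) 0 * z ^ 0) = ((n : ℝ) + 1 - (0 : ℕ)) *
      (gbinom (n + A + 1) (n + 1 - 0) * gbinom (n + (0 : ℕ) + S) 0 * z ^ 0) := by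
    simp only [gbinom_zero]
    push_cast
    rw [show (n : ℝ) + 1 + A = n + A + 1 by ring]
    ring
  rw [h0, add_sub_add_right_eq_sub, ← Finset.sum_sub_distrib]
  refine Finset.sum_congr rfl fun j hj => ?_
  have hj' : j ≤ n := by simpa [Nat.lt_succ_iff] using hj
  have h2 := gbinom_pascal ((n : ℝ) + j + S + 1) j
  have h3 := gbinom_succ ((n : ℝ) + j + S + 1) j
  rw [show n + 1 - (j + 1) = n - j by omega]
  push_cast
  rw [show (n : ℝ) + 1 + (j + 1) + S = n + j + S + 1 + 1 by ring, h2,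
    show (n : ℝ) + (j + 1) + S = n + j + S + 1 by ring,
    show (n : ℝ) + j + (S + 1) = n + j + S + 1 by ring, show (n : ℝ) + 1 + A = n + A + 1 by ring,
    show (n : ℝ) + (A + 1) = n + A + 1 by ring, pow_succ]
  linear_combination -(z ^ j * z * gbinom (n + A + 1) (n - j)) * h3

end Polynomials
end NearNeighbour
namespace NearNeighbour

/-! ## Relations between the Jacobi polynomials in the eigenfunctions of the rational model -/

section Contiguous

variable {α β t : ℝ} {m : ℕ}

/-- This is `mul_jac` solved for the polynomial of higher degree. In the applications `S` depends on
`m`, hence on `k`, in such a way that `c` is one of the numbers `1/2`, `-1/2`, `-3/2`; having it as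
a parameter keeps the rewritten expressions small. -/
lemma jac_succ_of_mul (k : ℕ) {A A' S S' : ℝ} (hA : A' = A + 1) (hS : S' = S + 1) (z : ℝ) {c : ℝ}
    (hc : 2 * k + S + 2 = c) :
    jac (k + 1) A S z = (c * (z * jac k A' S' z) + (k + A + 1) * jac k A S z) / (k + 1) := by
  have := mul_jac k hA hS z
  rw [hc] at this
  have h : (k : ℝ) + 1 ≠ 0 := by positivity
  field_simp
  linear_combination -this

lemma jac_of_mul (k : ℕ) {A A' S S' : ℝ} (hA : A' = A + 1) (hS : S' = S + 1) (z : ℝ) {c : ℝ}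
    (hc : 2 * k + S + 2 = c) (h : 0 < k + A + 1) :
    jac k A S z = ((k + 1) * jac (k + 1) A S z - c * (z * jac k A' S' z)) / (k + A + 1) := by
  have := mul_jac k hA hS z
  rw [hc] at this
  rw [eq_div_iff h.ne']
  linear_combination this

lemma jac_lower_alpha' (k : ℕ) {A A' S S' : ℝ} (hA : A' = A + 1) (hS : S' = S + 1) (z : ℝ) {c : ℝ}
    (hc : 2 * k + 2 + S' = c) (h : c ≠ 0) :
    jac (k + 1) A S z =
      ((k + 1 + S') * jac (k + 1) A' S' z - (k + 1 + S' - A') * jac k A' S' z) / c := by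
  have := jac_lower_alpha k hA hS z
  rw [hc] at this
  rw [eq_div_iff h]
  linear_combination this

/-- The left side is the coefficient of `Λ|s⟩` in the second family after the ladder over `wave2`
has been split off; it must be a multiple of the ladder over `Λ|s⟩` itself. In either parity of `m`
everything is expressed through the two polynomials of degree `k` with parameters `α + 1` and `α +
2`, which leaves a rational identity. -/
lemma jacobi_relation_two (hm : 2 ≤ m) (h : α + β = -m - 1 / 2) :
    (t - 1) / 2 * jacobi (m / 2 - 1) (α + 2) β t
      - 2 * (α + 1) / (2 * ((m - 1) / 2 : ℕ) + 1) * jacobi (m / 2 - 1) (α + 1) β t =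
    -(2 * (m / 2 : ℕ) / (2 * ((m - 1) / 2 : ℕ) + 1)) * jacobi (m / 2) α β t := by
  obtain ⟨k, hk⟩ : ∃ k, m = 2 * k + 2 ∨ m = 2 * k + 3 := ⟨(m - 2) / 2, by omega⟩
  set z := (t - 1) / 2
  rw [jacobi_eq_jac _ (show α + 2 + β = -m + 3 / 2 by linarith),
    jacobi_eq_jac _ (show α + 1 + β = -m + 1 / 2 by linarith), jacobi_eq_jac _ h]
  change z * jac (m / 2 - 1) (α + 2) (-m + 3 / 2) z - 2 * (α + 1) / (2 * ((m - 1) / 2 : ℕ) + 1) *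
    jac (m / 2 - 1) (α + 1) (-m + 1 / 2) z = -(2 * (m / 2 : ℕ) / (2 * ((m - 1) / 2 : ℕ) + 1)) *
      jac (m / 2) α (-m - 1 / 2) z
  have hk0 : (0 : ℝ) ≤ k := k.cast_nonneg
  have e1 : m / 2 = k + 1 := by omega
  have h1 : α + 2 = α + 1 + 1 := by ring
  have s1 : -(m : ℝ) + 3 / 2 = -m + 1 / 2 + 1 := by ring
  have s2 : -(m : ℝ) + 1 / 2 = -m - 1 / 2 + 1 := by ring
  rcases hk with hk | hk
  · have e2 : (m - 1) / 2 = k := by omega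
    have hm' : (m : ℝ) = 2 * k + 2 := by rw [hk]; push_cast; ring
    have r1 := jac_succ_of_mul k h1 s1 z (c := 1 / 2) (by linarith)
    have r2 := jac_lower_alpha' k (show α + 1 = α + 1 from rfl) s2 z (c := 1 / 2) (by linarith) (by norm_num)
    rw [e1, e2, Nat.add_sub_cancel]
    generalize jac k (α + 2) (-m + 3 / 2) z = P2 at *
    generalize jac k (α + 1) (-m + 1 / 2) z = P1 at *
    rw [r2, r1, hm']
    push_cast
    field_simp
    ring
  · have e2 : (m - 1) / 2 = k + 1 := by omega
    have hm' : (m : ℝ) = 2 * k + 3 := by rw [hk]; push_cast; ring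
    have r1 := jac_succ_of_mul k h1 s1 z (c := -1 / 2) (by linarith)
    have r2 := jac_lower_alpha' k (show α + 1 = α + 1 from rfl) s2 z (c := -1 / 2) (by linarith) (by norm_num)
    rw [e1, e2, Nat.add_sub_cancel]
    generalize jac k (α + 2) (-m + 3 / 2) z = P2 at *
    generalize jac k (α + 1) (-m + 1 / 2) z = P1 at *
    rw [r2, r1, hm']
    push_cast
    have : 2 * ((k : ℝ) + 1) + 1 ≠ 0 := by positivity
    field_simp
    ring

/-- The factor `2 z + 2 / 3` stems from the part of `2 / (3 N) ∑ x_i³` that is not translation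
invariant. The identity says that what remains of the fourth family beyond the ladder over `cubic`
is a multiple of the ladder over `Λ|s⟩`, with a factor depending on the parity of `m`. -/
lemma jacobi_relation_three (hm : 3 ≤ m) (hα : -1 < α) (h : α + β = -m - 1 / 2) :
    jacobi ((m - 3) / 2) (α + 3) β t * (2 * ((t - 1) / 2) + 2 / 3) + phi3 m α β t =
    (if Even m then (m + 2 * α + 2) / (m - 1) else -(1 / (m * (m - 2)))) *
      jacobi (m / 2) α β t := by
  set z := (t - 1) / 2 with hz
  have hA1 : α + 2 = α + 1 + 1 := by ring
  have hA2 : α + 3 = α + 2 + 1 := by ring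
  have s1 : -(m : ℝ) + 1 / 2 = -m - 1 / 2 + 1 := by ring
  have s2 : -(m : ℝ) + 3 / 2 = -m + 1 / 2 + 1 := by ring
  have s3 : -(m : ℝ) + 5 / 2 = -m + 3 / 2 + 1 := by ring
  have t0 : α + β = -(m : ℝ) - 1 / 2 := h
  have t1 : α + 1 + β = -(m : ℝ) + 1 / 2 := by linarith
  have t2 : α + 2 + β = -(m : ℝ) + 3 / 2 := by linarith
  have t3 : α + 3 + β = -(m : ℝ) + 5 / 2 := by linarith
  have t2b : α + 2 + (β - 1) = -(m : ℝ) + 1 / 2 := by linarith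
  have t2bb : α + 2 + (β - 2) = -(m : ℝ) - 1 / 2 := by linarith
  have t3b : α + 3 + (β - 1) = -(m : ℝ) + 3 / 2 := by linarith
  rcases Nat.even_or_odd m with he | ho
  · obtain ⟨k, hk⟩ : ∃ k, m = 2 * k + 4 := by
      obtain ⟨j, hj⟩ := he; exact ⟨j - 2, by omega⟩
    have hk0 : (0 : ℝ) ≤ k := k.cast_nonneg
    have hm' : (m : ℝ) = 2 * k + 4 := by rw [hk]; push_cast; ring
    rw [phi3, if_pos he, if_pos he]
    simp only [show (m - 3) / 2 = k by omega, show m / 2 = k + 2 by omega, Nat.add_sub_cancel,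
      show k + 2 - 1 = k + 1 by omega]
    simp only [jacobi_eq_jac _ t0, jacobi_eq_jac _ t2b, jacobi_eq_jac _ t2bb, jacobi_eq_jac _ t3,
      jacobi_eq_jac _ t3b, ← hz]
    have b1 := jac_lower_beta k hA2 s3 z
    have b2 := jac_lower_beta k hA1 s2 z
    have b3 := jac_lower_beta (k + 1) hA1 s1 z
    have b4 := jac_lower_beta (k + 1) (show α + 1 = α + 1 from rfl) s1 z
    have r2 := jac_succ_of_mul k hA2 s3 z (c := -1 / 2) (by linarith)
    have r4 := jac_lower_alpha' k hA1 s2 z (c := -1 / 2) (by linarith) (by norm_num)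
    simp only [show k + 1 + 1 = k + 2 by omega] at b3 b4
    rw [b3, b4, b2, b1, r4, r2]
    generalize jac k (α + 3) (-m + 5 / 2) z = P3
    generalize jac k (α + 2) (-m + 3 / 2) z = P2
    generalize jac (k + 2) α (-m - 1 / 2) z = P0
    rw [hm']
    have : (2 * (k : ℝ) + 4 - 1) ≠ 0 := by linarith
    field_simp
    ring
  · obtain ⟨k, hk⟩ : ∃ k, m = 2 * k + 3 := by
      obtain ⟨j, hj⟩ := ho; exact ⟨j - 1, by omega⟩
    have hk0 : (0 : ℝ) ≤ k := k.cast_nonneg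
    have hm' : (m : ℝ) = 2 * k + 3 := by rw [hk]; push_cast; ring
    rw [phi3, if_neg (Nat.not_even_iff_odd.mpr ho), if_neg (Nat.not_even_iff_odd.mpr ho)]
    simp only [show (m - 3) / 2 = k by omega, show m / 2 = k + 1 by omega,
      show (m - 1) / 2 = k + 1 by omega]
    simp only [jacobi_eq_jac _ t0, jacobi_eq_jac _ t1, jacobi_eq_jac _ t2, jacobi_eq_jac _ t2b,
      jacobi_eq_jac _ t3, jacobi_eq_jac _ t3b, ← hz]
    have b1 := jac_lower_beta k hA2 s3 z
    have b2 := jac_lower_beta k hA1 s2 z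
    have r2 := jac_succ_of_mul k hA2 s3 z (c := 1 / 2) (by linarith)
    have r4 := jac_lower_alpha' k hA1 s2 z (c := 1 / 2) (by linarith) (by norm_num)
    have r5 := jac_of_mul k hA1 s2 z (c := -1 / 2) (by linarith) (by linarith)
    have r6 := jac_lower_alpha' k (show α + 1 = α + 1 from rfl) s1 z (c := -1 / 2) (by linarith)
      (by norm_num)
    rw [b2, b1, r6, r5, r4, r2]
    generalize jac k (α + 3) (-m + 5 / 2) z = P3
    generalize jac k (α + 2) (-m + 3 / 2) z = P2
    rw [hm']
    have : (2 * (k : ℝ) + 3 - 2) ≠ 0 := by linarith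
    have : (k : ℝ) + (α + 1) + 1 ≠ 0 := by linarith
    have : (2 * (k : ℝ) + 3) ≠ 0 := by linarith
    field_simp
    ring

-- The three identities concern the coefficients of `wave2`, `wave1` and `Λ|s⟩` in the fifth family
-- after the ladder over `wave4` has been split off. The first is again a ladder, the second is a
-- ladder for even `m` and zero for odd `m`, and the third vanishes.
set_option maxHeartbeats 1000000 in
lemma jacobi_relation_four (hm : 4 ≤ m) (hα : -1 < α) (h : α + β = -m - 1 / 2) :
    3 / (2 * (((m - 3) / 2 : ℕ) + 1 / 2)) * jacobi (m / 2 - 2) (α + 3) β t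
        - 3 / (2 * (α + 3)) * ((t - 1) / 2 * jacobi (m / 2 - 2) (α + 4) β t) =
      3 * (m / 2 - 1 : ℕ) / ((2 * ((m - 3) / 2 : ℕ) + 1) * (α + 3)) *
        jacobi (m / 2 - 1) (α + 2) β t ∧
    2 * (3 / (2 * (((m - 3) / 2 : ℕ) + 1 / 2)) * jacobi (m / 2 - 2) (α + 3) β t) +
        3 / 2 * phi4 m α β t - jacobi (m / 2 - 2) (α + 4) β t * (3 * ((t - 1) / 2) + 1) =
      (if Even m then -(3 * (m + 2 * α + 2) / (2 * (m - 1) * (m - 3))) else 0) *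
        jacobi ((m - 1) / 2) (α + 1) β t ∧
    3 / (2 * (((m - 3) / 2 : ℕ) + 1 / 2)) * jacobi (m / 2 - 2) (α + 3) β t * ((t - 1) / 2 + 1) +
        3 / 2 * (phi4 m α β t + chi4 m α β t) = 0 := by
  set z := (t - 1) / 2 with hz
  have hA1 : α + 2 = α + 1 + 1 := by ring
  have hA2 : α + 3 = α + 2 + 1 := by ring
  have hA3 : α + 4 = α + 3 + 1 := by ring
  have s2 : -(m : ℝ) + 3 / 2 = -m + 1 / 2 + 1 := by ring
  have s3 : -(m : ℝ) + 5 / 2 = -m + 3 / 2 + 1 := by ring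
  have s4 : -(m : ℝ) + 7 / 2 = -m + 5 / 2 + 1 := by ring
  have t1 : α + 1 + β = -(m : ℝ) + 1 / 2 := by linarith
  have t2 : α + 2 + β = -(m : ℝ) + 3 / 2 := by linarith
  have t3 : α + 3 + β = -(m : ℝ) + 5 / 2 := by linarith
  have t4 : α + 4 + β = -(m : ℝ) + 7 / 2 := by linarith
  have t2b : α + 2 + (β - 1) = -(m : ℝ) + 1 / 2 := by linarith
  have t3b : α + 3 + (β - 1) = -(m : ℝ) + 3 / 2 := by linarith
  have t4b : α + 4 + (β - 1) = -(m : ℝ) + 5 / 2 := by linarith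
  obtain ⟨k, hk⟩ : ∃ k, m = 2 * k + 4 ∨ m = 2 * k + 5 := ⟨(m - 4) / 2, by omega⟩
  have hk0 : (0 : ℝ) ≤ k := k.cast_nonneg
  have b1 := jac_lower_beta k hA3 s4 z
  have b2 := jac_lower_beta k hA2 s3 z
  have b3 := jac_lower_beta k hA1 s2 z
  have hα3 : α + 3 ≠ 0 := by linarith
  have hkα : (k : ℝ) + (α + 2) + 1 ≠ 0 := by linarith
  rcases hk with hk | hk
  · have he : Even m := ⟨k + 2, by omega⟩
    have hm' : (m : ℝ) = 2 * k + 4 := by rw [hk]; push_cast; ring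
    rw [phi4, chi4, if_pos he, if_pos he, if_pos he]
    simp only [show (m - 3) / 2 = k by omega, show m / 2 = k + 2 by omega, Nat.add_sub_cancel,
      show k + 2 - 1 = k + 1 by omega, show (m - 1) / 2 = k + 1 by omega]
    simp only [jacobi_eq_jac _ t1, jacobi_eq_jac _ t2, jacobi_eq_jac _ t2b, jacobi_eq_jac _ t3,
      jacobi_eq_jac _ t3b, jacobi_eq_jac _ t4, jacobi_eq_jac _ t4b, ← hz]
    have r1 := jac_succ_of_mul k hA3 s4 z (c := 1 / 2) (by linarith)
    have r2 := jac_lower_alpha' k hA2 s3 z (c := 1 / 2) (by linarith) (by norm_num)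
    have r3 := jac_of_mul k hA2 s3 z (c := -1 / 2) (by linarith) (by linarith)
    have r4 := jac_lower_alpha' k hA1 s2 z (c := -1 / 2) (by linarith) (by norm_num)
    -- The parameter is raised successively from `α + 1` to `α + 4` until only the two polynomials
    -- `P3` and `P4` of degree `k` remain. The claims are then rational identities in `k`, `α` and
    -- `z`.
    rw [b1, b2, b3, r4, r3, r2, r1]
    generalize jac k (α + 4) (-m + 7 / 2) z = P4
    generalize jac k (α + 3) (-m + 5 / 2) z = P3
    rw [hm']
    have : (2 * (k : ℝ) + 4 - 1) ≠ 0 := by linarith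
    have : (2 * (k : ℝ) + 4 - 3) ≠ 0 := by linarith
    have : (k : ℝ) + 1 / 2 ≠ 0 := by linarith
    have : 2 * (k : ℝ) + 1 ≠ 0 := by linarith
    push_cast
    refine ⟨?_, ?_, ?_⟩
    · field_simp
      ring
    · field_simp
      ring
    · field_simp
      ring
  · have he : ¬ Even m := by
      rw [Nat.not_even_iff_odd]; exact ⟨k + 2, by omega⟩
    have hm' : (m : ℝ) = 2 * k + 5 := by rw [hk]; push_cast; ring
    rw [phi4, chi4, if_neg he, if_neg he, if_neg he]
    simp only [show (m - 3) / 2 = k + 1 by omega, show m / 2 = k + 2 by omega, Nat.add_sub_cancel,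
      show k + 2 - 1 = k + 1 by omega, show (m - 5) / 2 = k by omega]
    simp only [jacobi_eq_jac _ t2, jacobi_eq_jac _ t2b, jacobi_eq_jac _ t3,
      jacobi_eq_jac _ t3b, jacobi_eq_jac _ t4, jacobi_eq_jac _ t4b, ← hz]
    have r1 := jac_succ_of_mul k hA3 s4 z (c := -1 / 2) (by linarith)
    have r2 := jac_lower_alpha' k hA2 s3 z (c := -1 / 2) (by linarith) (by norm_num)
    have r3 := jac_of_mul k hA2 s3 z (c := -3 / 2) (by linarith) (by linarith)
    have r4 := jac_lower_alpha' k hA1 s2 z (c := -3 / 2) (by linarith) (by norm_num)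
    rw [b1, b2, b3, r4, r3, r2, r1]
    generalize jac k (α + 4) (-m + 7 / 2) z = P4
    generalize jac k (α + 3) (-m + 5 / 2) z = P3
    rw [hm']
    have : (2 * (k : ℝ) + 5 - 2) ≠ 0 := by linarith
    have : (2 * (k : ℝ) + 5) ≠ 0 := by linarith
    have : (k : ℝ) + 1 + 1 / 2 ≠ 0 := by linarith
    have : 2 * ((k : ℝ) + 1) + 1 ≠ 0 := by linarith
    push_cast
    refine ⟨?_, ?_, ?_⟩
    · field_simp
      ring
    · field_simp
      ring
    · field_simp
      ring

end Contiguous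
end NearNeighbour
namespace NearNeighbour
open scoped ContDiff

variable {N κ : ℕ}

/-! ## Homogeneous functions annihilated by a gauge transformed Hamiltonian -/

section Harmonic

variable [NeZero N]

omit [NeZero N] in
lemma contDiff_com : ContDiff ℝ ∞ (com : Pos N → ℝ) := by
  unfold com
  fun_prop

omit [NeZero N] in
lemma hasPD_com (i : Fin N) (x : Pos N) : HasPD i (com : Pos N → ℝ) (1 / N) x := by
  have h := (HasPD.sum (s := Finset.univ) (f' := fun j : Fin N => if i = j then (1 : ℝ) else 0)
    fun j _ => HasPD.coord (i := i) (x := x) j).const_mul (1 / (N : ℝ))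
  have e : (com : Pos N → ℝ) = fun x => 1 / (N : ℝ) * ∑ j, x j := by
    funext y; rw [com]; ring
  rw [e]
  exact h.congr (by simp)

/-- The variance of the coordinates. -/
noncomputable def dispersion (x : Pos N) : ℝ := psum 2 x / N - com x ^ 2

omit [NeZero N] in
lemma contDiff_dispersion : ContDiff ℝ ∞ (dispersion : Pos N → ℝ) := by
  unfold dispersion
  exact ((contDiff_psum 2).div_const _).sub (contDiff_com.pow 2)

lemma natCast_ne_zero : (N : ℝ) ≠ 0 := Nat.cast_ne_zero.mpr (NeZero.ne N)

omit [NeZero N] in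
lemma hasPD_dispersion (i : Fin N) (x : Pos N) :
    HasPD i (dispersion : Pos N → ℝ) (2 * (x i - com x) / N) x := by
  have h := ((hasPD_psum 2 i x).const_mul (1 / (N : ℝ))).sub ((hasPD_com i x).pow 2)
  have e : (dispersion : Pos N → ℝ) = fun x => 1 / (N : ℝ) * psum 2 x - com x ^ 2 := by
    funext y; rw [dispersion]; ring
  rw [e]
  refine h.congr ?_
  norm_num
  ring

lemma sum_sub_com (x : Pos N) : ∑ i, (x i - com x) = 0 := by
  rw [Finset.sum_sub_distrib, Finset.sum_const, Finset.card_univ, Fintype.card_fin, com,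
    nsmul_eq_mul, mul_div_cancel₀ _ natCast_ne_zero, sub_self]

lemma sum_sub_com_sq (x : Pos N) : ∑ i, (x i - com x) ^ 2 = N * dispersion x := by
  have h : ∀ i, (x i - com x) ^ 2 = x i ^ 2 - 2 * com x * (x i - com x) - com x ^ 2 := fun i => by
    ring
  simp_rw [h]
  rw [Finset.sum_sub_distrib, Finset.sum_sub_distrib, ← Finset.mul_sum, sum_sub_com,
    Finset.sum_const, Finset.card_univ, Fintype.card_fin, dispersion, nsmul_eq_mul, mul_sub,
    mul_div_cancel₀ _ natCast_ne_zero, psum]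
  ring

/-- `f` is smooth, homogeneous of degree `d`, and annihilated by `gaugedOp F w` on `C`. -/
structure Harm (C : Set (Pos N)) (F w : Fin N → Pos N → ℝ) (f : Wave N κ) (d : ℕ) : Prop where
  smooth : ContDiff ℝ ∞ f
  euler : ∀ x, ∑ i, x i • pD i f x = (d : ℝ) • f x
  zero : ∀ x ∈ C, gaugedOp F w f x = 0

/-- `f` is translation invariant. -/
def TransInv (f : Wave N κ) : Prop := ∀ x, ∑ i, pD i f x = 0

variable {C : Set (Pos N)} {F w : Fin N → Pos N → ℝ} {f g : Wave N κ} {d : ℕ}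

lemma Harm.add (hf : Harm C F w f d) (hg : Harm C F w g d) :
    Harm C F w (fun x => f x + g x) d where
  smooth := hf.smooth.add hg.smooth
  euler x := by
    simp only [pD_add hf.smooth hg.smooth, smul_add, Finset.sum_add_distrib, hf.euler, hg.euler]
  zero x hx := by rw [gaugedOp_add F w hf.smooth hg.smooth, hf.zero x hx, hg.zero x hx, add_zero]

lemma Harm.const_smul (c : ℝ) (hf : Harm C F w f d) : Harm C F w (fun x => c • f x) d where
  smooth := hf.smooth.const_smul c
  euler x := by
    simp only [pD_const_smul c hf.smooth, smul_comm _ c, ← Finset.smul_sum, hf.euler]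
  zero x hx := by rw [gaugedOp_const_smul F w c hf.smooth, hf.zero x hx, smul_zero]

omit [NeZero N] in
lemma hasPD_psum_pow (k : ℕ) (i : Fin N) (x : Pos N) :
    HasPD i (fun x => psum 2 x ^ k) (k * psum 2 x ^ (k - 1) * (2 * x i)) x :=
  ((hasPD_psum 2 i x).pow k).congr (by norm_num)

omit [NeZero N] in
lemma scalarOp_psum_pow {s : ℝ} {x : Pos N} (hs : ∑ i, F i x * x i = s) (k : ℕ) :
    scalarOp F (fun x => psum 2 x ^ k) x =
      4 * k * (k - 1 + N / 2 + s) * psum 2 x ^ (k - 1) := by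
  have h1 : ∀ i, pD i (fun x : Pos N => psum 2 x ^ k) =
      fun x => k * psum 2 x ^ (k - 1) * (2 * x i) := fun i => pD_eq_of (hasPD_psum_pow k i)
  have h2 : ∀ i, pD i (fun x : Pos N => k * psum 2 x ^ (k - 1) * (2 * x i)) x =
      4 * (k * ((k - 1 : ℕ) : ℝ) * psum 2 x ^ (k - 1 - 1)) * x i ^ 2 +
        2 * k * psum 2 x ^ (k - 1) := by
    intro i
    rw [(((hasPD_psum_pow (k - 1) i x).const_mul (k : ℝ)).mul
      ((HasPD.coord i).const_mul (2 : ℝ))).eq]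
    simp
    ring
  have h3 : ∀ i, F i x * (k * psum 2 x ^ (k - 1) * (2 * x i)) =
      2 * k * psum 2 x ^ (k - 1) * (F i x * x i) := fun i => by ring
  unfold scalarOp
  simp only [h1, h2, h3]
  rw [Finset.sum_add_distrib, ← Finset.mul_sum, ← Finset.mul_sum, ← Finset.mul_sum, hs, Finset.sum_const,
    Finset.card_univ, Fintype.card_fin, nsmul_eq_mul]
  have h4 : ∑ i, x i ^ 2 = psum 2 x := rfl
  rw [h4]
  rcases k with _ | _ | k
  · simp
  · simp; ring
  · simp only [Nat.add_sub_cancel]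
    push_cast
    ring

/-- The cross term of `r^(2k)` and `f` is `4 k r^(2k-2)` times Euler's operator, so homogeneity of
`f` merely shifts the dimension parameter by `d`. -/
lemma Harm.gaugedOp_psum_pow (h : Harm C F w f d) {s : ℝ} {x : Pos N} (hx : x ∈ C)
    (hs : ∑ i, F i x * x i = s) (k : ℕ) :
    gaugedOp F w (fun x => psum 2 x ^ k • f x) x =
      (4 * k * (k - 1 + N / 2 + s + d) * psum 2 x ^ (k - 1)) • f x := by
  have h1 : ∀ i, pD i (fun x : Pos N => psum 2 x ^ k) x • pD i f x =
      (2 * k * psum 2 x ^ (k - 1)) • (x i • pD i f x) := fun i => by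
    rw [(hasPD_psum_pow k i x).eq, smul_smul]
    congr 1; ring
  rw [gaugedOp_smul F w ((contDiff_psum 2).pow k) h.smooth, scalarOp_psum_pow hs, h.zero x hx]
  simp only [h1]
  rw [← Finset.smul_sum, h.euler]
  module

lemma Harm.euler_psum_pow (h : Harm C F w f d) (x : Pos N) (k : ℕ) :
    ∑ i, x i • pD i (fun x => psum 2 x ^ k • f x) x =
      ((2 * k + d) * psum 2 x ^ k) • f x := by
  have h1 : ∀ i, x i • pD i (fun x => psum 2 x ^ k • f x) x =
      (2 * k * psum 2 x ^ (k - 1)) • (x i ^ 2 • f x) + psum 2 x ^ k • (x i • pD i f x) := fun i => by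
    rw [((hasPD_psum_pow k i x).smul (HasPD.of_contDiff h.smooth)).eq]
    module
  simp only [h1]
  rw [Finset.sum_add_distrib, ← Finset.smul_sum, ← Finset.smul_sum, ← Finset.sum_smul, h.euler]
  have h4 : ∑ i, x i ^ 2 = psum 2 x := rfl
  rw [h4]
  rcases k with _ | k
  · simp
  · simp only [Nat.add_sub_cancel]
    push_cast
    module

lemma gaugedOp_sub_linear (om : ℝ) (f : Wave N κ) (x : Pos N) :
    gaugedOp (fun i x => F i x - om * x i) w f x =
      gaugedOp F w f x - (2 * om) • ∑ i, x i • pD i f x := by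
  unfold gaugedOp
  simp only [sub_smul, Finset.sum_sub_distrib, mul_smul, ← Finset.smul_sum]
  module

/-- The coefficient of `x^k` in the Laguerre polynomial. -/
noncomputable def laguerreCoeff (l : ℕ) (lam : ℝ) (k : ℕ) : ℝ :=
  (-1) ^ k * gbinom (l + lam) (l - k) / k.factorial

lemma laguerre_eq (l : ℕ) (lam x : ℝ) :
    laguerre l lam x = ∑ k ∈ Finset.range (l + 1), laguerreCoeff l lam k * x ^ k :=
  Finset.sum_congr rfl fun k _ => by rw [laguerreCoeff]; ring

/-- The coefficient form of Laguerre's differential equation, valid for every real parameter. -/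
lemma laguerreCoeff_succ (l : ℕ) (lam : ℝ) {k : ℕ} (hk : k < l) :
    (k + 1) * (k + 1 + lam) * laguerreCoeff l lam (k + 1) = -((l - k) * laguerreCoeff l lam k) := by
  have h1 := gbinom_succ ((l : ℝ) + lam) (l - (k + 1))
  rw [show l - (k + 1) + 1 = l - k by omega] at h1
  rw [Nat.cast_sub (by omega : k + 1 ≤ l)] at h1
  push_cast at h1
  unfold laguerreCoeff
  rw [Nat.factorial_succ]
  have := Nat.factorial_ne_zero k
  push_cast
  field_simp
  rw [pow_succ]
  linear_combination (-1) ^ k * h1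

/-- Multiplication by a Laguerre polynomial turns homogeneous solutions of the problem without
harmonic confinement into eigenfunctions of the confined problem. -/
lemma Harm.laguerre (h : Harm C F w f d) {s lam : ℝ} (hs : ∀ x ∈ C, ∑ i, F i x * x i = s)
    (hlam : lam = N / 2 + s + d - 1) (om : ℝ) (l : ℕ) {x : Pos N} (hx : x ∈ C) :
    gaugedOp (fun i x => F i x - om * x i) w (fun x => laguerre l lam (om * psum 2 x) • f x) x =
      -((2 * om * (2 * l + d)) • (laguerre l lam (om * psum 2 x) • f x)) := by
  set c : ℕ → ℝ := fun k => laguerreCoeff l lam k * om ^ k with hc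
  have e1 : (fun x => NearNeighbour.laguerre l lam (om * psum 2 x) • f x) = fun x =>
      ∑ k ∈ Finset.range (l + 1), c k • (psum 2 x ^ k • f x) := by
    funext y
    rw [laguerre_eq, Finset.sum_smul]
    exact Finset.sum_congr rfl fun k _ => by rw [hc, mul_pow, smul_smul]; congr 1; ring
  have hsm : ∀ k, ContDiff ℝ ∞ (fun x => psum 2 x ^ k • f x) := fun k =>
    ((contDiff_psum 2).pow k).smul h.smooth
  have e2 : ∀ k, gaugedOp (fun i x => F i x - om * x i) w (fun x => c k • (psum 2 x ^ k • f x)) x =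
      (c k * (4 * k * (k + lam) * psum 2 x ^ (k - 1)
        - 2 * om * ((2 * k + d) * psum 2 x ^ k))) • f x := by
    intro k
    rw [gaugedOp_const_smul _ _ _ (hsm k), gaugedOp_sub_linear, h.gaugedOp_psum_pow hx (hs x hx),
      h.euler_psum_pow, hlam]
    module
  have e3 : NearNeighbour.laguerre l lam (om * psum 2 x) • f x =
      (∑ k ∈ Finset.range (l + 1), c k * psum 2 x ^ k) • f x := by
    rw [laguerre_eq]
    congr 1
    exact Finset.sum_congr rfl fun k _ => by rw [hc, mul_pow]; ring
  rw [e1, gaugedOp_sum _ _ _ (f := fun k x => c k • (psum 2 x ^ k • f x))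
    (fun k => (hsm k).const_smul (c k))]
  simp only [e2]
  rw [← Finset.sum_smul, e3, smul_smul, ← neg_smul]
  congr 1
  simp only [mul_sub, Finset.sum_sub_distrib]
  -- The unconfined operator lowers the power of `r²` by one. After the shift of the index the
  -- recursion for the coefficients applies, and both sides are compared power by power.
  rw [Finset.sum_range_succ' (fun k => c k * (4 * k * (k + lam) * psum 2 x ^ (k - 1)))]
  have e4 : ∀ k ∈ Finset.range l, c (k + 1) * (4 * ((k + 1 : ℕ) : ℝ) * (((k + 1 : ℕ) : ℝ) + lam)
      * psum 2 x ^ (k + 1 - 1)) = -(4 * om) * ((l - k) * (c k * psum 2 x ^ k)) := by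
    intro k hk
    have := laguerreCoeff_succ l lam (Finset.mem_range.mp hk)
    simp only [hc, Nat.add_sub_cancel]
    push_cast
    rw [pow_succ]
    linear_combination 4 * om ^ k * om * psum 2 x ^ k * this
  rw [Finset.sum_congr rfl e4]
  have e5 : ∑ k ∈ Finset.range l, -(4 * om) * (((l : ℝ) - k) * (c k * psum 2 x ^ k)) =
      ∑ k ∈ Finset.range (l + 1), -(4 * om) * (((l : ℝ) - k) * (c k * psum 2 x ^ k)) := by
    rw [Finset.sum_range_succ]; simp
  rw [e5, Finset.mul_sum]
  simp only [Nat.cast_zero, mul_zero, zero_mul, add_zero]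
  rw [← Finset.sum_sub_distrib, ← Finset.sum_neg_distrib]
  exact Finset.sum_congr rfl fun k _ => by ring

end Harmonic
end NearNeighbour
namespace NearNeighbour
open scoped ContDiff

variable {N κ : ℕ}

/-! ## Functions of the centre of mass and the dispersion -/

section Ladder

variable [NeZero N]

omit [NeZero N] in
lemma hasPD_com_pow_mul (j k : ℕ) (i : Fin N) (x : Pos N) :
    HasPD i (fun x => com x ^ j * dispersion x ^ k)
      (j * com x ^ (j - 1) * (1 / N) * dispersion x ^ k +
        com x ^ j * (k * dispersion x ^ (k - 1) * (2 * (x i - com x) / N))) x :=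
  ((hasPD_com i x).pow j).mul ((hasPD_dispersion i x).pow k)

lemma natCast_mul_pred (k : ℕ) : (k : ℝ) * ((k - 1 : ℕ) : ℝ) = k * (k - 1) := by
  rcases k with _ | k <;> simp

omit [NeZero N] in
lemma sum_affine (p q : ℝ) (c : Fin N → ℝ) (hc : ∑ i, c i = 0) : ∑ i, (p + q * c i) = N * p := by
  rw [Finset.sum_add_distrib, ← Finset.mul_sum, hc, Finset.sum_const, Finset.card_univ,
    Fintype.card_fin, nsmul_eq_mul]
  ring

/-- The gradient of `com` is constant and that of `dispersion` is proportional to `x_i - com x`,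
whose sum is zero. The two are orthogonal, so no mixed term appears; the drift does not act on `com`
because `∑ F_i = 0`. -/
lemma scalarOp_com_pow_mul {F : Fin N → Pos N → ℝ} {s : ℝ} {x : Pos N} (h0 : ∑ i, F i x = 0)
    (hs : ∑ i, F i x * x i = s) (j k : ℕ) :
    scalarOp F (fun x => com x ^ j * dispersion x ^ k) x =
      (j * (j - 1) * com x ^ (j - 2) * dispersion x ^ k
        + 4 * k * (k - 1 + (N - 1) / 2 + s) * com x ^ j * dispersion x ^ (k - 1)) / N := by
  have hN : (N : ℝ) ≠ 0 := natCast_ne_zero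
  have h2 : ∀ i, pD i (pD i (fun x => com x ^ j * dispersion x ^ k)) x =
      (j * (j - 1) * com x ^ (j - 2) * dispersion x ^ k / N ^ 2
        + 2 * k * (1 - 1 / N) / N * com x ^ j * dispersion x ^ (k - 1))
      + 4 * j * k / N ^ 2 * com x ^ (j - 1) * dispersion x ^ (k - 1) * (x i - com x)
      + 4 * k * (k - 1) / N ^ 2 * com x ^ j * dispersion x ^ (k - 2) * (x i - com x) ^ 2 := by
    intro i
    rw [pD_eq_of (hasPD_com_pow_mul j k i)]
    have a1 := (((hasPD_com i x).pow (j - 1)).const_mul (j : ℝ)).mul (HasPD.const (1 / (N : ℝ)))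
    have a2 := a1.mul ((hasPD_dispersion i x).pow k)
    have a3 := (((HasPD.coord (i := i) (x := x) i).sub (hasPD_com i x)).const_mul 2).mul
      (HasPD.const (N : ℝ)⁻¹)
    have a4 := ((hasPD_com i x).pow j).mul
      ((((hasPD_dispersion i x).pow (k - 1)).const_mul (k : ℝ)).mul a3)
    have a5 := (a2.add a4).eq
    simp only [← div_eq_mul_inv] at a5
    rw [a5, show j - 1 - 1 = j - 2 by omega, show k - 1 - 1 = k - 2 by omega]
    simp only [if_true, mul_zero, add_zero]
    linear_combination
      (com x ^ (j - 2) * dispersion x ^ k / N ^ 2) * natCast_mul_pred j +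
      (4 / N ^ 2 * com x ^ j * dispersion x ^ (k - 2) * (x i - com x) ^ 2) * natCast_mul_pred k
  have h1 : ∀ i, F i x * pD i (fun x => com x ^ j * dispersion x ^ k) x =
      (j * com x ^ (j - 1) * (1 / N) * dispersion x ^ k
        - com x ^ j * (k * dispersion x ^ (k - 1) * (2 * com x / N))) * F i x
      + com x ^ j * (k * dispersion x ^ (k - 1) * (2 / N)) * (F i x * x i) := by
    intro i
    rw [(hasPD_com_pow_mul j k i x).eq]
    ring
  unfold scalarOp
  simp only [h1, h2]
  rw [Finset.sum_add_distrib, sum_affine _ _ _ (sum_sub_com x), ← Finset.mul_sum, sum_sub_com_sq,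
    Finset.sum_add_distrib, ← Finset.mul_sum, ← Finset.mul_sum, h0, hs]
  have hk : (k : ℝ) * (k - 1) * dispersion x ^ (k - 2) * dispersion x =
      k * (k - 1) * dispersion x ^ (k - 1) := by
    rcases k with _ | _ | k
    · simp
    · simp
    · simp only [show k + 1 + 1 - 1 = k + 1 by omega, show k + 1 + 1 - 2 = k by omega]; ring
  field_simp
  linear_combination 8 * com x ^ j * hk

variable {C : Set (Pos N)} {F w : Fin N → Pos N → ℝ} {f : Wave N κ} {d : ℕ}

lemma TransInv.sum_smul_sub (ht : TransInv f) (h : Harm C F w f d) (x : Pos N) (p q : ℝ) :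
    ∑ i, (p + q * (x i - com x)) • pD i f x = (q * d) • f x := by
  have e : ∀ i, (p + q * (x i - com x)) • pD i f x =
      (p - q * com x) • pD i f x + q • (x i • pD i f x) := fun i => by module
  simp only [e]
  rw [Finset.sum_add_distrib, ← Finset.smul_sum, ← Finset.smul_sum, ht x, h.euler, smul_zero,
    zero_add, smul_smul]

/-- Translation invariance of `f` kills the cross term with the gradient of `com`, and Euler's
identity turns the one with the gradient of `dispersion` into the shift by `d`. -/
lemma Harm.gaugedOp_com_pow_mul (h : Harm C F w f d) (ht : TransInv f) {s : ℝ} {x : Pos N}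
    (hx : x ∈ C) (h0 : ∑ i, F i x = 0) (hs : ∑ i, F i x * x i = s) (j k : ℕ) :
    gaugedOp F w (fun x => (com x ^ j * dispersion x ^ k) • f x) x =
      ((j * (j - 1) * com x ^ (j - 2) * dispersion x ^ k
        + 4 * k * (k - 1 + (N - 1) / 2 + s + d) * com x ^ j * dispersion x ^ (k - 1)) / N) • f x := by
  have h1 : ∀ i, pD i (fun x : Pos N => com x ^ j * dispersion x ^ k) x • pD i f x =
      (j * com x ^ (j - 1) * (1 / N) * dispersion x ^ k
        + com x ^ j * (k * dispersion x ^ (k - 1) * (2 / N)) * (x i - com x)) • pD i f x := fun i => by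
    rw [(hasPD_com_pow_mul j k i x).eq]
    congr 1; ring
  rw [gaugedOp_smul F w ((contDiff_com.pow j).mul (contDiff_dispersion.pow k)) h.smooth,
    scalarOp_com_pow_mul h0 hs, h.zero x hx]
  simp only [h1]
  rw [ht.sum_smul_sub h]
  have hN : (N : ℝ) ≠ 0 := natCast_ne_zero
  rw [smul_zero, add_zero, smul_smul, ← add_smul]
  congr 1
  ring

lemma sum_mul_sub_com (x : Pos N) : ∑ i, x i * (x i - com x) = N * dispersion x := by
  have h : ∀ i, x i * (x i - com x) = (x i - com x) ^ 2 + com x * (x i - com x) := fun i => by ring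
  simp only [h, Finset.sum_add_distrib, ← Finset.mul_sum, sum_sub_com, sum_sub_com_sq]
  ring

lemma sum_coord (x : Pos N) : ∑ i, x i = N * com x := by
  rw [com, mul_div_cancel₀ _ natCast_ne_zero]

lemma Harm.euler_com_pow_mul (h : Harm C F w f d) (x : Pos N) (j k : ℕ) :
    ∑ i, x i • pD i (fun x => (com x ^ j * dispersion x ^ k) • f x) x =
      ((j + 2 * k + d : ℝ) * (com x ^ j * dispersion x ^ k)) • f x := by
  have h1 : ∀ i, x i • pD i (fun x => (com x ^ j * dispersion x ^ k) • f x) x =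
      (j * com x ^ (j - 1) * (1 / N) * dispersion x ^ k * x i +
        com x ^ j * (k * dispersion x ^ (k - 1) * (2 / N)) * (x i * (x i - com x))) • f x
      + (com x ^ j * dispersion x ^ k) • (x i • pD i f x) := fun i => by
    rw [((hasPD_com_pow_mul j k i x).smul (HasPD.of_contDiff h.smooth)).eq, smul_add, smul_smul,
      smul_comm (x i)]
    congr 2
    ring
  simp only [h1]
  rw [Finset.sum_add_distrib, ← Finset.smul_sum, ← Finset.sum_smul, h.euler,
    Finset.sum_add_distrib, ← Finset.mul_sum, ← Finset.mul_sum, sum_mul_sub_com, sum_coord,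
    smul_smul, ← add_smul]
  congr 1
  have hN : (N : ℝ) ≠ 0 := natCast_ne_zero
  have hk : (k : ℝ) * dispersion x ^ (k - 1) * dispersion x = k * dispersion x ^ k := by
    rcases k with _ | k
    · simp
    · simp only [Nat.add_sub_cancel]; ring
  have hj : (j : ℝ) * com x ^ (j - 1) * com x = j * com x ^ j := by
    rcases j with _ | j
    · simp
    · simp only [Nat.add_sub_cancel]; ring
  field_simp
  linear_combination 2 * com x ^ j * hk + dispersion x ^ k * hj

/-- Coefficients of the Jacobi polynomial of degree `e / 2` with parameters `A`, `-e - 1/2 - A`. -/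
noncomputable def ladderCoeff (e : ℕ) (A : ℝ) (k : ℕ) : ℝ :=
  gbinom ((e / 2 : ℕ) + A) (e / 2 - k) * gbinom ((e / 2 : ℕ) + k + (-e - 1 / 2)) k

/-- The polynomial `com^e P(t)` with `P` a Jacobi polynomial, see `ladder_eq`. -/
noncomputable def ladder (e : ℕ) (A : ℝ) (x : Pos N) : ℝ :=
  ∑ k ∈ Finset.range (e / 2 + 1), ladderCoeff e A k * (com x ^ (e - 2 * k) * dispersion x ^ k)

lemma tvar_eq (x : Pos N) (hx : com x ≠ 0) : (tvar x - 1) / 2 = dispersion x / com x ^ 2 := by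
  have hN : (N : ℝ) ≠ 0 := natCast_ne_zero
  rw [tvar, dispersion]
  field_simp
  ring

lemma ladder_eq {e : ℕ} {A B : ℝ} (h : A + B = -e - 1 / 2) {x : Pos N} (hx : com x ≠ 0) :
    ladder e A x = com x ^ e * jacobi (e / 2) A B (tvar x) := by
  rw [jacobi_eq, h, tvar_eq x hx, ladder, Finset.mul_sum]
  refine Finset.sum_congr rfl fun k hk => ?_
  have hk' : 2 * k ≤ e := by have := Finset.mem_range.mp hk; omega
  have : com x ^ e = com x ^ (e - 2 * k) * (com x ^ 2) ^ k := by
    rw [← pow_mul, ← pow_add]; congr 1; omega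
  rw [this, div_pow, ladderCoeff]
  field_simp

lemma ladderCoeff_succ (e : ℕ) (A : ℝ) {k : ℕ} (hk : k < e / 2) :
    4 * (k + 1) * (k + 1 + A) * ladderCoeff e A (k + 1) =
      -((e - 2 * k) * (e - 2 * k - 1) * ladderCoeff e A k) := by
  have h1 := gbinom_succ (((e / 2 : ℕ) : ℝ) + A) (e / 2 - (k + 1))
  rw [show e / 2 - (k + 1) + 1 = e / 2 - k by omega] at h1
  rw [Nat.cast_sub (by omega : k + 1 ≤ e / 2)] at h1
  have h2 := gbinom_add_one_succ (((e / 2 : ℕ) : ℝ) + k + (-e - 1 / 2)) k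
  rw [show ((e / 2 : ℕ) : ℝ) + k + (-e - 1 / 2) + 1 = (e / 2 : ℕ) + (k + 1 : ℕ) + (-e - 1 / 2) by
    push_cast; ring] at h2
  push_cast at h1 h2
  -- The remainder of `e` modulo `2` is `0` or `1`; in both cases this product vanishes, which is
  -- why the series terminates at `k = e / 2` for either parity.
  have h3 : ((e : ℝ) - 2 * (e / 2 : ℕ)) * (e - 2 * (e / 2 : ℕ) - 1) = 0 := by
    rcases Nat.even_or_odd' e with ⟨n, rfl | rfl⟩
    · simp
    · rw [show (2 * n + 1) / 2 = n by omega]; push_cast; ring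
  unfold ladderCoeff
  push_cast
  linear_combination
    -(4 * (k + 1) * gbinom ((e / 2 : ℕ) + (k + 1) + (-e - 1 / 2)) (k + 1)) * h1
    + 4 * ((e / 2 : ℕ) - k) * gbinom ((e / 2 : ℕ) + A) (e / 2 - k) * h2
    + gbinom ((e / 2 : ℕ) + A) (e / 2 - k) * gbinom ((e / 2 : ℕ) + k + (-e - 1 / 2)) k * h3

omit [NeZero N] in
lemma contDiff_ladder (e : ℕ) (A : ℝ) : ContDiff ℝ ∞ (ladder e A : Pos N → ℝ) := by
  unfold ladder
  exact ContDiff.sum fun k _ =>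
    contDiff_const.mul ((contDiff_com.pow _).mul (contDiff_dispersion.pow _))

/-- Multiplying a translation invariant homogeneous solution by suitable polynomials in the centre
of mass and the dispersion yields further homogeneous solutions. -/
lemma Harm.ladder (h : Harm C F w f d) (ht : TransInv f) {s A : ℝ}
    (h0 : ∀ x ∈ C, ∑ i, F i x = 0) (hs : ∀ x ∈ C, ∑ i, F i x * x i = s)
    (hA : A + 1 = (N - 1) / 2 + s + d) (e : ℕ) :
    Harm C F w (fun x => ladder e A x • f x) (e + d) := by
  set t : ℕ → Wave N κ := fun k x => (com x ^ (e - 2 * k) * dispersion x ^ k) • f x with htt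
  have hsm : ∀ k, ContDiff ℝ ∞ (t k) := fun k =>
    ((contDiff_com.pow _).mul (contDiff_dispersion.pow _)).smul h.smooth
  have e1 : (fun x => NearNeighbour.ladder e A x • f x) = fun x =>
      ∑ k ∈ Finset.range (e / 2 + 1), ladderCoeff e A k • t k x := by
    funext x
    rw [NearNeighbour.ladder, Finset.sum_smul]
    exact Finset.sum_congr rfl fun k _ => by rw [mul_smul]
  refine ⟨(contDiff_ladder e A).smul h.smooth, fun x => ?_, fun x hx => ?_⟩
  · rw [e1]
    have e2 : ∀ i, pD i (fun x => ∑ k ∈ Finset.range (e / 2 + 1), ladderCoeff e A k • t k x) x =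
        ∑ k ∈ Finset.range (e / 2 + 1), ladderCoeff e A k • pD i (t k) x := fun i => by
      rw [pD_sum fun k _ => (hsm k).const_smul (ladderCoeff e A k)]
      exact Finset.sum_congr rfl fun k _ => by
        rw [pD_const_smul _ (hsm k)]
    simp only [e2, Finset.smul_sum, smul_comm (x _)]
    rw [Finset.sum_comm, NearNeighbour.ladder, Finset.sum_smul, Finset.smul_sum]
    refine Finset.sum_congr rfl fun k hk => ?_
    rw [← Finset.smul_sum, h.euler_com_pow_mul]
    have hk' : 2 * k ≤ e := by have := Finset.mem_range.mp hk; omega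
    rw [Nat.cast_sub hk', smul_smul, smul_smul]
    push_cast
    congr 1
    ring
  · rw [e1, gaugedOp_sum _ _ _ (f := fun k x => ladderCoeff e A k • t k x)
      (fun k => (hsm k).const_smul (ladderCoeff e A k))]
    have e2 : ∀ k ∈ Finset.range (e / 2 + 1),
        gaugedOp F w (fun x => ladderCoeff e A k • t k x) x =
        ((ladderCoeff e A k * ((e - 2 * k) * (e - 2 * k - 1))
            * com x ^ (e - 2 * k - 2) * dispersion x ^ k
          + 4 * k * (k + A) * ladderCoeff e A k * com x ^ (e - 2 * k) * dispersion x ^ (k - 1)) / N)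
          • f x := by
      intro k hk
      have hk' : 2 * k ≤ e := by have := Finset.mem_range.mp hk; omega
      rw [gaugedOp_const_smul _ _ _ (hsm k), h.gaugedOp_com_pow_mul ht hx (h0 x hx) (hs x hx),
        smul_smul, Nat.cast_sub hk']
      push_cast
      congr 1
      linear_combination (-4 * k * ladderCoeff e A k * com x ^ (e - 2 * k) * dispersion x ^ (k - 1) / N) * hA
    rw [Finset.sum_congr rfl e2, ← Finset.sum_smul, ← Finset.sum_div, Finset.sum_add_distrib]
    rw [Finset.sum_range_succ' (fun k => 4 * (k : ℝ) * (k + A) * ladderCoeff e A k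
      * com x ^ (e - 2 * k) * dispersion x ^ (k - 1))]
    rw [Finset.sum_range_succ]
    have h3 : ((e : ℝ) - 2 * (e / 2 : ℕ)) * (e - 2 * (e / 2 : ℕ) - 1) = 0 := by
      rcases Nat.even_or_odd' e with ⟨n, rfl | rfl⟩
      · simp
      · rw [show (2 * n + 1) / 2 = n by omega]; push_cast; ring
    rw [h3]
    simp only [mul_zero, zero_mul, add_zero, Nat.cast_zero]
    rw [← Finset.sum_add_distrib, Finset.sum_eq_zero, zero_div, zero_smul]
    intro k hk
    have := ladderCoeff_succ e A (Finset.mem_range.mp hk)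
    rw [show e - 2 * (k + 1) = e - 2 * k - 2 by omega, Nat.add_sub_cancel]
    push_cast
    linear_combination com x ^ (e - 2 * k - 2) * dispersion x ^ k * this

end Ladder

end NearNeighbour
namespace NearNeighbour
open scoped ContDiff

variable {N κ : ℕ}

/-! ## The spin states `|s_i⟩` and `|s_{ij}⟩` -/

section SpinStates

lemma permSpin_smul_sum (σ : Equiv.Perm (Fin N)) (c : ℝ) (p : Equiv.Perm (Fin N) → Prop)
    [DecidablePred p] (s : Spin N κ) :
    permSpin σ (c • ∑ τ ∈ Finset.univ.filter p, permSpin τ s) =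
      c • ∑ τ ∈ Finset.univ.filter (fun τ => p (σ⁻¹ * τ)), permSpin τ s := by
  rw [permSpin_smul, permSpin_sum, Finset.sum_filter, Finset.sum_filter,
    ← Equiv.sum_comp (Equiv.mulLeft σ) fun τ => if p (σ⁻¹ * τ) then permSpin τ s else 0]
  simp [permSpin_mul]

lemma permSpin_symmetrize_const (σ : Equiv.Perm (Fin N)) (s : Spin N κ) (x : Pos N) :
    permSpin σ (sym0 s x) = sym0 s x := by
  simpa [sym0, symmetrize] using
    permSpin_smul_sum σ ((N.factorial : ℝ)⁻¹) (fun _ => True) s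

lemma sym0_eq (s : Spin N κ) (x y : Pos N) : sym0 s x = sym0 s y := rfl

lemma sym0_ne_zero {s : Spin N κ} (h : sym0 s ≠ 0) (x : Pos N) : sym0 s x ≠ 0 :=
  fun h' => h (funext fun y => (sym0_eq s y x).trans h')

variable [NeZero N]

/-- Left multiplication by `σ` permutes the summation range. This covariance is all that the
exchange computations for `|s_i⟩` use. -/
lemma permSpin_spinOne (σ : Equiv.Perm (Fin N)) (s : Spin N κ) (i : Fin N) :
    permSpin σ (spinOne s i) = spinOne s (σ i) := by
  rw [spinOne, permSpin_smul_sum, spinOne]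
  congr 2
  ext τ
  simp [Equiv.symm_apply_eq, Equiv.Perm.inv_def]

lemma permSpin_spinTwo (σ : Equiv.Perm (Fin N)) (s : Spin N κ) (i j : Fin N) :
    permSpin σ (spinTwo s i j) = spinTwo s (σ i) (σ j) := by
  rw [spinTwo, permSpin_smul_sum, spinTwo]
  congr 2
  ext τ
  simp [Equiv.symm_apply_eq, Equiv.Perm.inv_def]

lemma spinTwo_comm (s : Spin N κ) (i j : Fin N) : spinTwo s i j = spinTwo s j i := by
  unfold spinTwo
  congr 2
  ext τ
  simp [or_comm]

lemma fin_zero_ne_one (hN : 2 ≤ N) : (0 : Fin N) ≠ 1 := by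
  intro h
  have h' := congrArg Fin.val h
  rw [Fin.val_one', Fin.val_zero, Nat.mod_eq_of_lt (by omega)] at h'
  omega

lemma spinTwo_self (hN : 2 ≤ N) (s : Spin N κ) (i : Fin N) : spinTwo s i i = 0 := by
  unfold spinTwo
  rw [Finset.sum_eq_zero, smul_zero]
  intro τ hτ
  simp only [Finset.mem_filter, Finset.mem_univ, true_and, or_self] at hτ
  exact absurd (τ.injective (hτ.1.trans hτ.2.symm)) (fin_zero_ne_one hN)

lemma symmetrize_apply_zero (g : ℝ → ℝ) (s : Spin N κ) (x : Pos N) :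
    symmetrize (fun y => g (y 0) • s) x = ∑ i, g (x i) • spinOne s i :=
  symmetrize_coord s (fun i => g (x i))

lemma sum_spinOne (s : Spin N κ) (x : Pos N) : ∑ i, spinOne s i = sym0 s x := by
  have h := symmetrize_apply_zero (fun _ => 1) s x
  simp only [one_smul] at h
  exact h.symm

lemma sum_spinTwo (hN : 2 ≤ N) (s : Spin N κ) (x : Pos N) :
    ∑ i, ∑ j, (x i * x j) • spinTwo s i j = (2 : ℝ) • sym11 s x := by
  have e : ∀ i j : Fin N, (x i * x j) • spinTwo s i j =
      (if i < j then (x i * x j) • spinTwo s i j else 0)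
      + (if j < i then (x j * x i) • spinTwo s j i else 0) := by
    intro i j
    rcases lt_trichotomy i j with h | rfl | h
    · rw [if_pos h, if_neg h.not_gt, add_zero]
    · simp [spinTwo_self hN]
    · rw [if_neg h.not_gt, if_pos h, zero_add, spinTwo_comm s i j, mul_comm]
  rw [Finset.sum_congr rfl fun i _ => Finset.sum_congr rfl fun j _ => e i j]
  simp_rw [Finset.sum_add_distrib]
  rw [Finset.sum_comm (f := fun i j => if j < i then (x j * x i) • spinTwo s j i else 0),
    two_smul, sym11, symmetrize_coord_mul hN]

lemma sym11_translate (s : Spin N κ) (x : Pos N) (c : ℝ) :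
    sym11 s (fun i => x i - c) = sym11 s x - c • symSum s x + c ^ 2 • sym0 s x := by
  unfold sym11 symSum sym0 symmetrize
  simp only [Function.comp, permSpin_smul]
  have e : ∀ σ : Equiv.Perm (Fin N), ((x (σ 0) - c) * (x (σ 1) - c)) • permSpin σ s =
      (x (σ 0) * x (σ 1)) • permSpin σ s - c • ((x (σ 0) + x (σ 1)) • permSpin σ s)
        + c ^ 2 • permSpin σ s := fun σ => by module
  simp only [e, Finset.sum_add_distrib, Finset.sum_sub_distrib, ← Finset.smul_sum]
  module

omit [NeZero N] in
lemma sym0_of_invariant (v : Spin N κ) (x : Pos N)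
    (h : ∀ σ : Equiv.Perm (Fin N), permSpin σ v = v) : sym0 v x = v := by
  unfold sym0 symmetrize
  simp only [h]
  rw [Finset.sum_const, Finset.card_univ, Fintype.card_perm, Fintype.card_fin,
    ← Nat.cast_smul_eq_nsmul ℝ, smul_smul, inv_mul_cancel₀ (by positivity), one_smul]

omit [NeZero N] in
lemma sym0_permSpin (τ : Equiv.Perm (Fin N)) (s : Spin N κ) (x : Pos N) :
    sym0 (permSpin τ s) x = sym0 s x := by
  unfold sym0 symmetrize
  simp only [← permSpin_mul]
  exact congrArg _ (Equiv.sum_comp (Equiv.mulRight τ) fun σ => permSpin σ s)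

omit [NeZero N] in
lemma sym0_sum {ι : Type*} (t : Finset ι) (v : ι → Spin N κ) (x : Pos N) :
    sym0 (∑ k ∈ t, v k) x = ∑ k ∈ t, sym0 (v k) x := by
  unfold sym0 symmetrize
  simp only [permSpin_sum]
  rw [Finset.sum_comm, Finset.smul_sum]

omit [NeZero N] in
lemma sym0_smul (c : ℝ) (v : Spin N κ) (x : Pos N) : sym0 (c • v) x = c • sym0 v x := by
  unfold sym0 symmetrize
  simp only [permSpin_smul, ← Finset.smul_sum]
  rw [smul_comm]

/-- Some permutation maps the pair `(0, 1)` to `(k, l)`, and symmetrization is blind to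
permutations. It is built from the swap of `0` and `k` followed by the swap of the image of `1` with
`l`. -/
lemma sym0_spinTwo (hN : 2 ≤ N) (s : Spin N κ) {k l : Fin N} (h : k ≠ l) (x : Pos N) :
    sym0 (spinTwo s k l) x = sym0 (spinTwo s 0 1) x := by
  have h01 := fin_zero_ne_one hN
  have hk : k ≠ Equiv.swap 0 k 1 := by
    intro h'
    have : Equiv.swap 0 k 0 = Equiv.swap 0 k 1 := by rw [Equiv.swap_apply_left]; exact h'
    exact h01 ((Equiv.swap 0 k).injective this)
  have e := sym0_permSpin (Equiv.swap (Equiv.swap 0 k 1) l * Equiv.swap 0 k) (spinTwo s 0 1) x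
  rw [permSpin_spinTwo] at e
  simp only [Equiv.Perm.mul_apply, Equiv.swap_apply_left] at e
  rwa [Equiv.swap_apply_of_ne_of_ne hk h] at e

lemma fin_ne_add_one (hN : 2 ≤ N) (i : Fin N) : i ≠ i + 1 := by
  intro h
  have : (0 : Fin N) = 1 := by simpa using h
  exact fin_zero_ne_one hN this

/-- For `s ∈ Σ'`, the sum of `|s_{i,i+1}⟩` is proportional to `Λ|s⟩`. -/
lemma sum_spinTwo_of_mem (hN : 2 ≤ N) {s : Spin N κ} (hs : s ∈ SpinPrime N κ) (x : Pos N) :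
    ((N : ℝ) - 1) • ∑ i, spinTwo s i (i + 1) = (2 : ℝ) • sym0 s x := by
  -- Symmetrizing leaves both invariant vectors unchanged, while the `N` terms of the cyclic sum and
  -- the `N (N - 1)` off-diagonal terms of the double sum all become the same vector. This yields
  -- the ratio `2 / (N - 1)`.
  have h1 : sym0 (∑ i, spinTwo s i (i + 1)) x = ∑ i, spinTwo s i (i + 1) :=
    sym0_of_invariant _ x hs
  rw [sym0_sum, Finset.sum_congr rfl fun i _ => sym0_spinTwo hN s (fin_ne_add_one hN i) x,
    Finset.sum_const, Finset.card_univ, Fintype.card_fin] at h1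
  have h2 := sum_spinTwo hN s (fun _ => 1)
  simp only [mul_one, one_smul] at h2
  have h3 : sym11 s (fun _ => 1) = sym0 s x := by simp [sym11, sym0, symmetrize, Function.comp]
  have h4 : sym0 ((2 : ℝ) • sym0 s x) x = (2 : ℝ) • sym0 s x := by
    rw [sym0_smul, sym0_of_invariant _ x fun σ => permSpin_symmetrize_const σ s x]
  rw [h3] at h2
  rw [← h2, sym0_sum] at h4
  have h5 : ∀ i : Fin N, sym0 (∑ j, spinTwo s i j) x = ((N : ℝ) - 1) • sym0 (spinTwo s 0 1) x := by
    intro i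
    rw [← Finset.add_sum_erase _ _ (Finset.mem_univ i), spinTwo_self hN, zero_add, sym0_sum,
      Finset.sum_congr rfl fun j hj => sym0_spinTwo hN s (Finset.ne_of_mem_erase hj).symm x,
      Finset.sum_const, Finset.card_erase_of_mem (Finset.mem_univ i), Finset.card_univ,
      Fintype.card_fin, ← Nat.cast_smul_eq_nsmul ℝ, Nat.cast_sub (by omega), Nat.cast_one]
  simp only [h5] at h4
  rw [Finset.sum_const, Finset.card_univ, Fintype.card_fin] at h4
  rw [← h1, ← h2, ← h4, smul_comm]

end SpinStates

/-! ## Sums of functions of one coordinate -/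

section Spread

variable {E : Type*} [NormedAddCommGroup E] [NormedSpace ℝ E]

/-- `∑ φ(x_k - θ com x) v_k`. -/
noncomputable def spread (φ : ℝ → ℝ) (θ : ℝ) (v : Fin N → E) (x : Pos N) : E :=
  ∑ k, φ (x k - θ * com x) • v k

lemma contDiff_spread {φ : ℝ → ℝ} (hφ : ContDiff ℝ ∞ φ) (θ : ℝ) (v : Fin N → E) :
    ContDiff ℝ ∞ (spread φ θ v) := by
  unfold spread com
  fun_prop

lemma hasPD_spread {φ φ' : ℝ → ℝ} (hφ : ∀ t, HasDerivAt φ (φ' t) t) (θ : ℝ) (v : Fin N → E)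
    (i : Fin N) (x : Pos N) :
    HasPD i (spread φ θ v) (φ' (x i - θ * com x) • v i - (θ / N) • spread φ' θ v x) x := by
  have h := HasPD.sum (s := Finset.univ) fun k _ => HasPD.smul_const (HasPD.comp (hφ _)
    ((HasPD.coord (i := i) (x := x) k).sub ((hasPD_com i x).const_mul θ))) (v k)
  refine h.congr ?_
  simp only [mul_sub, sub_smul, Finset.sum_sub_distrib, mul_ite, mul_one, mul_zero, ite_smul,
    zero_smul, Finset.sum_ite_eq, Finset.mem_univ, if_true, spread, Finset.smul_sum, smul_smul]
  congr 1
  exact Finset.sum_congr rfl fun k _ => by congr 1; ring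

lemma pD_spread {φ φ' : ℝ → ℝ} (hφ : ∀ t, HasDerivAt φ (φ' t) t) (θ : ℝ) (v : Fin N → E)
    (i : Fin N) (x : Pos N) :
    pD i (spread φ θ v) x = φ' (x i - θ * com x) • v i - (θ / N) • spread φ' θ v x :=
  (hasPD_spread hφ θ v i x).eq

lemma pD_pD_spread {φ φ' φ'' : ℝ → ℝ} (hφ : ∀ t, HasDerivAt φ (φ' t) t)
    (hφ' : ∀ t, HasDerivAt φ' (φ'' t) t) (θ : ℝ) (v : Fin N → E) (i j : Fin N) (x : Pos N) :
    pD j (pD i (spread φ θ v)) x =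
      (((if j = i then 1 else 0) - θ / N) * φ'' (x i - θ * com x)) • v i
        - (θ / N) • (φ'' (x j - θ * com x) • v j - (θ / N) • spread φ'' θ v x) := by
  rw [pD_eq_of (hasPD_spread hφ θ v i)]
  have h := (HasPD.smul_const (HasPD.comp (hφ' _)
    ((HasPD.coord (i := j) (x := x) i).sub ((hasPD_com j x).const_mul θ))) (v i)).sub
    ((hasPD_spread hφ' θ v j x).const_smul (θ / N))
  rw [h.eq]
  congr 2
  ring

/-- The coefficient is `∑_i (δ_{ik} - θ / N)²`, which does not depend on `k`. The value `θ = 0`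
keeps the coordinates, and `θ = 1` makes them relative to the centre of mass. -/
lemma sum_pD_pD_spread [NeZero N] {φ φ' φ'' : ℝ → ℝ} (hφ : ∀ t, HasDerivAt φ (φ' t) t)
    (hφ' : ∀ t, HasDerivAt φ' (φ'' t) t) (θ : ℝ) (v : Fin N → E) (x : Pos N) :
    ∑ i, pD i (pD i (spread φ θ v)) x = (1 - 2 * θ / N + θ ^ 2 / N) • spread φ'' θ v x := by
  simp only [pD_pD_spread hφ hφ', if_true, mul_smul, Finset.sum_sub_distrib, ← Finset.smul_sum,
    Finset.sum_const, Finset.card_univ, Fintype.card_fin]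
  rw [← spread, ← Nat.cast_smul_eq_nsmul ℝ]
  have hN : (N : ℝ) ≠ 0 := natCast_ne_zero
  match_scalars
  field_simp
  ring

/-- Reindexing by the transposition moves it from the spin vectors to the coordinates, where only
the terms `i` and `j` are affected. -/
lemma spread_sub_exchange [NeZero N] {v : Fin N → Spin N κ}
    (hv : ∀ (σ : Equiv.Perm (Fin N)) k, permSpin σ (v k) = v (σ k)) (φ : ℝ → ℝ) (θ : ℝ)
    {i j : Fin N} (hij : i ≠ j) (x : Pos N) :
    spread φ θ v x - exchange i j (spread φ θ v x) =
      (φ (x i - θ * com x) - φ (x j - θ * com x)) • (v i - v j) := by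
  have e : exchange i j (spread φ θ v x) =
      ∑ k, φ (x (Equiv.swap i j k) - θ * com x) • v k := by
    unfold spread
    rw [exchange_sum]
    rw [← Equiv.sum_comp (Equiv.swap i j)]
    exact Finset.sum_congr rfl fun k _ => by
      rw [exchange_smul, exchange, hv, Equiv.swap_apply_self]
  rw [e, spread, ← Finset.sum_sub_distrib]
  simp only [← sub_smul]
  rw [← Finset.sum_subset (Finset.subset_univ {i, j})]
  · rw [Finset.sum_pair hij, Equiv.swap_apply_left, Equiv.swap_apply_right]
    module
  · intro k _ hk
    simp only [Finset.mem_insert, Finset.mem_singleton, not_or] at hk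
    rw [Equiv.swap_apply_of_ne_of_ne hk.1 hk.2, sub_self, zero_smul]

end Spread

end NearNeighbour
namespace NearNeighbour
open scoped ContDiff

variable {N κ : ℕ}

/-! ## Translation invariant nearest neighbour gauges -/

section Link

lemma HasPD.prod {ι : Type*} (s : Finset ι) {i : Fin N} {g : ι → Pos N → ℝ} {F : ι → ℝ} {x : Pos N}
    (h : ∀ k ∈ s, HasPD i (g k) (F k * g k x) x) :
    HasPD i (fun x => ∏ k ∈ s, g k x) ((∑ k ∈ s, F k) * ∏ k ∈ s, g k x) x := by
  classical
  induction s using Finset.induction_on with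
  | empty => simpa using HasPD.const (i := i) (x := x) (1 : ℝ)
  | insert k s hk ih =>
    simp only [Finset.prod_insert hk, Finset.sum_insert hk]
    refine ((h k (Finset.mem_insert_self k s)).mul
      (ih fun j hj => h j (Finset.mem_insert_of_mem hj))).congr ?_
    ring

/-- A function `ρ` on `{d | P d}` with logarithmic derivative `a ℓ`, where `ℓ` is odd and solves
the Riccati equation `ℓ' = -(K + ℓ²)`. -/
structure LinkFactor (P : ℝ → Prop) (K a : ℝ) (l ρ : ℝ → ℝ) : Prop where
  symm : ∀ d, P d → P (-d)
  odd : ∀ d, l (-d) = -l d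
  riccati : ∀ d, P d → HasDerivAt l (-(K + l d ^ 2)) d
  deriv : ∀ d, P d → HasDerivAt ρ (a * l d * ρ d) d
  smooth : ∀ d, P d → ContDiffAt ℝ ∞ ρ d
  pos : ∀ d, P d → 0 < ρ d

variable [NeZero N]

/-- Gradient of the logarithm of `∏ ρ (x_i - x_{i+1})`. -/
def linkF (a : ℝ) (l : ℝ → ℝ) (i : Fin N) (x : Pos N) : ℝ :=
  a * (l (x i - x (i + 1)) + l (x i - x (i - 1)))

/-- Weights of the spin exchange terms. -/
def linkW (a K : ℝ) (l : ℝ → ℝ) (i : Fin N) (x : Pos N) : ℝ :=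
  2 * a * (K + l (x i - x (i + 1)) ^ 2)

lemma sum_shift {E : Type*} [AddCommMonoid E] (g : Fin N → E) : ∑ i, g (i + 1) = ∑ i, g i :=
  Equiv.sum_comp (Equiv.addRight (1 : Fin N)) g

variable {P : ℝ → Prop} {K a : ℝ} {l ρ : ℝ → ℝ}

/-- Summation by parts around the cycle: since `ℓ` is odd, the link from `i` to `i + 1` pushes its
two ends with opposite signs. -/
lemma LinkFactor.sum_linkF (h : LinkFactor P K a l ρ) {E : Type*} [NormedAddCommGroup E]
    [NormedSpace ℝ E] (g : Fin N → E) (x : Pos N) :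
    ∑ i, linkF a l i x • g i = a • ∑ i, l (x i - x (i + 1)) • (g i - g (i + 1)) := by
  have e : ∑ i, l (x i - x (i - 1)) • g i = ∑ i, l (x (i + 1) - x i) • g (i + 1) := by
    rw [← sum_shift]
    simp
  have e' : ∀ i, l (x (i + 1) - x i) = -l (x i - x (i + 1)) := fun i => by
    rw [← h.odd, neg_sub]
  simp only [linkF, mul_add, add_smul, Finset.sum_add_distrib, mul_smul, ← Finset.smul_sum, e, e',
    smul_sub, Finset.sum_sub_distrib, neg_smul, Finset.sum_neg_distrib]
  module

lemma LinkFactor.sum_linkF_mul (h : LinkFactor P K a l ρ) (g : Fin N → ℝ) (x : Pos N) :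
    ∑ i, linkF a l i x * g i = a * ∑ i, l (x i - x (i + 1)) * (g i - g (i + 1)) :=
  h.sum_linkF g x

lemma LinkFactor.gaugedOp_eq (h : LinkFactor P K a l ρ) (f : Wave N κ) (x : Pos N) :
    gaugedOp (linkF a l) (linkW a K l) f x = ∑ i, pD i (pD i f) x +
      (2 * a) • ∑ i, (l (x i - x (i + 1)) • (pD i f x - pD (i + 1) f x)
        - (K + l (x i - x (i + 1)) ^ 2) • (f x - exchange i (i + 1) (f x))) := by
  rw [gaugedOp, h.sum_linkF]
  simp only [linkW, Finset.sum_sub_distrib, mul_smul, ← Finset.smul_sum]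
  module

lemma LinkFactor.scalarOp_eq (h : LinkFactor P K a l ρ) (f : Pos N → ℝ) (x : Pos N) :
    scalarOp (linkF a l) f x = ∑ i, pD i (pD i f) x +
      2 * a * ∑ i, l (x i - x (i + 1)) * (pD i f x - pD (i + 1) f x) := by
  rw [scalarOp, h.sum_linkF_mul]
  ring

/-- The condition `hψ` says that on a link the drift term and the exchange term of `φ`, each
singular, combine into a function of one endpoint. The sum over links then becomes a sum over
particles. Each particle belongs to two links, which turns `2 a` into `4 a`. -/
lemma LinkFactor.gaugedOp_spread (h : LinkFactor P K a l ρ) (hN : 2 ≤ N) {φ φ' φ'' ψ : ℝ → ℝ}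
    (hφ : ∀ t, HasDerivAt φ (φ' t) t) (hφ' : ∀ t, HasDerivAt φ' (φ'' t) t)
    (hψ : ∀ s t, P (s - t) → l (s - t) * φ' s - (K + l (s - t) ^ 2) * (φ s - φ t) = ψ s) (θ : ℝ)
    {v : Fin N → Spin N κ} (hv : ∀ (σ : Equiv.Perm (Fin N)) k, permSpin σ (v k) = v (σ k))
    {x : Pos N} (hx : ∀ i, P (x i - x (i + 1))) :
    gaugedOp (linkF a l) (linkW a K l) (spread φ θ v) x =
      (1 - 2 * θ / N + θ ^ 2 / N) • spread φ'' θ v x + (4 * a) • spread ψ θ v x := by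
  rw [h.gaugedOp_eq, sum_pD_pD_spread hφ hφ']
  have e : ∀ i, l (x i - x (i + 1)) • (pD i (spread φ θ v) x - pD (i + 1) (spread φ θ v) x)
      - (K + l (x i - x (i + 1)) ^ 2) •
        (spread φ θ v x - exchange i (i + 1) (spread φ θ v x)) =
      ψ (x i - θ * com x) • v i + ψ (x (i + 1) - θ * com x) • v (i + 1) := by
    intro i
    rw [spread_sub_exchange hv φ θ (fin_ne_add_one hN i), pD_spread hφ, pD_spread hφ]
    have e1 : (x i - θ * com x) - (x (i + 1) - θ * com x) = x i - x (i + 1) := by ring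
    have e2 : (x (i + 1) - θ * com x) - (x i - θ * com x) = -(x i - x (i + 1)) := by ring
    have h1 := hψ (x i - θ * com x) (x (i + 1) - θ * com x) (by rw [e1]; exact hx i)
    have h2 := hψ (x (i + 1) - θ * com x) (x i - θ * com x) (by rw [e2]; exact h.symm _ (hx i))
    rw [e1] at h1
    rw [e2, h.odd] at h2
    rw [← h1, ← h2]
    module
  simp only [e]
  rw [Finset.sum_add_distrib, sum_shift (fun i => ψ (x i - θ * com x) • v i), ← spread]
  module

lemma LinkFactor.scalarOp_spread (h : LinkFactor P K a l ρ) {φ φ' φ'' ψ : ℝ → ℝ}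
    (hφ : ∀ t, HasDerivAt φ (φ' t) t) (hφ' : ∀ t, HasDerivAt φ' (φ'' t) t)
    (hψ : ∀ s t, P (s - t) → l (s - t) * (φ' s - φ' t) = ψ s + ψ t) (θ : ℝ)
    {x : Pos N} (hx : ∀ i, P (x i - x (i + 1))) :
    scalarOp (linkF a l) (spread φ θ fun _ => (1 : ℝ)) x =
      (1 - 2 * θ / N + θ ^ 2 / N) * spread φ'' θ (fun _ => (1 : ℝ)) x
        + 4 * a * spread ψ θ (fun _ => (1 : ℝ)) x := by
  rw [h.scalarOp_eq, sum_pD_pD_spread hφ hφ']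
  have e : ∀ i, l (x i - x (i + 1)) * (pD i (spread φ θ fun _ => (1 : ℝ)) x
      - pD (i + 1) (spread φ θ fun _ => (1 : ℝ)) x) =
      ψ (x i - θ * com x) • (1 : ℝ) + ψ (x (i + 1) - θ * com x) • (1 : ℝ) := by
    intro i
    rw [pD_spread hφ, pD_spread hφ]
    have e1 : (x i - θ * com x) - (x (i + 1) - θ * com x) = x i - x (i + 1) := by ring
    have h1 := hψ (x i - θ * com x) (x (i + 1) - θ * com x) (by rw [e1]; exact hx i)
    rw [e1] at h1
    simp only [smul_eq_mul, mul_one]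
    rw [← h1]
    ring
  simp only [e]
  rw [Finset.sum_add_distrib, sum_shift (fun i => ψ (x i - θ * com x) • (1 : ℝ)), ← spread,
    smul_eq_mul]
  ring

lemma LinkFactor.sum_linkF_eq_zero (h : LinkFactor P K a l ρ) (x : Pos N) :
    ∑ i, linkF a l i x = 0 := by
  have := h.sum_linkF_mul (fun _ => 1) x
  simpa using this

/-- The gauge `exp (-om r² / 2) ∏ ρ (x_i - x_{i+1})`. -/
theorem LinkFactor.gauge (h : LinkFactor P K a l ρ) (hN : 2 ≤ N) (ha : 0 < a) (hK : 0 ≤ K)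
    {C : Set (Pos N)} (hC : IsOpen C) (hP : ∀ x ∈ C, ∀ i, P (x i - x (i + 1))) {om : ℝ}
    (hom : ∀ d, P d → om * (l d * d) = om) {V : Pos N → Spin N κ → Spin N κ}
    (hV : ∀ x ∈ C, ∀ v, V x v =
      (om ^ 2 * psum 2 x + 2 * a ^ 2 * ∑ i, l (x i - x (i - 1)) * l (x i - x (i + 1))) • v
      + ∑ i, (2 * a * (K + l (x i - x (i + 1)) ^ 2)) • (a • v - exchange i (i + 1) v)) :
    Gauge C V (fun x => Real.exp (-(om / 2) * psum 2 x) * ∏ i, ρ (x i - x (i + 1)))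
      (fun x => om ^ 2 * psum 2 x + 2 * a ^ 2 * ∑ i, l (x i - x (i - 1)) * l (x i - x (i + 1))
        + ∑ i, 2 * a * (a - 1) * (K + l (x i - x (i + 1)) ^ 2))
      (fun i x => linkF a l i x - om * x i)
      (fun i x => -(a * (2 * K + l (x i - x (i + 1)) ^ 2 + l (x i - x (i - 1)) ^ 2)) - om)
      (linkW a K l) (2 * a ^ 2 * N * K + N * om * (2 * a + 1)) := by
  have hP' : ∀ x ∈ C, ∀ i, P (x i - x (i - 1)) := fun x hx i => by
    have := h.symm _ (hP x hx (i - 1))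
    rwa [neg_sub, sub_add_cancel] at this
  have hl : ∀ i, ContinuousOn (fun x : Pos N => l (x i - x (i + 1))) C := fun i x hx =>
    (ContinuousAt.comp (f := fun x : Pos N => x i - x (i + 1)) (h.riccati _ (hP x hx i)).continuousAt
      (by fun_prop)).continuousWithinAt
  have hl' : ∀ i, ContinuousOn (fun x : Pos N => l (x i - x (i - 1))) C := fun i x hx =>
    (ContinuousAt.comp (f := fun x : Pos N => x i - x (i - 1))
      (h.riccati _ (hP' x hx i)).continuousAt (by fun_prop)).continuousWithinAt
  have hodd : ∀ (x : Pos N) i, l (x (i + 1) - x i) = -l (x i - x (i + 1)) := fun x i => by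
    rw [← h.odd, neg_sub]
  refine ⟨hC, fun x hx => mul_pos (Real.exp_pos _) (Finset.prod_pos fun i _ => h.pos _ (hP x hx i)),
    ?_, ?_, ?_, ?_, ?_, ?_, ?_, ?_⟩
  · refine ContDiffOn.mul ((contDiff_const.mul (contDiff_psum 2)).exp).contDiffOn ?_
    refine contDiffOn_prod fun i _ x hx => ?_
    exact ((h.smooth _ (hP x hx i)).comp x (f := fun x : Pos N => x i - x (i + 1))
      (by fun_prop)).contDiffWithinAt
  · intro x hx i
    have h1 := ((hasPD_psum 2 i x).const_mul (-(om / 2))).exp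
    have h2 := HasPD.prod (s := Finset.univ) (i := i) (x := x)
      (g := fun k (x : Pos N) => ρ (x k - x (k + 1)))
      (F := fun k => a * l (x k - x (k + 1)) * ((if i = k then 1 else 0) - if i = k + 1 then 1 else 0))
      fun k _ => (HasPD.comp (h.deriv _ (hP x hx k)) ((HasPD.coord k).sub (HasPD.coord (k + 1)))).congr
        (by ring)
    refine (h1.mul h2).congr ?_
    have e1 : ∑ k, a * l (x k - x (k + 1)) *
        ((if i = k then 1 else 0) - if i = k + 1 then 1 else 0) = linkF a l i x := by
      have e2 : ∀ k, (i = k + 1) = (i - 1 = k) := fun k => by rw [sub_eq_iff_eq_add]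
      simp only [mul_sub, Finset.sum_sub_distrib, mul_ite, mul_one, mul_zero, Finset.sum_ite_eq,
        Finset.mem_univ, if_true, e2]
      have := hodd x (i - 1)
      rw [sub_add_cancel] at this
      rw [sub_add_cancel, linkF, this]
      ring
    rw [e1]
    norm_num
    ring
  · intro x hx i
    have h1 := HasPD.comp (h.riccati _ (hP x hx i)) ((HasPD.coord (i := i) (x := x) i).sub
      (HasPD.coord (i + 1)))
    have h2 := HasPD.comp (h.riccati _ (hP' x hx i)) ((HasPD.coord (i := i) (x := x) i).sub
      (HasPD.coord (i - 1)))
    have h3 := ((h1.add h2).const_mul a).sub ((HasPD.coord (i := i) (x := x) i).const_mul om)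
    refine h3.congr ?_
    have n1 : i ≠ i + 1 := fin_ne_add_one hN i
    have n2 : i ≠ i - 1 := fun h' => fin_ne_add_one hN (i - 1) (by rw [sub_add_cancel]; exact h'.symm)
    rw [if_pos rfl, if_neg n1, if_neg n2]
    ring
  · intro i
    exact (continuousOn_const.mul ((continuousOn_const.add ((hl i).pow 2)).add
      ((hl' i).pow 2))).neg.sub continuousOn_const
  · intro i
    exact continuousOn_const.mul (continuousOn_const.add ((hl i).pow 2))
  · intro x hx i
    unfold linkW
    positivity
  · intro x hx v
    have e : ∀ i, (2 * a * (K + l (x i - x (i + 1)) ^ 2)) • (a • v - exchange i (i + 1) v) =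
        (2 * a * (a - 1) * (K + l (x i - x (i + 1)) ^ 2)) • v
          + linkW a K l i x • (v - exchange i (i + 1) v) := fun i => by
      rw [linkW]; module
    rw [hV x hx]
    simp only [e]
    rw [Finset.sum_add_distrib, ← Finset.sum_smul]
    module
  · intro x hx
    have e1 : ∑ i, linkF a l i x * x i = a * ∑ i, l (x i - x (i + 1)) * (x i - x (i + 1)) :=
      h.sum_linkF_mul x x
    -- By `hom`, either `ℓ d · d = 1` on all links or there is no confinement; in both cases the
    -- cross term between the drift and the confinement is constant. The squares of `ℓ` carry the
    -- coefficient `a² - a` of `U`, so only constants remain for the energy.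
    have e2 : om * ∑ i, l (x i - x (i + 1)) * (x i - x (i + 1)) = N * om := by
      rw [Finset.mul_sum, Finset.sum_congr rfl fun i _ => hom _ (hP x hx i)]
      simp
    have e3 : ∑ i, l (x i - x (i - 1)) ^ 2 = ∑ i, l (x i - x (i + 1)) ^ 2 := by
      rw [← sum_shift]
      exact Finset.sum_congr rfl fun i _ => by rw [add_sub_cancel_right, hodd, neg_sq]
    have e4 : ∀ i, -(a * (2 * K + l (x i - x (i + 1)) ^ 2 + l (x i - x (i - 1)) ^ 2)) - om
        + (linkF a l i x - om * x i) ^ 2 =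
        -(2 * a * K + om) + (a ^ 2 - a) * l (x i - x (i + 1)) ^ 2
          + (a ^ 2 - a) * l (x i - x (i - 1)) ^ 2
          + 2 * a ^ 2 * (l (x i - x (i - 1)) * l (x i - x (i + 1)))
          - 2 * om * (linkF a l i x * x i) + om ^ 2 * x i ^ 2 := fun i => by
      rw [linkF]; ring
    simp only [e4]
    simp only [Finset.sum_add_distrib, Finset.sum_sub_distrib, ← Finset.mul_sum, e1, e3,
      Finset.sum_const, Finset.card_univ, Fintype.card_fin, nsmul_eq_mul]
    have e5 : ∑ i, x i ^ 2 = psum 2 x := rfl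
    rw [e5]
    linear_combination (-2 * a) * e2

end Link

end NearNeighbour
namespace NearNeighbour
open scoped ContDiff
open MeasureTheory

variable {N κ : ℕ}

/-! ## Gaussian decay -/

section Decay

lemma sq_norm_le_psum (x : Pos N) : ‖x‖ ^ 2 ≤ psum 2 x := by
  have h0 : 0 ≤ psum 2 x := Finset.sum_nonneg fun i _ => sq_nonneg _
  have h : ‖x‖ ≤ √(psum 2 x) := (pi_norm_le_iff_of_nonneg (Real.sqrt_nonneg _)).mpr fun i =>
    abs_coord_le (Real.sqrt_nonneg _) (by rw [Real.sq_sqrt h0]) i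
  calc ‖x‖ ^ 2 ≤ √(psum 2 x) ^ 2 := by gcongr
    _ = psum 2 x := Real.sq_sqrt h0

lemma exists_pow_mul_exp_le {c : ℝ} (hc : 0 < c) (k : ℕ) :
    ∃ B, 0 < B ∧ ∀ x : Pos N, (1 + ‖x‖) ^ k * Real.exp (-c * psum 2 x) ≤ B := by
  refine ⟨2 ^ k * k.factorial / c ^ k * Real.exp c, by positivity, fun x => ?_⟩
  have h1 : (1 + ‖x‖) ^ k ≤ (2 * (1 + psum 2 x)) ^ k := by
    gcongr
    nlinarith [sq_norm_le_psum x, sq_nonneg (‖x‖ - 1), norm_nonneg x]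
  have h0 : 0 ≤ psum 2 x := (sq_nonneg _).trans (sq_norm_le_psum x)
  have h2 := Real.pow_div_factorial_le_exp (c * (1 + psum 2 x)) (by positivity) k
  have h3 : (2 * (1 + psum 2 x)) ^ k ≤
      2 ^ k * k.factorial / c ^ k * Real.exp (c * (1 + psum 2 x)) := by
    rw [div_le_iff₀ (by positivity), mul_pow] at h2
    rw [mul_pow, mul_div_assoc, mul_assoc]
    gcongr
    rw [div_mul_eq_mul_div, le_div_iff₀ (by positivity)]
    linarith
  calc (1 + ‖x‖) ^ k * Real.exp (-c * psum 2 x)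
      ≤ 2 ^ k * k.factorial / c ^ k * Real.exp (c * (1 + psum 2 x)) * Real.exp (-c * psum 2 x) := by
        gcongr
        exact h1.trans h3
    _ = 2 ^ k * k.factorial / c ^ k * Real.exp c := by
        rw [mul_assoc, ← Real.exp_add]
        congr 2
        ring

lemma integrable_exp_psum {c : ℝ} (hc : 0 < c) :
    Integrable fun x : Pos N => Real.exp (-c * psum 2 x) := by
  have h := Integrable.fintype_prod (ι := Fin N) (μ := fun _ => (volume : Measure ℝ))
    (f := fun _ t => Real.exp (-c * t ^ 2)) fun _ => integrable_exp_neg_mul_sq hc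
  refine h.congr (Filter.Eventually.of_forall fun x => ?_)
  simp only [← Real.exp_sum, psum, Finset.mul_sum]

lemma memLp_of_gaussian_bound {C : Set (Pos N)} (hC : MeasurableSet C) {Ψ : Wave N κ}
    (hΨ : ContinuousOn Ψ C) {c A : ℝ} (hc : 0 < c) {k : ℕ}
    (hb : ∀ x ∈ C, ‖Ψ x‖ ≤ A * (1 + ‖x‖) ^ k * Real.exp (-c * psum 2 x)) :
    MemLp Ψ 2 (volume.restrict C) := by
  obtain ⟨B, hB, hB'⟩ := exists_pow_mul_exp_le (N := N) (half_pos hc) k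
  have h1 : MemLp (fun x : Pos N => |A| * B * Real.exp (-(c / 2) * psum 2 x)) 2
      (volume.restrict C) := by
    refine MemLp.const_mul ?_ _
    have hm : Continuous fun x : Pos N => Real.exp (-(c / 2) * psum 2 x) :=
      (continuous_const.mul (contDiff_psum 2).continuous).rexp
    rw [memLp_two_iff_integrable_sq hm.aestronglyMeasurable]
    have h2 := (integrable_exp_psum (N := N) hc).restrict (s := C)
    refine h2.congr (Filter.Eventually.of_forall fun x => ?_)
    simp only [← Real.exp_nat_mul]
    congr 1
    push_cast
    ring
  refine h1.of_le (hΨ.aestronglyMeasurable hC) ?_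
  refine (ae_restrict_iff' hC).mpr (Filter.Eventually.of_forall fun x hx => (hb x hx).trans ?_)
  rw [Real.norm_of_nonneg (by positivity)]
  calc A * (1 + ‖x‖) ^ k * Real.exp (-c * psum 2 x)
      ≤ |A| * (1 + ‖x‖) ^ k * Real.exp (-c * psum 2 x) := by gcongr; exact le_abs_self A
    _ = |A| * ((1 + ‖x‖) ^ k * Real.exp (-(c / 2) * psum 2 x)) * Real.exp (-(c / 2) * psum 2 x) := by
        rw [mul_assoc, mul_assoc, mul_assoc, ← Real.exp_add]
        congr 3
        ring
    _ ≤ |A| * B * Real.exp (-(c / 2) * psum 2 x) := by gcongr; exact hB' x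

/-- A gauge factor with Gaussian decay makes functions of temperate growth square integrable. -/
lemma memLp_gauge_smul {C : Set (Pos N)} (hC : IsOpen C) {μ : Pos N → ℝ} (hμ : ContinuousOn μ C)
    {c A : ℝ} (hc : 0 < c) {k : ℕ}
    (hb : ∀ x ∈ C, |μ x| ≤ A * (1 + ‖x‖) ^ k * Real.exp (-c * psum 2 x))
    {f : Wave N κ} (hf : Function.HasTemperateGrowth f) :
    MemLp (fun x => μ x • f x) 2 (volume.restrict C) := by
  obtain ⟨j, B, hB⟩ := hf.2 0
  refine memLp_of_gaussian_bound hC.measurableSet (hμ.smul hf.1.continuous.continuousOn) hc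
    (A := |A| * |B|) (k := k + j) fun x hx => ?_
  have h1 := hB x
  rw [norm_iteratedFDeriv_zero] at h1
  rw [norm_smul, Real.norm_eq_abs]
  calc |μ x| * ‖f x‖ ≤ (|A| * (1 + ‖x‖) ^ k * Real.exp (-c * psum 2 x)) * (|B| * (1 + ‖x‖) ^ j) := by
        gcongr
        · refine (hb x hx).trans ?_
          gcongr
          exact le_abs_self A
        · refine h1.trans ?_
          gcongr
          exact le_abs_self B
    _ = |A| * |B| * (1 + ‖x‖) ^ (k + j) * Real.exp (-c * psum 2 x) := by rw [pow_add]; ring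

lemma prod_le_mul_pow {ι : Type*} [DecidableEq ι] {s : Finset ι} {g : ι → ℝ} {L m : ℝ}
    (h0 : ∀ k ∈ s, 0 ≤ g k) (hL : ∀ k ∈ s, g k ≤ L) {k : ι} (hk : k ∈ s) (hm : g k ≤ m) :
    ∏ k ∈ s, g k ≤ m * L ^ (s.card - 1) := by
  rw [← Finset.mul_prod_erase s g hk, ← Finset.card_erase_of_mem hk]
  have h1 : 0 ≤ ∏ k ∈ s.erase k, g k :=
    Finset.prod_nonneg fun j hj => h0 j (Finset.mem_of_mem_erase hj)
  refine mul_le_mul hm ?_ h1 ((h0 k hk).trans hm)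
  exact (Finset.prod_le_prod (fun j hj => h0 j (Finset.mem_of_mem_erase hj))
    fun j hj => hL j (Finset.mem_of_mem_erase hj)).trans_eq (Finset.prod_const _)

lemma rpow_le_growth {a t : ℝ} {x : Pos N} (ha : 0 ≤ a) (h0 : 0 ≤ t) (h : t ≤ 2 * (1 + ‖x‖)) :
    t ^ a ≤ (2 * (1 + ‖x‖)) ^ ⌈a⌉₊ := by
  have h1 : (1 : ℝ) ≤ 2 * (1 + ‖x‖) := by linarith [norm_nonneg x]
  calc t ^ a ≤ (2 * (1 + ‖x‖)) ^ a := Real.rpow_le_rpow h0 h ha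
    _ ≤ (2 * (1 + ‖x‖)) ^ (⌈a⌉₊ : ℝ) := Real.rpow_le_rpow_of_exponent_le h1 (Nat.le_ceil a)
    _ = _ := Real.rpow_natCast _ _

lemma norm_le_sqrt_of_psum_le {x : Pos N} {R : ℝ} (h : psum 2 x ≤ R) : ‖x‖ ≤ √R :=
  Real.le_sqrt_of_sq_le ((sq_norm_le_psum x).trans h)

end Decay

/-! ## The rational model: ground state -/

section RationalGauge

lemma mem_C0_iff (x : Pos N) :
    x ∈ C0 N ↔ ∀ p : {p : Fin N × Fin N // p.1 < p.2}, 0 < x p.1.2 - x p.1.1 :=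
  ⟨fun h p => sub_pos.mpr (h p.2), fun h i j hij => sub_pos.mp (h ⟨(i, j), hij⟩)⟩

lemma isWall_sub {i j : Fin N} (h : i ≠ j) (c : ℝ) : IsWall fun x : Pos N => x j - x i + c :=
  ⟨i, j, h, -1, c, by norm_num, fun x => by ring⟩

lemma isOpen_C0 : IsOpen (C0 N) := by
  have : C0 N = ⋂ p : {p : Fin N × Fin N // p.1 < p.2}, {x | 0 < x p.1.2 - x p.1.1} := by
    ext x
    rw [mem_C0_iff, Set.mem_iInter]
    rfl
  rw [this]
  exact isOpen_iInter_of_finite fun p => isOpen_lt continuous_const (by fun_prop)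

lemma C0_nonempty : (C0 N).Nonempty :=
  ⟨fun i => (i : ℝ), fun i j h => by simpa using h⟩

lemma linkFactor_rational (a : ℝ) :
    LinkFactor (fun d => d ≠ 0) 0 a (fun d => d⁻¹) fun d => |d| ^ a where
  symm d hd := neg_ne_zero.mpr hd
  odd d := inv_neg
  riccati d hd := (hasDerivAt_inv hd).congr_deriv (by rw [zero_add, inv_pow])
  deriv d hd := by
    refine ((hasDerivAt_abs hd).rpow_const (p := a) (Or.inl (abs_ne_zero.mpr hd))).congr_deriv ?_
    rw [Real.rpow_sub_one (abs_ne_zero.mpr hd)]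
    rcases lt_or_gt_of_ne hd with h | h
    · rw [abs_of_neg h, sign_neg h]
      field_simp
      norm_num
    · rw [abs_of_pos h, sign_pos h]
      field_simp
      norm_num
  smooth d hd := (contDiffAt_abs hd).rpow_const_of_ne (abs_ne_zero.mpr hd)
  pos d hd := Real.rpow_pos_of_pos (abs_pos.mpr hd) a

variable [NeZero N]

lemma fin_add_one_of_lt {i j : Fin N} (h : i < j) : i < i + 1 ∧ i + 1 ≤ j := by
  have h1 : ((i + 1 : Fin N) : ℕ) = i + 1 := by
    rw [Fin.val_add, Fin.val_one', Nat.add_mod_mod, Nat.mod_eq_of_lt (by omega)]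
  rw [Fin.lt_def, Fin.le_def, h1]
  omega

lemma link_ne_zero (hN : 2 ≤ N) {x : Pos N} (hx : x ∈ C0 N) (i : Fin N) : x i - x (i + 1) ≠ 0 :=
  sub_ne_zero.mpr fun h => fin_ne_add_one hN i (hx.injective h)

lemma gauge0_isGauge (hN : 2 ≤ N) {a om : ℝ} (ha : 0 < a) :
    Gauge (κ := κ) (C0 N) (V0 om a) (gauge0 om a)
      (fun x => om ^ 2 * psum 2 x + 2 * a ^ 2 * ∑ i, (x i - x (i - 1))⁻¹ * (x i - x (i + 1))⁻¹
        + ∑ i, 2 * a * (a - 1) * (0 + (x i - x (i + 1))⁻¹ ^ 2))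
      (fun i x => linkF a (fun d => d⁻¹) i x - om * x i)
      (fun i x => -(a * (2 * 0 + (x i - x (i + 1))⁻¹ ^ 2 + (x i - x (i - 1))⁻¹ ^ 2)) - om)
      (linkW a 0 fun d => d⁻¹) (ground0 N om a) := by
  have h := (linkFactor_rational a).gauge (κ := κ) hN ha le_rfl (isOpen_C0 (N := N))
    (fun x hx i => link_ne_zero hN hx i) (om := om) (fun d hd => by field_simp)
    (V := V0 om a) (fun x hx v => by
      rw [V0]
      congr 2
      · rw [Finset.mul_sum]
        congr 1
        exact Finset.sum_congr rfl fun i _ => by rw [← mul_inv, div_eq_mul_inv]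
      · funext i
        rw [zero_add, inv_pow, div_eq_mul_inv])
  rw [show 2 * a ^ 2 * N * 0 + N * om * (2 * a + 1) = ground0 N om a by rw [ground0]; ring] at h
  exact h

lemma gauge0_factor_le {a : ℝ} (ha : 0 ≤ a) (x : Pos N) (i : Fin N) :
    |x i - x (i + 1)| ^ a ≤ (2 * (1 + ‖x‖)) ^ ⌈a⌉₊ := by
  refine rpow_le_growth ha (abs_nonneg _) ?_
  have h1 := norm_le_pi_norm x i
  have h2 := norm_le_pi_norm x (i + 1)
  rw [Real.norm_eq_abs] at h1 h2
  linarith [abs_sub (x i) (x (i + 1))]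

lemma abs_gauge0_le {a om : ℝ} (ha : 0 ≤ a) (x : Pos N) :
    |gauge0 om a x| ≤ 2 ^ (⌈a⌉₊ * N) * (1 + ‖x‖) ^ (⌈a⌉₊ * N) * Real.exp (-(om / 2) * psum 2 x) := by
  have h0 : 0 ≤ ∏ i, |x i - x (i + 1)| ^ a :=
    Finset.prod_nonneg fun i _ => Real.rpow_nonneg (abs_nonneg _) _
  rw [gauge0, abs_of_nonneg (mul_nonneg (Real.exp_pos _).le h0), mul_comm, ← mul_pow, pow_mul]
  gcongr
  have := Finset.prod_le_prod (s := Finset.univ)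
    (fun i _ => Real.rpow_nonneg (abs_nonneg (x i - x (i + 1))) a)
    fun i _ => gauge0_factor_le ha x i
  rwa [Finset.prod_const, Finset.card_univ, Fintype.card_fin] at this

theorem isGroundStateEnergy_H0 (hN : 2 ≤ N) {a om : ℝ} (ha : 1 / 2 < a) (hom : 0 < om) :
    IsGroundStateEnergy (H0 om a : Wave N κ → Wave N κ) (C0 N) (ground0 N om a) := by
  have ha0 : 0 ≤ a := by linarith
  obtain ⟨B, hB, hB'⟩ := exists_pow_mul_exp_le (N := N) (half_pos hom) (⌈a⌉₊ * N)
  refine (gauge0_isGauge (κ := κ) hN (by linarith : 0 < a)).isGroundStateEnergy C0_nonempty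
    (d := fun (p : {p : Fin N × Fin N // p.1 < p.2}) x => x p.1.2 - x p.1.1)
    (fun p => by simpa using isWall_sub p.2.ne 0) mem_C0_iff
    (B := 2 ^ (⌈a⌉₊ * N) * B) (fun x _ => (le_abs_self _).trans ((abs_gauge0_le ha0 x).trans ?_))
    (e := fun _ => a) (fun _ => ha) fun R => ?_
  · rw [mul_assoc]
    gcongr
    exact hB' x
  · refine ⟨((2 * (1 + √R)) ^ ⌈a⌉₊) ^ (N - 1), fun x hx hR p => ?_⟩
    obtain ⟨⟨i, j⟩, hij⟩ := p
    have h0 : 0 ≤ psum 2 x := (sq_nonneg _).trans (sq_norm_le_psum x)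
    -- The gap between `i` and `j` is at least the gap between `i` and its right neighbour, so a
    -- single factor of the product supplies `d ^ a`; the other factors are bounded on the ball.
    have hk : |x i - x (i + 1)| ^ a ≤ (x j - x i) ^ a := by
      refine Real.rpow_le_rpow (abs_nonneg _) ?_ ha0
      obtain ⟨hi', hi⟩ := fin_add_one_of_lt hij
      rw [abs_sub_comm, abs_of_pos (sub_pos.mpr (hx hi'))]
      linarith [hx.monotone hi]
    have hp := prod_le_mul_pow (s := Finset.univ) (g := fun i => |x i - x (i + 1)| ^ a)
      (fun i _ => Real.rpow_nonneg (abs_nonneg _) _) (fun i _ => gauge0_factor_le ha0 x i)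
      (Finset.mem_univ i) hk
    rw [Finset.card_univ, Fintype.card_fin] at hp
    have hd : 0 ≤ (x j - x i) ^ a := Real.rpow_nonneg (sub_pos.mpr (hx hij)).le _
    calc gauge0 om a x ≤ 1 * ∏ i, |x i - x (i + 1)| ^ a := by
          rw [gauge0]
          gcongr
          exact Real.exp_le_one_iff.mpr (by nlinarith)
      _ ≤ (x j - x i) ^ a * ((2 * (1 + ‖x‖)) ^ ⌈a⌉₊) ^ (N - 1) := by rw [one_mul]; exact hp
      _ ≤ ((2 * (1 + √R)) ^ ⌈a⌉₊) ^ (N - 1) * (x j - x i) ^ a := by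
          rw [mul_comm]
          gcongr
          exact norm_le_sqrt_of_psum_le hR

end RationalGauge

end NearNeighbour
namespace NearNeighbour
open scoped ContDiff

variable {N κ : ℕ}

/-! ## Homogeneous functions -/

section Homogeneous

variable {E : Type*} [NormedAddCommGroup E] [NormedSpace ℝ E]

lemma fderiv_eq_sum_pD (f : Pos N → E) (x v : Pos N) : fderiv ℝ f x v = ∑ i, v i • pD i f x := by
  conv_lhs => rw [pi_eq_sum_univ' v, map_sum]
  refine Finset.sum_congr rfl fun i _ => ?_
  rw [map_smul, pD]

/-- Functions of temperate growth, homogeneous of degree `d`. -/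
structure Homog (f : Pos N → E) (d : ℕ) : Prop where
  temperate : Function.HasTemperateGrowth f
  hom : ∀ (t : ℝ) x, f (fun i => t * x i) = t ^ d • f x

/-- Invariance under translations of all particles. -/
def Invariant (f : Pos N → E) : Prop := ∀ (c : ℝ) x, f (fun i => x i + c) = f x

/-- Differentiate `f (t x) = t ^ d f x` at `t = 1`. -/
lemma Homog.euler {f : Pos N → E} {d : ℕ} (h : Homog f d) (x : Pos N) :
    ∑ i, x i • pD i f x = (d : ℝ) • f x := by
  rw [← fderiv_eq_sum_pD]
  have h1 : HasDerivAt (fun t : ℝ => fun i => t * x i) x 1 :=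
    hasDerivAt_pi.mpr fun i => (hasDerivAt_mul_const (x i))
  have e1 : (fun i => (1 : ℝ) * x i) = x := by simp
  have h2 : HasFDerivAt f (fderiv ℝ f x) (fun i => (1 : ℝ) * x i) := by
    rw [e1]; exact (h.temperate.1.differentiable (by simp) x).hasFDerivAt
  have h3 := h2.comp_hasDerivAt (1 : ℝ) h1
  have h4 : HasDerivAt (fun t : ℝ => t ^ d • f x) (((d : ℝ) * 1 ^ (d - 1)) • f x) (1 : ℝ) :=
    (hasDerivAt_pow d (1 : ℝ)).smul_const (f x)
  have e2 : (f ∘ fun t : ℝ => fun i => t * x i) = fun t => t ^ d • f x := funext fun t => h.hom t x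
  rw [e2] at h3
  simpa using h3.unique h4

lemma Invariant.sum_pD {f : Pos N → E} (hf : ContDiff ℝ ∞ f) (h : Invariant f) (x : Pos N) :
    ∑ i, pD i f x = 0 := by
  have e := fderiv_eq_sum_pD f x fun _ => 1
  simp only [one_smul] at e
  rw [← e]
  have h1 : HasDerivAt (fun t : ℝ => fun i => x i + t) (fun _ => (1 : ℝ)) 0 :=
    hasDerivAt_pi.mpr fun i => (hasDerivAt_id (0 : ℝ)).const_add (x i)
  have e1 : (fun i => x i + 0) = x := by simp
  have h2 : HasFDerivAt f (fderiv ℝ f x) (fun i => x i + 0) := by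
    rw [e1]; exact (hf.differentiable (by simp) x).hasFDerivAt
  have h3 := h2.comp_hasDerivAt (0 : ℝ) h1
  have e2 : (f ∘ fun t : ℝ => fun i => x i + t) = fun _ => f x := funext fun t => h t x
  rw [e2] at h3
  exact h3.unique (hasDerivAt_const _ _)

lemma Homog.add {f g : Pos N → E} {d : ℕ} (hf : Homog f d) (hg : Homog g d) :
    Homog (fun x => f x + g x) d :=
  ⟨hf.temperate.fun_add hg.temperate, fun t x => by rw [hf.hom, hg.hom, smul_add]⟩

lemma Homog.smul {A : Pos N → ℝ} {f : Pos N → E} {p q : ℕ} (hA : Homog A p) (hf : Homog f q) :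
    Homog (fun x => A x • f x) (p + q) :=
  ⟨hA.temperate.fun_smul hf.temperate, fun t x => by
    rw [hA.hom, hf.hom, pow_add, smul_eq_mul]; module⟩

lemma Homog.const (c : E) : Homog (fun _ : Pos N => c) 0 := ⟨.const c, fun t x => by simp⟩

lemma Homog.const_smul (c : ℝ) {f : Pos N → E} {q : ℕ} (hf : Homog f q) :
    Homog (fun x => c • f x) q := by
  have h := (Homog.const (N := N) c).smul hf
  rwa [zero_add] at h

lemma temperate_coord (i : Fin N) : Function.HasTemperateGrowth fun x : Pos N => x i :=
  (ContinuousLinearMap.proj (R := ℝ) (φ := fun _ : Fin N => ℝ) i).hasTemperateGrowth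

lemma temperate_com : Function.HasTemperateGrowth (com : Pos N → ℝ) := by
  have h : Function.HasTemperateGrowth fun x : Pos N => ∑ i, x i :=
    .sum fun i _ => temperate_coord i
  have e : (com : Pos N → ℝ) = fun x => (∑ i, x i) * (N : ℝ)⁻¹ := rfl
  rw [e]
  exact h.fun_mul (.const _)

lemma temperate_psum (k : ℕ) : Function.HasTemperateGrowth (psum k : Pos N → ℝ) := by
  unfold psum
  exact .sum fun i _ => (temperate_coord i).fun_pow k

lemma com_mul (t : ℝ) (x : Pos N) : com (fun i => t * x i) = t * com x := by
  rw [com, com, ← Finset.mul_sum, mul_div_assoc]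

lemma psum_mul (k : ℕ) (t : ℝ) (x : Pos N) : psum k (fun i => t * x i) = t ^ k * psum k x := by
  simp only [psum, mul_pow, Finset.mul_sum]

lemma homog_psum (k : ℕ) : Homog (psum k : Pos N → ℝ) k :=
  ⟨temperate_psum k, fun t x => by rw [psum_mul, smul_eq_mul]⟩

lemma homog_dispersion : Homog (dispersion : Pos N → ℝ) 2 := by
  refine ⟨?_, fun t x => ?_⟩
  · have e : (dispersion : Pos N → ℝ) = fun x => psum 2 x * (N : ℝ)⁻¹ - com x ^ 2 := rfl
    rw [e]
    exact ((temperate_psum 2).fun_mul (.const _)).fun_sub (temperate_com.fun_pow 2)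
  · rw [dispersion, dispersion, psum_mul, com_mul, smul_eq_mul]
    ring

lemma homog_spread (n : ℕ) (θ : ℝ) (v : Fin N → E) : Homog (spread (fun t => t ^ n) θ v) n := by
  refine ⟨?_, fun t x => ?_⟩
  · unfold spread
    exact .sum fun i _ => (((temperate_coord i).fun_sub
      ((Function.HasTemperateGrowth.const θ).fun_mul temperate_com)).fun_pow n).fun_smul (.const _)
  · simp only [spread, com_mul, Finset.smul_sum, smul_smul, ← mul_pow]
    exact Finset.sum_congr rfl fun k _ => by congr 2; ring

lemma temperate_ladder (e : ℕ) (A : ℝ) : Function.HasTemperateGrowth (ladder e A : Pos N → ℝ) := by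
  unfold ladder
  exact .sum fun k _ => (Function.HasTemperateGrowth.const _).fun_mul
    ((temperate_com.fun_pow _).fun_mul (homog_dispersion.temperate.fun_pow _))

lemma temperate_laguerre (l : ℕ) (lam om : ℝ) :
    Function.HasTemperateGrowth fun x : Pos N => laguerre l lam (om * psum 2 x) := by
  simp only [laguerre_eq]
  exact .sum fun k _ => (Function.HasTemperateGrowth.const _).fun_mul
    (((Function.HasTemperateGrowth.const _).fun_mul (temperate_psum 2)).fun_pow k)

variable [NeZero N]

lemma com_add (c : ℝ) (x : Pos N) : com (fun i => x i + c) = com x + c := by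
  have hN : (N : ℝ) ≠ 0 := natCast_ne_zero
  rw [com, com, Finset.sum_add_distrib]
  simp
  field_simp

lemma invariant_dispersion : Invariant (dispersion : Pos N → ℝ) := fun c x => by
  have hN : (N : ℝ) ≠ 0 := natCast_ne_zero
  apply mul_left_cancel₀ hN
  rw [← sum_sub_com_sq, ← sum_sub_com_sq, com_add]
  simp

lemma invariant_spread (φ : ℝ → ℝ) (v : Fin N → E) : Invariant (spread φ 1 v) := fun c x => by
  simp only [spread, com_add, one_mul, add_sub_add_right_eq_sub]

end Homogeneous

/-! ## Quadratic functions of the relative coordinates -/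

section Quadratic

variable [NeZero N]

/-- `∑ y_k y_l M_{kl}` with `y = x - com x`. -/
noncomputable def quadForm (M : Fin N → Fin N → Spin N κ) (x : Pos N) : Spin N κ :=
  ∑ k, (x k - com x) • spread (fun t => t ^ 1) 1 (M k) x

variable {M : Fin N → Fin N → Spin N κ}

omit [NeZero N] in
lemma homog_quadForm : Homog (quadForm M) 2 := by
  refine ⟨?_, fun t x => ?_⟩
  · unfold quadForm
    exact .sum fun k _ => ((temperate_coord k).fun_sub temperate_com).fun_smul
      (homog_spread 1 1 (M k)).temperate
  · simp only [quadForm, (homog_spread 1 1 (M _)).hom, com_mul, Finset.smul_sum, smul_smul]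
    exact Finset.sum_congr rfl fun k _ => by congr 1; ring

lemma invariant_quadForm : Invariant (quadForm M) := fun c x => by
  simp only [quadForm, invariant_spread _ (M _) c x, com_add, add_sub_add_right_eq_sub]

omit [NeZero N] in
lemma hasPD_quadForm (hM : ∀ k l, M k l = M l k) (i : Fin N) (x : Pos N) :
    HasPD i (quadForm M) ((2 : ℝ) • spread (fun t => t ^ 1) 1 (M i) x
      - (2 / N : ℝ) • ∑ k, spread (fun t => t ^ 1) 1 (M k) x) x := by
  have h := HasPD.sum (s := Finset.univ) fun k _ =>
    ((HasPD.coord (i := i) (x := x) k).sub (hasPD_com i x)).smul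
      (hasPD_spread (fun t => hasDerivAt_pow 1 t) 1 (M k) i x)
  refine HasPD.congr h ?_
  have e1 : ∑ k, (x k - com x) • M k i = spread (fun t => t ^ 1) 1 (M i) x := by
    simp only [spread, pow_one, one_mul, hM i]
  have e2 : ∑ k, (x k - com x) • ∑ j, M k j = ∑ j, spread (fun t => t ^ 1) 1 (M j) x := by
    simp only [Finset.smul_sum, spread, pow_one, one_mul]
    rw [Finset.sum_comm]
    exact Finset.sum_congr rfl fun j _ => Finset.sum_congr rfl fun k _ => by rw [hM]
  have e3 : ∀ k, ((if i = k then (1 : ℝ) else 0) - 1 / N) • spread (fun t => t ^ 1) 1 (M k) x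
      + (x k - com x) • ((((1 : ℕ) : ℝ) * (x i - 1 * com x) ^ (1 - 1)) • M k i
        - ((1 : ℝ) / N) • spread (fun t : ℝ => ((1 : ℕ) : ℝ) * t ^ (1 - 1)) 1 (M k) x) =
      (if i = k then spread (fun t => t ^ 1) 1 (M k) x else 0)
        - (1 / N : ℝ) • spread (fun t => t ^ 1) 1 (M k) x + (x k - com x) • M k i
        - (1 / N : ℝ) • ((x k - com x) • ∑ j, M k j) := by
    intro k
    have : spread (fun t : ℝ => ((1 : ℕ) : ℝ) * t ^ (1 - 1)) 1 (M k) x = ∑ j, M k j := by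
      simp [spread]
    rw [this]
    simp only [Nat.sub_self, pow_zero, Nat.cast_one, mul_one, one_smul]
    split_ifs <;> module
  rw [Finset.sum_congr rfl fun k _ => e3 k]
  simp only [Finset.sum_add_distrib, Finset.sum_sub_distrib, Finset.sum_ite_eq, Finset.mem_univ,
    if_true, ← Finset.smul_sum, e1, e2]
  module

lemma sum_pD_pD_quadForm (hM : ∀ k l, M k l = M l k) (hd : ∀ k, M k k = 0) (x : Pos N) :
    ∑ i, pD i (pD i (quadForm M)) x = -((2 / N : ℝ) • ∑ i, ∑ j, M i j) := by
  have e3 : ∀ k, spread (fun t : ℝ => ((1 : ℕ) : ℝ) * t ^ (1 - 1)) 1 (M k) x = ∑ j, M k j := by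
    intro k; simp [spread]
  have e : ∀ i, pD i (pD i (quadForm M)) x = (2 : ℝ) • (M i i - (1 / N : ℝ) • ∑ j, M i j)
      - (2 / N : ℝ) • ∑ k, (M k i - (1 / N : ℝ) • ∑ j, M k j) := by
    intro i
    rw [pD_eq_of (hasPD_quadForm hM i)]
    have h := ((hasPD_spread (fun t => hasDerivAt_pow 1 t) 1 (M i) i x).const_smul 2).sub
      ((HasPD.sum (s := Finset.univ) fun k _ =>
        hasPD_spread (fun t => hasDerivAt_pow 1 t) 1 (M k) i x).const_smul (2 / N : ℝ))
    rw [h.eq]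
    simp only [e3]
    simp
  have hN : (N : ℝ) ≠ 0 := natCast_ne_zero
  have e4 : ∑ i, ∑ k, M k i = ∑ i, ∑ j, M i j := Finset.sum_comm
  simp only [e, hd, zero_sub, Finset.sum_sub_distrib, ← Finset.smul_sum, e4, Finset.sum_const,
    Finset.card_univ, Fintype.card_fin, ← Nat.cast_smul_eq_nsmul ℝ, Finset.sum_neg_distrib]
  match_scalars
  field_simp
  ring

-- The transposition replaces the relative coordinates `y` by `y - (x_i - x_j) c` with `c = e_i -
-- e_j`. Expanding the form, the linear part gives the difference of the two rows, and the part
-- quadratic in `c` is `-2 M i j` because the diagonal vanishes.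
omit [NeZero N] in
lemma quadForm_sub_exchange (hM : ∀ k l, M k l = M l k) (hd : ∀ k, M k k = 0)
    (hσ : ∀ (σ : Equiv.Perm (Fin N)) k l, permSpin σ (M k l) = M (σ k) (σ l))
    {i j : Fin N} (x : Pos N) :
    quadForm M x - exchange i j (quadForm M x) =
      (2 * (x i - x j)) • (spread (fun t => t ^ 1) 1 (M i) x - spread (fun t => t ^ 1) 1 (M j) x)
        + (2 * (x i - x j) ^ 2) • M i j := by
  set y : Fin N → ℝ := fun k => x k - com x with hy
  set c : Fin N → ℝ := fun k => (if k = i then 1 else 0) - if k = j then 1 else 0 with hc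
  have hq : ∀ z : Fin N → ℝ, ∑ k, ∑ l, (z k * z l) • M k l = ∑ k, z k • ∑ l, z l • M k l :=
    fun z => by simp only [Finset.smul_sum, smul_smul]
  have e0 : quadForm M x = ∑ k, ∑ l, (y k * y l) • M k l := by
    rw [hq]; simp [quadForm, spread, hy]
  have hswap : ∀ k, y (Equiv.swap i j k) = y k - (x i - x j) * c k := by
    intro k
    simp only [hc]
    by_cases h1 : k = i
    · subst h1
      by_cases h2 : k = j
      · subst h2; simp
      · rw [Equiv.swap_apply_left, if_pos rfl, if_neg h2, hy]; ring
    · by_cases h2 : k = j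
      · subst h2
        rw [Equiv.swap_apply_right, if_pos rfl, if_neg h1, hy]; ring
      · rw [Equiv.swap_apply_of_ne_of_ne h1 h2, if_neg h1, if_neg h2]; ring
  have e1 : exchange i j (quadForm M x) = ∑ k, ∑ l,
      (y (Equiv.swap i j k) * y (Equiv.swap i j l)) • M k l := by
    rw [e0, exchange_sum, ← Equiv.sum_comp (Equiv.swap i j)]
    refine Finset.sum_congr rfl fun k _ => ?_
    rw [exchange_sum, ← Equiv.sum_comp (Equiv.swap i j)]
    refine Finset.sum_congr rfl fun l _ => ?_
    rw [exchange_smul, exchange, hσ, Equiv.swap_apply_self, Equiv.swap_apply_self]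
  have hcs : ∀ w : Fin N → Spin N κ, ∑ l, c l • w l = w i - w j := fun w => by
    simp [hc, sub_smul]
  have hr : ∀ k, spread (fun t => t ^ 1) 1 (M k) x = ∑ l, y l • M k l := fun k => by
    simp [spread, hy]
  have e2 : ∀ k l, (y (Equiv.swap i j k) * y (Equiv.swap i j l)) • M k l =
      (y k * y l) • M k l - (x i - x j) • (y k • (c l • M k l)) - (x i - x j) • (c k • (y l • M k l))
        + (x i - x j) ^ 2 • (c k • (c l • M k l)) := fun k l => by
    rw [hswap, hswap]; module
  rw [e1, e0]
  simp only [e2, Finset.sum_add_distrib, Finset.sum_sub_distrib, ← Finset.smul_sum, hcs, hr, hd,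
    smul_sub]
  have hsym : ∀ m, ∑ k, y k • M k m = ∑ k, y k • M m k := fun m =>
    Finset.sum_congr rfl fun k _ => by rw [hM]
  rw [hsym i, hsym j, hM j i]
  module

end Quadratic

end NearNeighbour
namespace NearNeighbour
open scoped ContDiff
open MeasureTheory

variable {N κ : ℕ}

/-! ## The rational model: eigenfunctions -/

section RationalWaves

variable [NeZero N]

/-- `∑ y_i |s_i⟩` with `y = x - com x`. -/
noncomputable def wave1 (s : Spin N κ) : Wave N κ := spread (fun t => t ^ 1) 1 (spinOne s)

/-- `∑ (y_i² - dispersion) |s_i⟩`. -/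
noncomputable def wave2 (s : Spin N κ) : Wave N κ := fun x =>
  spread (fun t => t ^ 2) 1 (spinOne s) x + (-1 : ℝ) • (dispersion x • sym0 s x)

/-- `∑ y_i³`. -/
noncomputable def cubic : Pos N → ℝ := spread (fun t => t ^ 3) 1 fun _ => 1

/-- The harmonic part of `cubic • wave1`. -/
noncomputable def wave4 (a : ℝ) (s : Spin N κ) : Wave N κ := fun x =>
  cubic x • wave1 s x + (-(3 * N / (2 * (alpha0 N a + 3)))) • (dispersion x • wave2 s x)

/-- The harmonic part of `Λ(y₁y₂|s⟩)`. -/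
noncomputable def waveTilde (s : Spin N κ) : Wave N κ := fun x =>
  (1 / 2 : ℝ) • quadForm (spinTwo s) x + (1 / (N - 1) : ℝ) • (dispersion x • sym0 s x)

omit [NeZero N] in
lemma sym0_eq_const (s : Spin N κ) : sym0 s = fun _ => sym0 s 0 := rfl

omit [NeZero N] in
lemma homog_sym0 (s : Spin N κ) : Homog (sym0 s) 0 := Homog.const (sym0 s 0)

omit [NeZero N] in
lemma invariant_sym0 (s : Spin N κ) : Invariant (sym0 s) := fun _ _ => rfl

lemma homog_wave1 (s : Spin N κ) : Homog (wave1 s) 1 := homog_spread 1 1 _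

lemma homog_wave2 (s : Spin N κ) : Homog (wave2 s) 2 :=
  (homog_spread 2 1 _).add ((homog_dispersion.smul (homog_sym0 s)).const_smul (-1))

omit [NeZero N] in
lemma homog_cubic : Homog (cubic : Pos N → ℝ) 3 := homog_spread 3 1 _

lemma homog_wave4 (a : ℝ) (s : Spin N κ) : Homog (wave4 a s) 4 :=
  (homog_cubic.smul (homog_wave1 s)).add ((homog_dispersion.smul (homog_wave2 s)).const_smul _)

lemma homog_waveTilde (s : Spin N κ) : Homog (waveTilde s) 2 :=
  (homog_quadForm.const_smul _).add ((homog_dispersion.smul (homog_sym0 s)).const_smul _)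

lemma invariant_wave1 (s : Spin N κ) : Invariant (wave1 s) := invariant_spread _ _

lemma invariant_wave2 (s : Spin N κ) : Invariant (wave2 s) := fun c x => by
  simp only [wave2, invariant_spread _ _ c x, invariant_dispersion c x, invariant_sym0 s c x]

lemma invariant_cubic : Invariant (cubic : Pos N → ℝ) := invariant_spread _ _

lemma invariant_wave4 (a : ℝ) (s : Spin N κ) : Invariant (wave4 a s) := fun c x => by
  simp only [wave4, invariant_cubic c x, invariant_wave1 s c x, invariant_dispersion c x,
    invariant_wave2 s c x]

lemma invariant_waveTilde (s : Spin N κ) : Invariant (waveTilde s) := fun c x => by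
  simp only [waveTilde, invariant_quadForm c x, invariant_dispersion c x, invariant_sym0 s c x]

lemma sym1_eq (s : Spin N κ) (x : Pos N) : sym1 s x = wave1 s x + com x • sym0 s x := by
  rw [sym1, symmetrize_coord, wave1, spread, ← sum_spinOne s x, Finset.smul_sum,
    ← Finset.sum_add_distrib]
  exact Finset.sum_congr rfl fun i _ => by rw [← add_smul]; congr 1; ring

lemma sym2_eq (s : Spin N κ) (x : Pos N) : sym2 s x = wave2 s x + (2 * com x) • wave1 s x +
    (dispersion x + com x ^ 2) • sym0 s x := by
  have e : sym2 s x = spread (fun t => t ^ 2) 1 (spinOne s) x + (2 * com x) • wave1 s x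
      + com x ^ 2 • sym0 s x := by
    rw [sym2, symmetrize_apply_zero (fun t => t ^ 2), wave1, spread, spread, ← sum_spinOne s x,
      Finset.smul_sum, Finset.smul_sum, ← Finset.sum_add_distrib, ← Finset.sum_add_distrib]
    exact Finset.sum_congr rfl fun i _ => by rw [smul_smul, ← add_smul, ← add_smul]; congr 1; ring
  rw [e, wave2]
  module

lemma psum_three_eq (x : Pos N) :
    psum 3 x = cubic x + 3 * N * com x * dispersion x + N * com x ^ 3 := by
  have e : ∀ i, x i ^ 3 = (x i - 1 * com x) ^ 3 • (1 : ℝ) + (3 * com x * (x i - com x) ^ 2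
      + 3 * com x ^ 2 * (x i - com x)) + com x ^ 3 := fun i => by rw [smul_eq_mul]; ring
  rw [psum, cubic, spread]
  simp only [e, Finset.sum_add_distrib, ← Finset.mul_sum, sum_sub_com_sq, sum_sub_com,
    Finset.sum_const, Finset.card_univ, Fintype.card_fin, nsmul_eq_mul]
  ring

lemma sym11_eq (hN : 2 ≤ N) (s : Spin N κ) (x : Pos N) :
    sym11 s x - com x • symSum s x + com x ^ 2 • sym0 s x =
      waveTilde s x + (-(dispersion x / (N - 1))) • sym0 s x := by
  rw [← sym11_translate]
  have h := sum_spinTwo hN s fun i => x i - com x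
  have e : quadForm (spinTwo s) x = ∑ i, ∑ j, ((x i - com x) * (x j - com x)) • spinTwo s i j := by
    simp only [quadForm, spread, Finset.smul_sum, smul_smul, pow_one, one_mul]
  rw [waveTilde, e, h]
  module

/-- The value of `∑ F_i x_i` on the configuration space. -/
lemma sum_linkF_rational (hN : 2 ≤ N) (a : ℝ) {x : Pos N} (hx : x ∈ C0 N) :
    ∑ i, linkF a (fun d => d⁻¹) i x * x i = a * N := by
  rw [(linkFactor_rational a).sum_linkF_mul, Finset.sum_congr rfl fun i _ =>
    inv_mul_cancel₀ (link_ne_zero hN hx i)]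
  simp

/-- The homogeneous solutions for the rational model without confinement. -/
abbrev RationalHarm (a : ℝ) (f : Wave N κ) (d : ℕ) : Prop :=
  Harm (C0 N) (linkF a fun d => d⁻¹) (linkW a 0 fun d => d⁻¹) f d

lemma gaugedOp_const_smul_sym0 {F w : Fin N → Pos N → ℝ} {A : Pos N → ℝ} (hA : ContDiff ℝ ∞ A)
    (s : Spin N κ) (x : Pos N) :
    gaugedOp F w (fun x => A x • sym0 s x) x = scalarOp F A x • sym0 s x := by
  have e : ∀ i, pD i (sym0 s) x = 0 := fun i => by rw [sym0_eq_const, pD_const]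
  have e2 : gaugedOp F w (sym0 s) x = 0 := by
    have h : ∀ i, exchange i (i + 1) (sym0 s x) = sym0 s x := fun i =>
      permSpin_symmetrize_const _ s x
    have e' : ∀ i, pD i (sym0 s) = fun _ => 0 := fun i => by rw [sym0_eq_const, pD_const]
    simp [gaugedOp, h, e', pD_const]
  rw [gaugedOp_smul F w hA (homog_sym0 s).temperate.1, e2]
  simp [e]

variable {a : ℝ}

lemma rationalHarm_sym0 (s : Spin N κ) : RationalHarm a (sym0 s) 0 :=
  ⟨(homog_sym0 s).temperate.1, (homog_sym0 s).euler, fun x _ => by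
    have h := gaugedOp_const_smul_sym0 (F := linkF a fun d => d⁻¹)
      (w := linkW a 0 fun d => d⁻¹) (contDiff_const (c := (1 : ℝ))) s x
    simp only [one_smul] at h
    rw [show (fun x => sym0 s x) = sym0 s from rfl] at h
    rw [h]
    simp [scalarOp, pD_const]⟩

/-- `gaugedOp` on a multiple of the dispersion. -/
lemma gaugedOp_dispersion_smul (hN : 2 ≤ N) {f : Wave N κ} {d : ℕ} (h : RationalHarm a f d)
    (ht : Invariant f) {x : Pos N} (hx : x ∈ C0 N) :
    gaugedOp (linkF a fun d => d⁻¹) (linkW a 0 fun d => d⁻¹) (fun x => dispersion x • f x) x =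
      (4 * (alpha0 N a + 1 + d) / N) • f x := by
  have h1 := h.gaugedOp_com_pow_mul (fun y => ht.sum_pD h.smooth y) hx
    ((linkFactor_rational a).sum_linkF_eq_zero x) (sum_linkF_rational hN a hx) 0 1
  simp only [pow_zero, one_mul, pow_one] at h1
  rw [h1, alpha0]
  congr 1
  push_cast
  ring

lemma permSpin_spinOne' (s : Spin N κ) (σ : Equiv.Perm (Fin N)) (k : Fin N) :
    permSpin σ (spinOne s k) = spinOne s (σ k) := permSpin_spinOne σ s k

lemma spread_const (c θ : ℝ) (s : Spin N κ) (x : Pos N) :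
    spread (fun _ => c) θ (spinOne s) x = c • sym0 s x := by
  rw [spread, ← Finset.smul_sum, sum_spinOne s x]

lemma rationalHarm_wave1 (hN : 2 ≤ N) (s : Spin N κ) : RationalHarm a (wave1 s) 1 :=
  ⟨(homog_wave1 s).temperate.1, (homog_wave1 s).euler, fun x hx => by
    rw [wave1, (linkFactor_rational a).gaugedOp_spread hN (φ' := fun _ => 1) (φ'' := fun _ => 0)
      (ψ := fun _ => 0) (fun t => by simpa using hasDerivAt_pow 1 t) (fun t => hasDerivAt_const t 1)
      (fun s t h => by field_simp; ring) 1 (permSpin_spinOne' s) (link_ne_zero hN hx)]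
    simp [spread]⟩

/-- The squares `y_i²` contribute `2 (1 - 1 / N) + 4 a` times `Λ|s⟩`, and the dispersion contributes
`4 (α + 1) / N`, which is the same number. -/
lemma rationalHarm_wave2 (hN : 2 ≤ N) (s : Spin N κ) : RationalHarm a (wave2 s) 2 := by
  refine ⟨(homog_wave2 s).temperate.1, (homog_wave2 s).euler, fun x hx => ?_⟩
  have hd : ContDiff ℝ ∞ fun x : Pos N => dispersion x • sym0 s x :=
    contDiff_dispersion.smul (homog_sym0 s).temperate.1
  unfold wave2
  rw [gaugedOp_add _ _ (homog_spread 2 1 (spinOne s)).temperate.1 (hd.const_smul (-1 : ℝ)),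
    gaugedOp_const_smul _ _ _ hd, gaugedOp_dispersion_smul hN (rationalHarm_sym0 s)
      (invariant_sym0 s) hx, (linkFactor_rational a).gaugedOp_spread hN (φ' := fun t => 2 * t)
      (φ'' := fun _ => 2) (ψ := fun _ => 1) (fun t => by simpa using hasDerivAt_pow 2 t)
      (fun t => by simpa using (hasDerivAt_id t).const_mul (2 : ℝ))
      (fun s t h => by field_simp; ring) 1 (permSpin_spinOne' s) (link_ne_zero hN hx),
    spread_const, spread_const, smul_smul, smul_smul, smul_smul, ← add_smul, ← add_smul, alpha0]
  have hN : (N : ℝ) ≠ 0 := natCast_ne_zero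
  convert zero_smul ℝ _
  field_simp
  push_cast
  ring

/-- Both the Laplacian and the drift produce multiples of `∑ (x_i - com x)`, which is zero. -/
lemma scalarOp_cubic (hN : 2 ≤ N) {x : Pos N} (hx : x ∈ C0 N) :
    scalarOp (linkF a fun d => d⁻¹) cubic x = 0 := by
  rw [cubic, (linkFactor_rational a).scalarOp_spread (φ' := fun t => 3 * t ^ 2)
    (φ'' := fun t => 6 * t ^ 1) (ψ := fun t => 3 * t) (fun t => by simpa using hasDerivAt_pow 3 t)
    (fun t => ((hasDerivAt_pow 2 t).const_mul 3).congr_deriv (by norm_num; ring))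
    (fun s t h => by field_simp; ring) 1 (link_ne_zero hN hx)]
  have e := sum_sub_com x
  have e1 : ∀ c : ℝ, ∑ k, (c * (x k - com x)) = 0 := fun c => by rw [← Finset.mul_sum, e, mul_zero]
  simp only [spread, pow_one, one_mul, smul_eq_mul, mul_one, e1]
  simp

lemma pD_cubic (i : Fin N) (x : Pos N) :
    pD i cubic x = 3 * ((x i - com x) ^ 2 - dispersion x) := by
  have hN : (N : ℝ) ≠ 0 := natCast_ne_zero
  rw [cubic, pD_spread (fun t => hasDerivAt_pow 3 t)]
  simp only [spread, smul_eq_mul, mul_one, one_mul, ← Finset.mul_sum]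
  norm_num [sum_sub_com_sq]
  field_simp

lemma rationalHarm_cubic (hN : 2 ≤ N) (s : Spin N κ) :
    RationalHarm a (fun x => cubic x • sym0 s x) 3 :=
  ⟨(homog_cubic.smul (homog_sym0 s)).temperate.1, (homog_cubic.smul (homog_sym0 s)).euler,
    fun x hx => by
      rw [gaugedOp_const_smul_sym0 homog_cubic.temperate.1, scalarOp_cubic hN hx, zero_smul]⟩

lemma pD_wave1 (s : Spin N κ) (i : Fin N) (x : Pos N) :
    pD i (wave1 s) x = spinOne s i - (1 / N : ℝ) • sym0 s x := by
  rw [wave1, pD_spread (φ' := fun _ => 1) (fun t => by simpa using hasDerivAt_pow 1 t),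
    spread_const, one_smul, one_smul]

lemma sum_pD_cubic_smul_pD_wave1 (s : Spin N κ) (x : Pos N) :
    ∑ i, pD i cubic x • pD i (wave1 s) x = (3 : ℝ) • wave2 s x := by
  have hN : (N : ℝ) ≠ 0 := natCast_ne_zero
  have e : ∀ i, pD i cubic x • pD i (wave1 s) x =
      (3 : ℝ) • ((x i - 1 * com x) ^ 2 • spinOne s i) - (3 * dispersion x) • spinOne s i
        - ((3 / N : ℝ) * (x i - com x) ^ 2 - 3 / N * dispersion x) • sym0 s x := fun i => by
    rw [pD_cubic, pD_wave1, one_mul]; module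
  simp only [e, Finset.sum_sub_distrib, ← Finset.smul_sum, ← Finset.sum_smul, ← Finset.mul_sum,
    sum_sub_com_sq, sum_spinOne s x, Finset.sum_const, Finset.card_univ, Fintype.card_fin,
    nsmul_eq_mul]
  rw [wave2, spread]
  match_scalars
  all_goals field_simp
  ring

/-- Both `cubic` and `wave1` are annihilated, so their product leaves only the cross term, equal to
`6 wave2`. The multiple of `dispersion • wave2` in `wave4` is chosen to cancel it. -/
lemma rationalHarm_wave4 (hN : 2 ≤ N) (ha : 0 < a) (s : Spin N κ) : RationalHarm a (wave4 a s) 4 := by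
  refine ⟨(homog_wave4 a s).temperate.1, (homog_wave4 a s).euler, fun x hx => ?_⟩
  have hd : ContDiff ℝ ∞ fun x : Pos N => dispersion x • wave2 s x :=
    contDiff_dispersion.smul (homog_wave2 s).temperate.1
  have hq := homog_cubic (N := N)
  have h1 := homog_wave1 s
  unfold wave4
  rw [gaugedOp_add _ _ (hq.smul h1).temperate.1 (hd.const_smul _), gaugedOp_const_smul _ _ _ hd,
    gaugedOp_dispersion_smul hN (rationalHarm_wave2 hN s) (invariant_wave2 s) hx,
    gaugedOp_smul _ _ hq.temperate.1 h1.temperate.1, scalarOp_cubic hN hx,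
    (rationalHarm_wave1 hN s).zero x hx, sum_pD_cubic_smul_pD_wave1]
  have hN' : (N : ℝ) ≠ 0 := natCast_ne_zero
  have hα : alpha0 N a + 3 ≠ 0 := by
    have : 0 < N * (a + 1 / 2) := by positivity
    rw [alpha0]; intro h; linarith
  rw [zero_smul, smul_zero, zero_add, add_zero, smul_smul, smul_smul, ← add_smul]
  convert zero_smul ℝ _
  push_cast
  rw [show alpha0 N a + 1 + 2 = alpha0 N a + 3 by ring]
  field_simp
  ring

/-- On every link the poles cancel and `-2 |s_{i,i+1}⟩` is left over. Membership in `Σ'` makes the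
cyclic sum of these vectors a multiple of `Λ|s⟩`, which the dispersion term can absorb; without it
the remainder need not be symmetric. -/
lemma rationalHarm_waveTilde (hN : 2 ≤ N) {s : Spin N κ} (hs : s ∈ SpinPrime N κ) :
    RationalHarm a (waveTilde s) 2 := by
  refine ⟨(homog_waveTilde s).temperate.1, (homog_waveTilde s).euler, fun x hx => ?_⟩
  have hd : ContDiff ℝ ∞ fun x : Pos N => dispersion x • sym0 s x :=
    contDiff_dispersion.smul (homog_sym0 s).temperate.1
  have hq := homog_quadForm (M := spinTwo s)
  unfold waveTilde
  rw [gaugedOp_add _ _ (hq.const_smul _).temperate.1 (hd.const_smul _),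
    gaugedOp_const_smul _ _ _ hd, gaugedOp_const_smul _ _ _ hq.temperate.1,
    gaugedOp_dispersion_smul hN (rationalHarm_sym0 s) (invariant_sym0 s) hx,
    (linkFactor_rational a).gaugedOp_eq, sum_pD_pD_quadForm (spinTwo_comm s) (spinTwo_self hN s)]
  have e : ∀ i, (x i - x (i + 1))⁻¹ • (pD i (quadForm (spinTwo s)) x
      - pD (i + 1) (quadForm (spinTwo s)) x) - (0 + (x i - x (i + 1))⁻¹ ^ 2) •
        (quadForm (spinTwo s) x - exchange i (i + 1) (quadForm (spinTwo s) x)) =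
      (-2 : ℝ) • spinTwo s i (i + 1) := by
    intro i
    have hl := link_ne_zero hN hx i
    rw [quadForm_sub_exchange (spinTwo_comm s) (spinTwo_self hN s) (fun σ => permSpin_spinTwo σ s),
      (hasPD_quadForm (spinTwo_comm s) i x).eq, (hasPD_quadForm (spinTwo_comm s) (i + 1) x).eq]
    match_scalars
    all_goals field_simp
    all_goals ring
  have h2 : ∑ i, ∑ j, spinTwo s i j = (2 : ℝ) • sym0 s x := by
    have h2 := sum_spinTwo hN s (fun _ => 1)
    have h3 : sym11 s (fun _ => 1) = sym0 s x := by simp [sym11, sym0, symmetrize, Function.comp]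
    simpa [h3] using h2
  have hN1 : (N : ℝ) - 1 ≠ 0 := by
    have : (2 : ℝ) ≤ N := by exact_mod_cast hN
    intro h; linarith
  have h4 : ∑ i, spinTwo s i (i + 1) = (2 / (N - 1) : ℝ) • sym0 s x := by
    have h5 := congrArg (fun v => ((N : ℝ) - 1)⁻¹ • v) (sum_spinTwo_of_mem hN hs x)
    simp only [smul_smul, inv_mul_cancel₀ hN1, one_smul] at h5
    rw [h5]
    congr 1
    ring
  simp only [e]
  rw [← Finset.smul_sum, h2, h4, alpha0]
  have hN' : (N : ℝ) ≠ 0 := natCast_ne_zero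
  simp only [smul_smul, ← neg_smul, ← add_smul]
  convert zero_smul ℝ _
  push_cast
  field_simp
  ring

end RationalWaves

end NearNeighbour
namespace NearNeighbour
open scoped ContDiff
open MeasureTheory Filter Topology

variable {N κ : ℕ}

/-! ### Rational model: eigenfunctions from homogeneous solutions, and tools for nonvanishing -/

section RationalEigen

variable [NeZero N] {a om : ℝ}

/-- For total degree `m` the Laguerre parameter is `N / 2 + a N + m - 1 = -β(m)`. It depends on the
degree of the whole profile, which is why the same `β(m)` occurs in all summands of a family. -/
lemma rational_isEigenfunction (hN : 2 ≤ N) (ha : 0 < a) (hom : 0 < om) {f : Wave N κ} {m : ℕ}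
    (hf : RationalHarm a f m) (ht : Function.HasTemperateGrowth f) (l : ℕ) :
    IsEigenfunction (H0 om a) (C0 N)
      (fun x => gauge0 om a x • (laguerre l (-beta0 N a m) (om * psum 2 x) • f x))
      (ground0 N om a + 2 * om * (2 * l + m)) := by
  have hg := gauge0_isGauge (κ := κ) (om := om) hN ha
  have hL := (temperate_laguerre (N := N) l (-beta0 N a m) om).fun_smul ht
  refine ⟨hg.solves hL.1 fun x hx => ?_, ?_⟩
  · exact hf.laguerre (fun y hy => sum_linkF_rational hN a hy) (by rw [beta0]; ring) om l hx
  · exact memLp_gauge_smul isOpen_C0 hg.smooth.continuousOn (half_pos hom)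
      (fun x _ => abs_gauge0_le ha.le x) hL

lemma rational_extends (hN : 2 ≤ N) (ha : 0 < a) (hom : 0 < om) {f Ψ : Wave N κ} {m : ℕ}
    (hf : RationalHarm a f m) (ht : Function.HasTemperateGrowth f) (l : ℕ)
    (hΨ : ∀ x, com x ≠ 0 → Ψ x =
      gauge0 om a x • (laguerre l (-beta0 N a m) (om * psum 2 x) • f x)) :
    ExtendsToEigenfunction (H0 om a) (C0 N) Ψ (ground0 N om a + 2 * om * (2 * l + m)) :=
  ⟨_, fun x _ hx => (hΨ x hx).symm, rational_isEigenfunction hN ha hom hf ht l⟩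

/-! ### Nonvanishing -/

lemma gbinom_add_ne_zero (n : ℕ) {A : ℝ} (hA : -1 < A) : gbinom (n + A) n ≠ 0 :=
  gbinom_ne_zero fun i hi h => by
    have : (i : ℝ) + 1 ≤ n := by exact_mod_cast hi
    linarith

lemma eventually_laguerre_ne_zero (l : ℕ) (lam : ℝ) : ∀ᶠ t in atTop, laguerre l lam t ≠ 0 := by
  set P : Polynomial ℝ := ∑ k ∈ Finset.range (l + 1),
    Polynomial.C (laguerreCoeff l lam k) * Polynomial.X ^ k with hP
  have h1 : ∀ t, P.eval t = laguerre l lam t := fun t => by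
    rw [laguerre_eq, hP, Polynomial.eval_finsetSum]
    simp
  have h2 : P.coeff l ≠ 0 := by
    rw [hP, Polynomial.finsetSum_coeff]
    simp only [Polynomial.coeff_C_mul_X_pow]
    rw [Finset.sum_ite_eq, if_pos (Finset.self_mem_range_succ l), laguerreCoeff, Nat.sub_self,
      gbinom_zero]
    have := Nat.factorial_ne_zero l
    simp [this]
  have h3 : P ≠ 0 := fun h => h2 (by rw [h, Polynomial.coeff_zero])
  filter_upwards [Polynomial.eventually_atTop_not_isRoot P h3] with t ht
  rw [← h1]
  exact ht

lemma tendsto_psum_translate (x : Pos N) : Tendsto (fun u => psum 2 fun i => x i + u) atTop atTop := by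
  have h : Tendsto (fun u : ℝ => (x 0 + u) ^ 2) atTop atTop :=
    (tendsto_pow_atTop two_ne_zero).comp (tendsto_atTop_add_const_left _ _ tendsto_id)
  refine tendsto_atTop_mono (fun u => ?_) h
  exact Finset.single_le_sum (f := fun i => (x i + u) ^ 2) (fun i _ => sq_nonneg _)
    (Finset.mem_univ 0)

omit [NeZero N] in
lemma C0_translate {x : Pos N} (hx : x ∈ C0 N) (u : ℝ) : (fun i => x i + u) ∈ C0 N :=
  fun _ _ h => by simpa using hx h

/-- The configuration space is invariant under translations of all particles. A large translation
moves `r²` past all zeros of the Laguerre polynomial and makes the centre of mass positive. -/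
lemma rational_nonvanishing (hN : 2 ≤ N) (ha : 0 < a) (hom : 0 < om) {f Ψ : Wave N κ} {m l : ℕ}
    (hΨ : ∀ x, com x ≠ 0 → Ψ x =
      gauge0 om a x • (laguerre l (-beta0 N a m) (om * psum 2 x) • f x))
    {x : Pos N} (hx : x ∈ C0 N) (hf : ∀ᶠ u in atTop, f (fun i => x i + u) ≠ 0) :
    Nonvanishing (C0 N) Ψ := by
  have h1 : ∀ᶠ u : ℝ in atTop, laguerre l (-beta0 N a m) (om * psum 2 fun i => x i + u) ≠ 0 :=
    ((tendsto_psum_translate x).const_mul_atTop hom).eventually (eventually_laguerre_ne_zero _ _)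
  obtain ⟨u, hu1, hu2, hu3⟩ := (h1.and (hf.and (eventually_gt_atTop (-com x)))).exists
  have hc : com (fun i => x i + u) ≠ 0 := by rw [com_add]; intro h; linarith
  refine ⟨_, C0_translate hx u, hc, ?_⟩
  rw [hΨ _ hc]
  have h2 := (gauge0_isGauge (κ := κ) (om := om) hN ha).pos _ (C0_translate hx u)
  exact smul_ne_zero h2.ne' (smul_ne_zero hu1 hu2)

lemma tendsto_inv_pow_mul_add_pow (c : ℝ) {j e : ℕ} (h : j ≤ e) :
    Tendsto (fun u : ℝ => (u ^ e)⁻¹ * (c + u) ^ j) atTop (𝓝 (if j = e then 1 else 0)) := by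
  have h1 : Tendsto (fun u : ℝ => c * u⁻¹ + 1) atTop (𝓝 1) := by
    simpa using (tendsto_inv_atTop_zero.const_mul c).add_const 1
  have h2 : Tendsto (fun u : ℝ => u⁻¹ ^ (e - j)) atTop (𝓝 (if j = e then 1 else 0)) := by
    split_ifs with he
    · simp [he]
    · have := (tendsto_inv_atTop_zero (𝕜 := ℝ)).pow (e - j)
      rwa [zero_pow (by omega)] at this
  have h3 := (h1.pow j).mul h2
  rw [one_pow, one_mul] at h3
  refine h3.congr' ?_
  filter_upwards [eventually_gt_atTop 0] with u hu
  have e1 : u ^ e = u ^ j * u ^ (e - j) := by rw [← pow_add]; congr 1; omega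
  rw [e1, show c * u⁻¹ + 1 = (c + u) / u by field_simp, div_pow, inv_pow]
  field_simp

/-- Under translation by `u` the dispersion is fixed and `com` grows like `u`, so only the term `k =
0` of the ladder reaches the power `u ^ e`. -/
lemma tendsto_ladder (e E : ℕ) (h : e ≤ E) (A : ℝ) (x : Pos N) :
    Tendsto (fun u : ℝ => (u ^ E)⁻¹ * ladder e A (fun i => x i + u)) atTop
      (𝓝 (if e = E then gbinom ((e / 2 : ℕ) + A) (e / 2) else 0)) := by
  have h1 : ∀ u : ℝ, (u ^ E)⁻¹ * ladder e A (fun i => x i + u) =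
      ∑ k ∈ Finset.range (e / 2 + 1), ladderCoeff e A k * dispersion x ^ k *
        ((u ^ E)⁻¹ * (com x + u) ^ (e - 2 * k)) := fun u => by
    rw [ladder, Finset.mul_sum]
    exact Finset.sum_congr rfl fun k _ => by rw [com_add, invariant_dispersion]; ring
  simp only [h1]
  have h2 := tendsto_finsetSum (Finset.range (e / 2 + 1)) fun k _ =>
    (tendsto_inv_pow_mul_add_pow (com x) (show e - 2 * k ≤ E by omega)).const_mul
      (ladderCoeff e A k * dispersion x ^ k)
  convert h2 using 2
  rw [Finset.sum_range_succ', Finset.sum_eq_zero]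
  · simp [ladderCoeff, gbinom_zero]
  · intro k hk
    rw [if_neg, mul_zero]
    have := Finset.mem_range.mp hk
    omega

omit [NeZero N] in
lemma eventually_ne_zero_of_tendsto {f : ℝ → Spin N κ} {E : ℕ} {g : Spin N κ} (hg : g ≠ 0)
    (h : Tendsto (fun u : ℝ => (u ^ E)⁻¹ • f u) atTop (𝓝 g)) : ∀ᶠ u in atTop, f u ≠ 0 := by
  filter_upwards [h.eventually_ne hg] with u hu h0
  exact hu (by rw [h0, smul_zero])

omit [NeZero N] in
lemma pD_eq_zero_of_eqOn {E : Type*} [NormedAddCommGroup E] [NormedSpace ℝ E] {C : Set (Pos N)}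
    (hC : IsOpen C) {f : Pos N → E} (h : ∀ x ∈ C, f x = 0) (i : Fin N) {x : Pos N} (hx : x ∈ C) :
    pD i f x = 0 := by
  refine (HasPD.congr_of_eventuallyEq (HasPD.const (i := i) (x := x) (0 : E)) ?_).eq
  filter_upwards [hC.mem_nhds hx] with y hy using h y hy

lemma exists_wave1_ne_zero {C : Set (Pos N)} (hC : IsOpen C) (hne : C.Nonempty) {s : Spin N κ}
    (hs : ∃ i j, spinOne s i ≠ spinOne s j) : ∃ x ∈ C, wave1 s x ≠ 0 := by
  by_contra! h
  obtain ⟨x, hx⟩ := hne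
  obtain ⟨i, j, hij⟩ := hs
  have h1 : ∀ i, spinOne s i = (1 / N : ℝ) • sym0 s x := fun i => by
    have := pD_eq_zero_of_eqOn hC h i hx
    rw [pD_wave1] at this
    exact sub_eq_zero.mp this
  exact hij ((h1 i).trans (h1 j).symm)

lemma pD_wave2 (s : Spin N κ) (i : Fin N) (x : Pos N) :
    HasPD i (wave2 s) ((2 * (x i - com x)) • spinOne s i - (2 / N : ℝ) • wave1 s x
      - (2 / N * (x i - com x)) • sym0 s x) x := by
  have h1 := hasPD_spread (φ := fun t => t ^ 2) (φ' := fun t => 2 * t) (fun t => by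
    simpa using hasDerivAt_pow 2 t) 1 (spinOne s) i x
  have h2 := ((hasPD_dispersion i x).smul_const (sym0 s 0)).const_smul (-1)
  refine HasPD.congr (h1.add h2) ?_
  have e : spread (fun t : ℝ => 2 * t) 1 (spinOne s) x = (2 : ℝ) • wave1 s x := by
    simp only [wave1, spread, Finset.smul_sum, smul_smul, pow_one]
  rw [e, sym0_eq s x 0]
  module

/-- If `wave2` vanished, its mixed second derivatives would force `|s_i⟩ + |s_j⟩` to be the same for
all `i ≠ j`, and comparison through a third index would give `|s_i⟩ = |s_j⟩`. For `N = 2` there is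
no third index, and `wave2` is indeed identically zero. -/
lemma exists_wave2_ne_zero (hN : 3 ≤ N) {s : Spin N κ} (hs : ∃ i j, spinOne s i ≠ spinOne s j) :
    ∃ x ∈ C0 N, wave2 s x ≠ 0 := by
  by_contra! h
  obtain ⟨x, hx⟩ := C0_nonempty (N := N)
  obtain ⟨i, j, hij⟩ := hs
  have hN' : (N : ℝ) ≠ 0 := natCast_ne_zero
  have h1 : ∀ i j, j ≠ i → spinOne s i + spinOne s j = (2 / N : ℝ) • sym0 s x := by
    intro i j hij
    have h2 := pD_eq_zero_of_eqOn isOpen_C0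
      (fun y hy => pD_eq_zero_of_eqOn isOpen_C0 h i hy) j hx
    rw [pD_eq_of (pD_wave2 s i)] at h2
    have hc := (HasPD.coord (i := j) (x := x) i).sub (hasPD_com j x)
    have h3 := (((hc.const_mul 2).smul_const (spinOne s i)).sub
      ((HasPD.of_contDiff (i := j) (x := x) (homog_wave1 s).temperate.1).const_smul (2 / N : ℝ))).sub
      ((hc.const_mul (2 / N : ℝ)).smul_const (sym0 s 0))
    have h4 := h3.eq.symm.trans h2
    rw [pD_wave1, if_neg hij, sym0_eq s 0 x] at h4
    have h5 : (-(2 / N) : ℝ) • (spinOne s i + spinOne s j - (2 / N : ℝ) • sym0 s x) = 0 := by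
      rw [← h4]
      match_scalars
      all_goals field_simp
      all_goals ring
    have h6 := (smul_eq_zero.mp h5).resolve_left (by simp [hN'])
    exact sub_eq_zero.mp h6
  obtain ⟨k, hk1, hk2⟩ := Fin.exists_ne_and_ne_of_two_lt i j (by omega)
  have h7 := (h1 i k hk1).trans (h1 j k hk2).symm
  exact hij (add_right_cancel h7)

/-! ### The six families -/

/-- A seed of degree `d` raises the first Jacobi parameter by `d` and leaves a ladder of degree `m -
d`. These changes compensate in the condition on the sum of the parameters, so one `β(m)` serves all
seeds. -/
lemma ladder_eq_jacobi {m d : ℕ} (hd : d ≤ m) {x : Pos N} (hx : com x ≠ 0) :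
    com x ^ (m - d) * jacobi ((m - d) / 2) (alpha0 N a + d) (beta0 N a m) (tvar x) =
      ladder (m - d) (alpha0 N a + d) x := by
  rw [ladder_eq _ hx]
  rw [alpha0, beta0, Nat.cast_sub hd]
  ring

lemma rationalHarm_ladder (hN : 2 ≤ N) {f : Wave N κ} {d m : ℕ} (hd : d ≤ m)
    (hf : RationalHarm a f d) (ht : Invariant f) :
    RationalHarm a (fun x => ladder (m - d) (alpha0 N a + d) x • f x) m := by
  have h := hf.ladder (fun y => ht.sum_pD hf.smooth y)
    (fun y _ => (linkFactor_rational a).sum_linkF_eq_zero y)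
    (fun y hy => sum_linkF_rational hN a hy) (A := alpha0 N a + d) (by rw [alpha0]; ring) (m - d)
  rwa [Nat.sub_add_cancel hd] at h

omit [NeZero N] in
lemma alpha0_pos (hN : 2 ≤ N) (ha : 1 / 2 < a) : 0 < alpha0 N a := by
  have : (2 : ℝ) ≤ N := by exact_mod_cast hN
  rw [alpha0]
  nlinarith

end RationalEigen

end NearNeighbour
namespace NearNeighbour
open scoped ContDiff
open MeasureTheory Filter Topology

variable {N κ : ℕ}

/-! ### Rational model: the explicit functions as combinations of ladders -/

section RationalFamilies

variable [NeZero N] {a om : ℝ}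

/-- A polynomial profile of the eigenfunctions of the rational model. -/
noncomputable abbrev ladderWave (a : ℝ) (m d : ℕ) (f : Wave N κ) : Wave N κ := fun x =>
  ladder (m - d) (alpha0 N a + d) x • f x

omit [NeZero N] in
lemma alpha0_add_beta0 (a : ℝ) (m : ℕ) : alpha0 N a + beta0 N a m = -m - 1 / 2 := by
  rw [alpha0, beta0]; ring

/-- The leading behaviour of `f` at `x + u` as `u → ∞` is `u^E g`. -/
def Leading (f : Wave N κ) (x : Pos N) (E : ℕ) (g : Spin N κ) : Prop :=
  Tendsto (fun u : ℝ => (u ^ E)⁻¹ • f fun i => x i + u) atTop (𝓝 g)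

lemma leading_ladderWave {m d E : ℕ} (hE : m - d ≤ E) {f : Wave N κ} (hf : Invariant f) (x : Pos N) :
    Leading (ladderWave a m d f) x E
      ((if m - d = E then gbinom (((m - d) / 2 : ℕ) + (alpha0 N a + d)) ((m - d) / 2) else 0) • f x) := by
  have h := (tendsto_ladder (m - d) E hE (alpha0 N a + d) x).smul_const (f x)
  refine Tendsto.congr (fun u => ?_) h
  simp only [ladderWave, hf u x, mul_smul]

omit [NeZero N] in
lemma Leading.add {f g : Wave N κ} {x : Pos N} {E : ℕ} {v w : Spin N κ} (hf : Leading f x E v)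
    (hg : Leading g x E w) : Leading (fun x => f x + g x) x E (v + w) :=
  (Tendsto.add hf hg).congr fun u => by rw [smul_add]

omit [NeZero N] in
lemma Leading.const_smul {f : Wave N κ} {x : Pos N} {E : ℕ} {v : Spin N κ} (c : ℝ)
    (hf : Leading f x E v) : Leading (fun x => c • f x) x E (c • v) :=
  (Tendsto.const_smul hf c).congr fun u => by rw [smul_comm]

omit [NeZero N] in
lemma Leading.eventually_ne {f : Wave N κ} {x : Pos N} {E : ℕ} {g : Spin N κ}
    (h : Leading f x E g) (hg : g ≠ 0) : ∀ᶠ u in atTop, f (fun i => x i + u) ≠ 0 :=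
  eventually_ne_zero_of_tendsto hg h

omit [NeZero N] in
lemma temperate_ladderWave {m d q : ℕ} {f : Wave N κ} (hf : Homog f q) :
    Function.HasTemperateGrowth (ladderWave a m d f) :=
  (temperate_ladder _ _).fun_smul hf.temperate

lemma psi0_eq (l m : ℕ) (s : Spin N κ) (x : Pos N) (hx : com x ≠ 0) :
    psi0 om a l m s x = gauge0 om a x • (laguerre l (-beta0 N a m) (om * psum 2 x) •
      ladderWave a m 0 (sym0 s) x) := by
  have h := ladder_eq_jacobi (a := a) (Nat.zero_le m) hx
  simp only [Nat.cast_zero, add_zero, Nat.sub_zero] at h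
  simp only [psi0, mu0, ladderWave, Nat.cast_zero, add_zero, Nat.sub_zero, ← h]
  module

lemma psi1_eq (l m : ℕ) (hm : 1 ≤ m) (s : Spin N κ) (x : Pos N) (hx : com x ≠ 0) :
    psi1 om a l m s x = gauge0 om a x • (laguerre l (-beta0 N a m) (om * psum 2 x) •
      ladderWave a m 1 (wave1 s) x) := by
  have h := ladder_eq_jacobi (a := a) hm hx
  rw [Nat.cast_one] at h
  simp only [psi1, mu0, ladderWave, Nat.cast_one, ← h, sym1_eq]
  module

/-- The factor of `Λ|s⟩` in the second family. -/
noncomputable def kappa2 (m : ℕ) : ℝ := -(2 * (m / 2 : ℕ) / (2 * ((m - 1) / 2 : ℕ) + 1))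

lemma kappa2_ne_zero {m : ℕ} (hm : 2 ≤ m) : kappa2 m ≠ 0 := by
  have h : ((m / 2 : ℕ) : ℝ) ≠ 0 := Nat.cast_ne_zero.mpr (by omega)
  have h2 : (2 * ((m - 1) / 2 : ℕ) + 1 : ℝ) ≠ 0 := by positivity
  rw [kappa2]
  exact neg_ne_zero.mpr (div_ne_zero (mul_ne_zero two_ne_zero h) h2)

/-- The polynomial part of the second family. -/
noncomputable def profile2 (a : ℝ) (m : ℕ) (s : Spin N κ) : Wave N κ := fun x =>
  ladderWave a m 2 (wave2 s) x + kappa2 m • ladderWave a m 0 (sym0 s) x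

lemma tvar_half (x : Pos N) (hx : com x ≠ 0) :
    dispersion x = com x ^ 2 * ((tvar x - 1) / 2) := by
  rw [tvar_eq x hx]; field_simp

/-- In `wave2`, `wave1` and `Λ|s⟩` the first two coefficients agree identically, and the third is
`jacobi_relation_two`. The other families are treated in the same way. -/
lemma psi2_eq (l m : ℕ) (hm : 2 ≤ m) (s : Spin N κ) (x : Pos N) (hx : com x ≠ 0) :
    psi2 om a l m s x = gauge0 om a x • (laguerre l (-beta0 N a m) (om * psum 2 x) •
      profile2 a m s x) := by
  have h2 := ladder_eq_jacobi (a := a) hm hx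
  have h0 := ladder_eq_jacobi (a := a) (Nat.zero_le m) hx
  have hz := tvar_half x hx
  have hj := jacobi_relation_two (t := tvar x) hm (alpha0_add_beta0 (N := N) a m)
  simp only [Nat.cast_zero, add_zero, Nat.sub_zero, Nat.cast_ofNat] at h0 h2
  rw [show (m - 2) / 2 = m / 2 - 1 by omega] at h2
  simp only [psi2, mu0, profile2, ladderWave, Nat.cast_zero, add_zero, Nat.sub_zero, Nat.cast_ofNat,
    ← h0, ← h2, sym1_eq, sym2_eq]
  have hm' : com x ^ m = com x ^ (m - 2) * com x ^ 2 := by rw [← pow_add]; congr 1; omega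
  rw [hm', hz]
  rw [← kappa2] at hj
  match_scalars
  all_goals first | ring1 | skip
  linear_combination (gauge0 om a x * com x ^ (m - 2) * laguerre l (-beta0 N a m) (om * psum 2 x)
    * com x ^ 2) * hj

/-- The polynomial part of the family for `s ∈ Σ'`. -/
noncomputable def profileTilde (a : ℝ) (m : ℕ) (s : Spin N κ) : Wave N κ := fun x =>
  ladderWave a m 2 (waveTilde s) x + (-(kappa2 m / (N - 1))) • ladderWave a m 0 (sym0 s) x

/-- The coefficient of `Λ|s⟩` beyond the ladder over `waveTilde` is that of the second family
divided by `-(N - 1)`, so the same Jacobi relation applies. -/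
lemma psiTilde2_eq (hN : 2 ≤ N) (l m : ℕ) (hm : 2 ≤ m) (s : Spin N κ) (x : Pos N)
    (hx : com x ≠ 0) :
    psiTilde2 om a l m s x = gauge0 om a x • (laguerre l (-beta0 N a m) (om * psum 2 x) •
      profileTilde a m s x) := by
  have h2 := ladder_eq_jacobi (a := a) hm hx
  have h0 := ladder_eq_jacobi (a := a) (Nat.zero_le m) hx
  have hz := tvar_half x hx
  have hj := jacobi_relation_two (t := tvar x) hm (alpha0_add_beta0 (N := N) a m)
  have hs := sym11_eq hN s x
  have hN1 : (N : ℝ) - 1 ≠ 0 := by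
    have : (2 : ℝ) ≤ N := by exact_mod_cast hN
    intro h; linarith
  simp only [Nat.cast_zero, add_zero, Nat.sub_zero, Nat.cast_ofNat] at h0 h2
  rw [show (m - 2) / 2 = m / 2 - 1 by omega] at h2
  have hs' : sym11 s x - com x • symSum s x = waveTilde s x
      + (-(dispersion x / (N - 1)) - com x ^ 2) • sym0 s x := by
    rw [sub_smul, ← add_sub_assoc, ← hs]; abel
  simp only [psiTilde2, mu0, profileTilde, ladderWave, Nat.cast_zero, add_zero, Nat.sub_zero,
    Nat.cast_ofNat, ← h0, ← h2, hs']
  have hm' : com x ^ m = com x ^ (m - 2) * com x ^ 2 := by rw [← pow_add]; congr 1; omega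
  have hd : 2 * (alpha0 N a + 1) / ((2 * ((m - 1) / 2 : ℕ) + 1) * (N - 1)) =
    2 * (alpha0 N a + 1) / (2 * ((m - 1) / 2 : ℕ) + 1) * (N - 1 : ℝ)⁻¹ := by
    rw [← div_div, div_eq_mul_inv _ ((N : ℝ) - 1)]
  rw [hm', hz, hd, div_eq_mul_inv _ ((N : ℝ) - 1), div_eq_mul_inv _ ((N : ℝ) - 1)]
  rw [← kappa2] at hj
  match_scalars
  all_goals first | ring1 | skip
  linear_combination -(gauge0 om a x * com x ^ (m - 2) * laguerre l (-beta0 N a m) (om * psum 2 x)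
      * com x ^ 2 * ((N : ℝ) - 1)⁻¹) * hj

/-- The factor of `Λ|s⟩` in the fourth family. -/
noncomputable def kappa3 (m : ℕ) (α : ℝ) : ℝ :=
  if Even m then (m + 2 * α + 2) / (m - 1) else -(1 / (m * (m - 2)))

lemma kappa3_ne_zero {m : ℕ} (hm : 3 ≤ m) {α : ℝ} (hα : 0 < α) : kappa3 m α ≠ 0 := by
  have h : (3 : ℝ) ≤ m := by exact_mod_cast hm
  rw [kappa3]
  split_ifs
  · exact (div_pos (by linarith) (by linarith)).ne'
  · have : (0 : ℝ) < m * (m - 2) := mul_pos (by linarith) (by linarith)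
    exact neg_ne_zero.mpr (one_div_pos.mpr this).ne'

/-- The polynomial part of the fourth family. -/
noncomputable def profile3 (a : ℝ) (m : ℕ) (s : Spin N κ) : Wave N κ := fun x =>
  (2 / (3 * N) : ℝ) • ladderWave a m 3 (fun x => cubic x • sym0 s x) x
    + kappa3 m (alpha0 N a) • ladderWave a m 0 (sym0 s) x

lemma psi3_eq (hα : 0 < alpha0 N a) (l m : ℕ) (hm : 3 ≤ m) (s : Spin N κ) (x : Pos N)
    (hx : com x ≠ 0) :
    psi3 om a l m s x = gauge0 om a x • (laguerre l (-beta0 N a m) (om * psum 2 x) •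
      profile3 a m s x) := by
  have h3 := ladder_eq_jacobi (a := a) hm hx
  have h0 := ladder_eq_jacobi (a := a) (Nat.zero_le m) hx
  have hz := tvar_half x hx
  have hj := jacobi_relation_three (t := tvar x) hm (by linarith) (alpha0_add_beta0 (N := N) a m)
  simp only [Nat.cast_zero, add_zero, Nat.sub_zero, Nat.cast_ofNat] at h0 h3
  simp only [psi3, mu0, profile3, ladderWave, Nat.cast_zero, add_zero, Nat.sub_zero, Nat.cast_ofNat,
    ← h0, ← h3, psum_three_eq]
  have hm' : com x ^ m = com x ^ (m - 3) * com x ^ 3 := by rw [← pow_add]; congr 1; omega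
  rw [hm', hz]
  rw [← kappa3] at hj
  have hN : (N : ℝ) ≠ 0 := natCast_ne_zero
  match_scalars
  have hn : (2 / (3 * N) : ℝ) * N = 2 / 3 := by field_simp
  linear_combination (gauge0 om a x * com x ^ (m - 3) * laguerre l (-beta0 N a m) (om * psum 2 x)
      * com x ^ 3) * hj + (gauge0 om a x * com x ^ (m - 3) *
        laguerre l (-beta0 N a m) (om * psum 2 x) *
        jacobi ((m - 3) / 2) (alpha0 N a + 3) (beta0 N a m) (tvar x) *
        com x ^ 3 * (3 * ((tvar x - 1) / 2) + 1)) * hn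

/-- The factor of `wave2` in the fifth family. -/
noncomputable def kappa4 (m : ℕ) (α : ℝ) : ℝ :=
  3 * (m / 2 - 1 : ℕ) / ((2 * ((m - 3) / 2 : ℕ) + 1) * (α + 3))

/-- The factor of `wave1` in the fifth family. -/
noncomputable def kappa4' (m : ℕ) (α : ℝ) : ℝ :=
  if Even m then -(3 * (m + 2 * α + 2) / (2 * (m - 1) * (m - 3))) else 0

/-- The polynomial part of the fifth family. -/
noncomputable def profile4 (a : ℝ) (m : ℕ) (s : Spin N κ) : Wave N κ := fun x =>
  (-(1 / N) : ℝ) • ladderWave a m 4 (wave4 a s) x + kappa4 m (alpha0 N a) • ladderWave a m 2 (wave2 s) x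
    + kappa4' m (alpha0 N a) • ladderWave a m 1 (wave1 s) x

lemma psi4_eq (hα : 0 < alpha0 N a) (l m : ℕ) (hm : 4 ≤ m) (s : Spin N κ) (x : Pos N)
    (hx : com x ≠ 0) :
    psi4 om a l m s x = gauge0 om a x • (laguerre l (-beta0 N a m) (om * psum 2 x) •
      profile4 a m s x) := by
  have h4 := ladder_eq_jacobi (a := a) hm hx
  have h2 := ladder_eq_jacobi (a := a) (show 2 ≤ m by omega) hx
  have h1 := ladder_eq_jacobi (a := a) (show 1 ≤ m by omega) hx
  have hz := tvar_half x hx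
  obtain ⟨j1, j2, j3⟩ :=
    jacobi_relation_four (t := tvar x) hm (by linarith) (alpha0_add_beta0 (N := N) a m)
  rw [← kappa4] at j1
  rw [← kappa4'] at j2
  simp only [Nat.cast_one, Nat.cast_ofNat] at h1 h2 h4
  rw [show (m - 2) / 2 = m / 2 - 1 by omega] at h2
  rw [show (m - 4) / 2 = m / 2 - 2 by omega] at h4
  simp only [psi4, mu0, profile4, wave4, ladderWave, Nat.cast_one, Nat.cast_ofNat,
    ← h1, ← h2, ← h4, psum_three_eq, sym1_eq, sym2_eq]
  have hm2 : com x ^ (m - 2) = com x ^ (m - 4) * com x ^ 2 := by rw [← pow_add]; congr 1; omega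
  have hm1 : com x ^ (m - 1) = com x ^ (m - 4) * com x ^ 3 := by rw [← pow_add]; congr 1; omega
  rw [hm2, hm1, hz]
  have hN : (N : ℝ) ≠ 0 := natCast_ne_zero
  have hn : (1 / N : ℝ) * N = 1 := by field_simp
  have hn' : (3 * N / (2 * (alpha0 N a + 3)) : ℝ) = N * (3 / (2 * (alpha0 N a + 3))) := by ring
  rw [hn']
  set T := gauge0 om a x * com x ^ (m - 4) * laguerre l (-beta0 N a m) (om * psum 2 x) with hT
  set P := jacobi (m / 2 - 2) (alpha0 N a + 4) (beta0 N a m) (tvar x)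
  match_scalars
  · linear_combination (T * com x ^ 2) * j1 - (T * com x ^ 2 * ((tvar x - 1) / 2) * P
      * (3 / (2 * (alpha0 N a + 3)))) * hn
  · linear_combination (T * com x ^ 3) * j2
      - (T * com x ^ 3 * P * (3 * ((tvar x - 1) / 2) + 1)) * hn
  · linear_combination (T * com x ^ 4) * j3

end RationalFamilies

end NearNeighbour
namespace NearNeighbour
open scoped ContDiff
open MeasureTheory Filter Topology

variable {N κ : ℕ}

/-! ### Rational model: the six families of eigenfunctions -/

section RationalTheorems

variable [NeZero N] {a om : ℝ}

lemma leading_top {m d : ℕ} {f : Wave N κ} (hf : Invariant f) (x : Pos N) :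
    Leading (ladderWave a m d f) x (m - d)
      (gbinom (((m - d) / 2 : ℕ) + (alpha0 N a + d)) ((m - d) / 2) • f x) := by
  have h := leading_ladderWave (a := a) (m := m) (d := d) le_rfl hf x
  rwa [if_pos rfl] at h

lemma leading_lower {m d E : ℕ} (hE : m - d < E) {f : Wave N κ} (hf : Invariant f) (x : Pos N) :
    Leading (ladderWave a m d f) x E 0 := by
  have h := leading_ladderWave (a := a) hE.le hf x
  rwa [if_neg hE.ne, zero_smul] at h

omit [NeZero N] in
lemma leadingCoeff_ne_zero (hα : 0 < alpha0 N a) (n d : ℕ) : gbinom (n + (alpha0 N a + d)) n ≠ 0 :=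
  gbinom_add_ne_zero n (by have := d.cast_nonneg (α := ℝ); linarith)

lemma leading_ground {m : ℕ} (s : Spin N κ) (x : Pos N) :
    Leading (ladderWave a m 0 (sym0 s)) x m
      (gbinom ((m / 2 : ℕ) + (alpha0 N a + (0 : ℕ))) (m / 2) • sym0 s x) :=
  leading_top (m := m) (d := 0) (invariant_sym0 s) x

lemma rationalHarm_ground (hN : 2 ≤ N) (m : ℕ) (s : Spin N κ) :
    RationalHarm a (ladderWave a m 0 (sym0 s)) m :=
  rationalHarm_ladder hN (Nat.zero_le m) (rationalHarm_sym0 s) (invariant_sym0 s)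

theorem rational_psi0 (hN : 2 ≤ N) (ha : 1 / 2 < a) (hom : 0 < om) (s : Spin N κ) (l m : ℕ) :
    ExtendsToEigenfunction (H0 om a) (C0 N) (psi0 om a l m s)
        (ground0 N om a + 2 * om * (2 * l + m)) ∧
      (sym0 s ≠ 0 → Nonvanishing (C0 N) (psi0 om a l m s)) := by
  have ha0 : 0 < a := by linarith
  refine ⟨rational_extends hN ha0 hom (rationalHarm_ground hN m s)
    (temperate_ladderWave (homog_sym0 s)) l (psi0_eq l m s), fun hs => ?_⟩
  obtain ⟨x, hx⟩ := C0_nonempty (N := N)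
  exact rational_nonvanishing hN ha0 hom (psi0_eq l m s) hx ((leading_ground s x).eventually_ne
    (smul_ne_zero (leadingCoeff_ne_zero (alpha0_pos hN ha) _ _) (sym0_ne_zero hs x)))

theorem rational_psi1 (hN : 2 ≤ N) (ha : 1 / 2 < a) (hom : 0 < om) (s : Spin N κ) (l m : ℕ)
    (hm : 1 ≤ m) :
    ExtendsToEigenfunction (H0 om a) (C0 N) (psi1 om a l m s)
        (ground0 N om a + 2 * om * (2 * l + m)) ∧
      ((∃ i j, spinOne s i ≠ spinOne s j) → Nonvanishing (C0 N) (psi1 om a l m s)) := by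
  have ha0 : 0 < a := by linarith
  refine ⟨rational_extends hN ha0 hom
    (rationalHarm_ladder hN hm (rationalHarm_wave1 hN s) (invariant_wave1 s))
    (temperate_ladderWave (homog_wave1 s)) l (psi1_eq l m hm s), fun hs => ?_⟩
  obtain ⟨x, hx, hne⟩ := exists_wave1_ne_zero isOpen_C0 (C0_nonempty (N := N)) hs
  exact rational_nonvanishing hN ha0 hom (psi1_eq l m hm s) hx ((leading_top (invariant_wave1 s) x).eventually_ne
    (smul_ne_zero (leadingCoeff_ne_zero (alpha0_pos hN ha) _ _) hne))

/-- Under large translations the ladder over `Λ|s⟩` is of order `u ^ m` and dominates the rest,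
since every other seed has positive degree and leaves fewer powers of the centre of mass. -/
lemma nonvanishing_of_ground (hN : 2 ≤ N) (ha : 1 / 2 < a) (hom : 0 < om) {s : Spin N κ}
    (hs : sym0 s ≠ 0) {l m : ℕ} {c : ℝ} (hc : c ≠ 0) {f Ψ : Wave N κ}
    (hf : ∀ x, Leading f x m 0)
    (hΨ : ∀ x, com x ≠ 0 → Ψ x = gauge0 om a x • (laguerre l (-beta0 N a m) (om * psum 2 x) •
      (f x + c • ladderWave a m 0 (sym0 s) x))) :
    Nonvanishing (C0 N) Ψ := by
  obtain ⟨x, hx⟩ := C0_nonempty (N := N)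
  have hl := (hf x).add ((leading_ground (a := a) (m := m) s x).const_smul c)
  refine rational_nonvanishing hN (by linarith) hom hΨ hx (hl.eventually_ne ?_)
  rw [zero_add]
  exact smul_ne_zero hc
    (smul_ne_zero (leadingCoeff_ne_zero (alpha0_pos hN ha) _ _) (sym0_ne_zero hs x))

theorem rational_psi2 (hN : 2 ≤ N) (ha : 1 / 2 < a) (hom : 0 < om) (s : Spin N κ) (l m : ℕ)
    (hm : 2 ≤ m) :
    ExtendsToEigenfunction (H0 om a) (C0 N) (psi2 om a l m s)
        (ground0 N om a + 2 * om * (2 * l + m)) ∧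
      (sym0 s ≠ 0 → Nonvanishing (C0 N) (psi2 om a l m s)) := by
  refine ⟨rational_extends (f := profile2 a m s) hN (by linarith) hom ?_ ?_ l (psi2_eq l m hm s),
    fun hs => ?_⟩
  · exact (rationalHarm_ladder hN hm (rationalHarm_wave2 hN s) (invariant_wave2 s)).add
      ((rationalHarm_ground hN m s).const_smul _)
  · exact (temperate_ladderWave (homog_wave2 s)).fun_add
      ((Function.HasTemperateGrowth.const _).fun_smul (temperate_ladderWave (homog_sym0 s)))
  · exact nonvanishing_of_ground hN ha hom hs (kappa2_ne_zero hm)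
      (fun x => leading_lower (by omega) (invariant_wave2 s) x) (psi2_eq l m hm s)

theorem rational_psiTilde2 (hN : 2 ≤ N) (ha : 1 / 2 < a) (hom : 0 < om) (s : Spin N κ) (l m : ℕ)
    (hm : 2 ≤ m) (hs : s ∈ SpinPrime N κ) :
    ExtendsToEigenfunction (H0 om a) (C0 N) (psiTilde2 om a l m s)
        (ground0 N om a + 2 * om * (2 * l + m)) ∧
      (sym0 s ≠ 0 → Nonvanishing (C0 N) (psiTilde2 om a l m s)) := by
  refine ⟨rational_extends (f := profileTilde a m s) hN (by linarith) hom ?_ ?_ l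
    (psiTilde2_eq hN l m hm s), fun hs => ?_⟩
  · exact (rationalHarm_ladder hN hm (rationalHarm_waveTilde hN hs) (invariant_waveTilde s)).add
      ((rationalHarm_ground hN m s).const_smul _)
  · exact (temperate_ladderWave (homog_waveTilde s)).fun_add
      ((Function.HasTemperateGrowth.const _).fun_smul (temperate_ladderWave (homog_sym0 s)))
  · have hN1 : (N : ℝ) - 1 ≠ 0 := by
      have : (2 : ℝ) ≤ N := by exact_mod_cast hN
      intro h; linarith
    exact nonvanishing_of_ground hN ha hom hs
      (neg_ne_zero.mpr (div_ne_zero (kappa2_ne_zero hm) hN1))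
      (fun x => leading_lower (by omega) (invariant_waveTilde s) x) (psiTilde2_eq hN l m hm s)

theorem rational_psi3 (hN : 2 ≤ N) (ha : 1 / 2 < a) (hom : 0 < om) (s : Spin N κ) (l m : ℕ)
    (hm : 3 ≤ m) :
    ExtendsToEigenfunction (H0 om a) (C0 N) (psi3 om a l m s)
        (ground0 N om a + 2 * om * (2 * l + m)) ∧
      (sym0 s ≠ 0 → Nonvanishing (C0 N) (psi3 om a l m s)) := by
  have hα := alpha0_pos hN ha
  have hi : Invariant fun x : Pos N => cubic x • sym0 s x := fun c x => by
    simp only [invariant_cubic c x, invariant_sym0 s c x]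
  refine ⟨rational_extends (f := profile3 a m s) hN (by linarith) hom ?_ ?_ l (psi3_eq hα l m hm s),
    fun hs => ?_⟩
  · exact ((rationalHarm_ladder hN hm (rationalHarm_cubic hN s) hi).const_smul _).add
      ((rationalHarm_ground hN m s).const_smul _)
  · exact ((Function.HasTemperateGrowth.const _).fun_smul
      (temperate_ladderWave (homog_cubic.smul (homog_sym0 s)))).fun_add
      ((Function.HasTemperateGrowth.const _).fun_smul (temperate_ladderWave (homog_sym0 s)))
  · refine nonvanishing_of_ground hN ha hom hs (kappa3_ne_zero hm hα) (fun x => ?_)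
      (psi3_eq hα l m hm s)
    have := (leading_lower (a := a) (m := m) (d := 3) (E := m) (by omega) hi x).const_smul (2 / (3 * N))
    rwa [smul_zero] at this

theorem rational_psi4 (hN : 2 ≤ N) (ha : 1 / 2 < a) (hom : 0 < om) (s : Spin N κ) (l m : ℕ)
    (hm : 4 ≤ m) :
    ExtendsToEigenfunction (H0 om a) (C0 N) (psi4 om a l m s)
        (ground0 N om a + 2 * om * (2 * l + m)) ∧
      (3 ≤ N → (∃ i j, spinOne s i ≠ spinOne s j) → Nonvanishing (C0 N) (psi4 om a l m s)) := by
  have ha0 : 0 < a := by linarith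
  have hα := alpha0_pos hN ha
  have hm' : (4 : ℝ) ≤ m := by exact_mod_cast hm
  refine ⟨rational_extends (f := profile4 a m s) hN ha0 hom ?_ ?_ l (psi4_eq hα l m hm s),
    fun hN3 hs => ?_⟩
  · exact (((rationalHarm_ladder hN hm (rationalHarm_wave4 hN ha0 s)
      (invariant_wave4 a s)).const_smul _).add ((rationalHarm_ladder hN (by omega)
      (rationalHarm_wave2 hN s) (invariant_wave2 s)).const_smul _)).add
      ((rationalHarm_ladder hN (by omega) (rationalHarm_wave1 hN s) (invariant_wave1 s)).const_smul _)
  · exact (((Function.HasTemperateGrowth.const _).fun_smul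
      (temperate_ladderWave (homog_wave4 a s))).fun_add
      ((Function.HasTemperateGrowth.const _).fun_smul
        (temperate_ladderWave (homog_wave2 s)))).fun_add
      ((Function.HasTemperateGrowth.const _).fun_smul (temperate_ladderWave (homog_wave1 s)))
  · have h4 : ∀ x E, m - 4 < E → Leading (fun x => (-(1 / N) : ℝ) •
        ladderWave a m 4 (wave4 a s) x) x E 0 := fun x E hE => by
      have := (leading_lower (a := a) hE (invariant_wave4 a s) x).const_smul (-(1 / N))
      rwa [smul_zero] at this
    -- For even `m` the `wave1` part leads, with order `u ^ (m - 1)`. For odd `m` its coefficient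
    -- `kappa4'` is zero and the `wave2` part leads, with order `u ^ (m - 2)`; this is where `N ≥ 3`
    -- enters.
    by_cases he : Even m
    · obtain ⟨x, hx, hne⟩ := exists_wave1_ne_zero isOpen_C0 (C0_nonempty (N := N)) hs
      have h2 : Leading (ladderWave a m 2 (wave2 s)) x (m - 1) 0 :=
        leading_lower (by omega) (invariant_wave2 s) x
      have hl := ((h4 x (m - 1) (by omega)).add (h2.const_smul (kappa4 m (alpha0 N a)))).add
        ((leading_top (a := a) (m := m) (invariant_wave1 s) x).const_smul (kappa4' m (alpha0 N a)))
      refine rational_nonvanishing hN ha0 hom (psi4_eq hα l m hm s) hx (hl.eventually_ne ?_)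
      rw [smul_zero, zero_add, zero_add]
      refine smul_ne_zero ?_ (smul_ne_zero (leadingCoeff_ne_zero hα _ _) hne)
      rw [kappa4', if_pos he]
      exact neg_ne_zero.mpr (div_ne_zero (by positivity)
        (mul_ne_zero (mul_ne_zero two_ne_zero (by linarith)) (by linarith)))
    · obtain ⟨x, hx, hne⟩ := exists_wave2_ne_zero hN3 hs
      have hz : Leading (fun x => kappa4' m (alpha0 N a) • ladderWave a m 1 (wave1 s) x) x (m - 2)
          0 := by
        rw [kappa4', if_neg he]
        simp [Leading]
      have hl := ((h4 x (m - 2) (by omega)).add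
        ((leading_top (a := a) (m := m) (invariant_wave2 s) x).const_smul (kappa4 m (alpha0 N a)))).add hz
      refine rational_nonvanishing hN ha0 hom (psi4_eq hα l m hm s) hx (hl.eventually_ne ?_)
      rw [zero_add, add_zero]
      refine smul_ne_zero ?_ (smul_ne_zero (leadingCoeff_ne_zero hα _ _) hne)
      have : ((m / 2 - 1 : ℕ) : ℝ) ≠ 0 := Nat.cast_ne_zero.mpr (by omega)
      rw [kappa4]
      positivity

end RationalTheorems

end NearNeighbour
namespace NearNeighbour
open scoped ContDiff
open MeasureTheory Filter Topology

variable {N κ : ℕ}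

/-! ## The model with inverse square external potential -/

section RadialGauge

lemma mem_C1_iff (x : Pos N) :
    x ∈ C1 N ↔ ∀ p : {p : Fin N × Fin N // p.1 < p.2} ⊕ Fin N,
      0 < p.elim (fun p => x p.1.2 - x p.1.1) fun i => x i :=
  ⟨fun h p => p.casesOn (fun p => sub_pos.mpr (h.1 p.2)) h.2,
    fun h => ⟨(mem_C0_iff x).mpr fun p => h (Sum.inl p), fun i => h (Sum.inr i)⟩⟩

lemma isOpen_C1 : IsOpen (C1 N) := by
  have : C1 N = C0 N ∩ ⋂ i, {x | 0 < x i} := by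
    ext x
    simp [C1, C0]
  rw [this]
  exact isOpen_C0.inter
    (isOpen_iInter_of_finite fun i => isOpen_lt continuous_const (continuous_apply i))

lemma C1_nonempty : (C1 N).Nonempty :=
  ⟨fun i => (i : ℝ) + 1, fun i j h => by simpa using h, fun i => by positivity⟩

variable [NeZero N]

/-- `1 / (x_i² - x_{i+1}²)`. -/
noncomputable def sqLink (i : Fin N) (x : Pos N) : ℝ := (x i ^ 2 - x (i + 1) ^ 2)⁻¹

/-- The gradient of the logarithm of `∏ |x_i² - x_{i+1}²|^a x_i^b`. -/
noncomputable def radialF (a b : ℝ) (i : Fin N) (x : Pos N) : ℝ :=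
  b * (x i)⁻¹ + 2 * a * x i * (sqLink i x - sqLink (i - 1) x)

/-- Weights of the spin exchange terms. -/
noncomputable def radialW (a : ℝ) (i : Fin N) (x : Pos N) : ℝ :=
  4 * a * ((x i ^ 2 + x (i + 1) ^ 2) * sqLink i x ^ 2)

lemma sqLink_ne_zero (hN : 2 ≤ N) {x : Pos N} (hx : x ∈ C1 N) (i : Fin N) :
    x i ^ 2 - x (i + 1) ^ 2 ≠ 0 := by
  rw [sq_sub_sq]
  exact mul_ne_zero (add_pos (hx.2 i) (hx.2 (i + 1))).ne' (link_ne_zero hN hx.1 i)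

lemma sum_radialF {E : Type*} [NormedAddCommGroup E] [NormedSpace ℝ E] (a b : ℝ) (g : Fin N → E)
    (x : Pos N) :
    ∑ i, radialF a b i x • g i = b • ∑ i, (x i)⁻¹ • g i +
      (2 * a) • ∑ i, sqLink i x • (x i • g i - x (i + 1) • g (i + 1)) := by
  have e : ∑ i, sqLink (i - 1) x • x i • g i = ∑ i, sqLink i x • x (i + 1) • g (i + 1) := by
    rw [← sum_shift]
    simp
  have e1 : ∀ i, radialF a b i x • g i = b • (x i)⁻¹ • g i + (2 * a) • (sqLink i x • x i • g i)
      - (2 * a) • (sqLink (i - 1) x • x i • g i) := fun i => by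
    rw [radialF]; module
  simp only [e1, smul_sub, Finset.sum_add_distrib, Finset.sum_sub_distrib, ← Finset.smul_sum, e]
  module

lemma sum_radialF_mul (a b : ℝ) (g : Fin N → ℝ) (x : Pos N) :
    ∑ i, radialF a b i x * g i = b * ∑ i, (x i)⁻¹ * g i +
      2 * a * ∑ i, sqLink i x * (x i * g i - x (i + 1) * g (i + 1)) :=
  sum_radialF a b g x

lemma sum_radialF_coord (hN : 2 ≤ N) (a b : ℝ) {x : Pos N} (hx : x ∈ C1 N) :
    ∑ i, radialF a b i x * x i = b * N + 2 * a * N := by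
  rw [sum_radialF_mul]
  have e1 : ∀ i, (x i)⁻¹ * x i = 1 := fun i => inv_mul_cancel₀ (hx.2 i).ne'
  have e2 : ∀ i, sqLink i x * (x i * x i - x (i + 1) * x (i + 1)) = 1 := fun i => by
    rw [← sq, ← sq, sqLink, inv_mul_cancel₀ (sqLink_ne_zero hN hx i)]
  simp [e1, e2]

lemma hasPD_sqLink (hN : 2 ≤ N) {x : Pos N} (hx : x ∈ C1 N) (i k : Fin N) :
    HasPD i (sqLink k) (-(sqLink k x) ^ 2 * (2 * x k * (if i = k then 1 else 0)
      - 2 * x (k + 1) * (if i = k + 1 then 1 else 0))) x := by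
  have h := (((HasPD.coord (i := i) (x := x) k).pow 2).sub
    ((HasPD.coord (i := i) (x := x) (k + 1)).pow 2)).inv (sqLink_ne_zero hN hx k)
  refine HasPD.congr h ?_
  rw [sqLink]
  field_simp [sqLink_ne_zero hN hx k]
  norm_num

/-- Compared with the rational gauge there are new terms: the mixed products of `b / x_i` with the
links, together with the first-order terms from differentiating `x_i`, are multiples of `sqLink i -
sqLink (i - 1)`, and their sum around the cycle telescopes to zero. -/
theorem mu1_isGauge (hN : 2 ≤ N) {a b om : ℝ} (ha : 0 < a) :
    Gauge (κ := κ) (C1 N) (V1 om a b) (mu1 om a b)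
      (fun x => om ^ 2 * psum 2 x + ∑ i, b * (b - 1) * (x i)⁻¹ ^ 2
        - ∑ i, 8 * a ^ 2 * x i ^ 2 * (sqLink (i - 1) x * sqLink i x)
        + ∑ i, 4 * a * (a - 1) * ((x i ^ 2 + x (i + 1) ^ 2) * sqLink i x ^ 2))
      (fun i x => radialF a b i x - om * x i)
      (fun i x => -b * (x i)⁻¹ ^ 2 + 2 * a * (sqLink i x - sqLink (i - 1) x)
        - 4 * a * x i ^ 2 * (sqLink i x ^ 2 + sqLink (i - 1) x ^ 2) - om)
      (radialW a) (ground1 N om a b) := by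
  have hl : ∀ i : Fin N, ContinuousOn (sqLink i) (C1 N) := fun i =>
    ContinuousOn.inv₀ (by fun_prop) fun x hx => sqLink_ne_zero hN hx i
  have hi : ∀ i : Fin N, ContinuousOn (fun x : Pos N => (x i)⁻¹) (C1 N) := fun i =>
    ContinuousOn.inv₀ (by fun_prop) fun x hx => (hx.2 i).ne'
  have hp : ∀ x ∈ C1 N, ∀ i, 0 < |x i ^ 2 - x (i + 1) ^ 2| ^ a * x i ^ b := fun x hx i =>
    mul_pos (Real.rpow_pos_of_pos (abs_pos.mpr (sqLink_ne_zero hN hx i)) a)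
      (Real.rpow_pos_of_pos (hx.2 i) b)
  have hc : ∀ i, Continuous fun x : Pos N => x i := fun i => continuous_apply i
  refine ⟨isOpen_C1, fun x hx => mul_pos (Real.exp_pos _) (Finset.prod_pos fun i _ => hp x hx i),
    ?_, ?_, ?_, ?_, ?_, ?_, ?_, ?_⟩
  · refine ContDiffOn.mul ((contDiff_const.mul (contDiff_psum 2)).exp).contDiffOn ?_
    refine contDiffOn_prod fun i _ x hx => ?_
    refine ContDiffAt.contDiffWithinAt (ContDiffAt.mul ?_ ?_)
    · exact ((linkFactor_rational a).smooth _ (sqLink_ne_zero hN hx i)).comp x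
        (f := fun x : Pos N => x i ^ 2 - x (i + 1) ^ 2) (by fun_prop)
    · exact ContDiffAt.rpow_const_of_ne (by fun_prop) (hx.2 i).ne'
  · intro x hx i
    have h1 := ((hasPD_psum 2 i x).const_mul (-(om / 2))).exp
    have h2 := HasPD.prod (s := Finset.univ) (i := i) (x := x)
      (g := fun k (x : Pos N) => |x k ^ 2 - x (k + 1) ^ 2| ^ a * x k ^ b)
      (F := fun k => 2 * a * sqLink k x * (x k * (if i = k then 1 else 0)
        - x (k + 1) * if i = k + 1 then 1 else 0) + b * (x k)⁻¹ * (if i = k then 1 else 0))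
      fun k _ => by
        have h3 := HasPD.comp ((linkFactor_rational a).deriv _ (sqLink_ne_zero hN hx k))
          (((HasPD.coord (i := i) (x := x) k).pow 2).sub
            ((HasPD.coord (i := i) (x := x) (k + 1)).pow 2))
        have h4 := HasPD.comp (Real.hasDerivAt_rpow_const (p := b) (Or.inl (hx.2 k).ne'))
          (HasPD.coord (i := i) (x := x) k)
        refine (h3.mul h4).congr ?_
        rw [Real.rpow_sub_one (hx.2 k).ne', sqLink]
        norm_num only [pow_one]
        ring
    refine (h1.mul h2).congr ?_
    have e1 : ∑ k, (2 * a * sqLink k x * (x k * (if i = k then 1 else 0)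
        - x (k + 1) * if i = k + 1 then 1 else 0) + b * (x k)⁻¹ * (if i = k then 1 else 0)) =
        radialF a b i x := by
      have e2 : ∀ k, (i = k + 1) = (i - 1 = k) := fun k => by rw [sub_eq_iff_eq_add]
      simp only [mul_sub, Finset.sum_sub_distrib, Finset.sum_add_distrib, mul_ite, mul_one, mul_zero,
        Finset.sum_ite_eq, Finset.mem_univ, if_true, e2]
      rw [sub_add_cancel, radialF]
      ring
    rw [e1, mu1]
    norm_num
    ring
  · intro x hx i
    have hxi := HasPD.coord (i := i) (x := x) i
    have h1 := ((hxi.inv (hx.2 i).ne').const_mul b).add ((hxi.const_mul (2 * a)).mul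
      ((hasPD_sqLink hN hx i i).sub (hasPD_sqLink hN hx i (i - 1))))
    refine (h1.sub (hxi.const_mul om)).congr ?_
    have n1 : i ≠ i + 1 := fin_ne_add_one hN i
    have n2 : i ≠ i - 1 := fun h' => fin_ne_add_one hN (i - 1) (by rw [sub_add_cancel]; exact h'.symm)
    rw [sub_add_cancel, if_pos rfl, if_neg n1, if_neg n2]
    field_simp [(hx.2 i).ne']
    ring
  · intro i
    exact (((continuousOn_const.mul ((hi i).pow 2)).add (continuousOn_const.mul
      ((hl i).sub (hl (i - 1))))).sub ((continuousOn_const.mul ((hc i).continuousOn.pow 2)).mul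
      (((hl i).pow 2).add ((hl (i - 1)).pow 2)))).sub continuousOn_const
  · intro i
    exact continuousOn_const.mul ((((hc i).continuousOn.pow 2).add
      ((hc (i + 1)).continuousOn.pow 2)).mul ((hl i).pow 2))
  · intro x hx i
    unfold radialW
    positivity
  · intro x hx v
    have e : ∀ i, (4 * a * ((x i ^ 2 + x (i + 1) ^ 2) / (x i ^ 2 - x (i + 1) ^ 2) ^ 2)) •
        (a • v - exchange i (i + 1) v) =
        (4 * a * (a - 1) * ((x i ^ 2 + x (i + 1) ^ 2) * sqLink i x ^ 2)) • v
          + radialW a i x • (v - exchange i (i + 1) v) := fun i => by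
      rw [radialW, sqLink, inv_pow, div_eq_mul_inv]; module
    have e1 : ∀ i, 8 * a ^ 2 * x i ^ 2 / ((x i ^ 2 - x (i - 1) ^ 2) * (x i ^ 2 - x (i + 1) ^ 2)) =
        -(8 * a ^ 2 * x i ^ 2 * (sqLink (i - 1) x * sqLink i x)) := fun i => by
      rw [sqLink, sqLink, sub_add_cancel, div_eq_mul_inv, mul_inv,
        ← neg_sub (x (i - 1) ^ 2) (x i ^ 2), inv_neg]
      ring
    rw [V1]
    simp only [e]
    simp only [e1, div_eq_mul_inv, ← inv_pow]
    rw [Finset.sum_add_distrib, ← Finset.sum_smul, Finset.sum_neg_distrib]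
    module
  · intro x hx
    have e1 := sum_radialF_coord hN a b hx
    have e3 : ∑ i, x i ^ 2 * sqLink (i - 1) x ^ 2 = ∑ i, x (i + 1) ^ 2 * sqLink i x ^ 2 := by
      rw [← sum_shift]
      exact Finset.sum_congr rfl fun i _ => by rw [add_sub_cancel_right]
    have e6 : ∑ i, sqLink (i - 1) x = ∑ i, sqLink i x := by
      rw [← sum_shift]
      exact Finset.sum_congr rfl fun i _ => by rw [add_sub_cancel_right]
    have e4 : ∀ i, -b * (x i)⁻¹ ^ 2 + 2 * a * (sqLink i x - sqLink (i - 1) x)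
        - 4 * a * x i ^ 2 * (sqLink i x ^ 2 + sqLink (i - 1) x ^ 2) - om
        + (radialF a b i x - om * x i) ^ 2 =
        -om + b * (b - 1) * (x i)⁻¹ ^ 2 + (2 * a + 4 * a * b) * sqLink i x
          - (2 * a + 4 * a * b) * sqLink (i - 1) x
          + 4 * a * (a - 1) * (x i ^ 2 * sqLink i x ^ 2)
          + 4 * a * (a - 1) * (x i ^ 2 * sqLink (i - 1) x ^ 2)
          - 8 * a ^ 2 * (x i ^ 2 * (sqLink (i - 1) x * sqLink i x))
          - 2 * om * (radialF a b i x * x i) + om ^ 2 * x i ^ 2 := fun i => by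
      have : x i * (x i)⁻¹ = 1 := mul_inv_cancel₀ (hx.2 i).ne'
      rw [radialF]
      linear_combination (4 * a * b * (sqLink i x - sqLink (i - 1) x)) * this
    have e7 : ∑ i, 4 * a * (a - 1) * ((x i ^ 2 + x (i + 1) ^ 2) * sqLink i x ^ 2) =
        4 * a * (a - 1) * (∑ i, x i ^ 2 * sqLink i x ^ 2 + ∑ i, x (i + 1) ^ 2 * sqLink i x ^ 2) := by
      simp only [add_mul, ← Finset.mul_sum, Finset.sum_add_distrib]
    have e8 : ∑ i, 8 * a ^ 2 * x i ^ 2 * (sqLink (i - 1) x * sqLink i x) =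
        8 * a ^ 2 * ∑ i, x i ^ 2 * (sqLink (i - 1) x * sqLink i x) := by
      simp only [mul_assoc, ← Finset.mul_sum]
    rw [e7, e8, Finset.sum_congr rfl fun i _ => e4 i]
    simp only [Finset.sum_add_distrib, Finset.sum_sub_distrib, ← Finset.mul_sum, e1, e3, e6,
      Finset.sum_const, Finset.card_univ, Fintype.card_fin, nsmul_eq_mul]
    have e5 : ∑ i, x i ^ 2 = psum 2 x := rfl
    rw [e5, ground1]
    ring

end RadialGauge

end NearNeighbour
namespace NearNeighbour
open scoped ContDiff
open MeasureTheory Filter Topology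

variable {N κ : ℕ}

/-! ### Model with inverse square external potential: ground state energy and eigenfunctions -/

section RadialEigen

/-- The points with coordinates `c + t i`, `t > 0`, are ordered and tend to the diagonal point as `t
→ 0`, so conditions holding near that point can be met inside the configuration space. -/
lemma exists_mem_C0_near_diagonal {p : Pos N → Prop} (c : ℝ) (h : ∀ᶠ x in 𝓝 (fun _ => c), p x) :
    ∃ x ∈ C0 N, p x := by
  have ht : Tendsto (fun t : ℝ => fun i : Fin N => c + t * i) (𝓝[>] 0) (𝓝 fun _ => c) := by
    have h1 : Continuous fun t : ℝ => fun i : Fin N => c + t * (i : ℝ) := by fun_prop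
    simpa using (h1.tendsto 0).mono_left nhdsWithin_le_nhds
  obtain ⟨t, ht, h0⟩ := ((ht.eventually h).and self_mem_nhdsWithin).exists
  exact ⟨_, fun i j hij => by simpa using mul_lt_mul_of_pos_left (Nat.cast_lt.mpr hij) h0, ht⟩

variable [NeZero N] {a b om : ℝ}

lemma radial_factor_le (ha : 0 ≤ a) (hb : 0 ≤ b) {x : Pos N} (hx : x ∈ C1 N) (i : Fin N) :
    |x i + x (i + 1)| ^ a * x i ^ b ≤ (2 * (1 + ‖x‖)) ^ (⌈a⌉₊ + ⌈b⌉₊) := by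
  have h1 := norm_le_pi_norm x i
  have h2 := norm_le_pi_norm x (i + 1)
  rw [Real.norm_eq_abs] at h1 h2
  have h3 := hx.2 i
  rw [pow_add]
  refine mul_le_mul (rpow_le_growth ha (abs_nonneg _) ?_) (rpow_le_growth hb h3.le ?_)
    (Real.rpow_nonneg h3.le b) (by positivity)
  · linarith [abs_add_le (x i) (x (i + 1))]
  · linarith [le_abs_self (x i), abs_nonneg (x i)]

omit [NeZero N] in
lemma abs_sq_sub_rpow (s t : ℝ) : |s ^ 2 - t ^ 2| ^ a = |s - t| ^ a * |s + t| ^ a := by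
  rw [← Real.mul_rpow (abs_nonneg _) (abs_nonneg _), ← abs_mul, mul_comm, sq_sub_sq]

lemma mu1_factor_le (ha : 0 ≤ a) (hb : 0 ≤ b) {x : Pos N} (hx : x ∈ C1 N) (i : Fin N) :
    |x i ^ 2 - x (i + 1) ^ 2| ^ a * x i ^ b ≤ (2 * (1 + ‖x‖)) ^ (2 * ⌈a⌉₊ + ⌈b⌉₊) := by
  rw [abs_sq_sub_rpow, mul_assoc, show 2 * ⌈a⌉₊ + ⌈b⌉₊ = ⌈a⌉₊ + (⌈a⌉₊ + ⌈b⌉₊) by ring, pow_add]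
  have h3 := hx.2 i
  exact mul_le_mul (gauge0_factor_le ha x i) (radial_factor_le ha hb hx i)
    (mul_nonneg (Real.rpow_nonneg (abs_nonneg _) _) (Real.rpow_nonneg h3.le b)) (by positivity)

lemma mu1_factor_nonneg {x : Pos N} (hx : x ∈ C1 N) (i : Fin N) :
    0 ≤ |x i ^ 2 - x (i + 1) ^ 2| ^ a * x i ^ b :=
  mul_nonneg (Real.rpow_nonneg (abs_nonneg _) _) (Real.rpow_nonneg (hx.2 i).le b)

lemma abs_mu1_le (ha : 0 ≤ a) (hb : 0 ≤ b) {x : Pos N} (hx : x ∈ C1 N) :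
    |mu1 om a b x| ≤ 2 ^ ((2 * ⌈a⌉₊ + ⌈b⌉₊) * N) * (1 + ‖x‖) ^ ((2 * ⌈a⌉₊ + ⌈b⌉₊) * N) *
      Real.exp (-(om / 2) * psum 2 x) := by
  have h0 : 0 ≤ ∏ i, (|x i ^ 2 - x (i + 1) ^ 2| ^ a * x i ^ b) :=
    Finset.prod_nonneg fun i _ => mu1_factor_nonneg hx i
  rw [mu1, abs_of_nonneg (mul_nonneg (Real.exp_pos _).le h0), mul_comm, ← mul_pow, pow_mul]
  gcongr
  have := Finset.prod_le_prod (s := Finset.univ) (fun i _ => mu1_factor_nonneg (a := a) (b := b) hx i)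
    fun i _ => mu1_factor_le ha hb hx i
  rwa [Finset.prod_const, Finset.card_univ, Fintype.card_fin] at this

theorem isGroundStateEnergy_H1 (hN : 2 ≤ N) (ha : 1 / 2 < a) (hom : 0 < om) (hb : 1 / 2 < b) :
    IsGroundStateEnergy (H1 om a b : Wave N κ → Wave N κ) (C1 N) (ground1 N om a b) := by
  have ha0 : 0 ≤ a := by linarith
  have hb0 : 0 ≤ b := by linarith
  obtain ⟨B, hB, hB'⟩ := exists_pow_mul_exp_le (N := N) (half_pos hom) ((2 * ⌈a⌉₊ + ⌈b⌉₊) * N)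
  refine (mu1_isGauge (κ := κ) hN (by linarith : 0 < a)).isGroundStateEnergy C1_nonempty
    (d := fun (p : {p : Fin N × Fin N // p.1 < p.2} ⊕ Fin N) x =>
      p.elim (fun p => x p.1.2 - x p.1.1) fun i => x i) ?_ mem_C1_iff
    (B := 2 ^ ((2 * ⌈a⌉₊ + ⌈b⌉₊) * N) * B)
    (fun x hx => (le_abs_self _).trans ((abs_mu1_le ha0 hb0 hx).trans ?_))
    (e := fun p => p.elim (fun _ => a) fun _ => b) ?_ fun R => ?_
  · rintro (p | i)
    · simpa using isWall_sub p.2.ne 0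
    -- The wall `x_i = 0` is of the required form with `λ = 0`; the second index is irrelevant but
    -- has to be different from `i`.
    · exact ⟨i + 1, i, (fin_ne_add_one hN i).symm, 0, 0, by simp, fun x => by simp⟩
  · rw [mul_assoc]
    gcongr
    exact hB' x
  · rintro (p | i)
    exacts [ha, hb]
  · set k := 2 * ⌈a⌉₊ + ⌈b⌉₊ with hk
    refine ⟨(2 * (1 + √R)) ^ k * ((2 * (1 + √R)) ^ k) ^ (N - 1), fun x hx hR p => ?_⟩
    have h0 : 0 ≤ psum 2 x := (sq_nonneg _).trans (sq_norm_le_psum x)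
    have hL : (1 : ℝ) ≤ 2 * (1 + ‖x‖) := by linarith [norm_nonneg x]
    -- One small factor suffices. It is applied with `c = d ^ a` for a collision and with `c = x_i ^
    -- b` at the origin.
    have key : ∀ (i : Fin N) {c : ℝ}, 0 ≤ c →
        |x i ^ 2 - x (i + 1) ^ 2| ^ a * x i ^ b ≤ c * (2 * (1 + ‖x‖)) ^ k →
        mu1 om a b x ≤ (2 * (1 + √R)) ^ k * ((2 * (1 + √R)) ^ k) ^ (N - 1) * c := by
      intro i c hc h
      have hp := prod_le_mul_pow (s := Finset.univ)
        (g := fun i => |x i ^ 2 - x (i + 1) ^ 2| ^ a * x i ^ b)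
        (fun i _ => mu1_factor_nonneg hx i) (fun i _ => mu1_factor_le ha0 hb0 hx i)
        (Finset.mem_univ i) h
      rw [Finset.card_univ, Fintype.card_fin] at hp
      calc mu1 om a b x ≤ 1 * ∏ i, (|x i ^ 2 - x (i + 1) ^ 2| ^ a * x i ^ b) := by
            rw [mu1]
            gcongr
            · exact Finset.prod_nonneg fun i _ => mu1_factor_nonneg hx i
            · exact Real.exp_le_one_iff.mpr (by nlinarith)
        _ ≤ c * (2 * (1 + ‖x‖)) ^ k * ((2 * (1 + ‖x‖)) ^ k) ^ (N - 1) := by rw [one_mul]; exact hp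
        _ = (2 * (1 + ‖x‖)) ^ k * ((2 * (1 + ‖x‖)) ^ k) ^ (N - 1) * c := by ring
        _ ≤ _ := by
          have := norm_le_sqrt_of_psum_le hR
          gcongr
    rcases p with ⟨⟨i, j⟩, hij⟩ | i
    · have hd := sub_pos.mpr (hx.1 hij)
      refine key i (Real.rpow_nonneg hd.le _) ?_
      rw [abs_sq_sub_rpow, mul_assoc]
      refine mul_le_mul (Real.rpow_le_rpow (abs_nonneg _) ?_ ha0)
        ((radial_factor_le ha0 hb0 hx i).trans (pow_le_pow_right₀ hL (by omega)))
        (mul_nonneg (Real.rpow_nonneg (abs_nonneg _) _) (Real.rpow_nonneg (hx.2 i).le b))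
        (Real.rpow_nonneg hd.le _)
      obtain ⟨hi', hi⟩ := fin_add_one_of_lt hij
      rw [abs_sub_comm, abs_of_pos (sub_pos.mpr (hx.1 hi'))]
      exact sub_le_sub_right (hx.1.monotone hi) _
    · have hd := hx.2 i
      refine key i (Real.rpow_nonneg hd.le _) ?_
      rw [mul_comm]
      refine mul_le_mul_of_nonneg_left ?_ (Real.rpow_nonneg hd.le _)
      rw [abs_sq_sub_rpow]
      have h1 : |x i + x (i + 1)| ^ a ≤ (2 * (1 + ‖x‖)) ^ ⌈a⌉₊ := by
        simpa using radial_factor_le ha0 le_rfl hx i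
      calc |x i - x (i + 1)| ^ a * |x i + x (i + 1)| ^ a
          ≤ (2 * (1 + ‖x‖)) ^ ⌈a⌉₊ * (2 * (1 + ‖x‖)) ^ ⌈a⌉₊ :=
            mul_le_mul (gauge0_factor_le ha0 x i) h1 (Real.rpow_nonneg (abs_nonneg _) _)
              (by positivity)
        _ = (2 * (1 + ‖x‖)) ^ (2 * ⌈a⌉₊) := by rw [← pow_add, ← two_mul ⌈a⌉₊]
        _ ≤ _ := pow_le_pow_right₀ hL (by omega)

/-! ### Homogeneous solutions -/

abbrev RadialHarm (a b : ℝ) (f : Wave N κ) (d : ℕ) : Prop :=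
  Harm (C1 N) (radialF a b) (radialW a) f d

lemma radialHarm_sym0 (s : Spin N κ) : RadialHarm a b (sym0 s) 0 where
  smooth := (homog_sym0 s).temperate.1
  euler := (homog_sym0 s).euler
  zero x _ := by
    have h := gaugedOp_const_smul_sym0 (F := radialF a b) (w := radialW a)
      (contDiff_const (c := (1 : ℝ))) s x
    simpa [scalarOp, pD_const] using h

/-- `N Λ(x₁²|s⟩) - r² Λ|s⟩`. -/
noncomputable def radialWave (s : Spin N κ) : Wave N κ := fun x =>
  (N : ℝ) • spread (fun t => t ^ 2) 0 (spinOne s) x + (-1 : ℝ) • (psum 2 x • sym0 s x)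

lemma radialWave_eq (s : Spin N κ) (x : Pos N) :
    radialWave s x = (N : ℝ) • sym2 s x - psum 2 x • sym0 s x := by
  rw [radialWave, sym2, symmetrize_apply_zero (fun t => t ^ 2), spread]
  simp only [zero_mul, sub_zero]
  module

lemma homog_radialWave (s : Spin N κ) : Homog (radialWave s) 2 :=
  ((homog_spread 2 0 _).const_smul _).add
    (((homog_psum 2).smul (homog_sym0 s)).const_smul (-1))

/-- On a link, `2 (x² v - y² w) = (x² + y²)(v - w) + (x² - y²)(v + w)`. The first part is cancelled
by the exchange term, and in the second the factor `x² - y²` removes the pole. -/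
lemma gaugedOp_spread_sq (hN : 2 ≤ N) (s : Spin N κ) {x : Pos N} (hx : x ∈ C1 N) :
    gaugedOp (radialF a b) (radialW a) (spread (fun t => t ^ 2) 0 (spinOne s)) x =
      (2 + 4 * b + 8 * a) • sym0 s x := by
  have hd : ∀ t : ℝ, HasDerivAt (fun t : ℝ => t ^ 2) (2 * t) t := fun t => by
    simpa using hasDerivAt_pow 2 t
  have hd' : ∀ t : ℝ, HasDerivAt (fun t : ℝ => 2 * t) 2 t := fun t => by
    simpa using (hasDerivAt_id t).const_mul (2 : ℝ)
  have e1 : ∀ i, radialW a i x • (spread (fun t => t ^ 2) 0 (spinOne s) x -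
      exchange i (i + 1) (spread (fun t => t ^ 2) 0 (spinOne s) x)) =
      (4 * a * ((x i ^ 2 + x (i + 1) ^ 2) * sqLink i x)) • (spinOne s i - spinOne s (i + 1)) := by
    intro i
    rw [spread_sub_exchange (permSpin_spinOne' s) _ 0 (fin_ne_add_one hN i), smul_smul]
    congr 1
    simp only [zero_mul, sub_zero]
    have := inv_mul_cancel₀ (sqLink_ne_zero hN hx i)
    rw [radialW, sqLink]
    linear_combination (4 * a * (x i ^ 2 + x (i + 1) ^ 2) * (x i ^ 2 - x (i + 1) ^ 2)⁻¹) * this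
  have e2 : ∀ i, sqLink i x • (x i • pD i (spread (fun t => t ^ 2) 0 (spinOne s)) x
      - x (i + 1) • pD (i + 1) (spread (fun t => t ^ 2) 0 (spinOne s)) x) =
      ((x i ^ 2 + x (i + 1) ^ 2) * sqLink i x) • (spinOne s i - spinOne s (i + 1))
        + (spinOne s i + spinOne s (i + 1)) := by
    intro i
    rw [pD_spread hd, pD_spread hd]
    have := inv_mul_cancel₀ (sqLink_ne_zero hN hx i)
    rw [sqLink]
    match_scalars
    all_goals first | ring1 | linear_combination this
  have e3 : ∀ i, (x i)⁻¹ • pD i (spread (fun t => t ^ 2) 0 (spinOne s)) x =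
      (2 : ℝ) • spinOne s i := by
    intro i
    rw [pD_spread hd]
    have := inv_mul_cancel₀ (hx.2 i).ne'
    match_scalars
    · linear_combination 2 * this
    all_goals ring
  rw [gaugedOp, sum_radialF, sum_pD_pD_spread hd hd', spread_const]
  simp only [e1, e2, e3]
  rw [Finset.sum_add_distrib, Finset.sum_add_distrib, sum_shift (spinOne s), ← Finset.smul_sum,
    sum_spinOne s x]
  simp only [mul_smul, ← Finset.smul_sum]
  module

lemma scalarOp_psum_four (hN : 2 ≤ N) {x : Pos N} (hx : x ∈ C1 N) :
    scalarOp (radialF a b) (psum 4) x = (12 + 8 * b + 32 * a) * psum 2 x := by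
  have h1 : ∀ i, pD i (psum 4 : Pos N → ℝ) = fun x => 4 * x i ^ 3 := fun i =>
    pD_eq_of fun x => (hasPD_psum 4 i x).congr (by norm_num)
  have h2 : ∀ i, pD i (fun x : Pos N => 4 * x i ^ 3) x = 12 * x i ^ 2 := fun i => by
    rw [(((HasPD.coord (i := i) (x := x) i).pow 3).const_mul 4).eq]
    norm_num
    ring
  rw [scalarOp, sum_radialF_mul]
  simp only [h1, h2]
  have e1 : ∀ i, (x i)⁻¹ * (4 * x i ^ 3) = 4 * x i ^ 2 := fun i => by
    field_simp [(hx.2 i).ne']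
  have e2 : ∀ i, sqLink i x * (x i * (4 * x i ^ 3) - x (i + 1) * (4 * x (i + 1) ^ 3)) =
      4 * x i ^ 2 + 4 * x (i + 1) ^ 2 := fun i => by
    have := inv_mul_cancel₀ (sqLink_ne_zero hN hx i)
    rw [sqLink]
    linear_combination (4 * (x i ^ 2 + x (i + 1) ^ 2)) * this
  simp only [e1, e2]
  rw [Finset.sum_add_distrib, sum_shift (fun i => 4 * x i ^ 2)]
  simp only [← Finset.mul_sum]
  rw [← psum]
  ring

/-- The sum of the `x_i² |s_i⟩` is mapped to `2 + 4 b + 8 a` times `Λ|s⟩`, and `r²` contributes `4 α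
= N (2 + 4 b + 8 a)`; hence the relative factor `N`. -/
lemma radialHarm_radialWave (hN : 2 ≤ N) (s : Spin N κ) : RadialHarm a b (radialWave s) 2 where
  smooth := (homog_radialWave s).temperate.1
  euler := (homog_radialWave s).euler
  zero x hx := by
    have h1 := (homog_spread (N := N) 2 0 (spinOne s)).temperate.1
    have h2 := ((homog_psum (N := N) 2).smul (homog_sym0 s)).temperate.1
    unfold radialWave
    rw [gaugedOp_add _ _ (h1.const_smul (N : ℝ)) (h2.const_smul (-1 : ℝ)),
      gaugedOp_const_smul _ _ _ h1, gaugedOp_const_smul _ _ _ h2,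
      gaugedOp_const_smul_sym0 (contDiff_psum 2), gaugedOp_spread_sq hN s hx]
    have h3 := scalarOp_psum_pow (sum_radialF_coord hN a b hx) 1
    simp only [pow_one, Nat.sub_self, pow_zero, Nat.cast_one] at h3
    rw [show scalarOp (radialF a b) (psum 2) x = _ from h3]
    module

/-- `N (α + 1) ∑ x_i⁴ - β r⁴`. -/
noncomputable def radialQuartic (a b : ℝ) (x : Pos N) : ℝ :=
  N * (alpha1 N a b + 1) * psum 4 x + -beta1 N a b * psum 2 x ^ 2

omit [NeZero N] in
lemma homog_radialQuartic : Homog (radialQuartic a b : Pos N → ℝ) 4 := by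
  refine ⟨((Function.HasTemperateGrowth.const _).fun_mul (temperate_psum 4)).fun_add
    ((Function.HasTemperateGrowth.const _).fun_mul ((temperate_psum 2).fun_pow 2)), fun t x => ?_⟩
  rw [radialQuartic, psum_mul, psum_mul, radialQuartic, smul_eq_mul]
  ring

omit [NeZero N] in
lemma scalarOp_add {F : Fin N → Pos N → ℝ} {A B : Pos N → ℝ} (hA : ContDiff ℝ ∞ A)
    (hB : ContDiff ℝ ∞ B) (x : Pos N) :
    scalarOp F (fun x => A x + B x) x = scalarOp F A x + scalarOp F B x := by
  simp only [scalarOp, pD_add hA hB, pD_add (contDiff_pD hA _) (contDiff_pD hB _), mul_add,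
    Finset.sum_add_distrib]
  ring

omit [NeZero N] in
lemma scalarOp_const_mul {F : Fin N → Pos N → ℝ} (c : ℝ) {A : Pos N → ℝ} (hA : ContDiff ℝ ∞ A)
    (x : Pos N) : scalarOp F (fun x => c * A x) x = c * scalarOp F A x := by
  have h := pD_const_smul c hA
  have h' := fun i => pD_const_smul c (contDiff_pD hA i)
  simp only [smul_eq_mul] at h h'
  simp only [scalarOp, h, h', mul_left_comm _ c, ← Finset.mul_sum]
  ring

/-- The operator maps `∑ x_i⁴` to `8 β / N` times `r²` and `r⁴` to `8 (α + 1)` times `r²`, which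
explains the two coefficients. -/
lemma radialHarm_radialQuartic (hN : 2 ≤ N) (s : Spin N κ) :
    RadialHarm a b (fun x => radialQuartic a b x • sym0 s x) 4 where
  smooth := (homog_radialQuartic.smul (homog_sym0 s)).temperate.1
  euler := (homog_radialQuartic.smul (homog_sym0 s)).euler
  zero x hx := by
    rw [gaugedOp_const_smul_sym0 homog_radialQuartic.temperate.1]
    unfold radialQuartic
    have h4 := contDiff_psum (N := N) 4
    have h2 := (contDiff_psum (N := N) 2).pow 2
    rw [scalarOp_add (contDiff_const.mul h4) (contDiff_const.mul h2), scalarOp_const_mul _ h4,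
      scalarOp_const_mul _ h2, scalarOp_psum_four hN hx,
      scalarOp_psum_pow (sum_radialF_coord hN a b hx)]
    rw [smul_eq_zero]
    left
    rw [alpha1, beta1]
    norm_num
    ring

/-! ### Eigenfunctions -/

lemma radial_isEigenfunction (hN : 2 ≤ N) (ha : 0 < a) (hb : 0 ≤ b) (hom : 0 < om) {f : Wave N κ}
    {d : ℕ} (hf : RadialHarm a b f d) (ht : Homog f d) (l : ℕ) :
    IsEigenfunction (H1 om a b) (C1 N)
      (fun x => mu1 om a b x • (laguerre l (alpha1 N a b + d - 1) (om * psum 2 x) • f x))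
      (ground1 N om a b + 2 * om * (2 * l + d)) := by
  have hg := mu1_isGauge (κ := κ) (om := om) (b := b) hN ha
  have hL := (temperate_laguerre (N := N) l (alpha1 N a b + d - 1) om).fun_smul ht.temperate
  refine ⟨hg.solves hL.1 fun x hx => ?_, ?_⟩
  · exact hf.laguerre (fun y hy => sum_radialF_coord hN a b hy) (by rw [alpha1]; ring) om l hx
  · exact memLp_gauge_smul isOpen_C1 hg.smooth.continuousOn (half_pos hom)
      (fun x hx => abs_mu1_le ha.le hb hx) hL

/-- The configuration space is a cone and `f` is homogeneous, so a dilation carries `r²` beyond the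
zeros of the Laguerre polynomial without making `f` vanish. -/
lemma radial_nonvanishing (hN : 2 ≤ N) (ha : 0 < a) (hom : 0 < om) {f : Wave N κ} {d : ℕ}
    (ht : Homog f d) {x : Pos N} (hx : x ∈ C1 N) (hf : f x ≠ 0) (l : ℕ) (lam : ℝ) :
    Nonvanishing (C1 N) fun x => mu1 om a b x • (laguerre l lam (om * psum 2 x) • f x) := by
  have h0 : 0 < psum 2 x := Finset.sum_pos (fun i _ => pow_pos (hx.2 i) 2) Finset.univ_nonempty
  have h1 : Tendsto (fun t : ℝ => om * (t ^ 2 * psum 2 x)) atTop atTop :=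
    ((tendsto_pow_atTop two_ne_zero).atTop_mul_const h0).const_mul_atTop hom
  obtain ⟨t, hl, ht0⟩ :=
    ((h1.eventually (eventually_laguerre_ne_zero l lam)).and (eventually_gt_atTop 0)).exists
  have hC : (fun i => t * x i) ∈ C1 N :=
    ⟨fun i j h => mul_lt_mul_of_pos_left (hx.1 h) ht0, fun i => mul_pos ht0 (hx.2 i)⟩
  refine ⟨_, hC, ?_, smul_ne_zero ((mu1_isGauge (κ := κ) hN ha).pos _ hC).ne'
    (smul_ne_zero (by rwa [psum_mul]) ?_)⟩
  · exact (div_pos (Finset.sum_pos (fun i _ => hC.2 i) Finset.univ_nonempty)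
      (Nat.cast_pos.mpr (NeZero.pos N))).ne'
  · rw [ht.hom]
    exact smul_ne_zero (pow_pos ht0 d).ne' hf

lemma exists_radialWave_ne_zero {s : Spin N κ} (hs : ∃ i j, spinOne s i ≠ spinOne s j) :
    ∃ x ∈ C1 N, radialWave s x ≠ 0 := by
  by_contra! h
  obtain ⟨x, hx⟩ := C1_nonempty (N := N)
  obtain ⟨i, j, hij⟩ := hs
  have h1 : ∀ i, spinOne s i = (1 / N : ℝ) • sym0 s x := fun i => by
    have h2 := pD_eq_zero_of_eqOn isOpen_C1 h i hx
    have h3 := ((hasPD_spread (φ := fun t => t ^ 2) (φ' := fun t => 2 * t) (fun t => by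
      simpa using hasDerivAt_pow 2 t) 0 (spinOne s) i x).const_smul (N : ℝ)).add
      (((hasPD_psum 2 i x).smul_const (sym0 s 0)).const_smul (-1))
    have h4 := h3.eq.symm.trans h2
    have h5 : (2 * N * x i : ℝ) • (spinOne s i - (1 / N : ℝ) • sym0 s x) = 0 := by
      rw [← h4, sym0_eq s x 0]
      have := natCast_ne_zero (N := N)
      match_scalars
      · ring
      · field_simp
        norm_num
      all_goals ring
    have h6 := mul_ne_zero (mul_ne_zero two_ne_zero (natCast_ne_zero (N := N))) (hx.2 i).ne'
    exact sub_eq_zero.mp ((smul_eq_zero.mp h5).resolve_left h6)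
  exact hij ((h1 i).trans (h1 j).symm)

-- At the diagonal point with all coordinates `1` the value is `N² (1 - N (2 a + 1)) < 0`, and by
-- continuity it stays nonzero at nearby ordered points.
omit [NeZero N] in
lemma exists_radialQuartic_ne_zero (hN : 2 ≤ N) (ha : 0 < a) :
    ∃ x ∈ C1 N, radialQuartic a b x ≠ 0 := by
  have hN' : (2 : ℝ) ≤ N := by exact_mod_cast hN
  have h1 : radialQuartic a b (fun _ : Fin N => 1) ≠ 0 := by
    have : radialQuartic a b (fun _ : Fin N => 1) = N ^ 2 * (1 - N * (2 * a + 1)) := by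
      simp [radialQuartic, psum, alpha1, beta1]
      ring
    rw [this]
    refine mul_ne_zero (by positivity) (ne_of_lt ?_)
    nlinarith
  have h2 : ∀ᶠ x in 𝓝 (fun _ : Fin N => (1 : ℝ)), radialQuartic a b x ≠ 0 ∧ ∀ i, 0 < x i := by
    refine (homog_radialQuartic.temperate.1.continuous.continuousAt.eventually_ne h1).and
      (eventually_all.mpr fun i => ?_)
    exact (continuous_apply i).continuousAt.eventually_const_lt one_pos
  obtain ⟨x, hx, hx1, hx2⟩ := exists_mem_C0_near_diagonal 1 h2
  exact ⟨x, ⟨hx, hx2⟩, hx1⟩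

theorem radial_xi0 (hN : 2 ≤ N) (ha : 1 / 2 < a) (hom : 0 < om) (hb : 1 / 2 < b) (s : Spin N κ)
    (k : ℕ) :
    IsEigenfunction (H1 om a b) (C1 N) (xi0 om a b k s) (ground1 N om a b + 4 * k * om) ∧
      (sym0 s ≠ 0 → Nonvanishing (C1 N) (xi0 om a b k s)) := by
  have e : xi0 om a b k s = fun x => mu1 om a b x •
      (laguerre k (alpha1 N a b + (0 : ℕ) - 1) (om * psum 2 x) • sym0 s x) := by
    funext x
    rw [xi0, Nat.cast_zero, add_zero, mul_smul]
  rw [e]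
  refine ⟨?_, fun hs => ?_⟩
  · rw [show ground1 N om a b + 4 * k * om = ground1 N om a b + 2 * om * (2 * k + (0 : ℕ)) by
      push_cast; ring]
    exact radial_isEigenfunction hN (by linarith) (by linarith) hom (radialHarm_sym0 s)
      (homog_sym0 s) k
  · obtain ⟨x, hx⟩ := C1_nonempty (N := N)
    exact radial_nonvanishing hN (by linarith) hom (homog_sym0 s) hx (sym0_ne_zero hs x) _ _

theorem radial_xi1 (hN : 2 ≤ N) (ha : 1 / 2 < a) (hom : 0 < om) (hb : 1 / 2 < b) (s : Spin N κ)
    (k : ℕ) (hk : 1 ≤ k) :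
    IsEigenfunction (H1 om a b) (C1 N) (xi1 om a b k s) (ground1 N om a b + 4 * k * om) ∧
      ((∃ i j, spinOne s i ≠ spinOne s j) → Nonvanishing (C1 N) (xi1 om a b k s)) := by
  have e : xi1 om a b k s = fun x => mu1 om a b x •
      (laguerre (k - 1) (alpha1 N a b + (2 : ℕ) - 1) (om * psum 2 x) • radialWave s x) := by
    funext x
    rw [xi1, radialWave_eq, mul_smul,
      show alpha1 N a b + 1 = alpha1 N a b + (2 : ℕ) - 1 by push_cast; ring]
  rw [e]
  refine ⟨?_, fun hs => ?_⟩
  · rw [show ground1 N om a b + 4 * k * om =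
      ground1 N om a b + 2 * om * (2 * (k - 1 : ℕ) + (2 : ℕ)) by push_cast [hk]; ring]
    exact radial_isEigenfunction hN (by linarith) (by linarith) hom (radialHarm_radialWave hN s)
      (homog_radialWave s) (k - 1)
  · obtain ⟨x, hx, hne⟩ := exists_radialWave_ne_zero hs
    exact radial_nonvanishing hN (by linarith) hom (homog_radialWave s) hx hne _ _

theorem radial_xi2 (hN : 2 ≤ N) (ha : 1 / 2 < a) (hom : 0 < om) (hb : 1 / 2 < b) (s : Spin N κ)
    (k : ℕ) (hk : 2 ≤ k) :
    IsEigenfunction (H1 om a b) (C1 N) (xi2 om a b k s) (ground1 N om a b + 4 * k * om) ∧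
      (sym0 s ≠ 0 → Nonvanishing (C1 N) (xi2 om a b k s)) := by
  have e : xi2 om a b k s = fun x => mu1 om a b x • (laguerre (k - 2)
      (alpha1 N a b + (4 : ℕ) - 1) (om * psum 2 x) • (radialQuartic a b x • sym0 s x)) := by
    funext x
    rw [xi2, mul_smul, mul_smul, radialQuartic, neg_mul, ← sub_eq_add_neg,
      show alpha1 N a b + 3 = alpha1 N a b + (4 : ℕ) - 1 by push_cast; ring]
  have h := homog_radialQuartic (N := N) (a := a) (b := b) |>.smul (homog_sym0 s)
  rw [e]
  refine ⟨?_, fun hs => ?_⟩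
  · rw [show ground1 N om a b + 4 * k * om =
      ground1 N om a b + 2 * om * (2 * (k - 2 : ℕ) + (4 : ℕ)) by push_cast [hk]; ring]
    exact radial_isEigenfunction hN (by linarith) (by linarith) hom (radialHarm_radialQuartic hN s)
      h (k - 2)
  · obtain ⟨x, hx, hne⟩ := exists_radialQuartic_ne_zero hN (by linarith : 0 < a) (b := b)
    exact radial_nonvanishing hN (by linarith) hom h hx (smul_ne_zero hne (sym0_ne_zero hs x)) _ _

end RadialEigen

end NearNeighbour
namespace NearNeighbour
open scoped ContDiff
open MeasureTheory Filter Topology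

variable {N κ : ℕ}

/-! ## The trigonometric model -/

section TrigGauge

lemma mem_C2_iff (x : Pos N) :
    x ∈ C2 N ↔ ∀ p : {p : Fin N × Fin N // p.1 < p.2} ⊕ {p : Fin N × Fin N // p.1 < p.2},
      0 < p.elim (fun p => x p.1.2 - x p.1.1) fun p => x p.1.1 - x p.1.2 + Real.pi := by
  refine ⟨?_, fun h => ⟨(mem_C0_iff x).mpr fun p => h (Sum.inl p), fun i j => ?_⟩⟩
  · rintro h (p | p)
    · exact sub_pos.mpr (h.1 p.2)
    · have := h.2 p.1.2 p.1.1
      simp only [Sum.elim_inr]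
      linarith
  · rcases lt_or_ge j i with hij | hij
    · have := h (Sum.inr ⟨(j, i), hij⟩)
      simp only [Sum.elim_inr] at this
      linarith
    · have := ((mem_C0_iff x).mpr fun p => h (Sum.inl p)).monotone hij
      linarith [Real.pi_pos]

lemma isOpen_C2 : IsOpen (C2 N) := by
  have : C2 N = C0 N ∩ ⋂ i, ⋂ j, {x | x i - x j < Real.pi} := by
    ext x
    simp [C2, C0]
  rw [this]
  exact isOpen_C0.inter (isOpen_iInter_of_finite fun i => isOpen_iInter_of_finite fun j =>
    isOpen_lt (by fun_prop) continuous_const)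

/-- The origin is a boundary point of the configuration space, so a continuous function that does
not vanish there is nonzero at some interior point. -/
lemma exists_mem_C2_ne_zero {f : Wave N κ} (hf : ContinuousAt f 0) (h0 : f 0 ≠ 0) :
    ∃ x ∈ C2 N, f x ≠ 0 := by
  have h : ∀ᶠ x in 𝓝 (fun _ : Fin N => (0 : ℝ)), f x ≠ 0 ∧ ∀ i j, x i - x j < Real.pi := by
    refine (hf.eventually_ne h0).and (eventually_all.mpr fun i => eventually_all.mpr fun j => ?_)
    have hc : Continuous fun x : Pos N => x i - x j := by fun_prop
    exact hc.continuousAt.eventually_lt_const (by simpa using Real.pi_pos)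
  obtain ⟨x, hx, hx1, hx2⟩ := exists_mem_C0_near_diagonal 0 h
  exact ⟨x, ⟨hx, hx2⟩, hx1⟩

lemma C2_nonempty : (C2 N).Nonempty := by
  have h : ∀ᶠ x in 𝓝 (fun _ : Fin N => (0 : ℝ)), ∀ i j, x i - x j < Real.pi := by
    refine eventually_all.mpr fun i => eventually_all.mpr fun j => ?_
    have hc : Continuous fun x : Pos N => x i - x j := by fun_prop
    exact hc.continuousAt.eventually_lt_const (by simpa using Real.pi_pos)
  obtain ⟨x, hx, hx1⟩ := exists_mem_C0_near_diagonal 0 h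
  exact ⟨x, hx, hx1⟩

lemma sin_abs_pos {d : ℝ} (hd : d ≠ 0 ∧ |d| < Real.pi) : 0 < Real.sin |d| :=
  Real.sin_pos_of_pos_of_lt_pi (abs_pos.mpr hd.1) hd.2

lemma sin_ne_zero_of_abs_lt {d : ℝ} (hd : d ≠ 0 ∧ |d| < Real.pi) : Real.sin d ≠ 0 := by
  have h := sin_abs_pos hd
  rcases lt_or_gt_of_ne hd.1 with h1 | h1
  · rw [abs_of_neg h1, Real.sin_neg] at h
    linarith
  · rw [abs_of_pos h1] at h
    exact h.ne'

lemma linkFactor_trig (a : ℝ) :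
    LinkFactor (fun d => d ≠ 0 ∧ |d| < Real.pi) 1 a Real.cot fun d => Real.sin |d| ^ a where
  symm d hd := ⟨neg_ne_zero.mpr hd.1, by rw [abs_neg]; exact hd.2⟩
  odd d := by rw [Real.cot_eq_cos_div_sin, Real.cot_eq_cos_div_sin, Real.cos_neg, Real.sin_neg, div_neg]
  riccati d hd := by
    have hs := sin_ne_zero_of_abs_lt hd
    have h := (Real.hasDerivAt_cos d).div (Real.hasDerivAt_sin d) hs
    have e : Real.cot = fun x => Real.cos x / Real.sin x := funext Real.cot_eq_cos_div_sin
    rw [e]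
    refine h.congr_deriv ?_
    field_simp
    ring
  deriv d hd := by
    have hp := sin_abs_pos hd
    have h := ((Real.hasDerivAt_sin |d|).comp d (hasDerivAt_abs hd.1)).rpow_const (p := a)
      (Or.inl hp.ne')
    refine h.congr_deriv ?_
    rw [Function.comp_apply, Real.rpow_sub_one hp.ne', Real.cot_eq_cos_div_sin]
    rcases lt_or_gt_of_ne hd.1 with h1 | h1
    · rw [abs_of_neg h1, sign_neg h1, Real.cos_neg, Real.sin_neg]
      have := sin_ne_zero_of_abs_lt hd
      field_simp
      norm_num
    · rw [abs_of_pos h1, sign_pos h1]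
      have := sin_ne_zero_of_abs_lt hd
      field_simp
      norm_num
  smooth d hd := ((Real.contDiff_sin.contDiffAt).comp d (contDiffAt_abs hd.1)).rpow_const_of_ne
    (sin_abs_pos hd).ne'
  pos d hd := Real.rpow_pos_of_pos (sin_abs_pos hd) a

variable [NeZero N] {a : ℝ}

lemma trig_link (hN : 2 ≤ N) {x : Pos N} (hx : x ∈ C2 N) (i : Fin N) :
    x i - x (i + 1) ≠ 0 ∧ |x i - x (i + 1)| < Real.pi :=
  ⟨link_ne_zero hN hx.1 i, abs_sub_lt_iff.mpr ⟨hx.2 _ _, hx.2 _ _⟩⟩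

theorem mu2_isGauge (hN : 2 ≤ N) (ha : 0 < a) :
    Gauge (κ := κ) (C2 N) (V2 a) (mu2 a)
      (fun x => 0 ^ 2 * psum 2 x
        + 2 * a ^ 2 * ∑ i, Real.cot (x i - x (i - 1)) * Real.cot (x i - x (i + 1))
        + ∑ i, 2 * a * (a - 1) * (1 + Real.cot (x i - x (i + 1)) ^ 2))
      (linkF a Real.cot)
      (fun i x => -(a * (2 * 1 + Real.cot (x i - x (i + 1)) ^ 2
        + Real.cot (x i - x (i - 1)) ^ 2)) - 0)
      (linkW a 1 Real.cot) (ground2 N a) := by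
  have h := (linkFactor_trig a).gauge (κ := κ) hN ha zero_le_one (isOpen_C2 (N := N))
    (fun x hx i => trig_link hN hx i) (om := 0) (fun d hd => by ring)
    (V := V2 a) (fun x hx v => by
      rw [V2]
      congr 2
      · ring
      · funext i
        congr 2
        have hs := sin_ne_zero_of_abs_lt (trig_link hN hx i)
        rw [Real.cot_eq_cos_div_sin]
        field_simp
        exact (Real.sin_sq_add_cos_sq _).symm)
  have e1 : (fun x : Pos N => Real.exp (-(0 / 2) * psum 2 x) *
      ∏ i, Real.sin |x i - x (i + 1)| ^ a) = mu2 a := by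
    funext x
    simp [mu2]
  have e2 : (fun i x => linkF a Real.cot i x - 0 * x i) = (linkF a Real.cot : Fin N → Pos N → ℝ) := by
    funext i x
    ring
  rw [e1, e2, show 2 * a ^ 2 * N * 1 + N * 0 * (2 * a + 1) = ground2 N a by rw [ground2]; ring] at h
  exact h

lemma mu2_factor_mem (hN : 2 ≤ N) (ha : 0 ≤ a) {x : Pos N} (hx : x ∈ C2 N) (i : Fin N) :
    0 ≤ Real.sin |x i - x (i + 1)| ^ a ∧ Real.sin |x i - x (i + 1)| ^ a ≤ 1 := by
  have h := (sin_abs_pos (trig_link hN hx i)).le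
  exact ⟨Real.rpow_nonneg h a, Real.rpow_le_one h (Real.sin_le_one _) ha⟩

lemma mu2_le (hN : 2 ≤ N) (ha : 0 ≤ a) {x : Pos N} (hx : x ∈ C2 N) (i : Fin N) {c : ℝ}
    (hc : Real.sin |x i - x (i + 1)| ≤ c) : mu2 a x ≤ c ^ a := by
  have h := prod_le_mul_pow (s := Finset.univ) (g := fun i => Real.sin |x i - x (i + 1)| ^ a)
    (fun i _ => (mu2_factor_mem hN ha hx i).1) (fun i _ => (mu2_factor_mem hN ha hx i).2)
    (Finset.mem_univ i) (Real.rpow_le_rpow (sin_abs_pos (trig_link hN hx i)).le hc ha)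
  rwa [one_pow, mul_one] at h

lemma mu2_le_one (hN : 2 ≤ N) (ha : 0 ≤ a) {x : Pos N} (hx : x ∈ C2 N) : mu2 a x ≤ 1 := by
  simpa using mu2_le hN ha hx 0 (Real.sin_le_one _)

theorem isGroundStateEnergy_H2 (hN : 2 ≤ N) (ha : 1 / 2 < a) :
    IsGroundStateEnergy (H2 a : Wave N κ → Wave N κ) (C2 N) (ground2 N a) := by
  have ha0 : 0 ≤ a := by linarith
  refine (mu2_isGauge (κ := κ) hN (by linarith : 0 < a)).isGroundStateEnergy C2_nonempty
    (d := fun (p : {p : Fin N × Fin N // p.1 < p.2} ⊕ {p : Fin N × Fin N // p.1 < p.2}) x =>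
      p.elim (fun p => x p.1.2 - x p.1.1) fun p => x p.1.1 - x p.1.2 + Real.pi) ?_ mem_C2_iff
    (B := 1) (fun x hx => mu2_le_one hN ha0 hx) (e := fun _ => a) (fun _ => ha)
    fun R => ⟨1, fun x hx _ p => ?_⟩
  · rintro (p | p)
    · simpa using isWall_sub p.2.ne 0
    · exact isWall_sub p.2.ne' Real.pi
  · rw [one_mul]
    rcases p with ⟨⟨i, j⟩, hij⟩ | ⟨⟨i, j⟩, hij⟩
    · refine mu2_le hN ha0 hx i ((Real.sin_le (abs_nonneg _)).trans ?_)
      obtain ⟨hi', hi⟩ := fin_add_one_of_lt hij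
      rw [abs_sub_comm, abs_of_pos (sub_pos.mpr (hx.1 hi'))]
      exact sub_le_sub_right (hx.1.monotone hi) _
    · set k : Fin N := ⟨N - 1, by omega⟩ with hk
      have hk1 : k + 1 = 0 := by
        apply Fin.ext
        rw [Fin.val_add, Fin.val_one', Fin.val_zero, Nat.add_mod_mod, hk]
        simp only
        rw [Nat.sub_add_cancel (by omega), Nat.mod_self]
      have hj : x j ≤ x k := hx.1.monotone (Fin.le_def.mpr (by rw [hk]; simp only; omega))
      have hi : x 0 ≤ x i := hx.1.monotone (Fin.zero_le i)
      have h0 := hx.1 hij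
      refine mu2_le hN ha0 hx k ?_
      have hkpi := hx.2 k 0
      rw [hk1, abs_of_nonneg (by linarith), ← Real.sin_pi_sub]
      refine (Real.sin_le (by linarith)).trans ?_
      simp only [Sum.elim_inr]
      linarith

/-! ### Eigenfunctions -/

/-- The momentum vanishes because `∑ F_i = 0` and `f` is translation invariant. For square
integrability, all differences are below `π`, so each coordinate is within `π` of the centre of mass
and the region in question is bounded; on it `μ ≤ 1` and `f` is bounded. -/
lemma trig_isEigenfunction (hN : 2 ≤ N) (ha : 0 < a) {f : Wave N κ} (hf : ContDiff ℝ ∞ f)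
    (hi : Invariant f) {e : ℝ}
    (he : ∀ x ∈ C2 N, gaugedOp (linkF a Real.cot) (linkW a 1 Real.cot) f x = -(e • f x)) :
    IsZeroMomentumEigenfunction (H2 a) (C2 N) (fun x => mu2 a x • f x) (ground2 N a + e) := by
  have hg := mu2_isGauge (κ := κ) hN ha
  refine ⟨hg.solves hf he, fun x hx => ?_, ?_⟩
  · have h1 : ∀ i, pd i (fun x => mu2 a x • f x) x =
        mu2 a x • (linkF a Real.cot i x • f x + pD i f x) := fun i => by
      rw [pd_eq, (hg.pd_smul hf hx i).eq]
    simp only [momentum, h1]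
    rw [← Finset.smul_sum, Finset.sum_add_distrib, ← Finset.sum_smul,
      (linkFactor_trig a).sum_linkF_eq_zero, hi.sum_pD hf]
    simp
  · set S : Set (Pos N) := {x ∈ C2 N | com x ∈ Set.Icc (0 : ℝ) 1} with hS
    have hN0 := natCast_ne_zero (N := N)
    have hSm : MeasurableSet S :=
      isOpen_C2.measurableSet.inter (contDiff_com.continuous.measurable measurableSet_Icc)
    have hSb : S ⊆ Metric.closedBall 0 (Real.pi + 1) := by
      rintro x ⟨hx, hx0, hx1⟩
      rw [mem_closedBall_zero_iff, pi_norm_le_iff_of_nonneg (by positivity)]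
      intro i
      have hp : (0 : ℝ) < N := Nat.cast_pos.mpr (NeZero.pos N)
      have h1 : ∑ j, (x i - x j) = N * (x i - com x) := by
        rw [Finset.sum_sub_distrib, com]
        field_simp
        simp
      have h2 : ∑ j, (x i - x j) ≤ N * Real.pi := by
        simpa using Finset.sum_le_card_nsmul Finset.univ _ _ fun j _ => (hx.2 i j).le
      have h3 : -(N * Real.pi) ≤ ∑ j, (x i - x j) := by
        have := Finset.sum_le_card_nsmul Finset.univ _ _ fun j _ => (hx.2 j i).le
        rw [← neg_le_neg_iff, ← Finset.sum_neg_distrib]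
        simpa using this
      rw [h1] at h2 h3
      have h4 := le_of_mul_le_mul_left h2 hp
      have h5 : -Real.pi ≤ x i - com x := by
        rw [← mul_neg] at h3
        exact le_of_mul_le_mul_left h3 hp
      rw [Real.norm_eq_abs, abs_le]
      constructor <;> linarith
    have hfin : IsFiniteMeasure (volume.restrict S) :=
      isFiniteMeasure_restrict.mpr (measure_ne_top_of_subset hSb
        (isCompact_closedBall _ _).measure_lt_top.ne)
    obtain ⟨B, hB⟩ := (isCompact_closedBall (0 : Pos N) (Real.pi + 1)).exists_bound_of_continuousOn
      hf.continuous.continuousOn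
    refine MemLp.of_bound ((hg.smooth.continuousOn.smul hf.continuous.continuousOn).mono
      (fun x hx => hx.1) |>.aestronglyMeasurable hSm) B ?_
    refine (ae_restrict_iff' hSm).mpr (Eventually.of_forall fun x hx => ?_)
    rw [norm_smul, Real.norm_of_nonneg (hg.pos x hx.1).le]
    have := hB x (hSb hx)
    calc mu2 a x * ‖f x‖ ≤ 1 * ‖f x‖ := by
          gcongr
          exact mu2_le_one hN ha.le hx.1
      _ ≤ B := by rwa [one_mul]

/-- A translation moves the centre of mass to `1` and does not change `f`. -/
lemma trig_nonvanishing (hN : 2 ≤ N) (ha : 0 < a) {f : Wave N κ} (hi : Invariant f)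
    (h : ∃ x ∈ C2 N, f x ≠ 0) : Nonvanishing (C2 N) fun x => mu2 a x • f x := by
  obtain ⟨x, hx, hne⟩ := h
  have hC : (fun i => x i + (1 - com x)) ∈ C2 N :=
    ⟨C0_translate hx.1 _, fun i j => by simpa using hx.2 i j⟩
  refine ⟨_, hC, ?_, smul_ne_zero ((mu2_isGauge (κ := κ) hN ha).pos _ hC).ne' ?_⟩
  · rw [com_add]
    norm_num
  · rwa [hi]

-- If `f` vanished on the open configuration space, so would its derivatives. This serves the
-- functions that vanish at the origin.
omit [NeZero N] in
lemma exists_mem_C2_of_pD {f : Wave N κ} (hf : ContDiff ℝ ∞ f) {i : Fin N} (h : pD i f 0 ≠ 0) :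
    ∃ x ∈ C2 N, f x ≠ 0 := by
  by_contra! h0
  obtain ⟨x, hx, hne⟩ := exists_mem_C2_ne_zero (contDiff_pD hf i).continuous.continuousAt h
  exact hne (pD_eq_zero_of_eqOn isOpen_C2 h0 i hx)

lemma exists_spinOne_ne {s : Spin N κ} (hs : ∃ i j, spinOne s i ≠ spinOne s j) :
    ∃ i, (N : ℝ) • spinOne s i - sym0 s 0 ≠ 0 := by
  by_contra! h
  obtain ⟨i, j, hij⟩ := hs
  have h1 := (sub_eq_zero.mp (h i)).trans (sub_eq_zero.mp (h j)).symm
  exact hij (smul_right_injective _ natCast_ne_zero h1)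

end TrigGauge

end NearNeighbour
namespace NearNeighbour
open scoped ContDiff
open MeasureTheory Filter Topology

variable {N κ : ℕ}

/-! ### Trigonometric model: eigenfunctions -/

section TrigEigen

lemma hasDerivAt_cos_two (t : ℝ) :
    HasDerivAt (fun t => Real.cos (2 * t)) (-2 * Real.sin (2 * t)) t :=
  ((Real.hasDerivAt_cos (2 * t)).comp t ((hasDerivAt_id t).const_mul 2)).congr_deriv (by ring)

lemma hasDerivAt_sin_two (t : ℝ) :
    HasDerivAt (fun t => Real.sin (2 * t)) (2 * Real.cos (2 * t)) t :=
  ((Real.hasDerivAt_sin (2 * t)).comp t ((hasDerivAt_id t).const_mul 2)).congr_deriv (by ring)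

lemma hasDerivAt_neg_sin_two (t : ℝ) :
    HasDerivAt (fun t => -2 * Real.sin (2 * t)) (-4 * Real.cos (2 * t)) t :=
  ((hasDerivAt_sin_two t).const_mul (-2)).congr_deriv (by ring)

lemma hasDerivAt_two_cos_two (t : ℝ) :
    HasDerivAt (fun t => 2 * Real.cos (2 * t)) (-4 * Real.sin (2 * t)) t :=
  ((hasDerivAt_cos_two t).const_mul 2).congr_deriv (by ring)

/-- The hypothesis is the conclusion multiplied by `sin²`, with `1 + cot² = 1 / sin²`. -/
lemma cot_mul_eq {s t p q r : ℝ} (hs : Real.sin (s - t) ≠ 0)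
    (h : Real.cos (s - t) * Real.sin (s - t) * p - q = r * Real.sin (s - t) ^ 2) :
    Real.cot (s - t) * p - (1 + Real.cot (s - t) ^ 2) * q = r := by
  have h1 := Real.sin_sq_add_cos_sq (s - t)
  rw [Real.cot_eq_cos_div_sin]
  field_simp
  linear_combination h - q * h1

/-- Writing `2 t = 2 s - 2 (s - t)`, the terms with `sin (2 s)` from the drift and from the exchange
cancel. What remains depends on `s` alone, as `LinkFactor.gaugedOp_spread` requires. -/
lemma trig_exchange_cos {s t : ℝ} (h : Real.sin (s - t) ≠ 0) :
    Real.cot (s - t) * (-2 * Real.sin (2 * s)) - (1 + Real.cot (s - t) ^ 2) *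
      (Real.cos (2 * s) - Real.cos (2 * t)) = -2 * Real.cos (2 * s) := by
  refine cot_mul_eq h ?_
  have h1 : Real.cos (2 * t) = Real.cos (2 * s - 2 * (s - t)) := by congr 1; ring
  rw [h1, Real.cos_sub (2 * s), Real.sin_two_mul (s - t), Real.cos_two_mul (s - t)]
  linear_combination (2 * Real.cos (2 * s)) * Real.sin_sq_add_cos_sq (s - t)

lemma trig_exchange_sin {s t : ℝ} (h : Real.sin (s - t) ≠ 0) :
    Real.cot (s - t) * (2 * Real.cos (2 * s)) - (1 + Real.cot (s - t) ^ 2) *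
      (Real.sin (2 * s) - Real.sin (2 * t)) = -2 * Real.sin (2 * s) := by
  refine cot_mul_eq h ?_
  have h1 : Real.sin (2 * t) = Real.sin (2 * s - 2 * (s - t)) := by congr 1; ring
  rw [h1, Real.sin_sub (2 * s), Real.sin_two_mul (s - t), Real.cos_two_mul (s - t)]
  linear_combination (2 * Real.sin (2 * s)) * Real.sin_sq_add_cos_sq (s - t)

lemma trig_diff_cos {s t : ℝ} (h : Real.sin (s - t) ≠ 0) :
    Real.cot (s - t) * (-2 * Real.sin (2 * s) - -2 * Real.sin (2 * t)) =
      -2 * Real.cos (2 * s) + -2 * Real.cos (2 * t) := by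
  have h1 : Real.sin (2 * s) - Real.sin (2 * t) = 2 * Real.sin (s - t) * Real.cos (s + t) := by
    rw [Real.sin_sub_sin]
    congr 2 <;> ring_nf
  have h2 : Real.cos (2 * s) + Real.cos (2 * t) = 2 * Real.cos (s + t) * Real.cos (s - t) := by
    rw [Real.cos_add_cos]
    congr 2 <;> ring_nf
  have h3 : Real.cot (s - t) * Real.sin (s - t) = Real.cos (s - t) := by
    rw [Real.cot_eq_cos_div_sin, div_mul_cancel₀ _ h]
  linear_combination (-2 * Real.cot (s - t)) * h1 + 2 * h2 - 4 * Real.cos (s + t) * h3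

lemma trig_diff_sin {s t : ℝ} (h : Real.sin (s - t) ≠ 0) :
    Real.cot (s - t) * (2 * Real.cos (2 * s) - 2 * Real.cos (2 * t)) =
      -2 * Real.sin (2 * s) + -2 * Real.sin (2 * t) := by
  have h1 : Real.cos (2 * s) - Real.cos (2 * t) = -2 * Real.sin (s + t) * Real.sin (s - t) := by
    rw [Real.cos_sub_cos]
    congr 2 <;> ring_nf
  have h2 : Real.sin (2 * s) + Real.sin (2 * t) = 2 * Real.sin (s + t) * Real.cos (s - t) := by
    rw [Real.sin_add_sin]
    congr 2 <;> ring_nf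
  have h3 : Real.cot (s - t) * Real.sin (s - t) = Real.cos (s - t) := by
    rw [Real.cot_eq_cos_div_sin, div_mul_cancel₀ _ h]
  linear_combination (2 * Real.cot (s - t)) * h1 + 2 * h2 - 4 * Real.sin (s + t) * h3

lemma contDiff_cos_two : ContDiff ℝ ∞ fun t : ℝ => Real.cos (2 * t) := by fun_prop

lemma contDiff_sin_two : ContDiff ℝ ∞ fun t : ℝ => Real.sin (2 * t) := by fun_prop

variable {E : Type*} [NormedAddCommGroup E] [NormedSpace ℝ E]

/-- `∑ cos (2 (x_k - θ x̄)) v_k`. -/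
noncomputable abbrev cosWave (θ : ℝ) (v : Fin N → E) : Pos N → E :=
  spread (fun t => Real.cos (2 * t)) θ v

/-- `∑ sin (2 (x_k - θ x̄)) v_k`. -/
noncomputable abbrev sinWave (θ : ℝ) (v : Fin N → E) : Pos N → E :=
  spread (fun t => Real.sin (2 * t)) θ v

lemma contDiff_cosWave (θ : ℝ) (v : Fin N → E) : ContDiff ℝ ∞ (cosWave θ v) :=
  contDiff_spread contDiff_cos_two θ v

lemma contDiff_sinWave (θ : ℝ) (v : Fin N → E) : ContDiff ℝ ∞ (sinWave θ v) :=
  contDiff_spread contDiff_sin_two θ v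

lemma spread_const_mul (c : ℝ) (φ : ℝ → ℝ) (θ : ℝ) (v : Fin N → E) (x : Pos N) :
    spread (fun t => c * φ t) θ v x = c • spread φ θ v x := by
  simp only [spread, mul_smul, Finset.smul_sum]

variable [NeZero N] {a : ℝ}

lemma gaugedOp_cosWave (hN : 2 ≤ N) (θ : ℝ) (s : Spin N κ) {x : Pos N} (hx : x ∈ C2 N) :
    gaugedOp (linkF a Real.cot) (linkW a 1 Real.cot) (cosWave θ (spinOne s)) x =
      (-4 * (1 - 2 * θ / N + θ ^ 2 / N) - 8 * a) • cosWave θ (spinOne s) x := by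
  rw [cosWave, (linkFactor_trig a).gaugedOp_spread hN hasDerivAt_cos_two hasDerivAt_neg_sin_two
    (fun s t h => trig_exchange_cos (sin_ne_zero_of_abs_lt h)) θ (permSpin_spinOne' s)
    (fun i => trig_link hN hx i), spread_const_mul, spread_const_mul]
  module

lemma gaugedOp_sinWave (hN : 2 ≤ N) (θ : ℝ) (s : Spin N κ) {x : Pos N} (hx : x ∈ C2 N) :
    gaugedOp (linkF a Real.cot) (linkW a 1 Real.cot) (sinWave θ (spinOne s)) x =
      (-4 * (1 - 2 * θ / N + θ ^ 2 / N) - 8 * a) • sinWave θ (spinOne s) x := by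
  rw [sinWave, (linkFactor_trig a).gaugedOp_spread hN hasDerivAt_sin_two hasDerivAt_two_cos_two
    (fun s t h => trig_exchange_sin (sin_ne_zero_of_abs_lt h)) θ (permSpin_spinOne' s)
    (fun i => trig_link hN hx i), spread_const_mul, spread_const_mul]
  module

lemma scalarOp_cosWave (hN : 2 ≤ N) {x : Pos N} (hx : x ∈ C2 N) :
    scalarOp (linkF a Real.cot) (cosWave 0 fun _ => (1 : ℝ)) x =
      -4 * (1 + 2 * a) * cosWave 0 (fun _ => (1 : ℝ)) x := by
  rw [cosWave, (linkFactor_trig a).scalarOp_spread hasDerivAt_cos_two hasDerivAt_neg_sin_two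
    (fun s t h => trig_diff_cos (sin_ne_zero_of_abs_lt h)) 0 (fun i => trig_link hN hx i),
    spread_const_mul, spread_const_mul, smul_eq_mul, smul_eq_mul]
  ring

lemma scalarOp_sinWave (hN : 2 ≤ N) {x : Pos N} (hx : x ∈ C2 N) :
    scalarOp (linkF a Real.cot) (sinWave 0 fun _ => (1 : ℝ)) x =
      -4 * (1 + 2 * a) * sinWave 0 (fun _ => (1 : ℝ)) x := by
  rw [sinWave, (linkFactor_trig a).scalarOp_spread hasDerivAt_sin_two hasDerivAt_two_cos_two
    (fun s t h => trig_diff_sin (sin_ne_zero_of_abs_lt h)) 0 (fun i => trig_link hN hx i),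
    spread_const_mul, spread_const_mul, smul_eq_mul, smul_eq_mul]
  ring

omit [NeZero N] in
lemma pD_cosWave (v : Fin N → E) (i : Fin N) (x : Pos N) :
    pD i (cosWave 0 v) x = (-2 * Real.sin (2 * x i)) • v i := by
  rw [cosWave, pD_spread hasDerivAt_cos_two]
  simp

omit [NeZero N] in
lemma pD_sinWave (v : Fin N → E) (i : Fin N) (x : Pos N) :
    pD i (sinWave 0 v) x = (2 * Real.cos (2 * x i)) • v i := by
  rw [sinWave, pD_spread hasDerivAt_sin_two]
  simp

omit [NeZero N] in
lemma contDiff_cos_smul_cos (s : Fin N → E) :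
    ContDiff ℝ ∞ fun x => cosWave 0 (fun _ => (1 : ℝ)) x • cosWave 0 s x :=
  (contDiff_cosWave _ _).smul (contDiff_cosWave _ _)

omit [NeZero N] in
lemma contDiff_sin_smul_sin (s : Fin N → E) :
    ContDiff ℝ ∞ fun x => sinWave 0 (fun _ => (1 : ℝ)) x • sinWave 0 s x :=
  (contDiff_sinWave _ _).smul (contDiff_sinWave _ _)

omit [NeZero N] in
lemma contDiff_sin_smul_cos (s : Fin N → E) :
    ContDiff ℝ ∞ fun x => sinWave 0 (fun _ => (1 : ℝ)) x • cosWave 0 s x :=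
  (contDiff_sinWave _ _).smul (contDiff_cosWave _ _)

omit [NeZero N] in
lemma contDiff_cos_smul_sin (s : Fin N → E) :
    ContDiff ℝ ∞ fun x => cosWave 0 (fun _ => (1 : ℝ)) x • sinWave 0 s x :=
  (contDiff_cosWave _ _).smul (contDiff_sinWave _ _)

/-- `∑ cos (2 (x_i - x_j)) |s_j⟩ - Λ|s⟩ / (2a + 1)`. -/
noncomputable def pairCos (a : ℝ) (s : Spin N κ) : Wave N κ := fun x =>
  cosWave 0 (fun _ => (1 : ℝ)) x • cosWave 0 (spinOne s) x
    + sinWave 0 (fun _ => (1 : ℝ)) x • sinWave 0 (spinOne s) x + (-(1 / (2 * a + 1)) : ℝ) • sym0 s x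

/-- `∑ sin (2 (x_i - x_j)) |s_j⟩`. -/
noncomputable def pairSin (s : Spin N κ) : Wave N κ := fun x =>
  sinWave 0 (fun _ => (1 : ℝ)) x • cosWave 0 (spinOne s) x
    + (-1 : ℝ) • (cosWave 0 (fun _ => (1 : ℝ)) x • sinWave 0 (spinOne s) x)

lemma contDiff_pairCos (s : Spin N κ) : ContDiff ℝ ∞ (pairCos a s) :=
  ((contDiff_cos_smul_cos (spinOne s)).add (contDiff_sin_smul_sin (spinOne s))).add
    ((homog_sym0 s).temperate.1.const_smul (-(1 / (2 * a + 1)) : ℝ))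

lemma contDiff_pairSin (s : Spin N κ) : ContDiff ℝ ∞ (pairSin s) :=
  (contDiff_sin_smul_cos (spinOne s)).add ((contDiff_cos_smul_sin (spinOne s)).const_smul (-1 : ℝ))

lemma pairSin_eq (s : Spin N κ) (x : Pos N) :
    pairSin s x = ∑ j, ∑ i, Real.sin (2 * (x i - x j)) • spinOne s j := by
  simp only [pairSin, spread, zero_mul, sub_zero, smul_eq_mul, mul_one]
  rw [Finset.smul_sum, Finset.smul_sum, Finset.smul_sum, ← Finset.sum_add_distrib]
  refine Finset.sum_congr rfl fun j _ => ?_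
  rw [← Finset.sum_smul]
  simp only [mul_sub, Real.sin_sub]
  rw [Finset.sum_sub_distrib, ← Finset.sum_mul, ← Finset.sum_mul]
  module

lemma pairCos_eq (s : Spin N κ) (x : Pos N) :
    pairCos a s x = ∑ j, ∑ i, Real.cos (2 * (x i - x j)) • spinOne s j
      + (-(1 / (2 * a + 1)) : ℝ) • sym0 s x := by
  rw [pairCos]
  congr 1
  simp only [spread, zero_mul, sub_zero, smul_eq_mul, mul_one]
  rw [Finset.smul_sum, Finset.smul_sum, ← Finset.sum_add_distrib]
  refine Finset.sum_congr rfl fun j _ => ?_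
  rw [← Finset.sum_smul]
  simp only [mul_sub, Real.cos_sub]
  rw [Finset.sum_add_distrib, ← Finset.sum_mul, ← Finset.sum_mul]
  module

lemma invariant_pairSin (s : Spin N κ) : Invariant (pairSin s) := fun c x => by
  simp only [pairSin_eq, add_sub_add_right_eq_sub]

lemma invariant_pairCos (s : Spin N κ) : Invariant (pairCos a s) := fun c x => by
  simp only [pairCos_eq, add_sub_add_right_eq_sub, sym0_eq s (fun i => x i + c) x]

lemma gaugedOp_sym0 {F w : Fin N → Pos N → ℝ} (s : Spin N κ) (x : Pos N) :
    gaugedOp F w (sym0 s) x = 0 := by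
  have h := gaugedOp_const_smul_sym0 (F := F) (w := w) (contDiff_const (c := (1 : ℝ))) s x
  simpa [scalarOp, pD_const] using h

/-- Each product is a scalar eigenfunction times a spin eigenfunction, both with eigenvalue `-4 (1 +
2 a)`. The cross terms of the cosine and sine products add up, through `sin² + cos² = 1`, to `8
Λ|s⟩`; the constant `-1 / (2 a + 1)` in `pairCos` is the one that restores the eigenvalue equation.
-/
lemma gaugedOp_pairCos (hN : 2 ≤ N) (ha : 0 < a) (s : Spin N κ) {x : Pos N} (hx : x ∈ C2 N) :
    gaugedOp (linkF a Real.cot) (linkW a 1 Real.cot) (pairCos a s) x =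
      -((8 * (2 * a + 1)) • pairCos a s x) := by
  have hc := contDiff_cosWave (N := N) 0 fun _ => (1 : ℝ)
  have hs := contDiff_sinWave (N := N) 0 fun _ => (1 : ℝ)
  have hC := contDiff_cosWave 0 (spinOne s)
  have hS := contDiff_sinWave 0 (spinOne s)
  have h0 := (homog_sym0 s).temperate.1
  have e : (2 : ℝ) • ∑ i, pD i (cosWave 0 fun _ => (1 : ℝ)) x • pD i (cosWave 0 (spinOne s)) x
      + (2 : ℝ) • ∑ i, pD i (sinWave 0 fun _ => (1 : ℝ)) x • pD i (sinWave 0 (spinOne s)) x =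
      (8 : ℝ) • sym0 s x := by
    rw [← sum_spinOne s x, Finset.smul_sum, Finset.smul_sum, Finset.smul_sum,
      ← Finset.sum_add_distrib]
    refine Finset.sum_congr rfl fun i _ => ?_
    simp only [pD_cosWave, pD_sinWave, smul_smul, ← add_smul]
    congr 1
    simp only [smul_eq_mul]
    linear_combination 8 * Real.sin_sq_add_cos_sq (2 * x i)
  have h1 := contDiff_cos_smul_cos (spinOne s)
  have h1' := contDiff_sin_smul_sin (spinOne s)
  unfold pairCos
  rw [gaugedOp_add _ _ (h1.add h1') (h0.const_smul (-(1 / (2 * a + 1)) : ℝ)),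
    gaugedOp_add _ _ h1 h1', gaugedOp_const_smul _ _ _ h0,
    gaugedOp_smul _ _ hc hC, gaugedOp_smul _ _ hs hS, gaugedOp_cosWave hN 0 s hx,
    gaugedOp_sinWave hN 0 s hx, scalarOp_cosWave hN hx, scalarOp_sinWave hN hx, gaugedOp_sym0]
  have h2 : (2 * a + 1) ≠ 0 := by positivity
  have h3 : (8 : ℝ) • sym0 s x = -((8 * (2 * a + 1)) • (-(1 / (2 * a + 1)) : ℝ) • sym0 s x) := by
    rw [smul_smul, ← neg_smul]
    congr 1
    field_simp
  rw [smul_add, neg_add, ← h3, ← e]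
  module

/-- Here the cross terms of the two products are equal and enter with opposite signs, so no
correction is needed. -/
lemma gaugedOp_pairSin (hN : 2 ≤ N) (s : Spin N κ) {x : Pos N} (hx : x ∈ C2 N) :
    gaugedOp (linkF a Real.cot) (linkW a 1 Real.cot) (pairSin s) x =
      -((8 * (2 * a + 1)) • pairSin s x) := by
  have hc := contDiff_cosWave (N := N) 0 fun _ => (1 : ℝ)
  have hs := contDiff_sinWave (N := N) 0 fun _ => (1 : ℝ)
  have hC := contDiff_cosWave 0 (spinOne s)
  have hS := contDiff_sinWave 0 (spinOne s)
  have e : ∑ i, pD i (sinWave 0 fun _ => (1 : ℝ)) x • pD i (cosWave 0 (spinOne s)) x =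
      ∑ i, pD i (cosWave 0 fun _ => (1 : ℝ)) x • pD i (sinWave 0 (spinOne s)) x := by
    refine Finset.sum_congr rfl fun i _ => ?_
    simp only [pD_cosWave, pD_sinWave, smul_smul]
    congr 1
    simp only [smul_eq_mul]
    ring
  have h1 := contDiff_sin_smul_cos (spinOne s)
  have h1' := contDiff_cos_smul_sin (spinOne s)
  unfold pairSin
  rw [gaugedOp_add _ _ h1 (h1'.const_smul (-1 : ℝ)), gaugedOp_const_smul _ _ _ h1',
    gaugedOp_smul _ _ hs hC, gaugedOp_smul _ _ hc hS, gaugedOp_cosWave hN 0 s hx,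
    gaugedOp_sinWave hN 0 s hx, scalarOp_cosWave hN hx, scalarOp_sinWave hN hx, e]
  module

theorem trig_eta0 (hN : 2 ≤ N) (ha : 1 / 2 < a) (s : Spin N κ) :
    IsZeroMomentumEigenfunction (H2 a) (C2 N) (eta0 a s) (ground2 N a) ∧
      (sym0 s ≠ 0 → Nonvanishing (C2 N) (eta0 a s)) := by
  have ha0 : 0 < a := by linarith
  refine ⟨?_, fun hs => trig_nonvanishing hN ha0 (invariant_sym0 s) ?_⟩
  · rw [← add_zero (ground2 N a)]
    exact trig_isEigenfunction hN ha0 (homog_sym0 s).temperate.1 (invariant_sym0 s)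
      fun x _ => by rw [gaugedOp_sym0, zero_smul, neg_zero]
  · obtain ⟨x, hx⟩ := C2_nonempty (N := N)
    exact ⟨x, hx, sym0_ne_zero hs x⟩

-- With `θ = 1` the kinetic contribution is `4 (1 - 1 / N)` instead of `4`: the part carried by the
-- centre of mass is removed.
omit [NeZero N] in
lemma relative_energy (a : ℝ) : -(4 * (2 * a + 1 - 1 / N)) =
    -4 * (1 - 2 * 1 / N + 1 ^ 2 / N) - 8 * a := by ring

theorem trig_eta1 (hN : 2 ≤ N) (ha : 1 / 2 < a) (s : Spin N κ) :
    IsZeroMomentumEigenfunction (H2 a) (C2 N) (eta1 a s) (ground2 N a + 4 * (2 * a + 1 - 1 / N)) ∧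
      (sym0 s ≠ 0 → Nonvanishing (C2 N) (eta1 a s)) := by
  have ha0 : 0 < a := by linarith
  have e : eta1 a s = fun x => mu2 a x • cosWave 1 (spinOne s) x := by
    funext x
    simp only [eta1, spread, one_mul]
  rw [e]
  refine ⟨trig_isEigenfunction hN ha0 (contDiff_cosWave 1 _) (invariant_spread _ _) fun x hx => ?_,
    fun hs => trig_nonvanishing hN ha0 (invariant_spread _ _)
      (exists_mem_C2_ne_zero (contDiff_cosWave 1 _).continuous.continuousAt ?_)⟩
  · rw [gaugedOp_cosWave hN 1 s hx, ← neg_smul, relative_energy]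
  · simpa [spread, com, sum_spinOne s 0] using sym0_ne_zero hs 0

theorem trig_eta2 (hN : 2 ≤ N) (ha : 1 / 2 < a) (s : Spin N κ) :
    IsZeroMomentumEigenfunction (H2 a) (C2 N) (eta2 a s) (ground2 N a + 4 * (2 * a + 1 - 1 / N)) ∧
      ((∃ i j, spinOne s i ≠ spinOne s j) → Nonvanishing (C2 N) (eta2 a s)) := by
  have ha0 : 0 < a := by linarith
  have e : eta2 a s = fun x => mu2 a x • sinWave 1 (spinOne s) x := by
    funext x
    simp only [eta2, spread, one_mul]
  rw [e]
  refine ⟨trig_isEigenfunction hN ha0 (contDiff_sinWave 1 _) (invariant_spread _ _) fun x hx => ?_,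
    fun hs => ?_⟩
  · rw [gaugedOp_sinWave hN 1 s hx, ← neg_smul, relative_energy]
  -- All sines vanish at the origin, so the gradient is used; its components measure the deviation
  -- of `|s_i⟩` from the mean `Λ|s⟩ / N`.
  · obtain ⟨i, hi⟩ := exists_spinOne_ne hs
    refine trig_nonvanishing hN ha0 (invariant_spread _ _)
      (exists_mem_C2_of_pD (contDiff_sinWave 1 _) (i := i) ?_)
    have h1 : spread (fun t => 2 * Real.cos (2 * t)) 1 (spinOne s) 0 = (2 : ℝ) • sym0 s 0 := by
      simp [spread, com, ← sum_spinOne s 0, Finset.smul_sum]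
    have hN0 := natCast_ne_zero (N := N)
    have h2 : pD i (sinWave 1 (spinOne s)) 0 =
        (2 / N : ℝ) • ((N : ℝ) • spinOne s i - sym0 s 0) := by
      rw [sinWave, pD_spread hasDerivAt_sin_two, h1]
      simp only [com, Pi.zero_apply, Finset.sum_const_zero, zero_div, mul_zero, sub_zero,
        Real.cos_zero, mul_one]
      match_scalars
      · field_simp
      · ring
    rw [h2]
    exact smul_ne_zero (div_ne_zero two_ne_zero hN0) hi

theorem trig_eta3 (hN : 2 ≤ N) (ha : 1 / 2 < a) (s : Spin N κ) :
    IsZeroMomentumEigenfunction (H2 a) (C2 N) (eta3 a s) (ground2 N a + 8 * (2 * a + 1)) ∧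
      (sym0 s ≠ 0 → Nonvanishing (C2 N) (eta3 a s)) := by
  have ha0 : 0 < a := by linarith
  have e : eta3 a s = fun x => mu2 a x • pairCos a s x := by
    funext x
    rw [eta3, pairCos_eq]
    congr 1
    -- The terms `i = j` contribute `Λ|s⟩` in total, and `1 - 1 / (2 a + 1) = 2 a / (2 a + 1)` is
    -- the coefficient in the theorem.
    have h : ∀ j, ∑ i, Real.cos (2 * (x i - x j)) • spinOne s j =
        ∑ i ∈ Finset.univ.erase j, Real.cos (2 * (x i - x j)) • spinOne s j + spinOne s j :=
      fun j => by
        rw [← Finset.sum_erase_add _ _ (Finset.mem_univ j)]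
        simp
    simp only [h]
    rw [Finset.sum_add_distrib, sum_spinOne s x]
    have h2 : (2 * a + 1) ≠ 0 := by positivity
    match_scalars
    all_goals first | ring1 | (field_simp; ring)
  rw [e]
  refine ⟨trig_isEigenfunction hN ha0 (contDiff_pairCos s) (invariant_pairCos s)
    fun x hx => gaugedOp_pairCos hN ha0 s hx, fun hs => trig_nonvanishing hN ha0
      (invariant_pairCos s) (exists_mem_C2_ne_zero (contDiff_pairCos s).continuous.continuousAt ?_)⟩
  have h1 : pairCos a s 0 = (N - 1 / (2 * a + 1) : ℝ) • sym0 s 0 := by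
    rw [pairCos_eq, sub_smul, ← sum_spinOne s 0]
    simp [Finset.smul_sum, ← Nat.cast_smul_eq_nsmul ℝ, sub_eq_add_neg]
  rw [h1]
  refine smul_ne_zero (ne_of_gt (sub_pos.mpr ?_)) (sym0_ne_zero hs 0)
  have hN' : (2 : ℝ) ≤ N := by exact_mod_cast hN
  rw [div_lt_iff₀ (by positivity)]
  nlinarith

theorem trig_eta4 (hN : 2 ≤ N) (ha : 1 / 2 < a) (s : Spin N κ) :
    IsZeroMomentumEigenfunction (H2 a) (C2 N) (eta4 a s) (ground2 N a + 8 * (2 * a + 1)) ∧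
      ((∃ i j, spinOne s i ≠ spinOne s j) → Nonvanishing (C2 N) (eta4 a s)) := by
  have ha0 : 0 < a := by linarith
  have e : eta4 a s = fun x => mu2 a x • pairSin s x := by
    funext x
    rw [eta4, pairSin_eq]
    congr 1
    refine Finset.sum_congr rfl fun j _ => ?_
    rw [← Finset.sum_erase_add _ _ (Finset.mem_univ j)]
    simp
  rw [e]
  refine ⟨trig_isEigenfunction hN ha0 (contDiff_pairSin s) (invariant_pairSin s)
    fun x hx => gaugedOp_pairSin hN s hx, fun hs => ?_⟩
  obtain ⟨i, hi⟩ := exists_spinOne_ne hs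
  refine trig_nonvanishing hN ha0 (invariant_pairSin s)
    (exists_mem_C2_of_pD (contDiff_pairSin s) (i := i) ?_)
  have h1 := ((HasPD.of_contDiff (i := i) (x := 0) (contDiff_sinWave (N := N) 0 fun _ => (1 : ℝ))).smul
    (HasPD.of_contDiff (contDiff_cosWave 0 (spinOne s)))).add
    (((HasPD.of_contDiff (i := i) (x := 0) (contDiff_cosWave (N := N) 0 fun _ => (1 : ℝ))).smul
    (HasPD.of_contDiff (contDiff_sinWave 0 (spinOne s)))).const_smul (-1))
  have h2 : pD i (pairSin s) 0 = (-2 : ℝ) • ((N : ℝ) • spinOne s i - sym0 s 0) := by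
    refine h1.eq.trans ?_
    rw [pD_sinWave, pD_sinWave, pD_cosWave, pD_cosWave, ← sum_spinOne s 0]
    simp [spread]
    module
  rw [h2]
  exact smul_ne_zero (by norm_num) hi

end TrigEigen

end NearNeighbour
-- The three models together
theorem theorem1 (N κ : ℕ) [NeZero N] (hN : 2 ≤ N) (a : ℝ) (ha : 1 / 2 < a) :
    -- the rational model
    (∀ ω : ℝ, 0 < ω →
      IsGroundStateEnergy (H0 ω a : Wave N κ → Wave N κ) (C0 N) (ground0 N ω a) ∧
      (∀ s : Spin N κ, ∀ l m : ℕ,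
        (ExtendsToEigenfunction (H0 ω a) (C0 N) (psi0 ω a l m s)
            (ground0 N ω a + 2 * ω * (2 * l + m)) ∧
          (sym0 s ≠ 0 → Nonvanishing (C0 N) (psi0 ω a l m s))) ∧
        (1 ≤ m →
          ExtendsToEigenfunction (H0 ω a) (C0 N) (psi1 ω a l m s)
            (ground0 N ω a + 2 * ω * (2 * l + m)) ∧
          ((∃ i j, spinOne s i ≠ spinOne s j) → Nonvanishing (C0 N) (psi1 ω a l m s))) ∧
        (2 ≤ m →
          ExtendsToEigenfunction (H0 ω a) (C0 N) (psi2 ω a l m s)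
            (ground0 N ω a + 2 * ω * (2 * l + m)) ∧
          (sym0 s ≠ 0 → Nonvanishing (C0 N) (psi2 ω a l m s))) ∧
        (3 ≤ m →
          ExtendsToEigenfunction (H0 ω a) (C0 N) (psi3 ω a l m s)
            (ground0 N ω a + 2 * ω * (2 * l + m)) ∧
          (3 ≤ N → sym0 s ≠ 0 → Nonvanishing (C0 N) (psi3 ω a l m s))) ∧
        (4 ≤ m →
          ExtendsToEigenfunction (H0 ω a) (C0 N) (psi4 ω a l m s)
            (ground0 N ω a + 2 * ω * (2 * l + m)) ∧
          (3 ≤ N → (∃ i j, spinOne s i ≠ spinOne s j) →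
            Nonvanishing (C0 N) (psi4 ω a l m s))) ∧
        (2 ≤ m → s ∈ SpinPrime N κ →
          ExtendsToEigenfunction (H0 ω a) (C0 N) (psiTilde2 ω a l m s)
            (ground0 N ω a + 2 * ω * (2 * l + m)) ∧
          (sym0 s ≠ 0 → Nonvanishing (C0 N) (psiTilde2 ω a l m s))))) ∧
    -- the model with inverse square external potential
    (∀ ω b : ℝ, 0 < ω → 1 / 2 < b →
      IsGroundStateEnergy (H1 ω a b : Wave N κ → Wave N κ) (C1 N)
        (ground1 N ω a b) ∧
      (∀ s : Spin N κ, ∀ k : ℕ,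
        (IsEigenfunction (H1 ω a b) (C1 N) (xi0 ω a b k s) (ground1 N ω a b + 4 * k * ω) ∧
          (sym0 s ≠ 0 → Nonvanishing (C1 N) (xi0 ω a b k s))) ∧
        (1 ≤ k →
          IsEigenfunction (H1 ω a b) (C1 N) (xi1 ω a b k s) (ground1 N ω a b + 4 * k * ω) ∧
          ((∃ i j, spinOne s i ≠ spinOne s j) → Nonvanishing (C1 N) (xi1 ω a b k s))) ∧
        (2 ≤ k →
          IsEigenfunction (H1 ω a b) (C1 N) (xi2 ω a b k s) (ground1 N ω a b + 4 * k * ω) ∧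
          (sym0 s ≠ 0 → Nonvanishing (C1 N) (xi2 ω a b k s))))) ∧
    -- the trigonometric model
    (IsGroundStateEnergy (H2 a : Wave N κ → Wave N κ) (C2 N) (ground2 N a) ∧
      ∀ s : Spin N κ,
        (IsZeroMomentumEigenfunction (H2 a) (C2 N) (eta0 a s) (ground2 N a) ∧
          (sym0 s ≠ 0 → Nonvanishing (C2 N) (eta0 a s))) ∧
        (IsZeroMomentumEigenfunction (H2 a) (C2 N) (eta1 a s)
            (ground2 N a + 4 * (2 * a + 1 - 1 / N)) ∧
          (sym0 s ≠ 0 → Nonvanishing (C2 N) (eta1 a s))) ∧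
        (IsZeroMomentumEigenfunction (H2 a) (C2 N) (eta2 a s)
            (ground2 N a + 4 * (2 * a + 1 - 1 / N)) ∧
          ((∃ i j, spinOne s i ≠ spinOne s j) → Nonvanishing (C2 N) (eta2 a s))) ∧
        (IsZeroMomentumEigenfunction (H2 a) (C2 N) (eta3 a s) (ground2 N a + 8 * (2 * a + 1)) ∧
          (sym0 s ≠ 0 → Nonvanishing (C2 N) (eta3 a s))) ∧
        (IsZeroMomentumEigenfunction (H2 a) (C2 N) (eta4 a s) (ground2 N a + 8 * (2 * a + 1)) ∧
          ((∃ i j, spinOne s i ≠ spinOne s j) → Nonvanishing (C2 N) (eta4 a s)))) := by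
  refine ⟨fun om hom => ⟨isGroundStateEnergy_H0 hN ha hom, fun s l m => ⟨?_, ?_, ?_, ?_, ?_, ?_⟩⟩,
    fun om b hom hb => ⟨isGroundStateEnergy_H1 hN ha hom hb, fun s k => ⟨?_, ?_, ?_⟩⟩,
    isGroundStateEnergy_H2 hN ha, fun s => ⟨?_, ?_, ?_, ?_, ?_⟩⟩
  · exact rational_psi0 hN ha hom s l m
  · exact rational_psi1 hN ha hom s l m
  · exact rational_psi2 hN ha hom s l m
  · exact fun hm => (rational_psi3 hN ha hom s l m hm).imp_right fun h _ => h
  · exact rational_psi4 hN ha hom s l m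
  · exact rational_psiTilde2 hN ha hom s l m
  · exact radial_xi0 hN ha hom hb s k
  · exact radial_xi1 hN ha hom hb s k
  · exact radial_xi2 hN ha hom hb s k
  · exact trig_eta0 hN ha s
  · exact trig_eta1 hN ha s
  · exact trig_eta2 hN ha s
  · exact trig_eta3 hN ha s
  · exact trig_eta4 hN ha s
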